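/- Let $M$ be a smooth manifold (Hausdorff, second countable, without boundary, not necessarily compact) of dimension $n\geq 1$ with a Riemannian metric $g$, and let $\mathcal{E}$ be a smooth complex vector bundle of finite rank over $M$. For $m\in\mathbb{Z}$ let $\Psi^{m}(M,\mathcal{E})$ be the space of classical pseudodifferential operators of order $m$, i.e. continuous linear operators $P:C^\infty_c(M,\mathcal{E})\to C^\infty(M,\mathcal{E})$ whose Schwartz kernel $k_P$ is smooth off the diagonal and which in any trivializing local coordinates are of the form $p(x,D)+R$ with $p\sim\sum_{j\geq 0}p_{m-j}$ a classical symbol of order $m$ and $R$ smoothing; $\Psi^{-\infty}(M,\mathcal{E})$ denotes the operators with smooth Schwartz kernel. If $P\in\Psi^m(M,\mathcal{E})$ with $m\geq -n$, its logarithmic singularity $c_P$ is the smooth $\operatorname{End}\mathcal{E}$-valued $1$-density on $M$ such that in any trivializing local coordinates over an open set $U\subset\mathbb{R}^n$, near the diagonal and locally uniformly, $$k_{P}(x,y)=\sum_{-(m+n)\leq j\leq -1}a_{j}(x,x-y)-c_{P}(x)\log|x-y|+\mathrm{O}(1),$$ where $a_j\in C^\infty(U\times(\mathbb{R}^n\setminus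 0))$ is homogeneous of degree $j$ in the second variable. If $P\in\Psi^m(M,\mathcal{E})$ is elliptic (its principal symbol is invertible off the zero section) and $m\leq n$, its Green kernel logarithmic singularity is $\gamma_P:=c_Q$, where $Q\in\Psi^{-m}(M,\mathcal{E})$ is any parametrix for $P$, i.e. a two-sided inverse of $P$ modulo $\Psi^{-\infty}(M,\mathcal{E})$ (compositions being formed with a properly supported representative of $Q$ modulo $\Psi^{-\infty}(M,\mathcal{E})$). Let $(P_{\hat g})\subset\Psi^m(M,\mathcal{E})$ be a family of operators of integer order $m$ indexed by the metrics $\hat g$ that are conformal multiples of $g$, and let $w,w'\in\mathbb{R}$ be such that, for all $f\in C^\infty(M,\mathbb{R})$, $$P_{e^fg}=e^{w'f}P_ge^{-wf}\quad\bmod\Psi^{-\infty}(M,\mathcal{E}).$$ 1) If $m\geq -n$, then for all $f\in C^\infty(M,\mathbb{R})$ the densities $c_{P_g}$ and $c_{P_{e^fg}}$ exist and are unique, and $$c_{P_{e^{f}g}}(x)=e^{-(w-w')f(x)}c_{P_{g}}(x).$$ 2) If $P_g$ is elliptic and $0\leq m\leq n$, then for all $f\in C^\infty(M,\mathbb{R})$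 the operator $P_{e^fg}$ is elliptic, every parametrix of $P_g$ or of $P_{e^fg}$ in $\Psi^{-m}(M,\mathcal{E})$ has a unique logarithmic singularity, and, whichever parametrices are used to define $\gamma_{P_g}$ and $\gamma_{P_{e^fg}}$, $$\gamma_{P_{e^{f}g}}(x)=e^{-(w'-w)f(x)}\gamma_{P_{g}}(x).$$ -/

import Mathlib

open scoped Manifold ContDiff
open Bundle

noncomputable section

namespace PsiDO

/-- The model space `ℝⁿ` with its Euclidean norm. -/
abbrev Rn (n : ℕ) : Type := EuclideanSpace ℝ (Fin n)

/-! ### Symbols on an open subset of `ℝⁿ`, with values in the endomorphisms of `F` -/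

section Symbols

variable {n : ℕ} {F : Type*} [NormedAddCommGroup F] [NormedSpace ℂ F]

/-- `a` is smooth on `V × (ℝⁿ ∖ 0)` and homogeneous of degree `k` in the second variable. -/
def IsHomogeneous (k : ℤ) (V : Set (Rn n)) (a : Rn n → Rn n → F →L[ℂ] F) : Prop :=
  ContDiffOn ℝ ∞ (Function.uncurry a) (V ×ˢ {0}ᶜ) ∧
    ∀ x ∈ V, ∀ ξ : Rn n, ξ ≠ 0 → ∀ t : ℝ, 0 < t → a x (t • ξ) = t ^ k • a x ξ

/-- `p` is a (classical) symbol of order `m` on `V × ℝⁿ` with the asymptotic expansion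
`p ∼ ∑ pj j`, where `pj j` is homogeneous of degree `m - j`. The norms of the iterated Fréchet
derivatives of orders `a` in `x` and `b` in `ξ` control all `∂_x^α ∂_ξ^β`, `|α| = a`, `|β| = b`. -/
structure IsSymbol (m : ℤ) (V : Set (Rn n)) (p : Rn n → Rn n → F →L[ℂ] F)
    (pj : ℕ → Rn n → Rn n → F →L[ℂ] F) : Prop where
  smooth : ContDiffOn ℝ ∞ (Function.uncurry p) (V ×ˢ Set.univ)
  homogeneous : ∀ j : ℕ, IsHomogeneous (m - j) V (pj j)
  asymptotic : ∀ (N : ℕ) (K : Set (Rn n)), IsCompact K → K ⊆ V → ∀ a b : ℕ,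
    ∃ C : ℝ, ∀ x ∈ K, ∀ ξ : Rn n, 1 ≤ ‖ξ‖ →
      ‖iteratedFDeriv ℝ b
          (fun η => iteratedFDeriv ℝ a (fun y => p y η - ∑ j ∈ Finset.range N, pj j y η) x) ξ‖
        ≤ C * ‖ξ‖ ^ (m - b - N : ℤ)

/-- `û(ξ) = ∫_V e^{-i y·ξ} u(y) dy`, for `u` supported in `V`. -/
def fourierOn (V : Set (Rn n)) (u : Rn n → F) (ξ : Rn n) : F :=
  ∫ y in V, Complex.exp (-(Complex.I * (inner ℝ y ξ : ℝ))) • u y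

/-- `(p(x,D)u)(x) = (2π)^{-n} ∫ e^{i x·ξ} p(x,ξ) û(ξ) dξ`. -/
def quantize (V : Set (Rn n)) (p : Rn n → Rn n → F →L[ℂ] F) (u : Rn n → F) (x : Rn n) : F :=
  ((2 * Real.pi) ^ n : ℝ)⁻¹ •
    ∫ ξ : Rn n, Complex.exp (Complex.I * (inner ℝ x ξ : ℝ)) • p x ξ (fourierOn V u ξ)

end Symbols

/-! ### Sections of a complex vector bundle over a smooth manifold -/

section Manifold

variable {n : ℕ} {M : Type*} [TopologicalSpace M] [ChartedSpace (Rn n) M] [IsManifold (𝓡 n) ∞ M]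

/-- The smooth function `e^{a f}`. -/
def expFun (a : ℝ) (f : C^∞⟮𝓡 n, M; 𝓘(ℝ, ℝ), ℝ⟯) : C^∞⟮𝓡 n, M; 𝓘(ℝ, ℝ), ℝ⟯ :=
  ⟨fun x => Real.exp (a * f x),
    Real.contDiff_exp.contMDiff.comp (contMDiff_const.mul f.contMDiff)⟩

/-- Smooth Riemannian metrics on `M`. -/
abbrev RiemMetric (n : ℕ) (M : Type*) [TopologicalSpace M] [ChartedSpace (Rn n) M]
    [IsManifold (𝓡 n) ∞ M] : Type _ :=
  ContMDiffRiemannianMetric (𝓡 n) ∞ (Rn n) (fun x : M => TangentSpace (𝓡 n) x)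

set_option synthInstance.maxHeartbeats 400000 in
/-- The conformal change of metric `e^f g`. -/
def conformalChange (f : C^∞⟮𝓡 n, M; 𝓘(ℝ, ℝ), ℝ⟯) (g : RiemMetric n M) : RiemMetric n M where
  inner x := Real.exp (f x) • g.inner x
  symm x v w := by simp [g.symm x v w]
  pos x v hv := by
    simpa using mul_pos (Real.exp_pos (f x)) (g.pos x v hv)
  isVonNBounded x := by
    have h := (g.isVonNBounded x).image
      ((Real.exp (-(f x) / 2)) • ContinuousLinearMap.id ℝ (TangentSpace (𝓡 n) x))
    refine h.subset fun v hv => (Set.mem_image _ _ _).2 ⟨Real.exp (f x / 2) • v, ?_, ?_⟩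
    · have h2 : Real.exp (f x) = Real.exp (f x / 2) * Real.exp (f x / 2) := by
        rw [← Real.exp_add, add_halves]
      have hv' : Real.exp (f x) * g.inner x v v < 1 := by simpa using hv
      rw [h2] at hv'
      simpa [mul_assoc] using hv'
    · have h3 : Real.exp (f x / 2) * Real.exp (-(f x) / 2) = 1 := by
        rw [← Real.exp_add]; ring_nf; exact Real.exp_zero
      simp [smul_smul, h3]
  contMDiff := by
    have h : ContMDiff (𝓡 n) 𝓘(ℝ, ℝ) ∞ (fun x : M => Real.exp (f x)) :=
      Real.contDiff_exp.contMDiff.comp f.contMDiff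
    exact h.smul_section g.contMDiff

/-- The class of metrics that are conformal multiples of `g`. -/
def conformalClass (g : RiemMetric n M) : Set (RiemMetric n M) :=
  {g' | ∃ f : C^∞⟮𝓡 n, M; 𝓘(ℝ, ℝ), ℝ⟯, g' = conformalChange f g}

variable (n) {F : Type*} [NormedAddCommGroup F] [NormedSpace ℂ F]
  (E : M → Type*) [TopologicalSpace (TotalSpace F E)] [∀ x, TopologicalSpace (E x)]
  [∀ x, AddCommGroup (E x)] [∀ x, Module ℂ (E x)]
  [FiberBundle F E] [VectorBundle ℂ F E] [VectorBundle ℝ F E]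
  [ContMDiffVectorBundle ∞ F E (𝓡 n)]

variable (F) in
/-- `C^∞(M, E)`. -/
def SmoothSections : Submodule ℂ (∀ x, E x) where
  carrier := {s | ContMDiff (𝓡 n) ((𝓡 n).prod 𝓘(ℝ, F)) ∞ (fun x => TotalSpace.mk' F x (s x))}
  add_mem' hs ht := hs.add_section ht
  zero_mem' := contMDiff_zeroSection ℝ E
  smul_mem' z s hs := by
    intro x₀
    have h := hs x₀
    rw [contMDiffAt_section] at h ⊢
    have h2 : ContMDiffAt (𝓡 n) 𝓘(ℝ, F) ∞
        (fun x => z • (trivializationAt F E x₀ ⟨x, s x⟩).2) x₀ :=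
      ((contDiff_const_smul z).contMDiff (x := _)).comp x₀ h
    refine h2.congr_of_eventuallyEq ?_
    filter_upwards [(trivializationAt F E x₀).open_baseSet.mem_nhds
      (mem_baseSet_trivializationAt F E x₀)] with x hx
    exact ((trivializationAt F E x₀).linear ℂ hx).2 z (s x)

/-- The support of a section. -/
def secSupport {E : M → Type*} [∀ x, AddCommGroup (E x)] (s : ∀ x, E x) : Set M :=
  closure {x | s x ≠ 0}

variable (F) in
/-- `C_c^∞(M, E)`. -/
def TestSections : Submodule ℂ (∀ x, E x) where
  carrier := {s | s ∈ SmoothSections n F E ∧ IsCompact (secSupport s)}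
  add_mem' {s t} hs ht := by
    refine ⟨add_mem hs.1 ht.1, (hs.2.union ht.2).of_isClosed_subset isClosed_closure ?_⟩
    unfold secSupport
    rw [← closure_union]
    refine closure_mono fun x hx => ?_
    by_contra h
    simp only [Set.mem_union, Set.mem_ofPred_eq, not_or, not_not] at h
    exact hx (by simp [h.1, h.2])
  zero_mem' := ⟨zero_mem _, by simp [secSupport]⟩
  smul_mem' z s hs := by
    refine ⟨Submodule.smul_mem _ z hs.1, hs.2.of_isClosed_subset isClosed_closure ?_⟩
    refine closure_mono fun x hx => ?_
    intro h
    exact hx (by simp [h])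

/-- The operators from `C_c^∞(M, E)` to `C^∞(M, E)`. -/
abbrev Op (n : ℕ) {M : Type*} [TopologicalSpace M] [ChartedSpace (Rn n) M] [IsManifold (𝓡 n) ∞ M]
    (F : Type*) [NormedAddCommGroup F] [NormedSpace ℂ F]
    (E : M → Type*) [TopologicalSpace (TotalSpace F E)] [∀ x, TopologicalSpace (E x)]
    [∀ x, AddCommGroup (E x)] [∀ x, Module ℂ (E x)]
    [FiberBundle F E] [VectorBundle ℂ F E] [VectorBundle ℝ F E]
    [ContMDiffVectorBundle ∞ F E (𝓡 n)] : Type _ :=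
  TestSections n F E →ₗ[ℂ] SmoothSections n F E

variable {n} {E}

/-- The inclusion of `C_c^∞(M, E)` into `C^∞(M, E)`. -/
def incl : Op n F E := Submodule.inclusion fun _ h => h.1

/-- Multiplication of a smooth section by a smooth real function. -/
def mulSmooth (φ : C^∞⟮𝓡 n, M; 𝓘(ℝ, ℝ), ℝ⟯) :
    SmoothSections n F E →ₗ[ℂ] SmoothSections n F E where
  toFun s := ⟨fun x => φ x • s.1 x, φ.contMDiff.smul_section s.2⟩
  map_add' s t := by ext x; simp
  map_smul' z s := by ext x; exact smul_comm (φ x) z _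

/-- Multiplication of a compactly supported smooth section by a smooth real function. -/
def mulTest (φ : C^∞⟮𝓡 n, M; 𝓘(ℝ, ℝ), ℝ⟯) :
    TestSections n F E →ₗ[ℂ] TestSections n F E where
  toFun u := ⟨fun x => φ x • u.1 x, φ.contMDiff.smul_section u.2.1,
    u.2.2.of_isClosed_subset isClosed_closure
      (closure_mono fun x hx h => hx (by simp [h]))⟩
  map_add' s t := by ext x; simp
  map_smul' z s := by ext x; exact smul_comm (φ x) z _

/-! ### Trivializing local coordinates -/

variable (n F E) in
/-- Trivializing local coordinates: a smooth chart of `M` together with a trivialization of `E`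
over its domain. -/
structure LocalCoords where
  /-- the chart, an arbitrary one of the maximal smooth atlas -/
  chart : OpenPartialHomeomorph M (Rn n)
  chart_mem : chart ∈ IsManifold.maximalAtlas (𝓡 n) ∞ M
  /-- the trivialization -/
  triv : Trivialization F (π F E)
  triv_mem : MemTrivializationAtlas triv
  subset : chart.source ⊆ triv.baseSet

attribute [instance] LocalCoords.triv_mem

namespace LocalCoords

/-- The open subset of `ℝⁿ` in which the coordinates take their values. -/
def dom (c : LocalCoords n F E) : Set (Rn n) := c.chart.target

/-- A section in local coordinates, as an `F`-valued function (only meaningful on `c.dom`). -/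
def loc (c : LocalCoords n F E) (s : ∀ x, E x) (y : Rn n) : F :=
  (c.triv ⟨c.chart.symm y, s (c.chart.symm y)⟩).2

/-- The coordinate frame `(∂₁, …, ∂ₙ)` of the tangent space at the point with coordinates `y`. -/
def frame (c : LocalCoords n F E) (y : Rn n) (i : Fin n) :
    TangentSpace (𝓡 n) (c.chart.symm y) :=
  mfderiv 𝓘(ℝ, Rn n) (𝓡 n) c.chart.symm y (EuclideanSpace.single i (1 : ℝ))

/-- An endomorphism of a fibre of `E`, seen as an endomorphism of `F` via the trivialization. -/
def endo [FiniteDimensional ℂ F] (c : LocalCoords n F E) (x : M) (T : Module.End ℂ (E x)) :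
    F →L[ℂ] F :=
  LinearMap.toContinuousLinearMap (c.triv.linearMapAt ℂ x ∘ₗ T ∘ₗ c.triv.symmₗ ℂ x)

end LocalCoords

/-! ### Pseudodifferential operators -/

/-- Convergence to `0` in `C^∞(M, E)`: in all trivializing local coordinates, the derivatives of
all orders converge to `0` uniformly on compact sets. -/
def TendsToZero (s : ℕ → SmoothSections n F E) : Prop :=
  ∀ (c : LocalCoords n F E) (L : Set (Rn n)), IsCompact L → L ⊆ c.dom → ∀ k : ℕ,
    TendstoUniformlyOn (fun j y => iteratedFDeriv ℝ k (c.loc (s j).1) y) (fun _ => 0)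
      Filter.atTop L

/-- Continuity of a linear operator `C_c^∞(M, E) → C^∞(M, E)`. As `C_c^∞(M, E)` is the inductive
limit of the Fréchet spaces of sections supported in a fixed compact set, it amounts to sequential
continuity at `0` on each of these. -/
def IsContinuousOp (P : Op n F E) : Prop :=
  ∀ u : ℕ → TestSections n F E,
    (∃ K : Set M, IsCompact K ∧ ∀ j, ∀ x ∉ K, (u j).1 x = 0) →
    TendsToZero (fun j => incl (u j)) → TendsToZero (fun j => P (u j))

/-- In the local coordinates `c` (for `x`) and `c'` (for `y`) the Schwartz kernel of `P` is, off
the diagonal, the smooth function `k`. -/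
def IsOffDiagonalKernel (c c' : LocalCoords n F E) (P : Op n F E)
    (k : Rn n → Rn n → F →L[ℂ] F) : Prop :=
  ContDiffOn ℝ ∞ (Function.uncurry k)
      {z | z.1 ∈ c.dom ∧ z.2 ∈ c'.dom ∧ c.chart.symm z.1 ≠ c'.chart.symm z.2} ∧
    ∀ u : TestSections n F E, secSupport u.1 ⊆ c'.chart.source →
      ∀ x ∈ c.dom, c.chart.symm x ∉ secSupport u.1 →
        c.loc (P u).1 x = ∫ y in c'.dom, k x y (c'.loc u.1 y)

/-- `Ψ^{-∞}(M, E)`: the operators with smooth Schwartz kernel. -/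
def IsSmoothing (R : Op n F E) : Prop :=
  ∀ c c' : LocalCoords n F E, ∃ r : Rn n → Rn n → F →L[ℂ] F,
    ContDiffOn ℝ ∞ (Function.uncurry r) (c.dom ×ˢ c'.dom) ∧
      ∀ u : TestSections n F E, secSupport u.1 ⊆ c'.chart.source → ∀ x ∈ c.dom,
        c.loc (R u).1 x = ∫ y in c'.dom, r x y (c'.loc u.1 y)

/-- In the local coordinates `c`, `P = p(x,D) + R` where `p ∼ ∑ pj j` is a symbol of order `m`
and `R` is a smoothing operator. -/
def HasLocalSymbol (c : LocalCoords n F E) (m : ℤ) (P : Op n F E)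
    (p : Rn n → Rn n → F →L[ℂ] F) (pj : ℕ → Rn n → Rn n → F →L[ℂ] F) : Prop :=
  IsSymbol m c.dom p pj ∧
    ∃ r : Rn n → Rn n → F →L[ℂ] F, ContDiffOn ℝ ∞ (Function.uncurry r) (c.dom ×ˢ c.dom) ∧
      ∀ u : TestSections n F E, secSupport u.1 ⊆ c.chart.source → ∀ x ∈ c.dom,
        c.loc (P u).1 x =
          quantize c.dom p (c.loc u.1) x + ∫ y in c.dom, r x y (c.loc u.1 y)

/-- `Ψ^m(M, E)`. -/
structure IsPsiDO (m : ℤ) (P : Op n F E) : Prop where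
  continuous : IsContinuousOp P
  smooth_off_diagonal : ∀ c c' : LocalCoords n F E, ∃ k, IsOffDiagonalKernel c c' P k
  local_form : ∀ c : LocalCoords n F E, ∃ p pj, HasLocalSymbol c m P p pj

/-- Ellipticity: the principal symbol is invertible at all `ξ ≠ 0`. -/
def IsElliptic (m : ℤ) (P : Op n F E) : Prop :=
  ∀ c : LocalCoords n F E, ∃ p pj, HasLocalSymbol c m P p pj ∧
    ∀ x ∈ c.dom, ∀ ξ : Rn n, ξ ≠ 0 → IsUnit (pj 0 x ξ)

/-! ### Parametrices -/

/-- Sections vanishing on `K'` have an image under `Q` vanishing on `K`. -/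
def Controls (Q : Op n F E) (K' K : Set M) : Prop :=
  ∀ u : TestSections n F E, (∀ y ∈ K', u.1 y = 0) → ∀ x ∈ K, (Q u).1 x = 0

/-- `Q` is properly supported: both projections from the support of its Schwartz kernel to `M` are
proper. -/
def IsProperlySupported (Q : Op n F E) : Prop :=
  (∀ K : Set M, IsCompact K → ∃ K' : Set M, IsCompact K' ∧
    ∀ u : TestSections n F E, secSupport u.1 ⊆ K → secSupport (Q u).1 ⊆ K') ∧
  (∀ K : Set M, IsCompact K → ∃ K' : Set M, IsCompact K' ∧ Controls Q K' K)

/-- `Q ∈ Ψ^{-m}(M, E)` is a parametrix for `P ∈ Ψ^m(M, E)`, i.e., an inverse of `P` modulo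
smoothing operators. To compose with `P` one uses a properly supported `Q₀ = Q mod Ψ^{-∞}`,
which maps `C_c^∞` to itself (this is `Qc`) and extends to `C^∞` (this is `Qe`; the value of `Qe s`
on `K` is that of `Q₀ u` for any compactly supported `u` that agrees with `s` on a set `K'` as in
`Controls Q₀ K' K`). -/
def IsParametrix (m : ℤ) (P Q : Op n F E) : Prop :=
  IsPsiDO (-m) Q ∧
  ∃ (Q₀ : Op n F E) (Qc : TestSections n F E →ₗ[ℂ] TestSections n F E)
    (Qe : SmoothSections n F E →ₗ[ℂ] SmoothSections n F E),
    IsSmoothing (Q - Q₀) ∧ IsProperlySupported Q₀ ∧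
    incl ∘ₗ Qc = Q₀ ∧
    (∀ K' K : Set M, IsCompact K' → IsCompact K → Controls Q₀ K' K →
      ∀ (s : SmoothSections n F E) (u : TestSections n F E),
        (∀ y ∈ K', u.1 y = s.1 y) → ∀ x ∈ K, (Qe s).1 x = (Q₀ u).1 x) ∧
    IsSmoothing (P ∘ₗ Qc - incl) ∧ IsSmoothing (Qe ∘ₗ P - incl)

/-! ### Densities and logarithmic singularities -/

/-- A 1-density on `M` with values in `End E`: at each point `x` a function of `n`-tuples of tangent
vectors with values in `End E_x` such that `c(A v₁, …, A vₙ) = |det A| c(v₁, …, vₙ)`. -/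
@[ext]
structure EndDensity (n : ℕ) {M : Type*} [TopologicalSpace M] [ChartedSpace (Rn n) M]
    (E : M → Type*) [∀ x, AddCommGroup (E x)] [∀ x, Module ℂ (E x)] where
  /-- the underlying function -/
  toFun : ∀ x : M, (Fin n → TangentSpace (𝓡 n) x) → Module.End ℂ (E x)
  map_comp : ∀ (x : M) (A : TangentSpace (𝓡 n) x →ₗ[ℝ] TangentSpace (𝓡 n) x)
    (v : Fin n → TangentSpace (𝓡 n) x),
    toFun x (fun i => A (v i)) = |LinearMap.det A| • toFun x v

/-- The product of a real function and a density. -/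
def EndDensity.mul {n : ℕ} {M : Type*} [TopologicalSpace M] [ChartedSpace (Rn n) M]
    {E : M → Type*} [∀ x, AddCommGroup (E x)] [∀ x, Module ℂ (E x)]
    (h : M → ℝ) (c : EndDensity n E) : EndDensity n E where
  toFun x v := h x • c.toFun x v
  map_comp x A v := by rw [c.map_comp, smul_comm]

/-- The coefficient of a density in local coordinates: `c = c_loc(y) |dy|`. -/
def LocalCoords.coeff [FiniteDimensional ℂ F] (c : LocalCoords n F E) (d : EndDensity n E)
    (y : Rn n) : F →L[ℂ] F :=
  c.endo (c.chart.symm y) (d.toFun (c.chart.symm y) (c.frame y))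

/-- The smooth density `d` is the logarithmic singularity of the Schwartz kernel of the operator
`P` of order `m`: in all trivializing local coordinates, near the diagonal, the kernel of `P` is
`∑_{-(m+n) ≤ j ≤ -1} a_j(x, x - y) - d(x) log |x - y| + O(1)`
with `a_j` smooth on `V × (ℝⁿ ∖ 0)` and homogeneous of degree `j` in the second variable. -/
def HasLogSingularity [FiniteDimensional ℂ F] (m : ℤ) (P : Op n F E) (d : EndDensity n E) : Prop :=
  ∀ c : LocalCoords n F E,
    ContDiffOn ℝ ∞ (c.coeff d) c.dom ∧
    ∃ (k : Rn n → Rn n → F →L[ℂ] F) (a : ℤ → Rn n → Rn n → F →L[ℂ] F),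
      IsOffDiagonalKernel c c P k ∧
      (∀ j ∈ Finset.Icc (-(m + n)) (-1), IsHomogeneous j c.dom (a j)) ∧
      ∀ x₀ ∈ c.dom, ∃ W ∈ nhds x₀, ∃ C : ℝ, ∀ x ∈ W, ∀ y ∈ W, x ≠ y →
        ‖k x y - (∑ j ∈ Finset.Icc (-(m + n)) (-1), a j x (x - y)
          - Real.log ‖x - y‖ • c.coeff d x)‖ ≤ C

/-- `d` is the Green kernel logarithmic singularity of the operator `P` of order `m`, i.e., the
logarithmic singularity of the Schwartz kernel of a parametrix for `P`. -/
def HasGreenLogSingularity [FiniteDimensional ℂ F] (m : ℤ) (P : Op n F E) (d : EndDensity n E) :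
    Prop :=
  ∃ Q : Op n F E, IsParametrix m P Q ∧ HasLogSingularity (-m) Q d

end Manifold

end PsiDO

end

open PsiDO

/-! Near the diagonal the kernel of a classical operator of order m is the inverse Fourier transform
of its symbol in the variable x - y. A symbol term of degree l > -n contributes a kernel homogeneous
of degree -(n+l), the term of degree -n contributes a logarithm, and the rest is bounded.
Multiplying the kernel by α(x)β(y) with smooth α, β multiplies the logarithmic coefficient by
α(x)β(x), because the Taylor expansion of β at x turns poles into poles and bounded terms, never
into a logarithm. Smoothing operators change the kernel by a bounded term. With α = e^{w'f} and β =
e^{-wf} this is the first assertion.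

Existence is made explicit by scaling. A cut off homogeneous term is a superposition over s > 1 of
dilates of one amplitude supported in an annulus (`IsHomogeneous.cutoff_smul_eq_integral`), so its
kernel is a one-dimensional integral of a rapidly decreasing function of s(x - y). This integral is
homogeneous up to a bounded error, or logarithmic in the critical degree.
`IsSymbol.exists_bound_quantize_sub` adds up the terms, and `norm_kernel_le_of_forall_integral`
passes from integrated estimates to the kernel.

Uniqueness and independence of coordinates are seen on curves. Along x - tψ(t) the kernel has an
expansion in negative powers of t and log t modulo O(1), recorded by `HasLogExp`. The coefficient of
log t is unique and is multiplied by the value at t = 0 of any smooth factor.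
`HasLocalExpansion.transition` deduces the transformation law of a density, whence
`IsPsiDO.existsUnique_hasLogSingularity`.

For the second assertion, β⁻¹Qα⁻¹ is formally a parametrix of αPβ whenever Q is one of P. A full
comparison modulo smoothing operators is not required: it suffices that A = Q' - β⁻¹Qα⁻¹ has a
bounded kernel near the diagonal. `IsParametrix.tendsto_sub` shows that A sends sequences tending to
zero in L¹ to sequences tending to zero at each point, and `exists_bound_of_tendsto` turns this into
|Au(x)| ≤ C‖u‖₁, that is, into a bound for the kernel. The analytic core is a transposition: paired
with a smooth kernel, the image of u under a pseudodifferential operator is controlled by ‖u‖₁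
(`IsSymbol.isNull_quantize`, `IsPsiDO.isWeaklyNull`).

Ellipticity is transferred by testing on u(y)e^{it y·ξ} as t → ∞, which recovers the principal
symbol; that of αPβ is αβ times that of P (`principal_conjugate`). -/

namespace PsiDO

open MeasureTheory Set Filter Topology Function

noncomputable section

/-! ### Oscillatory integrals -/

/-- The oscillating factor `e^{i z·ξ}`. -/
def osc {n : ℕ} (z ξ : Rn n) : ℂ := Complex.exp (Complex.I * (inner ℝ z ξ : ℝ))

section Osc

variable {n : ℕ}

@[simp] lemma norm_osc (z ξ : Rn n) : ‖osc z ξ‖ = 1 := by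
  rw [osc, mul_comm, Complex.norm_exp_ofReal_mul_I]

lemma osc_comm (z ξ : Rn n) : osc z ξ = osc ξ z := by
  rw [osc, osc, real_inner_comm]

@[simp] lemma osc_zero_left (ξ : Rn n) : osc 0 ξ = 1 := by simp [osc]

lemma osc_add_left (z w ξ : Rn n) : osc (z + w) ξ = osc z ξ * osc w ξ := by
  rw [osc, osc, osc, ← Complex.exp_add, inner_add_left]
  push_cast; ring_nf

lemma osc_neg_left (z ξ : Rn n) :
    osc (-z) ξ = Complex.exp (-(Complex.I * (inner ℝ z ξ : ℝ))) := by
  rw [osc, inner_neg_left]; push_cast; ring_nf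

lemma osc_smul_left (s : ℝ) (z ξ : Rn n) : osc (s • z) ξ = osc z (s • ξ) := by
  rw [osc, osc, inner_smul_left, inner_smul_right]; simp

lemma contDiff_osc : ContDiff ℝ ∞ (fun p : Rn n × Rn n => osc p.1 p.2) := by
  unfold osc
  have h : ContDiff ℝ ∞ (fun p : Rn n × Rn n => ((inner ℝ p.1 p.2 : ℝ) : ℂ)) :=
    Complex.ofRealCLM.contDiff.comp (contDiff_fst.inner ℝ contDiff_snd)
  exact (contDiff_const.mul h).cexp

lemma continuous_osc : Continuous (fun p : Rn n × Rn n => osc p.1 p.2) := contDiff_osc.continuous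

lemma continuous_osc_left (ξ : Rn n) : Continuous (fun z => osc z ξ) :=
  continuous_osc.comp (continuous_id.prodMk continuous_const)

lemma continuous_osc_right (z : Rn n) : Continuous (fun ξ => osc z ξ) :=
  continuous_osc.comp (continuous_const.prodMk continuous_id)

lemma norm_osc_sub_one_le (z ξ : Rn n) : ‖osc z ξ - 1‖ ≤ ‖z‖ * ‖ξ‖ := by
  have h := Real.norm_exp_I_mul_ofReal_sub_one_le (x := inner ℝ z ξ)
  exact h.trans (norm_inner_le_norm z ξ)

lemma hasFDerivAt_osc (z ξ : Rn n) :
    HasFDerivAt (fun z => osc z ξ)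
      ((osc z ξ * Complex.I) • Complex.ofRealCLM.comp (innerSL ℝ ξ)) z := by
  have h : HasFDerivAt (fun z : Rn n => ((inner ℝ z ξ : ℝ) : ℂ))
      (Complex.ofRealCLM.comp (innerSL ℝ ξ)) z := by
    have := (Complex.ofRealCLM.comp (innerSL ℝ ξ)).hasFDerivAt (x := z)
    refine this.congr_of_eventuallyEq (Eventually.of_forall fun w => ?_)
    simp [real_inner_comm]
  have h2 := (h.const_mul Complex.I).cexp
  refine h2.congr_fderiv ?_
  ext v
  simp [osc, mul_assoc]

end Osc

/-! ### Decay of Fourier integrals of compactly supported functions -/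

section FourierDecay

variable {n : ℕ} {G : Type*} [NormedAddCommGroup G] [NormedSpace ℂ G]

open scoped FourierTransform in
lemma integral_osc_eq_fourier (f : Rn n → G) (z : Rn n) :
    ∫ ξ, osc z ξ • f ξ = 𝓕 f (-((2 * Real.pi)⁻¹ : ℝ) • z) := by
  rw [Real.fourier_eq']
  refine integral_congr_ae (Eventually.of_forall fun ξ => ?_)
  simp only
  congr 1
  rw [osc, inner_smul_right, real_inner_comm]
  congr 1
  push_cast
  have : (Real.pi : ℂ) ≠ 0 := by exact_mod_cast Real.pi_ne_zero
  field_simp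

lemma iteratedFDeriv_eq_zero_of_notMem {H : Type*} [NormedAddCommGroup H] [NormedSpace ℝ H]
    {f : Rn n → H} {K : Set (Rn n)} (hK : IsClosed K)
    (hf : ∀ ξ ∉ K, f ξ = 0) (k : ℕ) {ξ : Rn n} (hξ : ξ ∉ K) : iteratedFDeriv ℝ k f ξ = 0 := by
  have h : f =ᶠ[𝓝 ξ] fun _ => 0 :=
    eventually_of_mem (hK.isOpen_compl.mem_nhds hξ) fun y hy => hf y hy
  rw [(h.iteratedFDeriv ℝ k).eq_of_nhds]
  simp

open scoped FourierTransform in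
/-- Decay of oscillatory integrals of smooth functions supported in a fixed compact set. -/
lemma exists_fourier_decay (N : ℕ) {K : Set (Rn n)} (hK : IsCompact K) :
    ∃ C₀ : ℝ, 0 ≤ C₀ ∧ ∀ f : Rn n → G, ContDiff ℝ ∞ f → (∀ ξ ∉ K, f ξ = 0) → ∀ B : ℝ,
      (∀ k ≤ N, ∀ ξ ∈ K, ‖iteratedFDeriv ℝ k f ξ‖ ≤ B) →
      ∀ z, ‖z‖ ^ N * ‖∫ ξ, osc z ξ • f ξ‖ ≤ C₀ * B := by
  refine ⟨(2 * Real.pi) ^ N * (2 ^ N * ((N + 1) * (volume K).toReal)), by positivity,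
    fun f hf hfK B hB z => ?_⟩
  have hint : ∀ k : ℕ, Integrable (fun v => ‖iteratedFDeriv ℝ k f v‖) := fun k => by
    have hc : Continuous (iteratedFDeriv ℝ k f) :=
      hf.continuous_iteratedFDeriv (by exact_mod_cast le_top)
    refine (hc.integrable_of_hasCompactSupport ?_).norm
    exact HasCompactSupport.intro hK fun ξ hξ => iteratedFDeriv_eq_zero_of_notMem hK.isClosed hfK k hξ
  -- The library transform has phase -2πi⟨·,·⟩, so it is evaluated at -(2π)⁻¹z; this is where the
  -- factor (2π)^N comes from.
  have key := Real.pow_mul_norm_iteratedFDeriv_fourier_le (K := 0) (N := (⊤ : ℕ∞)) (f := f)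
    hf (fun k m hk _ => by
      have : k = 0 := by simpa using hk
      subst this
      simpa using hint m) (k := 0) (n := N) le_rfl le_top (-((2 * Real.pi)⁻¹ : ℝ) • z)
  rw [integral_osc_eq_fourier]
  simp only [norm_iteratedFDeriv_zero, pow_zero, one_mul, Nat.cast_zero, mul_zero, zero_add,
    Finset.range_one] at key
  have hsum : ∑ p ∈ ({0} : Finset ℕ) ×ˢ Finset.range (N + 1),
      ∫ v, ‖v‖ ^ p.1 * ‖iteratedFDeriv ℝ p.2 f v‖ ≤ (N + 1) * (volume K).toReal * B := by
    calc _ ≤ ∑ p ∈ ({0} : Finset ℕ) ×ˢ Finset.range (N + 1), (volume K).toReal * B := by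
          refine Finset.sum_le_sum fun p hp => ?_
          simp only [Finset.mem_product, Finset.mem_singleton, Finset.mem_range] at hp
          rw [hp.1]
          simp only [pow_zero, one_mul]
          have e : ∫ v, ‖iteratedFDeriv ℝ p.2 f v‖ = ∫ v in K, ‖iteratedFDeriv ℝ p.2 f v‖ := by
            rw [setIntegral_eq_integral_of_forall_compl_eq_zero]
            intro v hv
            rw [iteratedFDeriv_eq_zero_of_notMem hK.isClosed hfK p.2 hv, norm_zero]
          rw [e]
          have := norm_setIntegral_le_of_norm_le_const (μ := volume) (s := K)
            (f := fun v => ‖iteratedFDeriv ℝ p.2 f v‖) (C := B) hK.measure_lt_top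
            (fun x hx => by simpa using hB p.2 (by omega) x hx)
          refine (le_abs_self _).trans ?_
          rw [mul_comm]
          exact this
      _ = _ := by
          simp [Finset.sum_const, mul_assoc]
  have hn : ‖(-((2 * Real.pi)⁻¹ : ℝ) • z)‖ ^ N = ((2 * Real.pi) ^ N)⁻¹ * ‖z‖ ^ N := by
    rw [norm_smul, mul_pow, norm_neg, norm_inv, inv_pow, Real.norm_of_nonneg (by positivity)]
  rw [hn] at key
  have hpos : (0:ℝ) < (2 * Real.pi) ^ N := by positivity
  calc _ = (2 * Real.pi) ^ N * (((2 * Real.pi) ^ N)⁻¹ * ‖z‖ ^ N *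
        ‖𝓕 f (-((2 * Real.pi)⁻¹ : ℝ) • z)‖) := by field_simp
    _ ≤ (2 * Real.pi) ^ N * (2 ^ N * ((N + 1) * (volume K).toReal * B)) := by
        refine mul_le_mul_of_nonneg_left (key.trans ?_) hpos.le
        exact mul_le_mul_of_nonneg_left hsum (by positivity)
    _ = _ := by ring

end FourierDecay

end

end PsiDO

namespace PsiDO

open MeasureTheory Set Filter Topology Function

noncomputable section

set_option linter.unusedSectionVars false

/-! ### Partial derivatives -/

section Partial

variable {X Y H : Type*} [NormedAddCommGroup X] [NormedSpace ℝ X] [NormedAddCommGroup Y]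
  [NormedSpace ℝ Y] [NormedAddCommGroup H] [NormedSpace ℝ H]

/-- Freezing the first variable is composition of a translate of f with the inclusion `inr`.
Translation preserves derivatives and `inr` has norm at most one. -/
lemma norm_iteratedFDeriv_partial_snd_le {f : X × Y → H} {U : Set (X × Y)} (hU : IsOpen U)
    (hf : ContDiffOn ℝ ∞ f U) (k : ℕ) {x : X} {y : Y} (h : (x, y) ∈ U) :
    ‖iteratedFDeriv ℝ k (fun y => f (x, y)) y‖ ≤ ‖iteratedFDeriv ℝ k f (x, y)‖ := by
  set g : X × Y → H := fun w => f ((x, 0) + w) with hg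
  set U' : Set (X × Y) := (fun w => (x, 0) + w) ⁻¹' U with hU'
  have hU'o : IsOpen U' := hU.preimage (by fun_prop)
  have hgs : ContDiffOn ℝ ∞ g U' :=
    hf.comp (contDiff_const.add contDiff_id).contDiffOn fun w hw => hw
  have hy : ContinuousLinearMap.inr ℝ X Y y ∈ U' := by simpa [hU'] using h
  have hpre : IsOpen ((ContinuousLinearMap.inr ℝ X Y) ⁻¹' U') :=
    hU'o.preimage (ContinuousLinearMap.inr ℝ X Y).continuous
  have key := (ContinuousLinearMap.inr ℝ X Y).iteratedFDerivWithin_comp_right (i := k) hgs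
    hU'o.uniqueDiffOn hpre.uniqueDiffOn (x := y) hy (by exact_mod_cast le_top)
  rw [iteratedFDerivWithin_of_isOpen k hpre hy, iteratedFDerivWithin_of_isOpen k hU'o hy] at key
  have e1 : (g ∘ (ContinuousLinearMap.inr ℝ X Y)) = fun y => f (x, y) := by
    ext y; simp [hg]
  have e2 : iteratedFDeriv ℝ k g (ContinuousLinearMap.inr ℝ X Y y) =
      iteratedFDeriv ℝ k f (x, y) := by
    rw [hg, iteratedFDeriv_comp_add_left]; simp
  rw [e1, e2] at key
  rw [key]
  refine (ContinuousMultilinearMap.norm_compContinuousLinearMap_le _ _).trans ?_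
  refine mul_le_of_le_one_right (norm_nonneg _) ?_
  exact Finset.prod_le_one (fun _ _ => norm_nonneg _)
    fun _ _ => ContinuousLinearMap.norm_inr_le_one ℝ X Y

lemma exists_bound_iteratedFDeriv_partial_snd {f : X × Y → H} {U : Set (X × Y)} (hU : IsOpen U)
    (hf : ContDiffOn ℝ ∞ f U) {L : Set X} {K : Set Y} (hL : IsCompact L) (hK : IsCompact K)
    (hLK : L ×ˢ K ⊆ U) (N : ℕ) :
    ∃ B : ℝ, 0 ≤ B ∧ ∀ k ≤ N, ∀ x ∈ L, ∀ y ∈ K,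
      ‖iteratedFDeriv ℝ k (fun y => f (x, y)) y‖ ≤ B := by
  have h1 : ∀ k : ℕ, ∃ B : ℝ, ∀ p ∈ L ×ˢ K, ‖iteratedFDeriv ℝ k f p‖ ≤ B := fun k => by
    refine (hL.prod hK).exists_bound_of_continuousOn ?_
    have := hf.continuousOn_iteratedFDerivWithin (m := k) (by exact_mod_cast le_top) hU.uniqueDiffOn
    exact (this.congr fun p hp => (iteratedFDerivWithin_of_isOpen k hU hp).symm).mono hLK
  choose B hB using h1
  refine ⟨∑ k ∈ Finset.range (N + 1), |B k|, by positivity, fun k hk x hx y hy => ?_⟩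
  refine (norm_iteratedFDeriv_partial_snd_le hU hf k (hLK ⟨hx, hy⟩)).trans ?_
  refine ((hB k (x, y) ⟨hx, hy⟩).trans (le_abs_self _)).trans ?_
  exact Finset.single_le_sum (f := fun k => |B k|) (fun _ _ => abs_nonneg _)
    (Finset.mem_range.2 (by omega))

lemma contDiffOn_partial_fst_fderiv {f : X × Y → H} {U : Set (X × Y)} (hU : IsOpen U)
    (hf : ContDiffOn ℝ ∞ f U) :
    ContDiffOn ℝ ∞ (fun p : X × Y => fderiv ℝ (fun x => f (x, p.2)) p.1) U := by
  have h : ContDiffOn ℝ ∞ (fun p => (fderiv ℝ f p).comp (ContinuousLinearMap.inl ℝ X Y)) U :=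
    (hf.fderiv_of_isOpen hU (m := ∞) (by simp)).clm_comp contDiffOn_const
  refine h.congr fun p hp => ?_
  have hd : HasFDerivAt f (fderiv ℝ f p) p :=
    ((hf.differentiableOn (by simp)).differentiableAt (hU.mem_nhds hp)).hasFDerivAt
  have hi : HasFDerivAt (fun x : X => (x, p.2)) (ContinuousLinearMap.inl ℝ X Y) p.1 :=
    hasFDerivAt_prodMk_left p.1 p.2
  exact (HasFDerivAt.comp p.1 (f := fun x : X => (x, p.2)) hd hi).fderiv

lemma hasFDerivAt_partial_fst {f : X × Y → H} {U : Set (X × Y)} (hU : IsOpen U)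
    (hf : ContDiffOn ℝ ∞ f U) {p : X × Y} (hp : p ∈ U) :
    HasFDerivAt (fun x => f (x, p.2)) (fderiv ℝ (fun x => f (x, p.2)) p.1) p.1 := by
  have hd : HasFDerivAt f (fderiv ℝ f p) p :=
    ((hf.differentiableOn (by simp)).differentiableAt (hU.mem_nhds hp)).hasFDerivAt
  have hi : HasFDerivAt (fun x : X => (x, p.2)) (ContinuousLinearMap.inl ℝ X Y) p.1 :=
    hasFDerivAt_prodMk_left p.1 p.2
  exact (HasFDerivAt.comp p.1 (f := fun x : X => (x, p.2)) hd hi).differentiableAt.hasFDerivAt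

end Partial

/-- Any real structure compatible with a complex one is the restriction of scalars. -/
lemma normedSpace_eq_complexToReal {G : Type*} [NormedAddCommGroup G] [NormedSpace ℂ G]
    (i : NormedSpace ℝ G) [IsScalarTower ℝ ℂ G] : i = NormedSpace.complexToReal := by
  ext r x
  have h : r • x = (r • (1 : ℂ)) • x := by rw [smul_assoc, one_smul]
  refine h.trans ?_
  have h2 : (r • (1 : ℂ)) = (r : ℂ) := by simp
  rw [h2]
  rfl

/-- The derivatives of the families below take values in spaces such as `Rn n × Rn n →L[ℝ] G`, whose
real structure is not by definition the restriction of the complex one. Only the scalar tower is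
assumed here. -/
lemma exists_fourier_decay_of_tower {n : ℕ} {G : Type*} [NormedAddCommGroup G] [NormedSpace ℂ G]
    [i : NormedSpace ℝ G] [IsScalarTower ℝ ℂ G] (N : ℕ) {K : Set (Rn n)} (hK : IsCompact K) :
    ∃ C₀ : ℝ, 0 ≤ C₀ ∧ ∀ f : Rn n → G, ContDiff ℝ ∞ f → (∀ ξ ∉ K, f ξ = 0) → ∀ B : ℝ,
      (∀ k ≤ N, ∀ ξ ∈ K, ‖iteratedFDeriv ℝ k f ξ‖ ≤ B) →
      ∀ z, ‖z‖ ^ N * ‖∫ ξ, osc z ξ • f ξ‖ ≤ C₀ * B := by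
  obtain rfl := normedSpace_eq_complexToReal i
  exact exists_fourier_decay N hK

/-! ### Fourier integrals of families supported in the unit ball -/

section Families

universe u

variable {n : ℕ} {G : Type u} [NormedAddCommGroup G] [NormedSpace ℂ G] [NormedSpace ℝ G]
  [IsScalarTower ℝ ℂ G]

/-- A family `q x`, smooth in `x ∈ V`, of smooth functions supported in the unit ball. -/
structure IsBallFamily (V : Set (Rn n)) (q : Rn n → Rn n → G) : Prop where
  isOpen : IsOpen V
  smooth : ContDiffOn ℝ ∞ (uncurry q) (V ×ˢ univ)
  zero : ∀ x ∈ V, ∀ ξ : Rn n, ξ ∉ Metric.closedBall (0 : Rn n) 1 → q x ξ = 0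

/-- `∫ e^{i z·ξ} q(x, ξ) dξ`. -/
def oscInt (q : Rn n → Rn n → G) (x z : Rn n) : G := ∫ ξ, osc z ξ • q x ξ

/-- The part of the derivative of the amplitude coming from its dependence on `x`. -/
def derivParam (q : Rn n → Rn n → G) (x ξ : Rn n) : Rn n × Rn n →L[ℝ] G :=
  (fderiv ℝ (fun x' => q x' ξ) x).comp (ContinuousLinearMap.fst ℝ (Rn n) (Rn n))

/-- The part of the derivative of the amplitude coming from the phase. -/
def derivPhase (q : Rn n → Rn n → G) (x ξ : Rn n) : Rn n × Rn n →L[ℝ] G :=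
  ((innerSL ℝ ξ).comp (ContinuousLinearMap.snd ℝ (Rn n) (Rn n))).smulRight (Complex.I • q x ξ)

namespace IsBallFamily

variable {V : Set (Rn n)} {q : Rn n → Rn n → G}

lemma isOpen_prod (h : IsBallFamily V q) : IsOpen (V ×ˢ (univ : Set (Rn n))) :=
  h.isOpen.prod isOpen_univ

lemma contDiff_right (h : IsBallFamily V q) {x : Rn n} (hx : x ∈ V) : ContDiff ℝ ∞ (q x) := by
  rw [← contDiffOn_univ]
  exact h.smooth.comp (contDiff_const.prodMk contDiff_id).contDiffOn
    (fun ξ _ => ⟨hx, mem_univ _⟩)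

lemma integrable (h : IsBallFamily V q) {x : Rn n} (hx : x ∈ V) : Integrable (q x) :=
  (h.contDiff_right hx).continuous.integrable_of_hasCompactSupport
    (HasCompactSupport.intro (isCompact_closedBall 0 1) (h.zero x hx))

lemma integrable_osc (h : IsBallFamily V q) {x : Rn n} (hx : x ∈ V) (z : Rn n) :
    Integrable (fun ξ => osc z ξ • q x ξ) := by
  refine (h.integrable hx).norm.mono' ?_ (Eventually.of_forall fun ξ => by simp [norm_smul])
  exact ((continuous_osc_right z).smul (h.contDiff_right hx).continuous).aestronglyMeasurable

/-- Together with `derivPhase` this closes ball families under differentiation: both parts of the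
derivative of an oscillatory integral are oscillatory integrals of ball families with a larger
target. -/
lemma derivParam (h : IsBallFamily V q) : IsBallFamily V (derivParam q) where
  isOpen := h.isOpen
  smooth := (contDiffOn_partial_fst_fderiv h.isOpen_prod h.smooth).clm_comp contDiffOn_const
  zero x hx ξ hξ := by
    have e : (fun x' => q x' ξ) =ᶠ[𝓝 x] fun _ => 0 :=
      eventually_of_mem (h.isOpen.mem_nhds hx) fun x' hx' => h.zero x' hx' ξ hξ
    rw [PsiDO.derivParam, e.fderiv_eq]
    simp

lemma derivPhase (h : IsBallFamily V q) : IsBallFamily V (derivPhase q) where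
  isOpen := h.isOpen
  smooth := by
    have h1 : ContDiff ℝ ∞ (fun p : Rn n × Rn n =>
        (innerSL ℝ p.2).comp (ContinuousLinearMap.snd ℝ (Rn n) (Rn n))) :=
      ((innerSL ℝ (E := Rn n)).contDiff.comp contDiff_snd).clm_comp contDiff_const
    exact h1.contDiffOn.smulRight (h.smooth.const_smul Complex.I)
  zero x hx ξ hξ := by
    rw [PsiDO.derivPhase, h.zero x hx ξ hξ]
    simp

lemma exists_bound (h : IsBallFamily V q) {L : Set (Rn n)} (hL : IsCompact L) (hLV : L ⊆ V) :
    ∃ B : ℝ, 0 ≤ B ∧ ∀ x ∈ L, ∀ ξ, ‖q x ξ‖ ≤ B := by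
  obtain ⟨B, hB0, hB⟩ := exists_bound_iteratedFDeriv_partial_snd h.isOpen_prod h.smooth hL
    (isCompact_closedBall (0 : Rn n) 1) (prod_mono hLV (subset_univ _)) 0
  refine ⟨B, hB0, fun x hx ξ => ?_⟩
  by_cases hξ : ξ ∈ Metric.closedBall (0 : Rn n) 1
  · simpa using hB 0 le_rfl x hx ξ hξ
  · rw [h.zero x (hLV hx) ξ hξ]; simpa using hB0

/-- Rapid decay of the Fourier integrals, locally uniformly in the parameter. -/
lemma exists_decay (h : IsBallFamily V q) (N : ℕ) {L : Set (Rn n)} (hL : IsCompact L)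
    (hLV : L ⊆ V) :
    ∃ C : ℝ, 0 ≤ C ∧ ∀ x ∈ L, ∀ z, ‖oscInt q x z‖ ≤ C * ((1 + ‖z‖) ^ N)⁻¹ := by
  obtain ⟨B, hB0, hB⟩ := exists_bound_iteratedFDeriv_partial_snd h.isOpen_prod h.smooth hL
    (isCompact_closedBall (0 : Rn n) 1) (prod_mono hLV (subset_univ _)) N
  obtain ⟨C0, hC0, hC⟩ := exists_fourier_decay_of_tower (G := G) N (isCompact_closedBall (0 : Rn n) 1)
  obtain ⟨C1, hC1, hC'⟩ := exists_fourier_decay_of_tower (G := G) 0 (isCompact_closedBall (0 : Rn n) 1)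
  refine ⟨2 ^ N * (C1 * B + C0 * B), by positivity, fun x hx z => ?_⟩
  have hx' := hLV hx
  have b1 := hC (q x) (h.contDiff_right hx') (h.zero x hx') B
    (fun k hk ξ hξ => hB k hk x hx ξ hξ) z
  have b2 := hC' (q x) (h.contDiff_right hx') (h.zero x hx') B
    (fun k hk ξ hξ => hB k (by omega) x hx ξ hξ) z
  rw [pow_zero, one_mul] at b2
  -- Adding the estimates of orders 0 and N replaces ‖z‖^N by (1 + ‖z‖)^N, so that small z need no
  -- separate treatment.
  have hp : (1 + ‖z‖) ^ N ≤ 2 ^ N * (1 + ‖z‖ ^ N) := by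
    refine (add_pow_le zero_le_one (norm_nonneg z) N).trans ?_
    rw [one_pow]
    gcongr
    · norm_num
    · omega
  rw [← div_eq_mul_inv, le_div_iff₀ (by positivity), mul_comm]
  calc (1 + ‖z‖) ^ N * ‖oscInt q x z‖ ≤ 2 ^ N * (1 + ‖z‖ ^ N) * ‖oscInt q x z‖ := by gcongr
    _ = 2 ^ N * (‖oscInt q x z‖ + ‖z‖ ^ N * ‖oscInt q x z‖) := by ring
    _ ≤ _ := by
      refine mul_le_mul_of_nonneg_left (add_le_add b2 b1) (by positivity)

lemma exists_bound_oscInt (h : IsBallFamily V q) {L : Set (Rn n)} (hL : IsCompact L)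
    (hLV : L ⊆ V) : ∃ C : ℝ, 0 ≤ C ∧ ∀ x ∈ L, ∀ z, ‖oscInt q x z‖ ≤ C := by
  obtain ⟨C, hC, h'⟩ := h.exists_decay 0 hL hLV
  exact ⟨C, hC, fun x hx z => by simpa using h' x hx z⟩

/-- The Fourier integrals are Lipschitz at `0`, locally uniformly in the parameter. -/
lemma exists_lipschitz (h : IsBallFamily V q) {L : Set (Rn n)} (hL : IsCompact L) (hLV : L ⊆ V) :
    ∃ C : ℝ, 0 ≤ C ∧ ∀ x ∈ L, ∀ z, ‖oscInt q x z - oscInt q x 0‖ ≤ C * ‖z‖ := by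
  obtain ⟨B, hB0, hB⟩ := h.exists_bound hL hLV
  set K := Metric.closedBall (0 : Rn n) 1
  refine ⟨B * (volume K).toReal, by positivity, fun x hx z => ?_⟩
  have hx' := hLV hx
  have e : oscInt q x z - oscInt q x 0 = ∫ ξ in K, (osc z ξ - 1) • q x ξ := by
    rw [oscInt, oscInt, ← integral_sub (h.integrable_osc hx' z) (h.integrable_osc hx' 0),
      setIntegral_eq_integral_of_forall_compl_eq_zero]
    · refine integral_congr_ae (Eventually.of_forall fun ξ => ?_)
      simp [sub_smul]
    · intro ξ hξ
      rw [h.zero x hx' ξ hξ, smul_zero]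
  rw [e]
  have := norm_setIntegral_le_of_norm_le_const (μ := volume) (s := K)
    (f := fun ξ => (osc z ξ - 1) • q x ξ) (C := ‖z‖ * B)
    (isCompact_closedBall (0 : Rn n) 1).measure_lt_top (fun ξ hξ => by
      rw [norm_smul]
      refine mul_le_mul ((norm_osc_sub_one_le z ξ).trans ?_) (hB x hx ξ) (norm_nonneg _)
        (norm_nonneg _)
      refine mul_le_of_le_one_right (norm_nonneg _) (by simpa [K] using hξ))
  refine this.trans (le_of_eq ?_)
  rw [Measure.real]; ring

lemma hasFDerivAt_integrand (h : IsBallFamily V q) {x : Rn n} (hx : x ∈ V) (z ξ : Rn n) :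
    HasFDerivAt (fun p : Rn n × Rn n => osc p.2 ξ • q p.1 ξ)
      (osc z ξ • PsiDO.derivParam q x ξ + osc z ξ • PsiDO.derivPhase q x ξ) (x, z) := by
  have h1 : HasFDerivAt (fun p : Rn n × Rn n => q p.1 ξ) (PsiDO.derivParam q x ξ) (x, z) := by
    have := hasFDerivAt_partial_fst h.isOpen_prod h.smooth (p := (x, ξ)) ⟨hx, mem_univ _⟩
    exact HasFDerivAt.comp (f := Prod.fst) (x, z) (by simpa using this) hasFDerivAt_fst
  have h2 : HasFDerivAt (fun p : Rn n × Rn n => osc p.2 ξ) _ (x, z) :=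
    HasFDerivAt.comp (f := Prod.snd) (x, z) (hasFDerivAt_osc z ξ) hasFDerivAt_snd
  refine (h2.smul h1).congr_fderiv ?_
  ext v
  · simp [PsiDO.derivPhase]
  · simp only [PsiDO.derivPhase, FunLike.coe_add, FunLike.coe_smul, ContinuousLinearMap.coe_comp,
      comp_apply, Pi.add_apply, Pi.smul_apply, ContinuousLinearMap.smulRight_apply,
      ContinuousLinearMap.coe_snd', ContinuousLinearMap.inr_apply, Complex.ofRealCLM_apply,
      innerSL_apply_apply, smul_eq_mul]
    rw [smul_comm (inner ℝ ξ v) Complex.I, mul_smul, mul_smul]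
    congr 3
    rw [← smul_one_smul ℂ (inner ℝ ξ v)]
    simp

/-- Differentiation under the integral sign. The integrands vanish outside the unit ball and are
bounded uniformly for x in a compact neighbourhood and for all z, so a constant on the ball
dominates. -/
lemma hasFDerivAt_oscInt (h : IsBallFamily V q) {x : Rn n} (hx : x ∈ V) (z : Rn n) :
    HasFDerivAt (fun p : Rn n × Rn n => oscInt q p.1 p.2)
      (oscInt (PsiDO.derivParam q) x z + oscInt (PsiDO.derivPhase q) x z) (x, z) := by
  obtain ⟨L, hL, hLx, hLV⟩ : ∃ L, IsCompact L ∧ L ∈ 𝓝 x ∧ L ⊆ V := by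
    obtain ⟨L, hL, hLV, hc⟩ := local_compact_nhds (h.isOpen.mem_nhds hx)
    exact ⟨L, hc, hL, hLV⟩
  obtain ⟨B1, hB1, hb1⟩ := h.derivParam.exists_bound hL hLV
  obtain ⟨B2, hB2, hb2⟩ := h.derivPhase.exists_bound hL hLV
  let K := Metric.closedBall (0 : Rn n) 1
  rw [oscInt, oscInt, ← integral_add (h.derivParam.integrable_osc hx z)
    (h.derivPhase.integrable_osc hx z)]
  refine hasFDerivAt_integral_of_dominated_of_fderiv_le (𝕜 := ℝ) (μ := volume) (x₀ := (x, z))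
    (F := fun (p : Rn n × Rn n) ξ => osc p.2 ξ • q p.1 ξ)
    (F' := fun (p : Rn n × Rn n) ξ => osc p.2 ξ • PsiDO.derivParam q p.1 ξ +
      osc p.2 ξ • PsiDO.derivPhase q p.1 ξ)
    (s := L ×ˢ univ) (bound := K.indicator fun _ => B1 + B2)
    (prod_mem_nhds hLx univ_mem) ?_ (h.integrable_osc hx z) ?_ ?_ ?_ ?_
  · have : ∀ᶠ p : Rn n × Rn n in 𝓝 (x, z), p.1 ∈ V :=
      continuous_fst.continuousAt.eventually (h.isOpen.mem_nhds hx)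
    filter_upwards [this] with p hp
    exact (h.integrable_osc hp p.2).aestronglyMeasurable
  · exact ((h.derivParam.integrable_osc hx z).add
      (h.derivPhase.integrable_osc hx z)).aestronglyMeasurable
  · refine Eventually.of_forall fun ξ p hp => ?_
    by_cases hξ : ξ ∈ K
    · rw [indicator_of_mem hξ]
      refine (norm_add_le _ _).trans (add_le_add ?_ ?_)
      · simpa [norm_smul] using hb1 p.1 hp.1 ξ
      · simpa [norm_smul] using hb2 p.1 hp.1 ξ
    · rw [indicator_of_notMem hξ, h.derivParam.zero p.1 (hLV hp.1) ξ hξ,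
        h.derivPhase.zero p.1 (hLV hp.1) ξ hξ]
      simp
  · rw [integrable_indicator_iff measurableSet_closedBall]
    exact integrableOn_const (isCompact_closedBall (0 : Rn n) 1).measure_lt_top.ne
  · exact Eventually.of_forall fun ξ p hp => h.hasFDerivAt_integrand (hLV hp.1) p.2 ξ

lemma continuousOn_oscInt (h : IsBallFamily V q) :
    ContinuousOn (fun p : Rn n × Rn n => oscInt q p.1 p.2) (V ×ˢ univ) := fun p hp =>
  (h.hasFDerivAt_oscInt hp.1 p.2).continuousAt.continuousWithinAt

end IsBallFamily

end Families

end

end PsiDO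

namespace PsiDO

open MeasureTheory Set Filter Topology Function

noncomputable section

set_option linter.unusedSectionVars false

/-! ### Homogeneous kernels as radial integrals -/

section Radial

universe u

variable {n : ℕ} {G : Type u} [NormedAddCommGroup G] [NormedSpace ℂ G] [NormedSpace ℝ G]
  [IsScalarTower ℝ ℂ G]

/-- `∫₀^∞ s^d q^(x, s z) ds`, where `q^` is the Fourier integral of `q`. -/
def radialInt (q : Rn n → Rn n → G) (d : ℕ) (x z : Rn n) : G :=
  ∫ s in Ioi (0 : ℝ), s ^ d • oscInt q x (s • z)

/-- `∫₁^∞ s^e q^(x, s z) ds`, where `q^` is the Fourier integral of `q`. -/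
def tailInt (q : Rn n → Rn n → G) (e : ℤ) (x z : Rn n) : G :=
  ∫ s in Ioi (1 : ℝ), s ^ e • oscInt q x (s • z)

/-- The integral runs over the whole half line, so the substitution s ↦ ts absorbs a dilation of z
exactly. -/
lemma radialInt_smul (q : Rn n → Rn n → G) (d : ℕ) (x z : Rn n) {t : ℝ} (ht : 0 < t) :
    radialInt q d x (t • z) = t ^ (-(d + 1 : ℤ)) • radialInt q d x z := by
  have h := integral_comp_mul_left_Ioi (fun s : ℝ => s ^ d • oscInt q x (s • z)) 0 ht
  rw [mul_zero] at h
  have e : radialInt q d x (t • z) =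
      (t ^ d)⁻¹ • ∫ s in Ioi (0 : ℝ), (t * s) ^ d • oscInt q x ((t * s) • z) := by
    rw [radialInt, ← integral_smul]
    refine integral_congr_ae (Eventually.of_forall fun s => ?_)
    simp only
    rw [smul_smul, smul_smul, mul_pow, ← mul_assoc, inv_mul_cancel₀ (by positivity), one_mul,
      mul_comm s t]
  rw [e, h, smul_smul, radialInt]
  congr 1
  rw [zpow_neg, ← mul_inv, zpow_add₀ ht.ne', zpow_one, zpow_natCast]

namespace IsBallFamily

variable {V : Set (Rn n)} {q : Rn n → Rn n → G}

/-- Decay of order d + 2 beats s^d and leaves an integrable function of s. The lower bound on ‖z‖ is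
what converts decay in sz into decay in s. -/
lemma exists_bound_radial (h : IsBallFamily V q) (d : ℕ) {L : Set (Rn n)} (hL : IsCompact L)
    (hLV : L ⊆ V) {δ : ℝ} (hδ : 0 < δ) :
    ∃ C : ℝ, 0 ≤ C ∧ ∀ x ∈ L, ∀ z, δ ≤ ‖z‖ → ∀ s : ℝ, 0 < s →
      ‖s ^ d • oscInt q x (s • z)‖ ≤ C * (1 + s ^ 2)⁻¹ := by
  obtain ⟨C, hC0, hC⟩ := h.exists_decay (d + 2) hL hLV
  set ε := min δ 1 with hε
  have hε0 : 0 < ε := lt_min hδ one_pos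
  refine ⟨C * (ε ^ (d + 2))⁻¹, by positivity, fun x hx z hz s hs => ?_⟩
  have h1 : ε * (1 + s) ≤ 1 + ‖s • z‖ := by
    rw [norm_smul, Real.norm_of_nonneg hs.le]
    have a1 : ε ≤ 1 := min_le_right _ _
    have a2 : ε ≤ ‖z‖ := (min_le_left _ _).trans hz
    nlinarith
  rw [norm_smul, Real.norm_of_nonneg (by positivity)]
  calc s ^ d * ‖oscInt q x (s • z)‖
      ≤ (1 + s) ^ d * (C * ((ε * (1 + s)) ^ (d + 2))⁻¹) := by
        refine mul_le_mul (pow_le_pow_left₀ hs.le (by linarith) _) ((hC x hx _).trans ?_)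
          (norm_nonneg _) (by positivity)
        gcongr
    _ = C * (ε ^ (d + 2))⁻¹ * ((1 + s) ^ 2)⁻¹ := by
        rw [mul_pow, pow_add (1 + s)]
        have : (1 + s) ^ d ≠ 0 := by positivity
        field_simp
    _ ≤ _ := by
        gcongr
        nlinarith

lemma continuousOn_radial_integrand (h : IsBallFamily V q) {x : Rn n} (hx : x ∈ V) (z : Rn n) :
    Continuous (fun s : ℝ => oscInt q x (s • z)) := by
  have := h.continuousOn_oscInt.comp_continuous (f := fun s : ℝ => (x, s • z)) (by fun_prop)
    (fun s => ⟨hx, mem_univ _⟩)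
  exact this

lemma integrable_bound (C : ℝ) (S : Set ℝ) : IntegrableOn (fun s : ℝ => C * (1 + s ^ 2)⁻¹) S :=
  (integrable_inv_one_add_sq.const_mul C).integrableOn

lemma integrableOn_radial (h : IsBallFamily V q) (d : ℕ) {x z : Rn n} (hx : x ∈ V) (hz : z ≠ 0) :
    IntegrableOn (fun s : ℝ => s ^ d • oscInt q x (s • z)) (Ioi 0) := by
  obtain ⟨C, -, hC⟩ := h.exists_bound_radial d (isCompact_singleton (x := x))
    (singleton_subset_iff.2 hx) (norm_pos_iff.2 hz)
  refine (integrable_bound C (Ioi 0)).mono' ?_ ?_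
  · exact ((continuous_pow d).smul (h.continuousOn_radial_integrand hx z)).aestronglyMeasurable
  · exact (ae_restrict_iff' measurableSet_Ioi).2
      (Eventually.of_forall fun s hs => hC x rfl z le_rfl s hs)

/-- With `oscInt_derivPhase_apply` this separates the derivative at (x, sz) into a part blind to z
and a part linear in the increment of z. The chain rule then puts the extra factor s on the phase
part alone. -/
lemma oscInt_derivParam_apply (h : IsBallFamily V q) {x : Rn n} (hx : x ∈ V) (z a b b' : Rn n) :
    oscInt (PsiDO.derivParam q) x z (a, b) = oscInt (PsiDO.derivParam q) x z (a, b') := by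
  rw [oscInt, ContinuousLinearMap.integral_apply (h.derivParam.integrable_osc hx z),
    ContinuousLinearMap.integral_apply (h.derivParam.integrable_osc hx z)]
  rfl

lemma oscInt_derivPhase_apply (h : IsBallFamily V q) {x : Rn n} (hx : x ∈ V) (z a a' b : Rn n)
    (s : ℝ) :
    oscInt (PsiDO.derivPhase q) x z (a, s • b) = s • oscInt (PsiDO.derivPhase q) x z (a', b) := by
  rw [oscInt, ContinuousLinearMap.integral_apply (h.derivPhase.integrable_osc hx z),
    ContinuousLinearMap.integral_apply (h.derivPhase.integrable_osc hx z), ← integral_smul]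
  refine integral_congr_ae (Eventually.of_forall fun ξ => ?_)
  simp only [PsiDO.derivPhase, FunLike.coe_smul, Pi.smul_apply,
    ContinuousLinearMap.smulRight_apply, ContinuousLinearMap.coe_comp, comp_apply,
    ContinuousLinearMap.coe_snd', map_smul, smul_eq_mul]
  rw [mul_smul, smul_comm (osc z ξ) s]

lemma hasFDerivAt_radial_integrand (h : IsBallFamily V q) (d : ℕ) {x : Rn n} (hx : x ∈ V)
    (z : Rn n) (s : ℝ) :
    HasFDerivAt (fun p : Rn n × Rn n => s ^ d • oscInt q p.1 (s • p.2))
      (s ^ d • oscInt (PsiDO.derivParam q) x (s • z) +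
        s ^ (d + 1) • oscInt (PsiDO.derivPhase q) x (s • z)) (x, z) := by
  have h1 : HasFDerivAt (fun p : Rn n × Rn n => (p.1, s • p.2))
      ((ContinuousLinearMap.fst ℝ (Rn n) (Rn n)).prod
        (s • ContinuousLinearMap.snd ℝ (Rn n) (Rn n))) (x, z) :=
    hasFDerivAt_fst.prodMk (hasFDerivAt_snd.const_smul s)
  have h2 := (HasFDerivAt.comp (x, z) (f := fun p : Rn n × Rn n => (p.1, s • p.2))
    (h.hasFDerivAt_oscInt hx (s • z)) h1).const_smul (s ^ d)
  refine h2.congr_fderiv ?_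
  refine ContinuousLinearMap.ext fun v => ?_
  obtain ⟨a, b⟩ := v
  simp only [FunLike.coe_smul, FunLike.coe_add, Pi.smul_apply, Pi.add_apply,
    ContinuousLinearMap.coe_comp, comp_apply, ContinuousLinearMap.prod_apply,
    ContinuousLinearMap.coe_fst', ContinuousLinearMap.coe_snd']
  rw [h.oscInt_derivPhase_apply hx _ a a b s, h.oscInt_derivParam_apply hx _ a (s • b) b,
    smul_add, smul_smul, pow_succ]

/-- Dominated differentiation on a neighbourhood of z bounded away from the origin. The derivative
is a sum of integrals of the same kind, with exponent raised by one where the phase is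
differentiated. -/
lemma hasFDerivAt_radialInt (h : IsBallFamily V q) (d : ℕ) {x z : Rn n} (hx : x ∈ V)
    (hz : z ≠ 0) :
    HasFDerivAt (fun p : Rn n × Rn n => radialInt q d p.1 p.2)
      (radialInt (PsiDO.derivParam q) d x z + radialInt (PsiDO.derivPhase q) (d + 1) x z)
      (x, z) := by
  obtain ⟨L, hL, hLx, hLV⟩ : ∃ L, IsCompact L ∧ L ∈ 𝓝 x ∧ L ⊆ V := by
    obtain ⟨L, hL, hLV, hc⟩ := local_compact_nhds (h.isOpen.mem_nhds hx)
    exact ⟨L, hc, hL, hLV⟩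
  have hz0 : 0 < ‖z‖ := norm_pos_iff.2 hz
  have hδ : 0 < ‖z‖ / 2 := by linarith
  have hN : {w : Rn n | ‖z‖ / 2 ≤ ‖w‖} ∈ 𝓝 z := by
    filter_upwards [continuous_norm.continuousAt.eventually (lt_mem_nhds (half_lt_self hz0))]
      with w hw using hw.le
  obtain ⟨C1, hC1, hc1⟩ := h.derivParam.exists_bound_radial d hL hLV hδ
  obtain ⟨C2, hC2, hc2⟩ := h.derivPhase.exists_bound_radial (d + 1) hL hLV hδ
  have i1 := h.derivParam.integrableOn_radial d hx hz
  have i2 := h.derivPhase.integrableOn_radial (d + 1) hx hz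
  rw [radialInt, radialInt, ← integral_add i1 i2]
  refine hasFDerivAt_integral_of_dominated_of_fderiv_le (𝕜 := ℝ) (μ := volume.restrict (Ioi 0))
    (x₀ := (x, z)) (F := fun (p : Rn n × Rn n) (s : ℝ) => s ^ d • oscInt q p.1 (s • p.2))
    (F' := fun (p : Rn n × Rn n) s => s ^ d • oscInt (PsiDO.derivParam q) p.1 (s • p.2) +
        s ^ (d + 1) • oscInt (PsiDO.derivPhase q) p.1 (s • p.2))
    (s := L ×ˢ {w : Rn n | ‖z‖ / 2 ≤ ‖w‖})
    (bound := fun s => C1 * (1 + s ^ 2)⁻¹ + C2 * (1 + s ^ 2)⁻¹)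
    (prod_mem_nhds hLx hN) ?_ (h.integrableOn_radial d hx hz) ?_ ?_ ?_ ?_
  · have : ∀ᶠ p : Rn n × Rn n in 𝓝 (x, z), p.1 ∈ V :=
      continuous_fst.continuousAt.eventually (h.isOpen.mem_nhds hx)
    filter_upwards [this] with p hp
    exact ((continuous_pow d).smul (h.continuousOn_radial_integrand hp p.2)).aestronglyMeasurable
  · exact (i1.add i2).aestronglyMeasurable
  · refine (ae_restrict_iff' measurableSet_Ioi).2 (Eventually.of_forall fun s hs p hp => ?_)
    exact (norm_add_le _ _).trans (add_le_add (hc1 p.1 hp.1 p.2 hp.2 s hs)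
      (hc2 p.1 hp.1 p.2 hp.2 s hs))
  · exact (integrable_bound C1 _).add (integrable_bound C2 _)
  · exact Eventually.of_forall fun s p hp => h.hasFDerivAt_radial_integrand d (hLV hp.1) p.2 s

/-- The induction has to run over all targets, amplitudes and exponents at once, since each
derivative changes all three. The targets stay in one universe because `Rn n` is small. -/
lemma contDiffOn_nat_radialInt (k : ℕ) : ∀ {G : Type u} [NormedAddCommGroup G] [NormedSpace ℂ G]
    [NormedSpace ℝ G] [IsScalarTower ℝ ℂ G] {q : Rn n → Rn n → G} (_ : IsBallFamily V q) (d : ℕ),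
    ContDiffOn ℝ k (uncurry (radialInt q d)) (V ×ˢ {0}ᶜ) := by
  induction k with
  | zero =>
    intro G _ _ _ _ q h d
    exact contDiffOn_zero.2 fun p hp =>
      (h.hasFDerivAt_radialInt d hp.1 hp.2).continuousAt.continuousWithinAt
  | succ k ih =>
    intro G _ _ _ _ q h d
    have hO : IsOpen (V ×ˢ ({0}ᶜ : Set (Rn n))) := h.isOpen.prod isOpen_compl_singleton
    have hk : ((k + 1 : ℕ) : WithTop ℕ∞) = (k : WithTop ℕ∞) + 1 := by push_cast; rfl
    rw [hk, contDiffOn_succ_iff_fderiv_of_isOpen hO]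
    refine ⟨fun p hp =>
      (h.hasFDerivAt_radialInt d hp.1 hp.2).differentiableAt.differentiableWithinAt,
      fun hw => absurd hw (by simp), ?_⟩
    refine ((ih h.derivParam d).add (ih h.derivPhase (d + 1))).congr fun p hp => ?_
    exact (h.hasFDerivAt_radialInt d hp.1 hp.2).fderiv

lemma contDiffOn_radialInt (h : IsBallFamily V q) (d : ℕ) :
    ContDiffOn ℝ ∞ (uncurry (radialInt q d)) (V ×ˢ {0}ᶜ) :=
  contDiffOn_infty.2 fun k => contDiffOn_nat_radialInt k h d

end IsBallFamily

end Radial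

end

end PsiDO

namespace PsiDO

open MeasureTheory Set Filter Topology Function

noncomputable section

set_option linter.unusedSectionVars false

/-! ### Tail integrals: bounded and logarithmic corrections -/

section Tail

universe u

variable {n : ℕ} {G : Type u} [NormedAddCommGroup G] [NormedSpace ℂ G] [NormedSpace ℝ G]
  [IsScalarTower ℝ ℂ G]

namespace IsBallFamily

variable {V : Set (Rn n)} {q : Rn n → Rn n → G}

lemma contDiffOn_nat_oscInt (k : ℕ) : ∀ {G : Type u} [NormedAddCommGroup G] [NormedSpace ℂ G]
    [NormedSpace ℝ G] [IsScalarTower ℝ ℂ G] {q : Rn n → Rn n → G} (_ : IsBallFamily V q),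
    ContDiffOn ℝ k (uncurry (oscInt q)) (V ×ˢ univ) := by
  induction k with
  | zero =>
    intro G _ _ _ _ q h
    exact contDiffOn_zero.2 h.continuousOn_oscInt
  | succ k ih =>
    intro G _ _ _ _ q h
    have hk : ((k + 1 : ℕ) : WithTop ℕ∞) = (k : WithTop ℕ∞) + 1 := by push_cast; rfl
    rw [hk, contDiffOn_succ_iff_fderiv_of_isOpen h.isOpen_prod]
    refine ⟨fun p hp =>
      (h.hasFDerivAt_oscInt hp.1 p.2).differentiableAt.differentiableWithinAt,
      fun hw => absurd hw (by simp), ?_⟩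
    refine ((ih h.derivParam).add (ih h.derivPhase)).congr fun p hp => ?_
    exact (h.hasFDerivAt_oscInt hp.1 p.2).fderiv

lemma contDiffOn_oscInt_zero (h : IsBallFamily V q) :
    ContDiffOn ℝ ∞ (fun x => oscInt q x 0) V := by
  have h1 : ContDiffOn ℝ ∞ (uncurry (oscInt q)) (V ×ˢ univ) :=
    contDiffOn_infty.2 fun k => contDiffOn_nat_oscInt k h
  have h2 : ContDiff ℝ ∞ (fun x : Rn n => (x, (0 : Rn n))) := contDiff_id.prodMk contDiff_const
  have h3 := ContDiffOn.comp (g := uncurry (oscInt q)) (f := fun x : Rn n => (x, (0 : Rn n)))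
    (s := V) h1 h2.contDiffOn (fun x hx => ⟨hx, mem_univ _⟩)
  exact h3

/-- For s > 1 an integer power is at most the power with exponent `e.toNat`, which reduces the claim
to the radial integrand. -/
lemma integrableOn_tail (h : IsBallFamily V q) (e : ℤ) {x z : Rn n} (hx : x ∈ V) (hz : z ≠ 0) :
    IntegrableOn (fun s : ℝ => s ^ e • oscInt q x (s • z)) (Ioi 1) := by
  have h1 := (h.integrableOn_radial e.toNat hx hz).mono_set (Ioi_subset_Ioi zero_le_one)
  refine h1.norm.mono' ?_ ?_
  · refine ContinuousOn.aestronglyMeasurable ?_ measurableSet_Ioi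
    refine ContinuousOn.smul (fun s hs => ?_) (h.continuousOn_radial_integrand hx z).continuousOn
    exact (continuousAt_zpow₀ s e (Or.inl (zero_lt_one.trans hs).ne')).continuousWithinAt
  · refine (ae_restrict_iff' measurableSet_Ioi).2 (Eventually.of_forall fun s hs => ?_)
    have hs1 : (1 : ℝ) < s := hs
    have hs0 : (0 : ℝ) < s := zero_lt_one.trans hs
    rw [norm_smul, norm_smul, Real.norm_of_nonneg (by positivity),
      Real.norm_of_nonneg (by positivity)]
    gcongr
    rw [← zpow_natCast]
    exact zpow_le_zpow_right₀ hs1.le (Int.self_le_toNat e)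

/-- For nonnegative exponents the tail integral differs from the homogeneous one by a bounded
function. -/
lemma exists_bound_tailInt_sub_radialInt (h : IsBallFamily V q) (d : ℕ) {L : Set (Rn n)}
    (hL : IsCompact L) (hLV : L ⊆ V) :
    ∃ C : ℝ, ∀ x ∈ L, ∀ z : Rn n, z ≠ 0 → ‖tailInt q d x z - radialInt q d x z‖ ≤ C := by
  obtain ⟨C, hC0, hC⟩ := h.exists_bound_oscInt hL hLV
  refine ⟨C, fun x hx z hz => ?_⟩
  have hi := h.integrableOn_radial d (hLV hx) hz
  -- The difference is the integral over (0, 1], where both s^d and the Fourier integral are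
  -- bounded.
  have e : radialInt q d x z = (∫ s in Ioc (0 : ℝ) 1, s ^ d • oscInt q x (s • z)) +
      tailInt q d x z := by
    rw [radialInt, tailInt, ← Ioc_union_Ioi_eq_Ioi (zero_le_one (α := ℝ)),
      setIntegral_union Ioc_disjoint_Ioi_same measurableSet_Ioi (hi.mono_set Ioc_subset_Ioi_self)
        (hi.mono_set (Ioi_subset_Ioi zero_le_one))]
    simp only [zpow_natCast]
  rw [e, sub_add_cancel_right, norm_neg]
  have := norm_setIntegral_le_of_norm_le_const (μ := volume) (s := Ioc (0 : ℝ) 1)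
    (f := fun s => s ^ d • oscInt q x (s • z)) (C := C) (by simp) (fun s hs => by
      rw [norm_smul, Real.norm_of_nonneg (pow_nonneg hs.1.le _)]
      exact (mul_le_of_le_one_left (norm_nonneg _) (pow_le_one₀ hs.1.le hs.2)).trans
        (hC x hx _))
  simpa using this

/-- In the critical case the tail integral has a logarithmic singularity. -/
lemma exists_bound_tailInt_add_log [CompleteSpace G] (h : IsBallFamily V q) {L : Set (Rn n)}
    (hL : IsCompact L) (hLV : L ⊆ V) :
    ∃ C : ℝ, ∀ x ∈ L, ∀ z : Rn n, z ≠ 0 → ‖z‖ ≤ 1 →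
      ‖tailInt q (-1) x z + Real.log ‖z‖ • oscInt q x 0‖ ≤ C := by
  obtain ⟨C1, hC1, hc1⟩ := h.exists_lipschitz hL hLV
  obtain ⟨C2, hC2, hc2⟩ := h.exists_decay 1 hL hLV
  refine ⟨C1 + C2, fun x hx z hz hz1 => ?_⟩
  have hz0 : 0 < ‖z‖ := norm_pos_iff.2 hz
  -- The integral is split at s = ‖z‖⁻¹. Below this value the Fourier integral is close to its value
  -- at 0, and ∫ ds/s produces -log ‖z‖; above it the decay in sz takes over.
  set a : ℝ := ‖z‖⁻¹ with ha
  have ha1 : 1 ≤ a := (one_le_inv₀ hz0).2 hz1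
  have ha0 : 0 < a := by positivity
  have hi := h.integrableOn_tail (-1) (hLV hx) hz
  have hcont : Continuous (fun s : ℝ => oscInt q x (s • z)) :=
    h.continuousOn_radial_integrand (hLV hx) z
  have hinv : IntegrableOn (fun s : ℝ => s⁻¹) (Ioc 1 a) := by
    have : ContinuousOn (fun s : ℝ => s⁻¹) (Icc 1 a) :=
      continuousOn_id.inv₀ fun s hs => (zero_lt_one.trans_le hs.1).ne'
    exact (this.integrableOn_Icc).mono_set Ioc_subset_Icc_self
  have hlog : ∫ s in Ioc 1 a, s⁻¹ = -Real.log ‖z‖ := by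
    rw [← intervalIntegral.integral_of_le ha1, integral_inv_of_pos one_pos ha0, div_one, ha,
      Real.log_inv]
  have hsplit : tailInt q (-1) x z = (∫ s in Ioc 1 a, s⁻¹ • (oscInt q x (s • z) - oscInt q x 0)) +
      (-Real.log ‖z‖) • oscInt q x 0 + ∫ s in Ioi a, s⁻¹ • oscInt q x (s • z) := by
    rw [← hlog, ← integral_smul_const, ← integral_add]
    · rw [tailInt, ← Ioc_union_Ioi_eq_Ioi ha1,
        setIntegral_union Ioc_disjoint_Ioi_same measurableSet_Ioi (hi.mono_set Ioc_subset_Ioi_self)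
          (hi.mono_set (Ioi_subset_Ioi ha1))]
      simp only [zpow_neg, zpow_one, smul_sub, sub_add_cancel]
    · have h1 : IntegrableOn (fun s : ℝ => s⁻¹ • oscInt q x (s • z)) (Ioc 1 a) := by
        have := hi.mono_set (fun s (hs : s ∈ Ioc 1 a) => hs.1)
        simpa only [zpow_neg, zpow_one] using this
      simp only [smul_sub]
      exact h1.sub (hinv.smul_const (oscInt q x 0))
    · exact hinv.smul_const _
  -- By the Lipschitz bound the integrand is at most C1‖z‖, on an interval shorter than ‖z‖⁻¹.
  have b1 : ‖∫ s in Ioc 1 a, s⁻¹ • (oscInt q x (s • z) - oscInt q x 0)‖ ≤ C1 := by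
    have := norm_setIntegral_le_of_norm_le_const (μ := volume) (s := Ioc 1 a)
      (f := fun s => s⁻¹ • (oscInt q x (s • z) - oscInt q x 0)) (C := C1 * ‖z‖) (by simp)
      (fun s hs => by
        have hs0 : 0 < s := zero_lt_one.trans hs.1
        rw [norm_smul, norm_inv, Real.norm_of_nonneg hs0.le]
        calc s⁻¹ * ‖oscInt q x (s • z) - oscInt q x 0‖ ≤ s⁻¹ * (C1 * ‖s • z‖) := by
              gcongr; exact hc1 x hx _
          _ = C1 * ‖z‖ := by
              rw [norm_smul, Real.norm_of_nonneg hs0.le]; field_simp)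
    refine this.trans ?_
    rw [Measure.real, Real.volume_Ioc, ENNReal.toReal_ofReal (by linarith)]
    calc C1 * ‖z‖ * (a - 1) ≤ C1 * ‖z‖ * a := by gcongr; linarith
      _ = C1 := by rw [ha]; field_simp
  -- First-order decay bounds the integrand by C2‖z‖⁻¹s⁻², whose integral over s > ‖z‖⁻¹ is C2.
  have b2 : ‖∫ s in Ioi a, s⁻¹ • oscInt q x (s • z)‖ ≤ C2 := by
    have hint : IntegrableOn (fun s : ℝ => C2 * ‖z‖⁻¹ * s ^ (-2 : ℝ)) (Ioi a) :=
      (integrableOn_Ioi_rpow_of_lt (by norm_num) ha0).const_mul _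
    have := norm_integral_le_of_norm_le (f := fun s : ℝ => s⁻¹ • oscInt q x (s • z)) hint
      ((ae_restrict_iff' measurableSet_Ioi).2 (Eventually.of_forall fun s hs => by
        have hs0 : 0 < s := ha0.trans hs
        rw [norm_smul, norm_inv, Real.norm_of_nonneg hs0.le]
        have e2 : s ^ (-2 : ℝ) = s⁻¹ * s⁻¹ := by
          rw [Real.rpow_neg hs0.le, ← mul_inv]; norm_num [pow_two]
        rw [e2]
        calc s⁻¹ * ‖oscInt q x (s • z)‖ ≤ s⁻¹ * (C2 * (s * ‖z‖)⁻¹) := by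
              gcongr
              refine (hc2 x hx _).trans ?_
              rw [pow_one, norm_smul, Real.norm_of_nonneg hs0.le]
              gcongr
              linarith
          _ = _ := by rw [mul_inv]; ring))
    refine this.trans (le_of_eq ?_)
    rw [integral_const_mul, integral_Ioi_rpow_of_lt (by norm_num) ha0]
    norm_num
    rw [Real.rpow_neg_one, ha]
    field_simp
  rw [hsplit]
  have : (∫ s in Ioc 1 a, s⁻¹ • (oscInt q x (s • z) - oscInt q x 0)) +
      (-Real.log ‖z‖) • oscInt q x 0 + (∫ s in Ioi a, s⁻¹ • oscInt q x (s • z)) +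
      Real.log ‖z‖ • oscInt q x 0 =
      (∫ s in Ioc 1 a, s⁻¹ • (oscInt q x (s • z) - oscInt q x 0)) +
        ∫ s in Ioi a, s⁻¹ • oscInt q x (s • z) := by
    rw [neg_smul]; abel
  rw [this]
  exact (norm_add_le _ _).trans (add_le_add b1 b2)

end IsBallFamily

end Tail

end

end PsiDO

namespace PsiDO

open MeasureTheory Set Filter Topology Function

noncomputable section

set_option linter.unusedSectionVars false

/-! ### A cutoff at frequency zero -/

section Cutoff

variable {n : ℕ}

/-- A smooth function vanishing near `0` and equal to `1` outside the unit ball. -/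
def cutoff (ξ : Rn n) : ℝ := Real.smoothTransition (2 * ‖ξ‖ ^ 2 - 1)

/-- The radial derivative of the cutoff, supported in an annulus. -/
def annular (ξ : Rn n) : ℝ := fderiv ℝ (cutoff (n := n)) ξ ξ

lemma contDiff_cutoff : ContDiff ℝ ∞ (cutoff (n := n)) :=
  Real.smoothTransition.contDiff.comp
    ((contDiff_const.mul (contDiff_norm_sq ℝ)).sub contDiff_const)

lemma contDiff_annular : ContDiff ℝ ∞ (annular (n := n)) :=
  (contDiff_cutoff.fderiv_right (m := ∞) (by simp)).clm_apply contDiff_id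

lemma cutoff_eq_one {ξ : Rn n} (h : 1 ≤ ‖ξ‖) : cutoff ξ = 1 :=
  Real.smoothTransition.one_of_one_le (by nlinarith)

lemma cutoff_eq_zero {ξ : Rn n} (h : ‖ξ‖ ≤ 1 / 2) : cutoff ξ = 0 :=
  Real.smoothTransition.zero_of_nonpos (by nlinarith [norm_nonneg ξ])

lemma annular_eq_zero_of_lt {ξ : Rn n} (h : ‖ξ‖ < 1 / 2) : annular ξ = 0 := by
  have e : cutoff (n := n) =ᶠ[𝓝 ξ] fun _ => 0 := by
    filter_upwards [continuous_norm.continuousAt.eventually (gt_mem_nhds h)] with η hη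
    exact cutoff_eq_zero hη.le
  rw [annular, e.fderiv_eq]
  simp

lemma annular_eq_zero_of_gt {ξ : Rn n} (h : 1 < ‖ξ‖) : annular ξ = 0 := by
  have e : cutoff (n := n) =ᶠ[𝓝 ξ] fun _ => 1 := by
    filter_upwards [continuous_norm.continuousAt.eventually (lt_mem_nhds h)] with η hη
    exact cutoff_eq_one hη.le
  rw [annular, e.fderiv_eq]
  simp

lemma hasDerivAt_cutoff_inv_smul (ξ : Rn n) {s : ℝ} (hs : 0 < s) :
    HasDerivAt (fun s : ℝ => -cutoff (s⁻¹ • ξ)) (s⁻¹ * annular (s⁻¹ • ξ)) s := by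
  have h1 : HasDerivAt (fun s : ℝ => s⁻¹ • ξ) ((-(s ^ 2)⁻¹) • ξ) s :=
    (hasDerivAt_inv hs.ne').smul_const ξ
  have h2 : HasFDerivAt (cutoff (n := n)) (fderiv ℝ (cutoff (n := n)) (s⁻¹ • ξ)) (s⁻¹ • ξ) :=
    ((contDiff_cutoff (n := n)).differentiable (by simp)).differentiableAt.hasFDerivAt
  have h3 := (h2.comp_hasDerivAt s h1).neg
  refine h3.congr_deriv ?_
  rw [annular, map_smul, map_smul, smul_eq_mul, smul_eq_mul]
  field_simp

lemma integrableOn_annular (ξ : Rn n) :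
    IntegrableOn (fun s : ℝ => s⁻¹ * annular (s⁻¹ • ξ)) (Ioi 1) := by
  -- Once s > 2‖ξ‖ the point ξ/s lies in the ball of radius 1/2, where `annular` vanishes; the
  -- summand 1 ensures b ≥ 1.
  set b : ℝ := 1 + 2 * ‖ξ‖ with hb
  have hb1 : 1 ≤ b := by have := norm_nonneg ξ; linarith
  rw [← Ioc_union_Ioi_eq_Ioi hb1]
  refine IntegrableOn.union ?_ ?_
  · have hc : ContinuousOn (fun s : ℝ => s⁻¹ * annular (s⁻¹ • ξ)) (Icc 1 b) := by
      have hi : ContinuousOn (fun s : ℝ => s⁻¹) (Icc 1 b) :=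
        continuousOn_id.inv₀ fun s hs => (zero_lt_one.trans_le hs.1).ne'
      exact hi.mul (contDiff_annular.continuous.comp_continuousOn (hi.smul continuousOn_const))
    exact hc.integrableOn_Icc.mono_set Ioc_subset_Icc_self
  · refine (integrableOn_zero).congr_fun (fun s hs => ?_) measurableSet_Ioi
    have hs' : b < s := hs
    have hs0 : 0 < s := by linarith
    rw [annular_eq_zero_of_lt, mul_zero]
    rw [norm_smul, norm_inv, Real.norm_of_nonneg hs0.le, inv_mul_lt_iff₀ hs0]
    linarith

/-- The integrand is the derivative of -cutoff(ξ/s), which vanishes as s → ∞ because the cutoff is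
zero near the origin. This is a continuous dyadic decomposition adapted to dilations. -/
lemma integral_annular (ξ : Rn n) :
    ∫ s in Ioi (1 : ℝ), s⁻¹ * annular (s⁻¹ • ξ) = cutoff ξ := by
  have h := integral_Ioi_of_hasDerivAt_of_tendsto (a := 1) (m := 0)
    (f := fun s : ℝ => -cutoff (s⁻¹ • ξ)) (f' := fun s => s⁻¹ * annular (s⁻¹ • ξ))
    (hasDerivAt_cutoff_inv_smul ξ one_pos).continuousAt.continuousWithinAt
    (fun s hs => hasDerivAt_cutoff_inv_smul ξ (zero_lt_one.trans hs)) (integrableOn_annular ξ) ?_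
  · rw [h]; simp
  · have h1 : Tendsto (fun s : ℝ => s⁻¹ • ξ) atTop (𝓝 ((0 : ℝ) • ξ)) :=
      tendsto_inv_atTop_zero.smul_const ξ
    rw [zero_smul] at h1
    have h2 := ((contDiff_cutoff (n := n)).continuous.neg.tendsto 0).comp h1
    have h3 : cutoff (0 : Rn n) = 0 := cutoff_eq_zero (by simp)
    simpa [h3, Function.comp_def] using h2

end Cutoff

/-! ### Homogeneous symbols -/

section Homogeneous

universe u

variable {n : ℕ} {F : Type u} [NormedAddCommGroup F] [NormedSpace ℂ F]
  {V : Set (Rn n)} {a : Rn n → Rn n → F →L[ℂ] F} {l : ℤ}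

/-- The localization of a symbol to an annulus. -/
def annularPart (a : Rn n → Rn n → F →L[ℂ] F) (x ξ : Rn n) : F →L[ℂ] F := annular ξ • a x ξ

/-- The factor φ vanishes near ξ = 0, the only place where a homogeneous symbol may fail to be
smooth. -/
lemma contDiffOn_smul_of_zero {φ : Rn n → ℝ} (hφ : ContDiff ℝ ∞ φ)
    (hφ0 : ∀ ξ, ‖ξ‖ < 1 / 2 → φ ξ = 0) (hV : IsOpen V)
    (ha : ContDiffOn ℝ ∞ (uncurry a) (V ×ˢ {0}ᶜ)) :
    ContDiffOn ℝ ∞ (fun p : Rn n × Rn n => φ p.2 • a p.1 p.2) (V ×ˢ univ) := by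
  rintro ⟨x, ξ⟩ ⟨hx, -⟩
  refine ContDiffAt.contDiffWithinAt ?_
  by_cases hξ : ξ = 0
  · have e : (fun p : Rn n × Rn n => φ p.2 • a p.1 p.2) =ᶠ[𝓝 (x, ξ)] fun _ => 0 := by
      have : ∀ᶠ p : Rn n × Rn n in 𝓝 (x, ξ), ‖p.2‖ < 1 / 2 :=
        (continuous_norm.comp continuous_snd).continuousAt.eventually
          (gt_mem_nhds (by simp [hξ]))
      filter_upwards [this] with p hp
      rw [hφ0 _ hp, zero_smul]
    exact contDiffAt_const.congr_of_eventuallyEq e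
  · have h1 : ContDiffAt ℝ ∞ (uncurry a) (x, ξ) :=
      ha.contDiffAt ((hV.prod isOpen_compl_singleton).mem_nhds ⟨hx, hξ⟩)
    exact (hφ.comp contDiff_snd).contDiffAt.smul h1

lemma IsHomogeneous.isBallFamily (h : IsHomogeneous l V a) (hV : IsOpen V) :
    IsBallFamily V (annularPart a) where
  isOpen := hV
  smooth := contDiffOn_smul_of_zero contDiff_annular (fun _ => annular_eq_zero_of_lt) hV h.1
  zero x hx ξ hξ := by
    rw [annularPart, annular_eq_zero_of_gt (by simpa using hξ), zero_smul]

/-- Homogeneity of a moves the factor a(x, ξ) under the dilation in `integral_annular`. The cut off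
symbol thus becomes a superposition of dilates of one compactly supported amplitude, whose kernels
are ordinary convergent integrals; no distributions are needed. -/
lemma IsHomogeneous.cutoff_smul_eq_integral (h : IsHomogeneous l V a) {x : Rn n} (hx : x ∈ V)
    (ξ : Rn n) [CompleteSpace F] :
    cutoff ξ • a x ξ = ∫ s in Ioi (1 : ℝ), s ^ (l - 1) • annularPart a x (s⁻¹ • ξ) := by
  by_cases hξ : ξ = 0
  · subst hξ
    have h0 : cutoff (0 : Rn n) = 0 := cutoff_eq_zero (by simp)
    have h1 : annular (0 : Rn n) = 0 := annular_eq_zero_of_lt (by simp)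
    simp [h0, h1, annularPart]
  · rw [← integral_annular]
    refine (integral_smul_const (𝕜 := ℝ) (fun s : ℝ => s⁻¹ * annular (s⁻¹ • ξ)) (a x ξ)).symm.trans ?_
    refine setIntegral_congr_fun measurableSet_Ioi fun s hs => ?_
    have hs0 : (0 : ℝ) < s := zero_lt_one.trans hs
    rw [annularPart, h.2 x hx ξ hξ s⁻¹ (by positivity), smul_smul, smul_smul]
    congr 1
    rw [inv_zpow, zpow_sub₀ hs0.ne', zpow_one]
    field_simp

end Homogeneous

end

end PsiDO

namespace PsiDO

open MeasureTheory Set Filter Topology Function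

noncomputable section

set_option linter.unusedSectionVars false

/-! ### Fourier multipliers with integrable symbol -/

section Kernel

universe u

variable {n : ℕ} {F : Type u} [NormedAddCommGroup F] [NormedSpace ℂ F]

/-- The Fourier transform `∫ e^{-i y·ξ} u(y) dy`. -/
def ft (u : Rn n → F) (ξ : Rn n) : F := ∫ y, osc (-y) ξ • u y

lemma osc_neg_left_comm (y ξ : Rn n) : osc (-y) ξ = osc (-ξ) y := by
  rw [osc, osc, inner_neg_left, inner_neg_left, real_inner_comm]

lemma norm_ft_le (u : Rn n → F) (ξ : Rn n) : ‖ft u ξ‖ ≤ ∫ y, ‖u y‖ := by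
  refine (norm_integral_le_integral_norm _).trans (le_of_eq ?_)
  simp [norm_smul]

lemma integrable_inv_one_add_norm_pow :
    Integrable (fun ξ : Rn n => ((1 + ‖ξ‖) ^ (n + 1))⁻¹) := by
  have h := integrable_one_add_norm (E := Rn n) (μ := volume) (r := (n : ℝ) + 1) (by simp)
  refine h.congr (Eventually.of_forall fun ξ => ?_)
  simp only
  rw [Real.rpow_neg (by positivity)]
  congr 1
  exact_mod_cast Real.rpow_natCast (1 + ‖ξ‖) (n + 1)

lemma continuous_ft {u : Rn n → F} (hu : Integrable u) : Continuous (ft u) := by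
  refine continuous_of_dominated (bound := fun y => ‖u y‖) (fun ξ => ?_) (fun ξ => ?_) hu.norm ?_
  · exact (((continuous_osc_left ξ).comp continuous_neg).aestronglyMeasurable).smul hu.1
  · exact Eventually.of_forall fun y => by simp [norm_smul]
  · exact Eventually.of_forall fun y => (continuous_osc_right _).smul continuous_const

lemma exists_ft_decay {u : Rn n → F} (hu : ContDiff ℝ ∞ u) (huc : HasCompactSupport u) (N : ℕ) :
    ∃ C : ℝ, 0 ≤ C ∧ ∀ ξ, ‖ft u ξ‖ ≤ C * ((1 + ‖ξ‖) ^ N)⁻¹ := by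
  have hB : ∀ k : ℕ, ∃ B, ∀ y ∈ tsupport u, ‖iteratedFDeriv ℝ k u y‖ ≤ B := fun k =>
    huc.isCompact.exists_bound_of_continuousOn
      (hu.continuous_iteratedFDeriv (by exact_mod_cast le_top)).continuousOn
  choose B hB using hB
  obtain ⟨C0, hC0, hC⟩ := exists_fourier_decay (G := F) N huc.isCompact
  have b1 := hC u hu (fun y hy => image_eq_zero_of_notMem_tsupport hy)
    (∑ k ∈ Finset.range (N + 1), |B k|) (fun k hk y hy =>
      ((hB k y hy).trans (le_abs_self _)).trans
        (Finset.single_le_sum (f := fun k => |B k|) (fun _ _ => abs_nonneg _)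
          (Finset.mem_range.2 (by omega))))
  set B' := ∑ k ∈ Finset.range (N + 1), |B k|
  have hB' : 0 ≤ B' := by positivity
  refine ⟨2 ^ N * ((∫ y, ‖u y‖) + C0 * B'), by positivity, fun ξ => ?_⟩
  have e : ft u ξ = ∫ y, osc (-ξ) y • u y := by
    simp only [ft, osc_neg_left_comm]
  have b1' := b1 (-ξ)
  rw [norm_neg, ← e] at b1'
  have hp : (1 + ‖ξ‖) ^ N ≤ 2 ^ N * (1 + ‖ξ‖ ^ N) := by
    refine (add_pow_le zero_le_one (norm_nonneg ξ) N).trans ?_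
    rw [one_pow]
    gcongr
    · norm_num
    · omega
  rw [← div_eq_mul_inv, le_div_iff₀ (by positivity), mul_comm]
  calc (1 + ‖ξ‖) ^ N * ‖ft u ξ‖ ≤ 2 ^ N * (1 + ‖ξ‖ ^ N) * ‖ft u ξ‖ := by gcongr
    _ = 2 ^ N * (‖ft u ξ‖ + ‖ξ‖ ^ N * ‖ft u ξ‖) := by ring
    _ ≤ _ := mul_le_mul_of_nonneg_left (add_le_add (norm_ft_le u ξ) b1') (by positivity)

/-- The Fourier multiplier with integrable symbol has the kernel `∫ e^{i (x-y)·ξ} b(ξ) dξ`. -/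
lemma integral_osc_apply_ft [CompleteSpace F] {b : Rn n → F →L[ℂ] F} (hb : Integrable b)
    {u : Rn n → F} (hu : Integrable u) (x : Rn n) :
    ∫ ξ, osc x ξ • b ξ (ft u ξ) = ∫ y, (∫ ξ, osc (x - y) ξ • b ξ) (u y) := by
  have hm : Integrable (fun p : Rn n × Rn n => osc (x - p.2) p.1 • b p.1 (u p.2)) := by
    refine (hb.norm.mul_prod hu.norm).mono' ?_ (Eventually.of_forall fun p => ?_)
    · refine AEStronglyMeasurable.smul ?_ ?_
      · exact (continuous_osc.comp
          ((continuous_const.sub continuous_snd).prodMk continuous_fst)).aestronglyMeasurable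
      · exact (ContinuousLinearMap.apply ℂ F).flip.aestronglyMeasurable_comp₂
          (hb.1.comp_fst) (hu.1.comp_snd)
    · rw [norm_smul, norm_osc, one_mul]
      exact (b p.1).le_opNorm _
  have e1 : ∀ ξ, osc x ξ • b ξ (ft u ξ) = ∫ y, osc (x - y) ξ • b ξ (u y) := fun ξ => by
    rw [ft, ← ContinuousLinearMap.integral_comp_comm, ← integral_smul]
    · refine integral_congr_ae (Eventually.of_forall fun y => ?_)
      simp only
      rw [map_smul, smul_smul, sub_eq_add_neg, osc_add_left]
    · refine hu.norm.mono' ?_ (Eventually.of_forall fun y => by simp [norm_smul])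
      exact (((continuous_osc_left ξ).comp continuous_neg).aestronglyMeasurable).smul hu.1
  have e2 : ∀ y, (∫ ξ, osc (x - y) ξ • b ξ) (u y) = ∫ ξ, osc (x - y) ξ • b ξ (u y) := fun y => by
    rw [ContinuousLinearMap.integral_apply]
    · rfl
    · refine hb.norm.mono' ?_ (Eventually.of_forall fun y => by simp [norm_smul])
      exact ((continuous_osc_right _).aestronglyMeasurable).smul hb.1
  simp only [e1, e2]
  exact integral_integral_swap hm

/-- Substitution ξ = sη; the Jacobian s^n accounts for the exponent n + l - 1 of the tail integrals.
-/
lemma integral_osc_scaled [CompleteSpace F] (b : Rn n → F →L[ℂ] F) (z : Rn n) {s : ℝ} (hs : 0 < s)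
    (l : ℤ) :
    ∫ ξ, osc z ξ • (s ^ (l - 1) • b (s⁻¹ • ξ)) =
      s ^ (n + l - 1 : ℤ) • ∫ ξ, osc (s • z) ξ • b ξ := by
  have h := Measure.integral_comp_smul (volume : Measure (Rn n))
    (fun η => osc (s • z) η • b η) s⁻¹
  rw [finrank_euclideanSpace_fin] at h
  have e : ∀ ξ, osc z ξ • (s ^ (l - 1) • b (s⁻¹ • ξ)) =
      s ^ (l - 1) • (osc (s • z) (s⁻¹ • ξ) • b (s⁻¹ • ξ)) := fun ξ => by
    rw [smul_comm, osc_smul_left, smul_inv_smul₀ hs.ne']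
  simp only [e]
  rw [integral_smul, h, smul_smul]
  congr 1
  rw [inv_pow, inv_inv, abs_of_nonneg (by positivity), add_sub_assoc, zpow_add₀ hs.ne',
    zpow_natCast, mul_comm]

end Kernel

end

end PsiDO

namespace PsiDO

open MeasureTheory Set Filter Topology Function

noncomputable section

set_option linter.unusedSectionVars false

/-! ### Kernels of cut off homogeneous symbols -/

section HomogeneousKernel

universe u

variable {n : ℕ} {F : Type u} [NormedAddCommGroup F] [NormedSpace ℂ F] [CompleteSpace F]
  {V : Set (Rn n)} {a : Rn n → Rn n → F →L[ℂ] F} {l : ℤ}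

namespace IsHomogeneous

lemma integrableOn_scaled (h : IsHomogeneous l V a) {x : Rn n} (hx : x ∈ V) (ξ : Rn n) :
    IntegrableOn (fun s : ℝ => s ^ (l - 1) • annularPart a x (s⁻¹ • ξ)) (Ioi 1) := by
  by_cases hξ : ξ = 0
  · subst hξ
    have h1 : annular (0 : Rn n) = 0 := annular_eq_zero_of_lt (by simp)
    simp only [smul_zero, annularPart, h1, zero_smul]
    exact integrable_zero ℝ (F →L[ℂ] F) _
  · have h1 : IntegrableOn (fun s : ℝ => (s⁻¹ * annular (s⁻¹ • ξ)) • a x ξ) (Ioi 1) :=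
      (integrableOn_annular ξ).smul_const _
    refine h1.congr_fun (fun s hs => ?_) measurableSet_Ioi
    have hs0 : (0 : ℝ) < s := zero_lt_one.trans hs
    simp only
    rw [annularPart, h.2 x hx ξ hξ s⁻¹ (by positivity), smul_smul, smul_smul]
    congr 1
    rw [inv_zpow, zpow_sub₀ hs0.ne', zpow_one]
    field_simp

lemma aestronglyMeasurable_restrict_prod {H : Type*} [NormedAddCommGroup H]
    {f : ℝ × Rn n → H} (hf : ContinuousOn f (Ioi 1 ×ˢ univ)) :
    AEStronglyMeasurable f ((volume.restrict (Ioi (1 : ℝ))).prod (volume : Measure (Rn n))) := by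
  have e : (volume.restrict (Ioi (1 : ℝ))).prod (volume : Measure (Rn n)) =
      (volume.prod volume).restrict (Ioi (1 : ℝ) ×ˢ univ) := by
    rw [← Measure.prod_restrict, Measure.restrict_univ]
  rw [e]
  exact hf.aestronglyMeasurable (measurableSet_Ioi.prod MeasurableSet.univ)

lemma continuousOn_zpow_fst (e : ℤ) :
    ContinuousOn (fun p : ℝ × Rn n => p.1 ^ e) (Ioi 1 ×ˢ univ) := fun p hp =>
  ((continuousAt_zpow₀ p.1 e (Or.inl (zero_lt_one.trans hp.1).ne')).comp
    continuous_fst.continuousAt).continuousWithinAt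

/-- Justifies Fubini in (s, ξ). The dilated amplitude lives where ‖ξ‖ ≥ s/2, so the decay of `ft u`
in ξ is also decay in s and defeats the power of s for every degree l. -/
lemma integrable_prod_frequency (h : IsHomogeneous l V a) (hV : IsOpen V) {x : Rn n} (hx : x ∈ V)
    {u : Rn n → F} (hu : ContDiff ℝ ∞ u) (huc : HasCompactSupport u) :
    Integrable (fun p : ℝ × Rn n =>
      osc x p.2 • (p.1 ^ (l - 1) • annularPart a x (p.1⁻¹ • p.2)) (ft u p.2))
      ((volume.restrict (Ioi (1 : ℝ))).prod (volume : Measure (Rn n))) := by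
  have hq := h.isBallFamily hV
  have hui : Integrable u := hu.continuous.integrable_of_hasCompactSupport huc
  obtain ⟨B, hB0, hB⟩ := hq.exists_bound (isCompact_singleton (x := x)) (singleton_subset_iff.2 hx)
  -- M orders of decay are spent on s, leaving (1 + s²)⁻¹, and the other n + 1 on integrability in
  -- ξ.
  set M : ℕ := (l - 1).toNat + 2 with hM
  obtain ⟨C, hC0, hC⟩ := exists_ft_decay hu huc (M + (n + 1))
  have hg : Integrable (fun p : ℝ × Rn n => (B * C * 4 ^ M * (1 + p.1 ^ 2)⁻¹) *
      ((1 + ‖p.2‖) ^ (n + 1))⁻¹)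
      ((volume.restrict (Ioi (1 : ℝ))).prod (volume : Measure (Rn n))) :=
    (IsBallFamily.integrable_bound (B * C * 4 ^ M) (Ioi 1)).mul_prod
      (integrable_inv_one_add_norm_pow (n := n))
  refine hg.mono' ?_ ?_
  · refine aestronglyMeasurable_restrict_prod ?_
    refine ContinuousOn.smul ((continuous_osc_right x).comp continuous_snd).continuousOn ?_
    refine ContinuousOn.clm_apply ?_ ((continuous_ft hui).comp continuous_snd).continuousOn
    refine (continuousOn_zpow_fst _).smul ?_
    refine (hq.contDiff_right hx).continuous.comp_continuousOn ?_
    exact ContinuousOn.smul (continuousOn_fst.inv₀ fun p hp => (zero_lt_one.trans hp.1).ne')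
      continuousOn_snd
  · have e : (volume.restrict (Ioi (1 : ℝ))).prod (volume : Measure (Rn n)) =
        (volume.prod volume).restrict (Ioi (1 : ℝ) ×ˢ univ) := by
      rw [← Measure.prod_restrict, Measure.restrict_univ]
    rw [e]
    refine (ae_restrict_iff' (measurableSet_Ioi.prod MeasurableSet.univ)).2
      (Eventually.of_forall fun p hp => ?_)
    obtain ⟨s, ξ⟩ := p
    have hs : 1 < s := hp.1
    have hs0 : 0 < s := zero_lt_one.trans hs
    simp only
    rw [norm_smul, norm_osc, one_mul]
    by_cases hξ : ‖s⁻¹ • ξ‖ < 1 / 2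
    · rw [annularPart, annular_eq_zero_of_lt hξ]
      simp only [zero_smul, smul_zero, zero_apply, norm_zero]
      positivity
    · rw [norm_smul, norm_inv, Real.norm_of_nonneg hs0.le, inv_mul_lt_iff₀ hs0, not_lt] at hξ
      have h4 : (1 + s) / 4 ≤ 1 + ‖ξ‖ := by linarith
      have hle : ‖(s ^ (l - 1) • annularPart a x (s⁻¹ • ξ)) (ft u ξ)‖ ≤
          (s ^ (l - 1) * B) * (C * ((1 + ‖ξ‖) ^ (M + (n + 1)))⁻¹) := by
        refine (ContinuousLinearMap.le_opNorm _ _).trans ?_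
        refine mul_le_mul ?_ (hC ξ) (norm_nonneg _) (by positivity)
        rw [norm_smul, Real.norm_of_nonneg (by positivity)]
        gcongr
        exact hB x rfl _
      have hz : s ^ (l - 1) ≤ (1 + s) ^ (M - 2) := by
        have h1 : s ^ (l - 1) ≤ s ^ ((l - 1).toNat : ℤ) :=
          zpow_le_zpow_right₀ hs.le (Int.self_le_toNat _)
        rw [zpow_natCast] at h1
        have h2 : M - 2 = (l - 1).toNat := by omega
        rw [h2]
        exact h1.trans (pow_le_pow_left₀ hs0.le (by linarith) _)
      have hM2 : (1 + s) ^ M = (1 + s) ^ (M - 2) * (1 + s) ^ 2 := by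
        rw [← pow_add]; congr 1
      refine hle.trans ?_
      have hpw : ((1 + ‖ξ‖) ^ M)⁻¹ ≤ 4 ^ M * ((1 + s) ^ M)⁻¹ := by
        rw [← inv_inv ((4 : ℝ) ^ M), ← mul_inv]
        apply inv_anti₀ (by positivity)
        calc ((4 : ℝ) ^ M)⁻¹ * (1 + s) ^ M = ((1 + s) / 4) ^ M := by rw [div_pow]; ring
          _ ≤ _ := by gcongr
      calc s ^ (l - 1) * B * (C * ((1 + ‖ξ‖) ^ (M + (n + 1)))⁻¹)
          = B * C * (s ^ (l - 1) * ((1 + ‖ξ‖) ^ M)⁻¹) * ((1 + ‖ξ‖) ^ (n + 1))⁻¹ := by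
            rw [pow_add, mul_inv]; ring
        _ ≤ B * C * ((1 + s) ^ (M - 2) * (4 ^ M * ((1 + s) ^ M)⁻¹)) *
              ((1 + ‖ξ‖) ^ (n + 1))⁻¹ := by gcongr
        _ = B * C * 4 ^ M * ((1 + s) ^ 2)⁻¹ * ((1 + ‖ξ‖) ^ (n + 1))⁻¹ := by
            rw [hM2, mul_inv]
            have : (1 + s) ^ (M - 2) ≠ 0 := by positivity
            field_simp
        _ ≤ _ := by
            gcongr
            nlinarith

/-- Justifies Fubini in (s, y). As x has positive distance from the support of u, the rapid decay in
s(x - y) is uniform decay in s. -/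
lemma integrable_prod_space (h : IsHomogeneous l V a) (hV : IsOpen V) {x : Rn n} (hx : x ∈ V)
    {u : Rn n → F} (hu : ContDiff ℝ ∞ u) (huc : HasCompactSupport u) (hxu : x ∉ tsupport u)
    (e : ℤ) :
    Integrable (fun p : ℝ × Rn n =>
      (p.1 ^ e • oscInt (annularPart a) x (p.1 • (x - p.2))) (u p.2))
      ((volume.restrict (Ioi (1 : ℝ))).prod (volume : Measure (Rn n))) := by
  have hq := h.isBallFamily hV
  have hui : Integrable u := hu.continuous.integrable_of_hasCompactSupport huc
  obtain ⟨δ, hδ0, hδ⟩ : ∃ δ > 0, Metric.ball x δ ⊆ (tsupport u)ᶜ :=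
    Metric.isOpen_iff.1 (isClosed_tsupport u).isOpen_compl x hxu
  obtain ⟨C, hC0, hC⟩ := hq.exists_bound_radial e.toNat (isCompact_singleton (x := x))
    (singleton_subset_iff.2 hx) hδ0
  have hg : Integrable (fun p : ℝ × Rn n => (C * (1 + p.1 ^ 2)⁻¹) * ‖u p.2‖)
      ((volume.restrict (Ioi (1 : ℝ))).prod (volume : Measure (Rn n))) :=
    (IsBallFamily.integrable_bound C (Ioi 1)).mul_prod hui.norm
  refine hg.mono' ?_ ?_
  · refine aestronglyMeasurable_restrict_prod ?_
    refine ContinuousOn.clm_apply ?_ (hu.continuous.comp continuous_snd).continuousOn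
    refine (continuousOn_zpow_fst _).smul ?_
    have := hq.continuousOn_oscInt.comp_continuous
      (f := fun p : ℝ × Rn n => (x, p.1 • (x - p.2))) (by fun_prop) (fun s => ⟨hx, mem_univ _⟩)
    exact this.continuousOn
  · have e : (volume.restrict (Ioi (1 : ℝ))).prod (volume : Measure (Rn n)) =
        (volume.prod volume).restrict (Ioi (1 : ℝ) ×ˢ univ) := by
      rw [← Measure.prod_restrict, Measure.restrict_univ]
    rw [e]
    refine (ae_restrict_iff' (measurableSet_Ioi.prod MeasurableSet.univ)).2
      (Eventually.of_forall fun p hp => ?_)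
    obtain ⟨s, y⟩ := p
    have hs : 1 < s := hp.1
    have hs0 : 0 < s := zero_lt_one.trans hs
    simp only
    by_cases hy : y ∈ tsupport u
    · refine (ContinuousLinearMap.le_opNorm _ _).trans ?_
      refine mul_le_mul_of_nonneg_right ?_ (norm_nonneg _)
      have hd : δ ≤ ‖x - y‖ := by
        by_contra hlt
        exact hδ (by rw [Metric.mem_ball, dist_eq_norm, norm_sub_rev]; exact not_le.1 hlt) hy
      refine le_trans ?_ (hC x rfl (x - y) hd s hs0)
      rw [norm_smul, norm_smul, Real.norm_of_nonneg (by positivity),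
        Real.norm_of_nonneg (by positivity)]
      gcongr
      rw [← zpow_natCast]
      exact zpow_le_zpow_right₀ hs.le (Int.self_le_toNat _)
    · rw [image_eq_zero_of_notMem_tsupport hy]
      simp

lemma integral_tail_apply (h : IsHomogeneous l V a) (hV : IsOpen V) {x : Rn n} (hx : x ∈ V)
    {u : Rn n → F} (hxu : x ∉ tsupport u) (e : ℤ) (y : Rn n) :
    ∫ s in Ioi (1 : ℝ), (s ^ e • oscInt (annularPart a) x (s • (x - y))) (u y) =
      tailInt (annularPart a) e x (x - y) (u y) := by
  by_cases hy : y ∈ tsupport u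
  · have hxy : x - y ≠ 0 := sub_ne_zero.2 fun hxy => hxu (hxy ▸ hy)
    rw [tailInt, ContinuousLinearMap.integral_apply
      ((h.isBallFamily hV).integrableOn_tail e hx hxy)]
  · rw [image_eq_zero_of_notMem_tsupport hy]
    simp

lemma integral_frequency_apply (h : IsHomogeneous l V a) {x : Rn n} (hx : x ∈ V) (ξ : Rn n)
    (v : F) :
    ∫ s in Ioi (1 : ℝ), osc x ξ • (s ^ (l - 1) • annularPart a x (s⁻¹ • ξ)) v =
      osc x ξ • (cutoff ξ • a x ξ) v := by
  rw [integral_smul, h.cutoff_smul_eq_integral hx ξ,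
    ContinuousLinearMap.integral_apply (h.integrableOn_scaled hx ξ)]

lemma integrable_cutoff_apply_ft (h : IsHomogeneous l V a) (hV : IsOpen V) {x : Rn n} (hx : x ∈ V)
    {u : Rn n → F} (hu : ContDiff ℝ ∞ u) (huc : HasCompactSupport u) :
    Integrable (fun ξ => osc x ξ • (cutoff ξ • a x ξ) (ft u ξ)) :=
  (h.integrable_prod_frequency hV hx hu huc).integral_prod_right.congr
    (Eventually.of_forall fun ξ => h.integral_frequency_apply hx ξ (ft u ξ))

lemma integrable_tailInt_apply (h : IsHomogeneous l V a) (hV : IsOpen V) {x : Rn n} (hx : x ∈ V)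
    {u : Rn n → F} (hu : ContDiff ℝ ∞ u) (huc : HasCompactSupport u) (hxu : x ∉ tsupport u)
    (e : ℤ) :
    Integrable (fun y => tailInt (annularPart a) e x (x - y) (u y)) :=
  (h.integrable_prod_space hV hx hu huc hxu e).integral_prod_right.congr
    (Eventually.of_forall fun y => h.integral_tail_apply hV hx hxu e y)

/-- The kernel of the quantization of a homogeneous symbol cut off near zero frequency. -/
lemma integral_cutoff_apply_ft (h : IsHomogeneous l V a) (hV : IsOpen V) {x : Rn n} (hx : x ∈ V)
    {u : Rn n → F} (hu : ContDiff ℝ ∞ u) (huc : HasCompactSupport u) (hxu : x ∉ tsupport u) :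
    ∫ ξ, osc x ξ • (cutoff ξ • a x ξ) (ft u ξ) =
      ∫ y, tailInt (annularPart a) (n + l - 1) x (x - y) (u y) := by
  have hq := h.isBallFamily hV
  have hui : Integrable u := hu.continuous.integrable_of_hasCompactSupport huc
  have e1 : ∫ ξ, osc x ξ • (cutoff ξ • a x ξ) (ft u ξ) = ∫ ξ, ∫ s in Ioi (1 : ℝ),
      osc x ξ • (s ^ (l - 1) • annularPart a x (s⁻¹ • ξ)) (ft u ξ) :=
    integral_congr_ae (Eventually.of_forall fun ξ =>
      (h.integral_frequency_apply hx ξ (ft u ξ)).symm)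
  have e2 : ∫ y, tailInt (annularPart a) (n + l - 1) x (x - y) (u y) = ∫ y, ∫ s in Ioi (1 : ℝ),
      (s ^ (n + l - 1 : ℤ) • oscInt (annularPart a) x (s • (x - y))) (u y) :=
    integral_congr_ae (Eventually.of_forall fun y =>
      (h.integral_tail_apply hV hx hxu _ y).symm)
  rw [e1, e2]
  -- Both sides are now integrals over s. For fixed s the amplitude is integrable in ξ, so the
  -- multiplier has an explicit kernel and the scaling identity compares the two.
  refine (integral_integral_swap (h.integrable_prod_frequency hV hx hu huc)).symm.trans ?_
  refine Eq.trans ?_ (integral_integral_swap (h.integrable_prod_space hV hx hu huc hxu _))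
  refine setIntegral_congr_fun measurableSet_Ioi fun s hs => ?_
  have hs0 : (0 : ℝ) < s := zero_lt_one.trans hs
  have hb : Integrable (fun ξ => s ^ (l - 1) • annularPart a x (s⁻¹ • ξ)) := by
    have := (hq.integrable hx).comp_smul (inv_ne_zero hs0.ne')
    exact this.smul (s ^ (l - 1))
  rw [integral_osc_apply_ft hb hui]
  refine integral_congr_ae (Eventually.of_forall fun y => ?_)
  simp only
  rw [integral_osc_scaled _ _ hs0, oscInt]

end IsHomogeneous

end HomogeneousKernel

end

end PsiDO

namespace PsiDO

open MeasureTheory Set Filter Topology Function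

noncomputable section

set_option linter.unusedSectionVars false

/-! ### Singularities of the kernel of p(x, D) -/

section SymbolKernel

universe u

variable {n : ℕ} {F : Type u} [NormedAddCommGroup F] [NormedSpace ℂ F] [CompleteSpace F]
  {V : Set (Rn n)}

lemma continuous_apply_of_continuousOn {G : Type*} [NormedAddCommGroup G] [NormedSpace ℂ G]
    {X : Type*} [TopologicalSpace X] {U : Set X} (hU : IsOpen U)
    {f : X → F →L[ℂ] G} (hf : ContinuousOn f U) {u : X → F} (hu : Continuous u)
    (huU : tsupport u ⊆ U) : Continuous (fun y => f y (u y)) := by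
  rw [continuous_iff_continuousAt]
  intro y
  by_cases hy : y ∈ tsupport u
  · exact (hf.continuousAt (hU.mem_nhds (huU hy))).clm_apply hu.continuousAt
  · have e : (fun y => f y (u y)) =ᶠ[𝓝 y] fun _ => 0 := by
      filter_upwards [(isClosed_tsupport u).isOpen_compl.mem_nhds hy] with z hz
      rw [image_eq_zero_of_notMem_tsupport hz, map_zero]
    exact continuousAt_const.congr e.symm

lemma integrable_apply_of_continuousOn {G : Type*} [NormedAddCommGroup G] [NormedSpace ℂ G]
    {U : Set (Rn n)} (hU : IsOpen U)
    {f : Rn n → F →L[ℂ] G} (hf : ContinuousOn f U) {u : Rn n → F} (hu : Continuous u)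
    (huc : HasCompactSupport u) (huU : tsupport u ⊆ U) : Integrable (fun y => f y (u y)) := by
  refine (continuous_apply_of_continuousOn hU hf hu huU).integrable_of_hasCompactSupport ?_
  exact HasCompactSupport.intro huc.isCompact fun y hy => by
    rw [image_eq_zero_of_notMem_tsupport hy, map_zero]

lemma norm_integral_apply_le {f : Rn n → F →L[ℂ] F} {u : Rn n → F} (hu : Integrable u) {C : ℝ}
    (hC : ∀ y, u y ≠ 0 → ‖f y‖ ≤ C) : ‖∫ y, f y (u y)‖ ≤ C * ∫ y, ‖u y‖ := by
  rw [← integral_const_mul]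
  refine norm_integral_le_of_norm_le (hu.norm.const_mul C) (Eventually.of_forall fun y => ?_)
  by_cases hy : u y = 0
  · simp [hy]
  · exact ((f y).le_opNorm _).trans (mul_le_mul_of_nonneg_right (hC y hy) (norm_nonneg _))

lemma fourierOn_eq_ft {u : Rn n → F} (hu : tsupport u ⊆ V) (ξ : Rn n) :
    fourierOn V u ξ = ft u ξ := by
  rw [fourierOn, ft, setIntegral_eq_integral_of_forall_compl_eq_zero]
  · simp only [osc_neg_left]
  · intro y hy
    rw [image_eq_zero_of_notMem_tsupport fun h => hy (hu h), smul_zero]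

variable {p : Rn n → Rn n → F →L[ℂ] F} {pj : ℕ → Rn n → Rn n → F →L[ℂ] F} {m : ℤ}

/-- The remainder of a symbol after removal of the first `N` homogeneous terms. -/
def symbolRest (p : Rn n → Rn n → F →L[ℂ] F) (pj : ℕ → Rn n → Rn n → F →L[ℂ] F) (N : ℕ)
    (x ξ : Rn n) : F →L[ℂ] F :=
  p x ξ - ∑ j ∈ Finset.range N, cutoff ξ • pj j x ξ

lemma IsSymbol.continuousOn_rest (h : IsSymbol m V p pj) (hV : IsOpen V) (N : ℕ) :
    ContinuousOn (uncurry (symbolRest p pj N)) (V ×ˢ univ) := by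
  refine h.smooth.continuousOn.sub ?_
  refine continuousOn_finsetSum _ fun j _ => ?_
  exact (contDiffOn_smul_of_zero contDiff_cutoff (fun ξ hξ => cutoff_eq_zero hξ.le) hV
    (h.homogeneous j).1).continuousOn

/-- After removal of m + n + 1 terms the remainder has order -n-1 and is integrable in ξ, so its
kernel is bounded. For small ξ compactness applies, the cut off terms being continuous up to ξ = 0.
-/
lemma IsSymbol.exists_bound_rest (h : IsSymbol m V p pj) (hV : IsOpen V) {N : ℕ}
    (hN : m + n + 1 = N) {L : Set (Rn n)} (hL : IsCompact L) (hLV : L ⊆ V) :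
    ∃ C : ℝ, 0 ≤ C ∧ ∀ x ∈ L, ∀ ξ, ‖symbolRest p pj N x ξ‖ ≤ C * ((1 + ‖ξ‖) ^ (n + 1))⁻¹ := by
  obtain ⟨C1, hC1⟩ := h.asymptotic N L hL hLV 0 0
  obtain ⟨C2, hC2⟩ := (hL.prod (isCompact_closedBall (0 : Rn n) 1)).exists_bound_of_continuousOn
    ((h.continuousOn_rest hV N).mono (prod_mono hLV (subset_univ _)))
  refine ⟨(|C1| + |C2|) * 2 ^ (n + 1), by positivity, fun x hx ξ => ?_⟩
  rw [mul_assoc]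
  by_cases hξ : 1 ≤ ‖ξ‖
  · have h1 := hC1 x hx ξ hξ
    simp only [norm_iteratedFDeriv_zero] at h1
    have e : symbolRest p pj N x ξ = p x ξ - ∑ j ∈ Finset.range N, pj j x ξ := by
      simp [symbolRest, cutoff_eq_one hξ]
    have hexp : (m - (0 : ℕ) - N : ℤ) = -((n + 1 : ℕ) : ℤ) := by push_cast; omega
    rw [hexp, zpow_neg, zpow_natCast] at h1
    rw [e]
    have h0 : 0 < ‖ξ‖ := by linarith
    have h2 : (‖ξ‖ ^ (n + 1))⁻¹ ≤ 2 ^ (n + 1) * ((1 + ‖ξ‖) ^ (n + 1))⁻¹ := by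
      rw [← inv_inv ((2 : ℝ) ^ (n + 1)), ← mul_inv]
      apply inv_anti₀ (by positivity)
      rw [← inv_pow, ← mul_pow]
      gcongr
      linarith
    calc _ ≤ C1 * (‖ξ‖ ^ (n + 1))⁻¹ := h1
      _ ≤ (|C1| + |C2|) * (‖ξ‖ ^ (n + 1))⁻¹ := by
          gcongr
          linarith [le_abs_self C1, abs_nonneg C2]
      _ ≤ _ := by gcongr
  · have hξ' : ‖ξ‖ ≤ 1 := (not_le.1 hξ).le
    have h1 : ‖symbolRest p pj N x ξ‖ ≤ C2 := hC2 (x, ξ) ⟨hx, by simpa using hξ'⟩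
    have h2 : 1 ≤ 2 ^ (n + 1) * ((1 + ‖ξ‖) ^ (n + 1))⁻¹ := by
      rw [← div_eq_mul_inv, one_le_div (by positivity)]
      gcongr
      linarith
    calc ‖symbolRest p pj N x ξ‖ ≤ (|C1| + |C2|) * 1 := by
          linarith [abs_nonneg C1, le_abs_self C2]
      _ ≤ _ := by gcongr

lemma IsSymbol.integrable_rest (h : IsSymbol m V p pj) (hV : IsOpen V) {N : ℕ}
    (hN : m + n + 1 = N) {x : Rn n} (hx : x ∈ V) : Integrable (symbolRest p pj N x) := by
  obtain ⟨C, hC0, hC⟩ := h.exists_bound_rest hV hN (isCompact_singleton (x := x))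
    (singleton_subset_iff.2 hx)
  refine (integrable_inv_one_add_norm_pow.const_mul C).mono' ?_
    (Eventually.of_forall fun ξ => hC x rfl ξ)
  have : Continuous (symbolRest p pj N x) :=
    (h.continuousOn_rest hV N).comp_continuous (f := fun ξ => (x, ξ)) (by fun_prop)
      (fun ξ => ⟨hx, mem_univ _⟩)
  exact this.aestronglyMeasurable

/-- The homogeneous terms of the kernel of `p(x, D)`, indexed by their degree. -/
def kernelTerm (pj : ℕ → Rn n → Rn n → F →L[ℂ] F) (N : ℕ) (i : ℤ) (x z : Rn n) : F →L[ℂ] F :=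
  ((2 * Real.pi) ^ n : ℝ)⁻¹ • radialInt (annularPart (pj (N + i).toNat)) (-i - 1).toNat x z

/-- The coefficient of the logarithm in the kernel of `p(x, D)`. -/
def logTerm (pj : ℕ → Rn n → Rn n → F →L[ℂ] F) (N : ℕ) (x : Rn n) : F →L[ℂ] F :=
  ((2 * Real.pi) ^ n : ℝ)⁻¹ • oscInt (annularPart (pj N)) x 0

lemma IsSymbol.contDiffOn_logTerm (h : IsSymbol m V p pj) (hV : IsOpen V) (N : ℕ) :
    ContDiffOn ℝ ∞ (logTerm pj N) V :=
  ((h.homogeneous N).isBallFamily hV).contDiffOn_oscInt_zero.const_smul _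

lemma IsSymbol.isHomogeneous_kernelTerm (h : IsSymbol m V p pj) (hV : IsOpen V) (N : ℕ) {i : ℤ}
    (hi : i ≤ -1) : IsHomogeneous i V (kernelTerm pj N i) := by
  refine ⟨(((h.homogeneous _).isBallFamily hV).contDiffOn_radialInt _).const_smul _,
    fun x hx ξ hξ t ht => ?_⟩
  rw [kernelTerm, kernelTerm, radialInt_smul _ _ _ _ ht, smul_comm]
  congr 2
  omega

/-- Reindexing by i = j - N: when m + n = N, the symbol term of degree m - j has a kernel of degree
-(n + m - j) = j - N, hence the radial exponent -i - 1 = N - 1 - j. -/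
lemma sum_kernelTerm (pj : ℕ → Rn n → Rn n → F →L[ℂ] F) (N : ℕ) (x z : Rn n) :
    ∑ i ∈ Finset.Icc (-(N : ℤ)) (-1), kernelTerm pj N i x z =
      ((2 * Real.pi) ^ n : ℝ)⁻¹ •
        ∑ j ∈ Finset.range N, radialInt (annularPart (pj j)) (N - 1 - j) x z := by
  rw [Finset.smul_sum]
  refine Finset.sum_nbij' (fun i => (N + i).toNat) (fun j => (j : ℤ) - N) ?_ ?_ ?_ ?_ ?_
  · intro i hi; simp only [Finset.mem_Icc, Finset.mem_range] at *; omega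
  · intro i hi; simp only [Finset.mem_Icc, Finset.mem_range] at *; omega
  · intro i hi; simp only [Finset.mem_Icc] at *; omega
  · intro i hi; simp only [Finset.mem_range] at *; omega
  · intro i hi
    simp only [Finset.mem_Icc] at hi
    rw [kernelTerm]
    congr 2
    omega

/-- The kernel of `p(x, D)` is, up to a bounded kernel, the sum of its homogeneous terms and of the
logarithmic term. -/
lemma IsSymbol.exists_bound_quantize_sub (h : IsSymbol m V p pj) (hV : IsOpen V) {N : ℕ}
    (hN : m + n = N) {L : Set (Rn n)} (hL : IsCompact L) (hLV : L ⊆ V) :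
    ∃ C : ℝ, ∀ x ∈ L, ∀ u : Rn n → F, ContDiff ℝ ∞ u → HasCompactSupport u → tsupport u ⊆ V →
      x ∉ tsupport u → tsupport u ⊆ Metric.closedBall x 1 →
      ‖quantize V p u x - ∫ y, (∑ i ∈ Finset.Icc (-(N : ℤ)) (-1), kernelTerm pj N i x (x - y)
        - Real.log ‖x - y‖ • logTerm pj N x) (u y)‖ ≤ C * ∫ y, ‖u y‖ := by
  have hq : ∀ j, IsBallFamily V (annularPart (pj j)) := fun j => (h.homogeneous j).isBallFamily hV
  -- N + 1 terms are removed: those of index below N give the poles, and the one of index N = m + n,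
  -- of degree -n, gives the logarithm.
  obtain ⟨C1, hC10, hC1⟩ := h.exists_bound_rest hV (N := N + 1) (by push_cast; omega) hL hLV
  choose C2 hC2 using fun j => (hq j).exists_bound_tailInt_sub_radialInt (N - 1 - j) hL hLV
  obtain ⟨C3, hC3⟩ := (hq N).exists_bound_tailInt_add_log hL hLV
  set cst : ℝ := ((2 * Real.pi) ^ n : ℝ)⁻¹ with hcst
  have hcst0 : 0 ≤ cst := by positivity
  set I : ℝ := ∫ ξ : Rn n, C1 * ((1 + ‖ξ‖) ^ (n + 1))⁻¹
  refine ⟨cst * (I + (∑ j ∈ Finset.range N, C2 j + C3)), fun x hx u hu huc huV hxu hux => ?_⟩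
  have hxV := hLV hx
  have hui : Integrable u := hu.continuous.integrable_of_hasCompactSupport huc
  set J := ∫ y, ‖u y‖ with hJ
  have hJ0 : 0 ≤ J := by positivity
  -- The logarithmic estimate for tail integrals is available for ‖z‖ ≤ 1 only, hence the
  -- restriction on the support of u.
  have hne : ∀ y, u y ≠ 0 → x - y ≠ 0 ∧ ‖x - y‖ ≤ 1 := fun y hy => by
    have hy' : y ∈ tsupport u := subset_tsupport u hy
    refine ⟨sub_ne_zero.2 fun e => hxu (e ▸ hy'), ?_⟩
    have := hux hy'
    rwa [Metric.mem_closedBall, dist_eq_norm, norm_sub_rev] at this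
  -- integrability of the kernels
  have hcompl : IsOpen ({x}ᶜ : Set (Rn n)) := isOpen_compl_singleton
  have huc' : tsupport u ⊆ {x}ᶜ := fun y hy e => hxu (by rw [mem_singleton_iff] at e; exact e ▸ hy)
  have irad : ∀ j d, Integrable (fun y => radialInt (annularPart (pj j)) d x (x - y) (u y)) :=
    fun j d => by
      refine integrable_apply_of_continuousOn hcompl ?_ hu.continuous huc huc'
      refine ((hq j).contDiffOn_radialInt d).continuousOn.comp
        (f := fun y => (x, x - y)) (by fun_prop) fun y hy => ⟨hxV, ?_⟩
      exact sub_ne_zero.2 fun e => hy e.symm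
  have ilog : Integrable (fun y => (Real.log ‖x - y‖ • oscInt (annularPart (pj N)) x 0) (u y)) := by
    refine integrable_apply_of_continuousOn hcompl ?_ hu.continuous huc huc'
    refine ContinuousOn.smul (ContinuousOn.log (by fun_prop) fun y hy => ?_) continuousOn_const
    exact norm_ne_zero_iff.2 (sub_ne_zero.2 fun e => hy e.symm)
  have itail : ∀ j (e : ℤ), Integrable (fun y => tailInt (annularPart (pj j)) e x (x - y) (u y)) :=
    fun j e => (h.homogeneous j).integrable_tailInt_apply hV hxV hu huc hxu e
  -- the decomposition of the operator
  have hrest := h.integrable_rest hV (N := N + 1) (by push_cast; omega) hxV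
  have irest : Integrable (fun ξ => osc x ξ • symbolRest p pj (N + 1) x ξ (ft u ξ)) := by
    refine (hrest.norm.mul_const J).mono' ?_ (Eventually.of_forall fun ξ => ?_)
    · refine (continuous_osc_right x).aestronglyMeasurable.smul ?_
      exact (ContinuousLinearMap.apply ℂ F).flip.aestronglyMeasurable_comp₂ hrest.1
        (continuous_ft hui).aestronglyMeasurable
    · rw [norm_smul, norm_osc, one_mul]
      exact ((symbolRest p pj (N + 1) x ξ).le_opNorm _).trans
        (mul_le_mul_of_nonneg_left (norm_ft_le u ξ) (norm_nonneg _))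
  have e1 : quantize V p u x = cst • ((∫ ξ, osc x ξ • symbolRest p pj (N + 1) x ξ (ft u ξ)) +
      ∑ j ∈ Finset.range (N + 1),
        ∫ y, tailInt (annularPart (pj j)) (n + (m - j) - 1) x (x - y) (u y)) := by
    rw [quantize]
    congr 1
    have e2 : ∀ j ∈ Finset.range (N + 1),
        ∫ y, tailInt (annularPart (pj j)) (n + (m - j) - 1) x (x - y) (u y) =
          ∫ ξ, osc x ξ • (cutoff ξ • pj j x ξ) (ft u ξ) := fun j _ =>
      ((h.homogeneous j).integral_cutoff_apply_ft hV hxV hu huc hxu).symm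
    have e3 : ∀ j ∈ Finset.range (N + 1),
        Integrable fun ξ => osc x ξ • (cutoff ξ • pj j x ξ) (ft u ξ) := fun j _ =>
      (h.homogeneous j).integrable_cutoff_apply_ft hV hxV hu huc
    rw [Finset.sum_congr rfl e2, ← integral_finsetSum _ e3,
      ← integral_add irest (integrable_finsetSum _ e3)]
    refine integral_congr_ae (Eventually.of_forall fun ξ => ?_)
    simp only
    rw [fourierOn_eq_ft huV, ← Finset.smul_sum, ← smul_add]
    change osc x ξ • _ = _
    congr 1
    rw [symbolRest, sub_apply, sum_apply, sub_add_cancel]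
  have e4 : ∫ y, (∑ i ∈ Finset.Icc (-(N : ℤ)) (-1), kernelTerm pj N i x (x - y)
        - Real.log ‖x - y‖ • logTerm pj N x) (u y) =
      cst • (∑ j ∈ Finset.range N, (∫ y, radialInt (annularPart (pj j)) (N - 1 - j) x (x - y) (u y))
        - ∫ y, (Real.log ‖x - y‖ • oscInt (annularPart (pj N)) x 0) (u y)) := by
    rw [← integral_finsetSum _ fun j _ => irad j _,
      ← integral_sub (integrable_finsetSum _ fun j _ => irad j _) ilog, ← integral_smul]
    refine integral_congr_ae (Eventually.of_forall fun y => ?_)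
    simp only
    rw [sum_kernelTerm, logTerm, smul_comm (Real.log _), ← smul_sub]
    rw [smul_apply, sub_apply, sum_apply]
  -- For j < N the exponent of the tail integral is nonnegative, so the tail differs from the
  -- homogeneous kernel by a bounded function.
  have e5 : ∀ j ∈ Finset.range N,
      ∫ y, tailInt (annularPart (pj j)) (n + (m - j) - 1) x (x - y) (u y) =
        (∫ y, radialInt (annularPart (pj j)) (N - 1 - j) x (x - y) (u y)) +
        ∫ y, (tailInt (annularPart (pj j)) ((N - 1 - j : ℕ) : ℤ) x (x - y) -
          radialInt (annularPart (pj j)) (N - 1 - j) x (x - y)) (u y) := fun j hj => by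
    have hexp : (n + (m - j) - 1 : ℤ) = ((N - 1 - j : ℕ) : ℤ) := by
      have := Finset.mem_range.1 hj
      omega
    simp only [sub_apply]
    rw [hexp, integral_sub (itail j _) (irad j _), add_sub_cancel]
  -- For j = N the exponent is exactly -1, the logarithmic case.
  have e6 : ∫ y, tailInt (annularPart (pj N)) (n + (m - N) - 1) x (x - y) (u y) =
      (∫ y, (tailInt (annularPart (pj N)) (-1) x (x - y) +
        Real.log ‖x - y‖ • oscInt (annularPart (pj N)) x 0) (u y)) -
      ∫ y, (Real.log ‖x - y‖ • oscInt (annularPart (pj N)) x 0) (u y) := by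
    have hexp : (n + (m - N) - 1 : ℤ) = -1 := by omega
    simp only [add_apply]
    rw [hexp, integral_add (itail N _) ilog, add_sub_cancel_right]
  have e7 : quantize V p u x - ∫ y, (∑ i ∈ Finset.Icc (-(N : ℤ)) (-1), kernelTerm pj N i x (x - y)
        - Real.log ‖x - y‖ • logTerm pj N x) (u y) =
      cst • ((∫ ξ, osc x ξ • symbolRest p pj (N + 1) x ξ (ft u ξ)) +
        (∑ j ∈ Finset.range N, (∫ y, (tailInt (annularPart (pj j)) ((N - 1 - j : ℕ) : ℤ) x (x - y) -
          radialInt (annularPart (pj j)) (N - 1 - j) x (x - y)) (u y)) +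
        ∫ y, (tailInt (annularPart (pj N)) (-1) x (x - y) +
          Real.log ‖x - y‖ • oscInt (annularPart (pj N)) x 0) (u y))) := by
    rw [e1, e4, Finset.sum_range_succ, Finset.sum_congr rfl e5, Finset.sum_add_distrib, e6,
      ← smul_sub]
    congr 1
    abel
  rw [e7, norm_smul, Real.norm_of_nonneg hcst0, mul_assoc]
  refine mul_le_mul_of_nonneg_left ?_ hcst0
  rw [add_mul, add_mul, Finset.sum_mul]
  refine (norm_add_le _ _).trans (add_le_add ?_ ((norm_add_le _ _).trans (add_le_add
    ((norm_sum_le _ _).trans (Finset.sum_le_sum fun j _ => ?_)) ?_)))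
  · rw [← integral_mul_const]
    refine norm_integral_le_of_norm_le
      ((integrable_inv_one_add_norm_pow.const_mul C1).mul_const J)
      (Eventually.of_forall fun ξ => ?_)
    rw [norm_smul, norm_osc, one_mul]
    exact ((symbolRest p pj (N + 1) x ξ).le_opNorm _).trans
      (mul_le_mul (hC1 x hx ξ) (norm_ft_le u ξ) (norm_nonneg _) (by positivity))
  · exact norm_integral_apply_le hui fun y hy => hC2 j x hx (x - y) (hne y hy).1
  · exact norm_integral_apply_le hui fun y hy => hC3 x hx (x - y) (hne y hy).1 (hne y hy).2

end SymbolKernel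

end

end PsiDO

namespace PsiDO

open MeasureTheory Set Filter Topology Function

noncomputable section

set_option linter.unusedSectionVars false

/-! ### Identification of kernels -/

section KernelBound

variable {n : ℕ} {F : Type*} [NormedAddCommGroup F] [NormedSpace ℂ F] [CompleteSpace F]

/-- Testing with v times a normalized bump concentrating at y₀ recovers D y₀ v, and these test
functions have L¹ norm ‖v‖. An L¹ bound for the operator is therefore a pointwise bound for its
kernel; with C = 0 this is uniqueness of kernels. -/
lemma norm_kernel_le_of_forall_integral {U : Set (Rn n)} (hU : IsOpen U)
    {D : Rn n → F →L[ℂ] F} (hD : ContinuousOn D U) {C : ℝ} (hC : 0 ≤ C)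
    (h : ∀ u : Rn n → F, ContDiff ℝ ∞ u → HasCompactSupport u → tsupport u ⊆ U →
      ‖∫ y, D y (u y)‖ ≤ C * ∫ y, ‖u y‖) {y₀ : Rn n} (hy₀ : y₀ ∈ U) : ‖D y₀‖ ≤ C := by
  refine ContinuousLinearMap.opNorm_le_bound _ hC fun v => ?_
  refine le_of_forall_pos_le_add fun ε hε => ?_
  have hDv : ContinuousAt (fun y => D y v) y₀ :=
    (hD.continuousAt (hU.mem_nhds hy₀)).clm_apply continuousAt_const
  obtain ⟨r, hr, hrU⟩ : ∃ r > 0, ∀ y ∈ Metric.ball y₀ r, y ∈ U ∧ ‖D y v - D y₀ v‖ ≤ ε := by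
    have h1 : ∀ᶠ y in 𝓝 y₀, y ∈ U ∧ ‖D y v - D y₀ v‖ ≤ ε := by
      filter_upwards [hU.mem_nhds hy₀, Metric.continuousAt_iff'.1 hDv ε hε] with y hyU hy
      refine ⟨hyU, ?_⟩
      rw [← dist_eq_norm]; exact hy.le
    exact Metric.eventually_nhds_iff_ball.1 h1
  let φ : ContDiffBump y₀ := ⟨r / 4, r / 2, by linarith, by linarith⟩
  set ρ := φ.normed volume with hρ
  have hρc : HasCompactSupport ρ := φ.hasCompactSupport_normed
  have hρs : tsupport ρ ⊆ Metric.ball y₀ r := by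
    rw [hρ, φ.tsupport_normed_eq]
    exact Metric.closedBall_subset_ball (by change r / 2 < r; linarith)
  have hρd : ContDiff ℝ ∞ ρ := φ.contDiff_normed
  have hρi : ∫ y, ρ y = 1 := φ.integral_normed
  have hρ0 : ∀ y, 0 ≤ ρ y := φ.nonneg_normed
  set u : Rn n → F := fun y => ρ y • v with hu
  have hud : ContDiff ℝ ∞ u := hρd.smul contDiff_const
  have huc : HasCompactSupport u := hρc.smul_right
  have hus : tsupport u ⊆ tsupport ρ :=
    closure_mono fun y hy hy' => hy (by simp [hu, hy'])
  have huU : tsupport u ⊆ U := fun y hy => (hrU y (hρs (hus hy))).1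
  have hnorm : ∫ y, ‖u y‖ = ‖v‖ := by
    have : ∀ y, ‖u y‖ = ρ y * ‖v‖ := fun y => by
      rw [hu, norm_smul, Real.norm_of_nonneg (hρ0 y)]
    simp only [this, integral_mul_const, hρi, one_mul]
  have h1 := h u hud huc huU
  rw [hnorm] at h1
  have iu : Integrable fun y => D y (u y) :=
    integrable_apply_of_continuousOn hU hD hud.continuous huc huU
  have ir : Integrable ρ := hρd.continuous.integrable_of_hasCompactSupport hρc
  have e : (∫ y, D y (u y)) - D y₀ v = ∫ y, ρ y • (D y v - D y₀ v) := by
    have e1 : D y₀ v = ∫ y, ρ y • D y₀ v := by rw [integral_smul_const, hρi, one_smul]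
    have e2 : ∀ y, ρ y • (D y v - D y₀ v) = D y (u y) - ρ y • D y₀ v := fun y => by
      simp only [hu]
      rw [smul_sub, (D y).map_smul_of_tower]
    simp only [e2]
    rw [integral_sub iu (ir.smul_const _), ← e1]
  have h2 : ‖∫ y, ρ y • (D y v - D y₀ v)‖ ≤ ε := by
    have : ∫ y, ρ y * ε = ε := by rw [integral_mul_const, hρi, one_mul]
    rw [← this]
    refine norm_integral_le_of_norm_le (ir.mul_const ε) (Eventually.of_forall fun y => ?_)
    rw [norm_smul, Real.norm_of_nonneg (hρ0 y)]
    by_cases hy : y ∈ tsupport ρ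
    · exact mul_le_mul_of_nonneg_left (hrU y (hρs hy)).2 (hρ0 y)
    · rw [image_eq_zero_of_notMem_tsupport hy]; simp
  have e3 : D y₀ v = (∫ y, D y (u y)) - ∫ y, ρ y • (D y v - D y₀ v) := by rw [← e]; abel
  rw [e3]
  exact (norm_sub_le _ _).trans (add_le_add h1 h2)

end KernelBound

/-! ### Logarithmic expansions in one variable -/

section LogExp

variable {H H' : Type*} [NormedAddCommGroup H] [NormedSpace ℝ H] [NormedAddCommGroup H']
  [NormedSpace ℝ H']

/-- `h(t) = ∑ t^{-(i+1)} b_i - C log t + O(1)` as `t → 0+`. -/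
def HasLogExp (h : ℝ → H) (C : H) : Prop :=
  ∃ (N : ℕ) (b : ℕ → H), (fun t => h t -
    (∑ i ∈ Finset.range N, t ^ (-(i + 1 : ℤ)) • b i - Real.log t • C)) =O[𝓝[>] 0]
    (fun _ => (1 : ℝ))

namespace HasLogExp

lemma sum_pad (b : ℕ → H) (c : ℕ → ℝ) {N M : ℕ} (hNM : N ≤ M) :
    ∑ i ∈ Finset.range M, c i • (if i < N then b i else 0) = ∑ i ∈ Finset.range N, c i • b i := by
  rw [← Finset.sum_subset (Finset.range_subset_range.2 hNM)]
  · exact Finset.sum_congr rfl fun i hi => by rw [if_pos (Finset.mem_range.1 hi)]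
  · intro i _ hi
    rw [if_neg (by simpa using hi), smul_zero]

lemma add {h₁ h₂ : ℝ → H} {C₁ C₂ : H} (H₁ : HasLogExp h₁ C₁) (H₂ : HasLogExp h₂ C₂) :
    HasLogExp (fun t => h₁ t + h₂ t) (C₁ + C₂) := by
  obtain ⟨N₁, b₁, hb₁⟩ := H₁
  obtain ⟨N₂, b₂, hb₂⟩ := H₂
  refine ⟨max N₁ N₂, fun i => (if i < N₁ then b₁ i else 0) + (if i < N₂ then b₂ i else 0), ?_⟩
  refine (hb₁.add hb₂).congr_left fun t => ?_
  simp only [smul_add, Finset.sum_add_distrib]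
  rw [sum_pad b₁ _ (le_max_left _ _), sum_pad b₂ _ (le_max_right _ _)]
  abel

lemma of_isBigO {h : ℝ → H} (hh : h =O[𝓝[>] 0] (fun _ => (1 : ℝ))) : HasLogExp h 0 :=
  ⟨0, 0, by simpa using hh⟩

lemma congr' {h h' : ℝ → H} {C : H} (H₁ : HasLogExp h C) (e : h =ᶠ[𝓝[>] 0] h') :
    HasLogExp h' C := by
  obtain ⟨N, b, hb⟩ := H₁
  refine ⟨N, b, hb.congr' ?_ EventuallyEq.rfl⟩
  filter_upwards [e] with t ht
  rw [ht]

lemma add_isBigO {h h' : ℝ → H} {C : H} (H₁ : HasLogExp h C)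
    (hh : h' =O[𝓝[>] 0] (fun _ => (1 : ℝ))) : HasLogExp (fun t => h t + h' t) C := by
  simpa using H₁.add (of_isBigO hh)

lemma clm (T : H →L[ℝ] H') {h : ℝ → H} {C : H} (H₁ : HasLogExp h C) :
    HasLogExp (fun t => T (h t)) (T C) := by
  obtain ⟨N, b, hb⟩ := H₁
  refine ⟨N, fun i => T (b i), ((T.isBigO_comp _ _).trans hb).congr_left fun t => ?_⟩
  simp [map_sub, map_sum]

lemma sum_zero {ι : Type*} (s : Finset ι) {h : ι → ℝ → H} (H₁ : ∀ i ∈ s, HasLogExp (h i) 0) :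
    HasLogExp (fun t => ∑ i ∈ s, h i t) 0 := by
  classical
  induction s using Finset.induction_on with
  | empty => exact of_isBigO (by simpa using Asymptotics.isBigO_zero (E' := H) (fun _ => (1 : ℝ)) (𝓝[>] 0))
  | insert i s hi ih =>
    have := (H₁ i (Finset.mem_insert_self _ _)).add
      (ih fun j hj => H₁ j (Finset.mem_insert_of_mem hj))
    simpa [Finset.sum_insert hi] using this

lemma isBigO_one_of_contDiffAt {g : ℝ → H} (hg : ContinuousAt g 0) :
    g =O[𝓝[>] 0] (fun _ => (1 : ℝ)) :=
  (hg.tendsto.mono_left nhdsWithin_le_nhds).isBigO_one ℝ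

/-- A power of `t` times a smooth function has an expansion without logarithm. -/
lemma zpow_smul {g : ℝ → H} (hg : ContDiffAt ℝ ∞ g 0) (j : ℤ) :
    HasLogExp (fun t => t ^ j • g t) 0 := by
  rcases le_or_gt 0 j with hj | hj
  · lift j to ℕ using hj
    refine of_isBigO ?_
    have : ContinuousAt (fun t : ℝ => t ^ (j : ℤ) • g t) 0 := by
      simp only [zpow_natCast]
      exact (continuous_pow j).continuousAt.smul hg.continuousAt
    exact isBigO_one_of_contDiffAt this
  · obtain ⟨d, hd⟩ : ∃ d : ℕ, j = -((d : ℤ) + 1) := ⟨(-j - 1).toNat, by omega⟩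
    subst hd
    -- Taylor's formula to order d: multiplied by t^{-(d+1)}, the polynomial gives pure poles and
    -- the remainder O(t^{d+1}) becomes bounded.
    have hgd : ContDiffAt ℝ ((d : ℕ∞) + 1 : ℕ∞) g 0 := hg.of_le (by exact_mod_cast le_top)
    obtain ⟨ε, hε, hε'⟩ : ∃ ε > 0, ContDiffOn ℝ ((d : ℕ∞) + 1 : ℕ∞) g (Icc 0 ε) := by
      obtain ⟨u, hu, hgu⟩ := hgd.contDiffOn le_rfl (by simp)
      obtain ⟨ε, hε, hb⟩ := Metric.mem_nhds_iff.1 hu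
      refine ⟨ε / 2, by positivity, hgu.mono fun t ht => hb ?_⟩
      rw [Metric.mem_ball, Real.dist_eq, sub_zero, abs_of_nonneg ht.1]
      linarith [ht.2]
    obtain ⟨C, hC⟩ := exists_taylor_mean_remainder_bound (n := d) hε.le (by exact_mod_cast hε')
    set c : ℕ → H := fun k => ((k.factorial : ℝ)⁻¹) • iteratedDerivWithin k g (Icc 0 ε) 0 with hc
    -- The pole t^{-(i+1)} carries the Taylor coefficient of order d - i.
    refine ⟨d + 1, fun i => c (d - i), ?_⟩
    refine Asymptotics.IsBigO.of_bound C ?_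
    have hmem : Ioc (0 : ℝ) ε ∈ 𝓝[>] (0 : ℝ) := Ioc_mem_nhdsGT hε
    filter_upwards [hmem] with t ht
    have ht0 : t ≠ 0 := ht.1.ne'
    have h1 := hC t ⟨ht.1.le, ht.2⟩
    rw [taylor_within_apply, sub_zero] at h1
    have e : t ^ (-((d : ℤ) + 1)) • g t - (∑ i ∈ Finset.range (d + 1),
        t ^ (-(i + 1 : ℤ)) • c (d - i) - Real.log t • (0 : H)) =
        t ^ (-((d : ℤ) + 1)) • (g t - ∑ k ∈ Finset.range (d + 1),
          ((k.factorial : ℝ)⁻¹ * t ^ k) • iteratedDerivWithin k g (Icc 0 ε) 0) := by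
      rw [smul_zero, sub_zero, smul_sub, Finset.smul_sum, ← Finset.sum_range_reflect]
      congr 1
      refine Finset.sum_congr rfl fun k hk => ?_
      have hk' := Finset.mem_range.1 hk
      rw [hc, smul_smul, smul_smul]
      have e1 : d - (d + 1 - 1 - k) = k := by omega
      rw [e1]
      congr 1
      have e2 : t ^ (-(((d + 1 - 1 - k : ℕ) : ℤ) + 1)) = t ^ (-((d : ℤ) + 1)) * t ^ k := by
        rw [← zpow_natCast t k, ← zpow_add₀ ht0]
        congr 1
        omega
      rw [e2]; ring
    rw [e, norm_smul, norm_one, mul_one, norm_zpow, Real.norm_of_nonneg ht.1.le]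
    calc t ^ (-((d : ℤ) + 1)) * _ ≤ t ^ (-((d : ℤ) + 1)) * (C * t ^ (d + 1)) := by
          gcongr
          exact zpow_nonneg ht.1.le _
      _ = C := by
          have : t ^ (-((d : ℤ) + 1)) = (t ^ (d + 1))⁻¹ := by
            rw [zpow_neg]; norm_cast
          rw [this]
          field_simp

lemma tendsto_log_mul_self : Tendsto (fun t : ℝ => Real.log t * t) (𝓝[>] 0) (𝓝 0) := by
  simpa using tendsto_log_mul_rpow_nhdsGT_zero (r := 1) one_pos

/-- A logarithm times a smooth function. -/
lemma log_smul {g : ℝ → H} (hg : ContDiffAt ℝ ∞ g 0) :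
    HasLogExp (fun t => -(Real.log t • g t)) (g 0) := by
  refine ⟨0, 0, ?_⟩
  have h1 : (fun t => g t - g 0) =O[𝓝[>] 0] fun t => t := by
    have := (hg.differentiableAt (by simp)).isBigO_sub
    simp only [sub_zero] at this
    exact this.mono nhdsWithin_le_nhds
  have h2 : Tendsto (fun t : ℝ => Real.log t * t) (𝓝[>] 0) (𝓝 0) :=
    tendsto_log_mul_self
  have h3 : (fun t => Real.log t • (g t - g 0)) =O[𝓝[>] 0] fun t => Real.log t * t :=
    (Asymptotics.isBigO_refl Real.log _).smul h1
  refine ((h3.trans (h2.isBigO_one ℝ)).neg_left).congr_left fun t => ?_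
  simp only [Finset.range_zero, Finset.sum_empty, smul_sub]
  abel

/-- Multiplication by a smooth function. -/
lemma clm_apply {L : ℝ → H →L[ℝ] H'} (hL : ContDiffAt ℝ ∞ L 0) {h : ℝ → H} {C : H}
    (H₁ : HasLogExp h C) : HasLogExp (fun t => L t (h t)) (L 0 C) := by
  obtain ⟨N, b, hb⟩ := H₁
  -- The factor L t turns poles into further poles without logarithm, so the logarithmic coefficient
  -- comes from the term log t • L t C alone.
  have h1 : HasLogExp (fun t => ∑ i ∈ Finset.range N, t ^ (-(i + 1 : ℤ)) • L t (b i)) 0 :=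
    sum_zero _ fun i _ => zpow_smul (hL.clm_apply contDiffAt_const) _
  have h2 : HasLogExp (fun t => -(Real.log t • L t C)) (L 0 C) :=
    log_smul (hL.clm_apply contDiffAt_const)
  have h3 : (fun t => L t (h t -
      (∑ i ∈ Finset.range N, t ^ (-(i + 1 : ℤ)) • b i - Real.log t • C))) =O[𝓝[>] 0]
      (fun _ => (1 : ℝ)) := by
    have hL1 : L =O[𝓝[>] 0] (fun _ => (1 : ℝ)) := isBigO_one_of_contDiffAt hL.continuousAt
    have h4 := hL1.norm_left.mul hb.norm_left
    simp only [mul_one] at h4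
    refine Asymptotics.IsBigO.trans (Asymptotics.IsBigO.of_norm_le fun t => ?_) h4
    exact (L t).le_opNorm _
  have := (h1.add h2).add_isBigO h3
  rw [zero_add] at this
  refine this.congr' (Eventually.of_forall fun t => ?_)
  simp only [map_sub, map_sum, map_smul]
  abel

/-- Induction on the number of poles. Multiplication by t^{N+1} kills everything but the coefficient
of the highest pole, which is therefore zero; when no pole is left, unboundedness of log t forces C
= 0. -/
lemma eq_zero_of_isBigO (N : ℕ) : ∀ (b : ℕ → H) (C : H),
    (fun t => ∑ i ∈ Finset.range N, t ^ (-(i + 1 : ℤ)) • b i - Real.log t • C) =O[𝓝[>] 0]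
      (fun _ => (1 : ℝ)) → C = 0 := by
  induction N with
  | zero =>
    intro b C h
    by_contra hC
    simp only [Finset.range_zero, Finset.sum_empty, zero_sub] at h
    have h1 := h.neg_left
    simp only [neg_neg] at h1
    have h2 : Tendsto (fun t => ‖Real.log t • C‖) (𝓝[>] 0) atTop := by
      simp only [norm_smul]
      exact (tendsto_abs_atBot_atTop.comp Real.tendsto_log_nhdsGT_zero).atTop_mul_const
        (norm_pos_iff.2 hC)
    obtain ⟨K, hK⟩ := h1.bound
    obtain ⟨t, ht1, ht2⟩ := (hK.and (h2.eventually_gt_atTop (K * ‖(1 : ℝ)‖))).exists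
    linarith
  | succ N ih =>
    intro b C h
    have hb : b N = 0 := by
      have h1 : Tendsto (fun t : ℝ => t ^ (N + 1)) (𝓝[>] 0) (𝓝 0) := by
        have := (continuous_pow (M := ℝ) (N + 1)).tendsto 0
        rw [zero_pow (Nat.succ_ne_zero N)] at this
        exact this.mono_left nhdsWithin_le_nhds
      have h2 : Tendsto (fun t : ℝ => t ^ (N + 1) • (∑ i ∈ Finset.range (N + 1),
          t ^ (-(i + 1 : ℤ)) • b i - Real.log t • C)) (𝓝[>] 0) (𝓝 0) := by
        have h3 := (Asymptotics.isBigO_refl (fun t : ℝ => t ^ (N + 1)) (𝓝[>] 0)).smul h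
        simp only [smul_eq_mul, mul_one] at h3
        exact h3.trans_tendsto h1
      have h4 : Tendsto (fun t : ℝ => (∑ i ∈ Finset.range N, t ^ (N - i) • b i + b N) -
          (t ^ N * (Real.log t * t)) • C) (𝓝[>] 0) (𝓝 ((0 + b N) - ((0 : ℝ) ^ N * 0) • C)) := by
        refine Tendsto.sub (Tendsto.add ?_ tendsto_const_nhds) (Tendsto.smul_const ?_ C)
        · have : ∀ i ∈ Finset.range N,
              Tendsto (fun t : ℝ => t ^ (N - i) • b i) (𝓝[>] 0) (𝓝 0) := fun i hi => by
            have h5 : ContinuousAt (fun t : ℝ => t ^ (N - i) • b i) 0 :=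
              ((continuous_pow _).smul continuous_const).continuousAt
            have h6 := h5.tendsto
            rw [zero_pow (by have := Finset.mem_range.1 hi; omega), zero_smul] at h6
            exact h6.mono_left nhdsWithin_le_nhds
          simpa using tendsto_finsetSum _ this
        · exact (((continuous_pow (M := ℝ) N).tendsto 0).mono_left nhdsWithin_le_nhds).mul
            tendsto_log_mul_self
      have h7 := h4.congr' (f₂ := fun t : ℝ => t ^ (N + 1) • (∑ i ∈ Finset.range (N + 1),
          t ^ (-(i + 1 : ℤ)) • b i - Real.log t • C)) (by
        filter_upwards [self_mem_nhdsWithin] with t ht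
        have ht0 : t ≠ 0 := (mem_Ioi.1 ht).ne'
        rw [smul_sub, Finset.smul_sum, Finset.sum_range_succ, smul_smul, smul_smul]
        congr 1
        · congr 1
          · refine Finset.sum_congr rfl fun i hi => ?_
            rw [smul_smul]
            congr 1
            rw [← zpow_natCast, ← zpow_natCast, ← zpow_add₀ ht0]
            congr 1
            have := Finset.mem_range.1 hi
            omega
          · rw [← zpow_natCast, ← zpow_add₀ ht0]
            simp
        · congr 1; ring)
      have h8 := tendsto_nhds_unique h2 h7
      simpa using h8.symm
    refine ih b C (h.congr_left fun t => ?_)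
    rw [Finset.sum_range_succ, hb, smul_zero, add_zero]

/-- The coefficient of the logarithm is unique. -/
lemma unique {h : ℝ → H} {C C' : H} (H₁ : HasLogExp h C) (H₂ : HasLogExp h C') : C = C' := by
  have h3 := H₁.add (H₂.clm (-ContinuousLinearMap.id ℝ H))
  obtain ⟨N, b, hb⟩ := h3
  have h4 := hb.neg_left
  have := eq_zero_of_isBigO N b (C + (-ContinuousLinearMap.id ℝ H) C') (h4.congr_left fun t => by
    simp)
  simpa [← sub_eq_add_neg, sub_eq_zero] using this

end HasLogExp

end LogExp

end

end PsiDO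

namespace PsiDO

open MeasureTheory Set Filter Topology Function

noncomputable section

set_option linter.unusedSectionVars false

/-! ### Division of smooth curves by t -/

section Hadamard

variable {H : Type*} [NormedAddCommGroup H] [NormedSpace ℝ H] [CompleteSpace H]

-- The integral is the value at 0 of the convolution of the indicator of (0, 1] with s ↦ b(s) g(p,
-- -s). The bump b equals 1 where it matters and only supplies the compact support required for
-- smooth dependence on the parameter p.
open scoped Convolution in
lemma contDiff_integral_Ioc {g : ℝ → ℝ → H} (hg : ContDiff ℝ ∞ (uncurry g)) :
    ContDiff ℝ ∞ (fun p => ∫ s in Ioc (0 : ℝ) 1, g p s) := by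
  let b : ContDiffBump (0 : ℝ) := ⟨2, 3, by norm_num, by norm_num⟩
  set f₀ : ℝ → ℝ := (Ioc (0 : ℝ) 1).indicator fun _ => 1 with hf₀
  have hf : LocallyIntegrable f₀ volume := by
    have : Integrable f₀ := by
      rw [hf₀, integrable_indicator_iff measurableSet_Ioc]
      exact integrableOn_const (by simp)
    exact this.locallyIntegrable
  have hgs : ContDiffOn ℝ ∞ (uncurry fun p s => b s • g p (-s))
      ((univ : Set ℝ) ×ˢ (univ : Set ℝ)) := by
    refine ContDiff.contDiffOn ?_
    exact (b.contDiff.comp contDiff_snd).smul (hg.comp (contDiff_fst.prodMk contDiff_snd.neg))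
  have key := contDiffOn_convolution_right_with_param (μ := volume) (f := f₀) (n := ⊤)
    (g := fun p s => b s • g p (-s)) (s := univ) (k := Metric.closedBall 0 3)
    (ContinuousLinearMap.lsmul ℝ ℝ) isOpen_univ (isCompact_closedBall _ _)
    (fun p s _ hs => by
      have : b s = 0 := b.zero_of_le_dist (by
        have : 3 < dist s 0 := by simpa using hs
        exact this.le)
      rw [this, zero_smul]) hf hgs
  rw [univ_prod_univ, contDiffOn_univ] at key
  have h2 := key.comp (contDiff_id.prodMk (contDiff_const (c := (0 : ℝ))))
  convert h2 using 1
  ext p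
  simp only [comp_apply, id, convolution_def, zero_sub, neg_neg, ContinuousLinearMap.lsmul_apply]
  rw [← integral_indicator measurableSet_Ioc]
  refine integral_congr_ae (Eventually.of_forall fun s => ?_)
  by_cases hs : s ∈ Ioc (0 : ℝ) 1
  · have hb : b (-s) = 1 := b.one_of_mem_closedBall (by
      rw [Metric.mem_closedBall, dist_zero_right, norm_neg, Real.norm_of_nonneg hs.1.le]
      change s ≤ 2
      linarith [hs.2])
    simp [hf₀, indicator_of_mem hs, hb]
  · simp [hf₀, indicator_of_notMem hs]

/-- Hadamard's lemma in one variable. -/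
lemma exists_smul_eq_of_contDiffAt {f : ℝ → H} (hf : ∀ᶠ t in 𝓝 (0 : ℝ), ContDiffAt ℝ ∞ f t)
    (h0 : f 0 = 0) :
    ∃ ψ : ℝ → H, ContDiffAt ℝ ∞ ψ 0 ∧ ψ 0 = deriv f 0 ∧ ∀ᶠ t in 𝓝 (0 : ℝ), f t = t • ψ t := by
  obtain ⟨r, hr, hrf⟩ := Metric.eventually_nhds_iff_ball.1 hf
  let b : ContDiffBump (0 : ℝ) := ⟨r / 3, r / 2, by linarith, by linarith⟩
  set F : ℝ → H := fun t => b t • f t with hF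
  have hFd : ContDiff ℝ ∞ F := by
    rw [contDiff_iff_contDiffAt]
    intro t
    by_cases ht : t ∈ Metric.ball (0 : ℝ) r
    · exact b.contDiff.contDiffAt.smul (hrf t ht)
    · have ht' : t ∉ tsupport b := by
        rw [b.tsupport_eq]
        intro h
        exact ht (Metric.closedBall_subset_ball (by change r / 2 < r; linarith) h)
      have e : F =ᶠ[𝓝 t] fun _ => 0 := by
        filter_upwards [(isClosed_tsupport b).isOpen_compl.mem_nhds ht'] with s hs
        rw [hF]
        simp only
        rw [image_eq_zero_of_notMem_tsupport hs, zero_smul]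
      exact contDiffAt_const.congr_of_eventuallyEq e
  have hFf : F =ᶠ[𝓝 0] f := by
    filter_upwards [b.eventuallyEq_one] with t ht
    rw [hF]; simp only; rw [ht]; simp
  have hF' : ContDiff ℝ ∞ (deriv F) := (contDiff_infty_iff_deriv.1 hFd).2
  -- The fundamental theorem of calculus gives F(t) = t ∫₀¹ F'(st) ds. The cutoff made F globally
  -- smooth, so the quotient is smooth in p.
  refine ⟨fun p => ∫ s in Ioc (0 : ℝ) 1, deriv F (s * p), ?_, ?_, ?_⟩
  · refine (contDiff_integral_Ioc (g := fun p s => deriv F (s * p)) ?_).contDiffAt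
    exact hF'.comp (contDiff_snd.mul contDiff_fst)
  · simp [hFf.deriv_eq]
  · filter_upwards [hFf] with t ht
    have h1 : ∫ s in (0 : ℝ)..1, t • deriv F (s * t) = F (1 * t) - F (0 * t) := by
      refine intervalIntegral.integral_eq_sub_of_hasDerivAt (f := fun s => F (s * t))
        (fun s _ => ?_) ?_
      · have h2 : HasDerivAt F (deriv F (s * t)) (s * t) :=
          (hFd.differentiable (by simp)).differentiableAt.hasDerivAt
        have h3 : HasDerivAt (fun s : ℝ => s * t) t s := by
          simpa using (hasDerivAt_id s).mul_const t
        exact h2.scomp s h3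
      · exact (continuous_const.smul (hF'.continuous.comp
          (continuous_id.mul continuous_const))).intervalIntegrable _ _
    rw [← integral_smul, ← intervalIntegral.integral_of_le zero_le_one, h1, one_mul, zero_mul, ht]
    have : F 0 = 0 := by simp [hF, h0]
    rw [this, sub_zero]

end Hadamard

/-! ### Kernel expansions along curves ending on the diagonal -/

section Ray

variable {n : ℕ} {F : Type*} [NormedAddCommGroup F] [NormedSpace ℂ F]

/-- An expansion of a kernel near the diagonal restricts to logarithmic expansions along curves. -/
lemma hasLogExp_of_expansion {V : Set (Rn n)} {x : Rn n} (hx : x ∈ V) {s : Finset ℤ}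
    {a : ℤ → Rn n → Rn n → F →L[ℂ] F} (ha : ∀ j ∈ s, IsHomogeneous j V (a j))
    {k : Rn n → F →L[ℂ] F} {c : F →L[ℂ] F} {W : Set (Rn n)} (hW : W ∈ 𝓝 x) {C : ℝ}
    (hk : ∀ y ∈ W, x ≠ y →
      ‖k y - (∑ j ∈ s, a j x (x - y) - Real.log ‖x - y‖ • c)‖ ≤ C)
    {ψ : ℝ → Rn n} (hψ : ContDiffAt ℝ ∞ ψ 0) (hψ0 : ψ 0 ≠ 0) :
    HasLogExp (fun t => k (x - t • ψ t)) c := by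
  have hne : ∀ᶠ t in 𝓝[>] (0 : ℝ), ψ t ≠ 0 :=
    (hψ.continuousAt.eventually_ne hψ0).filter_mono nhdsWithin_le_nhds
  have hpos : ∀ᶠ t in 𝓝[>] (0 : ℝ), 0 < t := self_mem_nhdsWithin
  have hWt : ∀ᶠ t in 𝓝[>] (0 : ℝ), x - t • ψ t ∈ W := by
    have h1 : ContinuousAt (fun t : ℝ => x - t • ψ t) 0 :=
      continuousAt_const.sub (continuousAt_id.smul hψ.continuousAt)
    have h2 := h1.tendsto
    rw [zero_smul, sub_zero] at h2
    exact (h2.eventually_mem hW).filter_mono nhdsWithin_le_nhds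
  -- By homogeneity a_j(x, tψ(t)) = t^j a_j(x, ψ(t)), a power times a smooth function; and log
  -- ‖tψ(t)‖ differs from log t by the bounded term log ‖ψ(t)‖.
  have h1 : HasLogExp (fun t => ∑ j ∈ s, t ^ j • a j x (ψ t)) 0 := by
    refine HasLogExp.sum_zero s fun j hj => HasLogExp.zpow_smul ?_ j
    have h2 : ContDiffAt ℝ ∞ (a j x) (ψ 0) := by
      have h3 : ContDiffOn ℝ ∞ (a j x) {0}ᶜ :=
        (ha j hj).1.comp (contDiff_const.prodMk contDiff_id).contDiffOn (fun ξ hξ => ⟨hx, hξ⟩)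
      exact h3.contDiffAt (isOpen_compl_singleton.mem_nhds hψ0)
    exact h2.comp (0 : ℝ) hψ
  have h2 : HasLogExp (fun t : ℝ => -(Real.log t • c)) c :=
    HasLogExp.log_smul (g := fun _ => c) contDiffAt_const
  have h3 : (fun t => -(Real.log ‖ψ t‖ • c)) =O[𝓝[>] 0] (fun _ => (1 : ℝ)) := by
    refine HasLogExp.isBigO_one_of_contDiffAt ?_
    exact ((hψ.continuousAt.norm.log (norm_ne_zero_iff.2 hψ0)).smul continuousAt_const).neg
  have h4 : (fun t => k (x - t • ψ t) - (∑ j ∈ s, a j x (t • ψ t) -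
      Real.log ‖t • ψ t‖ • c)) =O[𝓝[>] 0] (fun _ => (1 : ℝ)) := by
    refine Asymptotics.IsBigO.of_bound C ?_
    filter_upwards [hne, hpos, hWt] with t ht ht0 htW
    have h5 := hk _ htW (by
      intro e
      have : t • ψ t = 0 := by simpa using e.symm
      exact (smul_ne_zero ht0.ne' ht) this)
    rw [sub_sub_cancel] at h5
    simpa using h5
  have h6 := ((h1.add h2).add_isBigO h3).add_isBigO h4
  rw [zero_add] at h6
  refine h6.congr' ?_
  filter_upwards [hne, hpos] with t ht ht0
  have e1 : ∑ j ∈ s, a j x (t • ψ t) = ∑ j ∈ s, t ^ j • a j x (ψ t) :=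
    Finset.sum_congr rfl fun j hj => (ha j hj).2 x hx _ ht t ht0
  have e2 : Real.log ‖t • ψ t‖ = Real.log t + Real.log ‖ψ t‖ := by
    rw [norm_smul, Real.norm_of_nonneg ht0.le, Real.log_mul ht0.ne' (norm_ne_zero_iff.2 ht)]
  rw [e1, e2, add_smul]
  abel

end Ray

end

end PsiDO

namespace PsiDO

open MeasureTheory Set Filter Topology Function

noncomputable section

set_option linter.unusedSectionVars false

/-! ### Sections in local coordinates -/

section Coordinates

variable {n : ℕ} {M : Type*} [TopologicalSpace M] [ChartedSpace (Rn n) M] [IsManifold (𝓡 n) ∞ M]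
  {F : Type*} [NormedAddCommGroup F] [NormedSpace ℂ F]
  {E : M → Type*} [TopologicalSpace (TotalSpace F E)] [∀ x, TopologicalSpace (E x)]
  [∀ x, AddCommGroup (E x)] [∀ x, Module ℂ (E x)]
  [FiberBundle F E] [VectorBundle ℂ F E] [VectorBundle ℝ F E]
  [ContMDiffVectorBundle ∞ F E (𝓡 n)]

namespace LocalCoords

variable (c : LocalCoords n F E)

lemma isOpen_dom : IsOpen c.dom := c.chart.open_target

variable {c} in
lemma symm_mem {y : Rn n} (hy : y ∈ c.dom) : c.chart.symm y ∈ c.chart.source :=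
  c.chart.map_target hy

variable {c} in
lemma symm_mem_baseSet {y : Rn n} (hy : y ∈ c.dom) : c.chart.symm y ∈ c.triv.baseSet :=
  c.subset (symm_mem hy)

variable {c} in
lemma chart_mem_dom {x : M} (hx : x ∈ c.chart.source) : c.chart x ∈ c.dom :=
  c.chart.map_source hx

lemma continuousOn_symm : ContinuousOn c.chart.symm c.dom := c.chart.continuousOn_symm

variable {c} in
lemma loc_add {y : Rn n} (hy : y ∈ c.dom) (s t : ∀ x, E x) :
    c.loc (s + t) y = c.loc s y + c.loc t y :=
  (c.triv.linear ℂ (symm_mem_baseSet hy)).1 _ _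

variable {c} in
lemma loc_smul {y : Rn n} (hy : y ∈ c.dom) (z : ℂ) (s : ∀ x, E x) :
    c.loc (z • s) y = z • c.loc s y :=
  (c.triv.linear ℂ (symm_mem_baseSet hy)).2 _ _

variable {c} in
lemma loc_zero {y : Rn n} (hy : y ∈ c.dom) : c.loc (0 : ∀ x, E x) y = 0 := by
  have := loc_smul hy (0 : ℂ) (0 : ∀ x, E x)
  rwa [zero_smul, zero_smul] at this

variable {c} in
lemma loc_sub {y : Rn n} (hy : y ∈ c.dom) (s t : ∀ x, E x) :
    c.loc (s - t) y = c.loc s y - c.loc t y := by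
  have h := loc_add hy s ((-1 : ℂ) • t)
  rw [loc_smul hy, neg_smul, one_smul, neg_smul, one_smul, ← sub_eq_add_neg,
    ← sub_eq_add_neg] at h
  exact h

variable {c} in
lemma loc_mul {y : Rn n} (hy : y ∈ c.dom) (φ : M → ℝ) (s : ∀ x, E x) :
    c.loc (fun x => φ x • s x) y = φ (c.chart.symm y) • c.loc s y :=
  (c.triv.linear ℂ (symm_mem_baseSet hy)).2 ((φ (c.chart.symm y) : ℝ) : ℂ) _

variable {c} in
lemma loc_eq_zero_iff {y : Rn n} (hy : y ∈ c.dom) (s : ∀ x, E x) :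
    c.loc s y = 0 ↔ s (c.chart.symm y) = 0 := by
  have hb := symm_mem_baseSet hy
  constructor
  · intro h
    have h1 : c.triv.symm (c.chart.symm y) (c.loc s y) = s (c.chart.symm y) := by
      rw [loc]
      exact c.triv.symm_apply_apply_mk hb _
    rw [← h1, h]
    exact (c.triv.symmₗ_apply (R := ℂ) hb 0).symm.trans (map_zero _)
  · intro h
    have := loc_zero (c := c) (E := E) hy
    rw [loc] at this ⊢
    rw [h]
    exact this

lemma loc_congr {s t : ∀ x, E x} {y : Rn n} (h : s (c.chart.symm y) = t (c.chart.symm y)) :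
    c.loc s y = c.loc t y := by
  rw [loc, loc, h]

lemma contDiffOn_loc {s : ∀ x, E x} (hs : s ∈ SmoothSections n F E) :
    ContDiffOn ℝ ∞ (c.loc s) c.dom := by
  have h1 : ContMDiffOn (𝓡 n) 𝓘(ℝ, F) ∞ (fun x => (c.triv ⟨x, s x⟩).2) c.chart.source :=
    (c.triv.contMDiffOn_section_iff c.chart.open_source c.subset).1 (ContMDiff.contMDiffOn hs)
  have h2 : ContMDiffOn (𝓡 n) (𝓡 n) ∞ c.chart.symm c.dom :=
    contMDiffOn_symm_of_mem_maximalAtlas c.chart_mem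
  exact contMDiffOn_iff_contDiffOn.1 (h1.comp h2 fun y hy => symm_mem hy)

lemma contDiffOn_comp_symm {φ : M → ℝ} (hφ : ContMDiff (𝓡 n) 𝓘(ℝ, ℝ) ∞ φ) :
    ContDiffOn ℝ ∞ (fun y => φ (c.chart.symm y)) c.dom := by
  have h2 : ContMDiffOn (𝓡 n) (𝓡 n) ∞ c.chart.symm c.dom :=
    contMDiffOn_symm_of_mem_maximalAtlas c.chart_mem
  exact contMDiffOn_iff_contDiffOn.1 (hφ.comp_contMDiffOn h2)

/-- A section in local coordinates, extended by zero. -/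
def cloc (s : ∀ x, E x) : Rn n → F := c.dom.indicator (c.loc s)

variable {c} in
lemma cloc_apply {y : Rn n} (hy : y ∈ c.dom) (s : ∀ x, E x) : c.cloc s y = c.loc s y :=
  indicator_of_mem hy _

lemma setIntegral_loc (s : ∀ x, E x) {H : Type*} [NormedAddCommGroup H] [NormedSpace ℂ H]
    (k : Rn n → F →L[ℂ] H) : ∫ y in c.dom, k y (c.loc s y) = ∫ y, k y (c.cloc s y) := by
  rw [← integral_indicator c.isOpen_dom.measurableSet]
  refine integral_congr_ae (Eventually.of_forall fun y => ?_)
  by_cases hy : y ∈ c.dom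
  · simp only [indicator_of_mem hy, cloc_apply hy]
  · simp only [indicator_of_notMem hy, cloc, map_zero]

lemma fourierOn_loc (s : ∀ x, E x) (ξ : Rn n) :
    fourierOn c.dom (c.loc s) ξ = ft (c.cloc s) ξ := by
  rw [fourierOn, ft, ← integral_indicator c.isOpen_dom.measurableSet]
  refine integral_congr_ae (Eventually.of_forall fun y => ?_)
  by_cases hy : y ∈ c.dom
  · simp only [indicator_of_mem hy, cloc_apply hy, osc_neg_left]
  · simp only [indicator_of_notMem hy, cloc, smul_zero]

lemma quantize_loc (s : ∀ x, E x) (p : Rn n → Rn n → F →L[ℂ] F) (x : Rn n) :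
    quantize c.dom p (c.loc s) x = ((2 * Real.pi) ^ n : ℝ)⁻¹ •
      ∫ ξ, osc x ξ • p x ξ (ft (c.cloc s) ξ) := by
  rw [quantize]
  simp only [fourierOn_loc]
  rfl

section Support

variable {c} {s : ∀ x, E x} (hs : secSupport s ⊆ c.chart.source)

include hs

lemma tsupport_cloc_subset_image (hsc : IsCompact (secSupport s)) :
    tsupport (c.cloc s) ⊆ c.chart '' secSupport s := by
  have hK : IsCompact (c.chart '' secSupport s) :=
    hsc.image_of_continuousOn (c.chart.continuousOn.mono hs)
  refine closure_minimal (fun y hy => ?_) hK.isClosed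
  have hyd : y ∈ c.dom := by
    by_contra h
    exact hy (indicator_of_notMem h _)
  have h1 : s (c.chart.symm y) ≠ 0 := fun h => hy (by
    rw [cloc_apply hyd]; exact (loc_eq_zero_iff hyd s).2 h)
  exact ⟨c.chart.symm y, subset_closure h1, c.chart.right_inv hyd⟩

lemma image_secSupport_subset : c.chart '' secSupport s ⊆ c.dom := by
  rintro _ ⟨x, hx, rfl⟩
  exact chart_mem_dom (hs hx)

lemma tsupport_cloc_subset (hsc : IsCompact (secSupport s)) : tsupport (c.cloc s) ⊆ c.dom :=
  (tsupport_cloc_subset_image hs hsc).trans (image_secSupport_subset hs)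

lemma hasCompactSupport_cloc (hsc : IsCompact (secSupport s)) : HasCompactSupport (c.cloc s) :=
  (hsc.image_of_continuousOn (c.chart.continuousOn.mono hs)).of_isClosed_subset
    (isClosed_tsupport _) (tsupport_cloc_subset_image hs hsc)

lemma contDiff_cloc (hss : s ∈ SmoothSections n F E) (hsc : IsCompact (secSupport s)) :
    ContDiff ℝ ∞ (c.cloc s) := by
  rw [contDiff_iff_contDiffAt]
  intro y
  by_cases hy : y ∈ c.dom
  · refine ((c.contDiffOn_loc hss).contDiffAt (c.isOpen_dom.mem_nhds hy)).congr_of_eventuallyEq ?_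
    filter_upwards [c.isOpen_dom.mem_nhds hy] with z hz using cloc_apply hz s
  · have hy' : y ∉ tsupport (c.cloc s) := fun h => hy (tsupport_cloc_subset hs hsc h)
    refine contDiffAt_const (c := (0 : F)) |>.congr_of_eventuallyEq ?_
    filter_upwards [(isClosed_tsupport _).isOpen_compl.mem_nhds hy'] with z hz
    exact image_eq_zero_of_notMem_tsupport hz

end Support

/-- The section with given local expression, extended by zero. -/
def secOf (φ : Rn n → F) : ∀ x, E x := fun x =>
  open Classical in if x ∈ c.chart.source then c.triv.symm x (φ (c.chart x)) else 0

lemma loc_secOf (φ : Rn n → F) {y : Rn n} (hy : y ∈ c.dom) : c.loc (c.secOf φ) y = φ y := by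
  rw [loc, secOf, if_pos (symm_mem hy), c.chart.right_inv hy,
    c.triv.apply_mk_symm (symm_mem_baseSet hy)]

lemma secOf_apply_of_mem (φ : Rn n → F) {x : M} (hx : x ∈ c.chart.source) :
    (c.triv ⟨x, c.secOf φ x⟩).2 = φ (c.chart x) := by
  rw [secOf, if_pos hx, c.triv.apply_mk_symm (c.subset hx)]

lemma secOf_eq_zero {φ : Rn n → F} {x : M} (hx : x ∉ c.chart.symm '' tsupport φ) :
    c.secOf φ x = 0 := by
  by_cases h : x ∈ c.chart.source
  · have h1 : φ (c.chart x) = 0 := by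
      refine image_eq_zero_of_notMem_tsupport fun h' => hx ⟨_, h', c.chart.left_inv h⟩
    rw [secOf, if_pos h, h1]
    exact (c.triv.symmₗ_apply (R := ℂ) (c.subset h) 0).symm.trans (map_zero _)
  · rw [secOf, if_neg h]

section OfLocal

variable {c} [T2Space M] {φ : Rn n → F} (hφc : HasCompactSupport φ) (hφd : tsupport φ ⊆ c.dom)

include hφc hφd

lemma isCompact_image_tsupport : IsCompact (c.chart.symm '' tsupport φ) :=
  hφc.isCompact.image_of_continuousOn (c.continuousOn_symm.mono hφd)

lemma secSupport_secOf_subset : secSupport (c.secOf φ) ⊆ c.chart.symm '' tsupport φ :=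
  closure_minimal (fun _ hx => by_contra fun h => hx (c.secOf_eq_zero h))
    (isCompact_image_tsupport hφc hφd).isClosed

lemma secOf_mem_smoothSections (hφ : ContDiff ℝ ∞ φ) : c.secOf φ ∈ SmoothSections n F E := by
  intro x
  by_cases hx : x ∈ c.chart.source
  · have h1 : ContMDiffOn (𝓡 n) 𝓘(ℝ, F) ∞ (fun x => φ (c.chart x)) c.chart.source :=
      hφ.contMDiff.comp_contMDiffOn (contMDiffOn_of_mem_maximalAtlas c.chart_mem)
    have h2 : ContMDiffOn (𝓡 n) 𝓘(ℝ, F) ∞ (fun x => (c.triv ⟨x, c.secOf φ x⟩).2)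
        c.chart.source := h1.congr fun x hx => c.secOf_apply_of_mem φ hx
    have h3 := (c.triv.contMDiffOn_section_iff (IB := 𝓡 n) (𝕜 := ℝ) (n := ∞) (s := c.secOf φ)
      c.chart.open_source c.subset).2 h2
    exact (h3 x hx).contMDiffAt (c.chart.open_source.mem_nhds hx)
  · have hx' : x ∉ c.chart.symm '' tsupport φ := by
      rintro ⟨y, hy, rfl⟩
      exact hx (symm_mem (hφd hy))
    have h0 : ContMDiffAt (𝓡 n) ((𝓡 n).prod 𝓘(ℝ, F)) ∞
        (fun x => TotalSpace.mk' F x (0 : E x)) x := contMDiff_zeroSection ℝ E x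
    refine h0.congr_of_eventuallyEq ?_
    filter_upwards [(isCompact_image_tsupport hφc hφd).isClosed.isOpen_compl.mem_nhds hx']
      with z hz
    rw [c.secOf_eq_zero hz]

end OfLocal

/-- The test section with given local expression. -/
def testOf [T2Space M] (φ : Rn n → F) (hφ : ContDiff ℝ ∞ φ) (hφc : HasCompactSupport φ)
    (hφd : tsupport φ ⊆ c.dom) : TestSections n F E :=
  ⟨c.secOf φ, secOf_mem_smoothSections hφc hφd hφ,
    (isCompact_image_tsupport hφc hφd).of_isClosed_subset isClosed_closure
      (secSupport_secOf_subset hφc hφd)⟩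

section TestOf

variable [T2Space M] {φ : Rn n → F} (hφ : ContDiff ℝ ∞ φ) (hφc : HasCompactSupport φ)
  (hφd : tsupport φ ⊆ c.dom)

lemma cloc_testOf : c.cloc (c.testOf φ hφ hφc hφd).1 = φ := by
  ext1 y
  by_cases hy : y ∈ c.dom
  · rw [cloc_apply hy]; exact c.loc_secOf φ hy
  · rw [cloc, indicator_of_notMem hy, image_eq_zero_of_notMem_tsupport fun h => hy (hφd h)]

lemma secSupport_testOf_subset :
    secSupport (c.testOf φ hφ hφc hφd).1 ⊆ c.chart.symm '' tsupport φ :=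
  secSupport_secOf_subset hφc hφd

lemma secSupport_testOf_subset_source :
    secSupport (c.testOf φ hφ hφc hφd).1 ⊆ c.chart.source := by
  refine (c.secSupport_testOf_subset hφ hφc hφd).trans ?_
  rintro _ ⟨y, hy, rfl⟩
  exact symm_mem (hφd hy)

lemma symm_notMem_secSupport_testOf {y : Rn n} (hy : y ∈ c.dom) (hy' : y ∉ tsupport φ) :
    c.chart.symm y ∉ secSupport (c.testOf φ hφ hφc hφd).1 := fun h => by
  obtain ⟨z, hz, hzy⟩ := c.secSupport_testOf_subset hφ hφc hφd h
  have : z = y := by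
    rw [← c.chart.right_inv (hφd hz), hzy, c.chart.right_inv hy]
  exact hy' (this ▸ hz)

end TestOf

/-- Coordinates around any point. -/
lemma exists_mem_source (x : M) (U : Set M) (hU : U ∈ 𝓝 x) :
    ∃ c : LocalCoords n F E, x ∈ c.chart.source ∧ c.chart.source ⊆ U := by
  obtain ⟨U', hU'U, hU'o, hxU'⟩ := mem_nhds_iff.1 hU
  set S := (trivializationAt F E x).baseSet ∩ U' with hS
  have hSo : IsOpen S := (trivializationAt F E x).open_baseSet.inter hU'o
  have e : ((chartAt (Rn n) x).restr S).source = (chartAt (Rn n) x).source ∩ S :=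
    (chartAt (Rn n) x).restr_source' S hSo
  refine ⟨⟨(chartAt (Rn n) x).restr S,
    restr_mem_maximalAtlas _ (IsManifold.chart_mem_maximalAtlas x) hSo,
    trivializationAt F E x, inferInstance, ?_⟩, ?_, ?_⟩
  · rw [e]; exact fun y hy => hy.2.1
  · rw [e]; exact ⟨mem_chart_source _ x, mem_baseSet_trivializationAt F E x, hxU'⟩
  · rw [e]; exact fun y hy => hU'U hy.2.2

end LocalCoords

end Coordinates

end

end PsiDO

namespace PsiDO

open MeasureTheory Set Filter Topology Function

noncomputable section

set_option linter.unusedSectionVars false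

/-! ### Off-diagonal kernels -/

section Kernels

lemma integral_sub_apply {n : ℕ} {F : Type*} [NormedAddCommGroup F] [NormedSpace ℂ F]
    [CompleteSpace F] {U : Set (Rn n)} (hU : IsOpen U) {f g : Rn n → F →L[ℂ] F} (hf : ContinuousOn f U)
    (hg : ContinuousOn g U) {u : Rn n → F} (hu : Continuous u) (huc : HasCompactSupport u)
    (huU : tsupport u ⊆ U) :
    ∫ y, (f - g) y (u y) = (∫ y, f y (u y)) - ∫ y, g y (u y) :=
  integral_sub (integrable_apply_of_continuousOn hU hf hu huc huU)
    (integrable_apply_of_continuousOn hU hg hu huc huU)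

variable {n : ℕ} {M : Type*} [TopologicalSpace M] [ChartedSpace (Rn n) M] [IsManifold (𝓡 n) ∞ M]
  {F : Type*} [NormedAddCommGroup F] [NormedSpace ℂ F]
  {E : M → Type*} [TopologicalSpace (TotalSpace F E)] [∀ x, TopologicalSpace (E x)]
  [∀ x, AddCommGroup (E x)] [∀ x, Module ℂ (E x)]
  [FiberBundle F E] [VectorBundle ℂ F E] [VectorBundle ℝ F E]
  [ContMDiffVectorBundle ∞ F E (𝓡 n)]

variable {c c' : LocalCoords n F E} {P : Op n F E} {k k' : Rn n → Rn n → F →L[ℂ] F}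

/-- The coordinates of the points different from the point with coordinates `x`. -/
def offDiag (c c' : LocalCoords n F E) (x : Rn n) : Set (Rn n) :=
  c'.dom ∩ c'.chart.symm ⁻¹' {c.chart.symm x}ᶜ

lemma isOpen_offDiag [T2Space M] (c c' : LocalCoords n F E) (x : Rn n) :
    IsOpen (offDiag c c' x) :=
  c'.continuousOn_symm.isOpen_inter_preimage c'.isOpen_dom isOpen_compl_singleton

lemma mem_offDiag_self {x y : Rn n} (hx : x ∈ c.dom) (hy : y ∈ c.dom) (hxy : x ≠ y) :
    y ∈ offDiag c c x :=
  ⟨hy, fun h => hxy (c.chart.symm.injOn hx hy (by simpa using h.symm))⟩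

lemma IsOffDiagonalKernel.contDiffOn_snd (h : IsOffDiagonalKernel c c' P k) {x : Rn n}
    (hx : x ∈ c.dom) : ContDiffOn ℝ ∞ (k x) (offDiag c c' x) := by
  have h1 : ContDiff ℝ ∞ (fun y : Rn n => (x, y)) := contDiff_const.prodMk contDiff_id
  exact h.1.comp h1.contDiffOn fun y hy => ⟨hx, hy.1, fun e => hy.2 e.symm⟩

variable [T2Space M] [CompleteSpace F]

lemma IsOffDiagonalKernel.loc_testOf (h : IsOffDiagonalKernel c c' P k) {x : Rn n}
    (hx : x ∈ c.dom) {u : Rn n → F} (hu : ContDiff ℝ ∞ u) (huc : HasCompactSupport u)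
    (hus : tsupport u ⊆ offDiag c c' x) :
    c.loc (P (c'.testOf u hu huc (hus.trans inter_subset_left))).1 x = ∫ y, k x y (u y) := by
  have hd := hus.trans inter_subset_left
  rw [h.2 _ (c'.secSupport_testOf_subset_source hu huc hd) x hx, c'.setIntegral_loc,
    c'.cloc_testOf]
  intro hmem
  obtain ⟨z, hz, hzx⟩ := c'.secSupport_testOf_subset hu huc hd hmem
  exact (hus hz).2 hzx

/-- Both kernels give the same integrals against test sections supported away from x. Consequently
any kernel of the operator may be used in the expansions. -/
lemma IsOffDiagonalKernel.eq_of_mem (h : IsOffDiagonalKernel c c' P k)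
    (h' : IsOffDiagonalKernel c c' P k') {x y : Rn n} (hx : x ∈ c.dom)
    (hy : y ∈ offDiag c c' x) : k x y = k' x y := by
  have key : ‖(k x - k' x) y‖ ≤ 0 := by
    refine norm_kernel_le_of_forall_integral (isOpen_offDiag c c' x)
      ((h.contDiffOn_snd hx).continuousOn.sub (h'.contDiffOn_snd hx).continuousOn) le_rfl ?_ hy
    intro u hu huc hus
    have e1 := h.loc_testOf hx hu huc hus
    have e2 := h'.loc_testOf hx hu huc hus
    rw [integral_sub_apply (isOpen_offDiag c c' x) (h.contDiffOn_snd hx).continuousOn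
      (h'.contDiffOn_snd hx).continuousOn hu.continuous huc hus, ← e1, ← e2, sub_self, norm_zero,
      zero_mul]
  have := norm_le_zero_iff.1 key
  exact sub_eq_zero.1 this

end Kernels

/-! ### Local expansions of kernels -/

section Expansion

variable {n : ℕ} {M : Type*} [TopologicalSpace M] [ChartedSpace (Rn n) M] [IsManifold (𝓡 n) ∞ M]
  {F : Type*} [NormedAddCommGroup F] [NormedSpace ℂ F]
  {E : M → Type*} [TopologicalSpace (TotalSpace F E)] [∀ x, TopologicalSpace (E x)]
  [∀ x, AddCommGroup (E x)] [∀ x, Module ℂ (E x)]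
  [FiberBundle F E] [VectorBundle ℂ F E] [VectorBundle ℝ F E]
  [ContMDiffVectorBundle ∞ F E (𝓡 n)]

variable {c : LocalCoords n F E} {P : Op n F E} {m : ℤ}

/-- In the coordinates `c`, the kernel of `P` has a logarithmic singularity with coefficient `C`. -/
def HasLocalExpansion (c : LocalCoords n F E) (m : ℤ) (P : Op n F E) (C : Rn n → F →L[ℂ] F) : Prop :=
  ContDiffOn ℝ ∞ C c.dom ∧
    ∃ (k : Rn n → Rn n → F →L[ℂ] F) (a : ℤ → Rn n → Rn n → F →L[ℂ] F),
      IsOffDiagonalKernel c c P k ∧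
      (∀ j ∈ Finset.Icc (-(m + n)) (-1), IsHomogeneous j c.dom (a j)) ∧
      ∀ x₀ ∈ c.dom, ∃ W ∈ nhds x₀, ∃ B : ℝ, ∀ x ∈ W, ∀ y ∈ W, x ≠ y →
        ‖k x y - (∑ j ∈ Finset.Icc (-(m + n)) (-1), a j x (x - y)
          - Real.log ‖x - y‖ • C x)‖ ≤ B

variable [T2Space M] [CompleteSpace F]

lemma continuousOn_expansion {V S : Set (Rn n)} {s : Finset ℤ} {a : ℤ → Rn n → Rn n → F →L[ℂ] F}
    (ha : ∀ j ∈ s, IsHomogeneous j V (a j)) (C : F →L[ℂ] F) {x : Rn n} (hx : x ∈ V)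
    (hS : ∀ y ∈ S, x ≠ y) :
    ContinuousOn (fun y => ∑ j ∈ s, a j x (x - y) - Real.log ‖x - y‖ • C) S := by
  have hne : ∀ y ∈ S, x - y ≠ 0 := fun y hy h => hS y hy (sub_eq_zero.1 h)
  have h0 : ContinuousOn (fun y : Rn n => x - y) S :=
    (continuous_const.sub continuous_id).continuousOn
  have h1 : ContinuousOn (fun y : Rn n => (x, x - y)) S := continuousOn_const.prodMk h0
  have h2 : ContinuousOn (fun y : Rn n => Real.log ‖x - y‖) S :=
    h0.norm.log fun y hy => norm_ne_zero_iff.2 (hne y hy)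
  refine ContinuousOn.sub (continuousOn_finsetSum _ fun j hj => ?_) (h2.smul continuousOn_const)
  have h3 := (ha j hj).1.continuousOn
  exact ContinuousOn.comp (g := uncurry (a j)) (t := V ×ˢ {0}ᶜ) h3 h1 fun y hy => ⟨hx, hne y hy⟩

/-- The kernel supplied by the definition and the explicit singular terms of p(x, D), integrated
against a test function, differ by at most a constant times its L¹ norm; the smooth remainder r is
locally bounded. Hence their difference is bounded pointwise. -/
lemma IsPsiDO.exists_hasLocalExpansion (hP : IsPsiDO m P) (hm : -(n : ℤ) ≤ m)
    (c : LocalCoords n F E) : ∃ C, HasLocalExpansion c m P C := by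
  obtain ⟨k, hk⟩ := hP.smooth_off_diagonal c c
  obtain ⟨p, pj, hp, r, hr, hloc⟩ := hP.local_form c
  obtain ⟨N, hN⟩ : ∃ N : ℕ, m + n = N := ⟨(m + n).toNat, by omega⟩
  have hhom : ∀ j ∈ Finset.Icc (-(m + n)) (-1), IsHomogeneous j c.dom (kernelTerm pj N j) :=
    fun j hj => hp.isHomogeneous_kernelTerm c.isOpen_dom N (Finset.mem_Icc.1 hj).2
  refine ⟨logTerm pj N, hp.contDiffOn_logTerm c.isOpen_dom N, k, kernelTerm pj N, hk, hhom, ?_⟩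
  rw [hN] at hhom ⊢
  intro x₀ hx₀
  obtain ⟨ε, hε, hball⟩ := Metric.nhds_basis_closedBall.mem_iff.1 (c.isOpen_dom.mem_nhds hx₀)
  -- With radius at most 1/2, any two points of the ball are at distance at most 1, as the
  -- logarithmic estimate demands.
  set δ := min ε (1 / 2) with hδ
  have hδ0 : 0 < δ := lt_min hε (by norm_num)
  set L := Metric.closedBall x₀ δ with hL
  have hLd : L ⊆ c.dom := (Metric.closedBall_subset_closedBall (min_le_left _ _)).trans hball
  have hLc : IsCompact L := isCompact_closedBall x₀ δ
  obtain ⟨B, hB⟩ := hp.exists_bound_quantize_sub c.isOpen_dom hN hLc hLd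
  obtain ⟨B', hB'⟩ := (hLc.prod hLc).exists_bound_of_continuousOn
    (hr.continuousOn.mono (prod_mono hLd hLd))
  refine ⟨Metric.ball x₀ δ, Metric.ball_mem_nhds _ hδ0, |B| + |B'|, fun x hx y hy hxy => ?_⟩
  have hxL : x ∈ L := Metric.ball_subset_closedBall hx
  have hxd : x ∈ c.dom := hLd hxL
  have hU : IsOpen (Metric.ball x₀ δ ∩ {x}ᶜ) := Metric.isOpen_ball.inter isOpen_compl_singleton
  have hUoff : Metric.ball x₀ δ ∩ {x}ᶜ ⊆ offDiag c c x := fun z hz =>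
    mem_offDiag_self hxd (hLd (Metric.ball_subset_closedBall hz.1)) (fun h => hz.2 h.symm)
  have hcexp := continuousOn_expansion hhom (logTerm pj N x) hxd (S := Metric.ball x₀ δ ∩ {x}ᶜ)
    fun y hy h => hy.2 h.symm
  have hck := (hk.contDiffOn_snd hxd).continuousOn.mono hUoff
  refine norm_kernel_le_of_forall_integral hU (hck.sub hcexp) (by positivity) ?_
    (y₀ := y) ⟨hy, fun h => hxy h.symm⟩
  intro u hu huc hus
  have hud : tsupport u ⊆ c.dom := hus.trans (hUoff.trans inter_subset_left)
  have e1 := hk.loc_testOf hxd hu huc (hus.trans hUoff)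
  have e2 := hloc (c.testOf u hu huc hud) (c.secSupport_testOf_subset_source hu huc hud) x hxd
  rw [e1, c.setIntegral_loc, c.quantize_loc, c.cloc_testOf] at e2
  have e3 : quantize c.dom p u x =
      ((2 * Real.pi) ^ n : ℝ)⁻¹ • ∫ ξ, osc x ξ • p x ξ (ft u ξ) := by
    rw [quantize]
    simp only [fourierOn_eq_ft hud]
    rfl
  rw [← e3] at e2
  have hsub : ∀ z ∈ tsupport u, z ∈ L := fun z hz => Metric.ball_subset_closedBall (hus hz).1
  rw [integral_sub_apply hU hck hcexp hu.continuous huc hus, e2, add_sub_right_comm]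
  have hui : Integrable u := hu.continuous.integrable_of_hasCompactSupport huc
  have b1 := hB x hxL u hu huc hud (fun h => (hus h).2 rfl) (fun z hz => by
    have h1 := Metric.mem_closedBall.1 (hsub z hz)
    have h2 := Metric.mem_closedBall'.1 hxL
    rw [Metric.mem_closedBall]
    have : δ ≤ 1 / 2 := min_le_right _ _
    linarith [dist_triangle z x₀ x])
  have b2 : ‖∫ y, r x y (u y)‖ ≤ B' * ∫ y, ‖u y‖ := norm_integral_apply_le hui fun z hz =>
    hB' (x, z) ⟨hxL, hsub z (subset_tsupport u hz)⟩
  have hI : 0 ≤ ∫ y, ‖u y‖ := integral_nonneg fun _ => norm_nonneg _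
  calc _ ≤ _ := norm_add_le _ _
    _ ≤ B * (∫ y, ‖u y‖) + B' * ∫ y, ‖u y‖ := add_le_add b1 b2
    _ ≤ (|B| + |B'|) * ∫ y, ‖u y‖ := by
      rw [add_mul]
      exact add_le_add (mul_le_mul_of_nonneg_right (le_abs_self _) hI)
        (mul_le_mul_of_nonneg_right (le_abs_self _) hI)

lemma HasLocalExpansion.hasLogExp {C : Rn n → F →L[ℂ] F} (h : HasLocalExpansion c m P C)
    {k : Rn n → Rn n → F →L[ℂ] F} (hk : IsOffDiagonalKernel c c P k) {x : Rn n} (hx : x ∈ c.dom)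
    {ψ : ℝ → Rn n} (hψ : ContDiffAt ℝ ∞ ψ 0) (hψ0 : ψ 0 ≠ 0) :
    HasLogExp (fun t => k x (x - t • ψ t)) (C x) := by
  obtain ⟨-, k', a, hk', ha, hexp⟩ := h
  obtain ⟨W, hW, B, hB⟩ := hexp x hx
  refine hasLogExp_of_expansion hx ha (W := W ∩ c.dom) (inter_mem hW (c.isOpen_dom.mem_nhds hx))
    (C := B) (fun y hy hxy => ?_) hψ hψ0
  rw [hk.eq_of_mem hk' hx (mem_offDiag_self hx hy.2 hxy)]
  exact hB x (mem_of_mem_nhds hW) y hy.1 hxy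

end Expansion

end

end PsiDO

namespace PsiDO

open MeasureTheory Set Filter Topology Function

noncomputable section

set_option linter.unusedSectionVars false

/-! ### Change of coordinates -/

section Transition

variable {n : ℕ} {M : Type*} [TopologicalSpace M] [ChartedSpace (Rn n) M] [IsManifold (𝓡 n) ∞ M]
  {F : Type*} [NormedAddCommGroup F] [NormedSpace ℂ F]
  {E : M → Type*} [TopologicalSpace (TotalSpace F E)] [∀ x, TopologicalSpace (E x)]
  [∀ x, AddCommGroup (E x)] [∀ x, Module ℂ (E x)]
  [FiberBundle F E] [VectorBundle ℂ F E] [VectorBundle ℝ F E]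
  [ContMDiffVectorBundle ∞ F E (𝓡 n)]

namespace LocalCoords

/-- The points in the domain of `c` that are also in the domain of `c'`. -/
def overlap (c c' : LocalCoords n F E) : Set (Rn n) :=
  c.dom ∩ c.chart.symm ⁻¹' c'.chart.source

/-- The change of coordinates. -/
def transition (c c' : LocalCoords n F E) (y : Rn n) : Rn n := c'.chart (c.chart.symm y)

/-- The change of trivialization. -/
def coordT (c c' : LocalCoords n F E) (y : Rn n) : F →L[ℂ] F :=
  (c.triv.coordChangeL ℂ c'.triv (c.chart.symm y) : F →L[ℂ] F)

variable {c c' : LocalCoords n F E} {y : Rn n}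

lemma isOpen_overlap : IsOpen (c.overlap c') :=
  c.continuousOn_symm.isOpen_inter_preimage c.isOpen_dom c'.chart.open_source

lemma symm_transition (hy : y ∈ c.overlap c') :
    c'.chart.symm (c.transition c' y) = c.chart.symm y :=
  c'.chart.left_inv hy.2

lemma transition_mem (hy : y ∈ c.overlap c') : c.transition c' y ∈ c'.overlap c :=
  ⟨chart_mem_dom hy.2, by
    rw [mem_preimage, symm_transition hy]; exact symm_mem hy.1⟩

lemma transition_transition (hy : y ∈ c.overlap c') :
    c'.transition c (c.transition c' y) = y := by
  rw [transition, symm_transition hy]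
  exact c.chart.right_inv hy.1

lemma injOn_transition : InjOn (c.transition c') (c.overlap c') := fun y hy z hz h => by
  rw [← transition_transition hy, h, transition_transition hz]

lemma contDiffOn_transition : ContDiffOn ℝ ∞ (c.transition c') (c.overlap c') := by
  have h1 : ContMDiffOn (𝓡 n) (𝓡 n) ∞ c.chart.symm c.dom :=
    contMDiffOn_symm_of_mem_maximalAtlas c.chart_mem
  have h2 : ContMDiffOn (𝓡 n) (𝓡 n) ∞ c'.chart c'.chart.source :=
    contMDiffOn_of_mem_maximalAtlas c'.chart_mem
  exact contMDiffOn_iff_contDiffOn.1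
    (h2.comp (h1.mono inter_subset_left) fun y hy => hy.2)

lemma contDiffAt_transition (hy : y ∈ c.overlap c') : ContDiffAt ℝ ∞ (c.transition c') y :=
  contDiffOn_transition.contDiffAt (isOpen_overlap.mem_nhds hy)

lemma hasFDerivAt_transition (hy : y ∈ c.overlap c') :
    HasFDerivAt (c.transition c') (fderiv ℝ (c.transition c') y) y :=
  ((contDiffAt_transition hy).differentiableAt (by simp)).hasFDerivAt

lemma coordT_apply (hy : y ∈ c.overlap c') (v : F) :
    c.coordT c' y v = (c'.triv ⟨c.chart.symm y, c.triv.symm (c.chart.symm y) v⟩).2 :=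
  c.triv.coordChangeL_apply c'.triv ⟨symm_mem_baseSet hy.1, c'.subset hy.2⟩ v

lemma loc_transition (hy : y ∈ c.overlap c') (s : ∀ x, E x) :
    c'.loc s (c.transition c' y) = c.coordT c' y (c.loc s y) := by
  have h1 : c.triv.symm (c.chart.symm y) (c.loc s y) = s (c.chart.symm y) :=
    c.triv.symm_apply_apply_mk (symm_mem_baseSet hy.1) _
  rw [coordT_apply hy, h1]
  exact congrArg (fun b => (c'.triv ⟨b, s b⟩).2) (symm_transition hy)

lemma coordT_comp (hy : y ∈ c.overlap c') :
    (c'.coordT c (c.transition c' y)).comp (c.coordT c' y) = ContinuousLinearMap.id ℂ F := by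
  ext v
  rw [ContinuousLinearMap.comp_apply, coordT_apply (transition_mem hy), coordT_apply hy,
    symm_transition hy, c'.triv.symm_apply_apply_mk (c'.subset hy.2),
    c.triv.apply_mk_symm (symm_mem_baseSet hy.1)]
  rfl

lemma contDiffOn_coordT_apply (v : F) : ContDiffOn ℝ ∞ (fun y => c.coordT c' y v)
    (c.overlap c') := by
  have h1 := contMDiffOn_coordChangeL (IB := 𝓡 n) (n := ∞) (𝕜 := ℝ) c.triv c'.triv
  have h2 : ContMDiffOn (𝓡 n) (𝓡 n) ∞ c.chart.symm c.dom :=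
    contMDiffOn_symm_of_mem_maximalAtlas c.chart_mem
  have h3 := h1.comp (h2.mono (inter_subset_left : c.overlap c' ⊆ _))
    fun y hy => ⟨symm_mem_baseSet hy.1, c'.subset hy.2⟩
  have h4 := contMDiffOn_iff_contDiffOn.1 h3
  refine (h4.clm_apply (contDiffOn_const (c := v))).congr fun y hy => ?_
  rw [coordT_apply hy]
  exact (c.triv.coordChangeL_apply (R := ℝ) c'.triv ⟨symm_mem_baseSet hy.1, c'.subset hy.2⟩ v).symm

/-- Smoothness of the change of trivialization is known for it as a real-linear map. A complex basis
of F writes the complex-linear version as a finite sum of smooth terms. -/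
lemma contDiffOn_coordT [FiniteDimensional ℂ F] : ContDiffOn ℝ ∞ (c.coordT c')
    (c.overlap c') := by
  let b := Module.finBasis ℂ F
  let L : Fin (Module.finrank ℂ F) → F →L[ℝ] F →L[ℂ] F := fun i =>
    (ContinuousLinearMap.smulRightL ℂ F F (b.coord i).toContinuousLinearMap).restrictScalars ℝ
  have e : c.coordT c' = fun y => ∑ i, L i (c.coordT c' y (b i)) := by
    ext y v
    conv_lhs => rw [← b.sum_repr v, map_sum]
    simp [L]
  rw [e]
  exact ContDiffOn.sum fun i _ => (L i).contDiff.comp_contDiffOn (contDiffOn_coordT_apply (b i))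

end LocalCoords

/-- The determinant is polynomial in the matrix entries, and the absolute value is smooth away from
zero. -/
lemma contDiffAt_abs_det {f : ℝ → Rn n →L[ℝ] Rn n} {t : ℝ} (hf : ContDiffAt ℝ ∞ f t)
    (h0 : (f t).det ≠ 0) : ContDiffAt ℝ ∞ (fun t => |(f t).det|) t := by
  refine (contDiffAt_abs h0).comp t (f := fun t => (f t).det) ?_
  let b := (EuclideanSpace.basisFun (Fin n) ℝ).toBasis
  have e : (fun t => (f t).det) = fun t => ∑ σ : Equiv.Perm (Fin n),
      (Equiv.Perm.sign σ : ℝ) * ∏ i, (f t (b i)) (σ i) := by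
    ext t
    rw [ContinuousLinearMap.det, ← LinearMap.det_toMatrix b, Matrix.det_apply']
    refine Finset.sum_congr rfl fun σ _ => ?_
    congr 1
    refine Finset.prod_congr rfl fun i _ => ?_
    rw [LinearMap.toMatrix_apply]
    rfl
  rw [e]
  refine ContDiffAt.sum fun σ _ => contDiffAt_const.mul (contDiffAt_prod fun i _ => ?_)
  have h1 : ContDiffAt ℝ ∞ (fun t => f t (b i)) t := hf.clm_apply contDiffAt_const
  exact (EuclideanSpace.proj (σ i) : Rn n →L[ℝ] ℝ).contDiff.contDiffAt.comp t h1

namespace LocalCoords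

variable {c c' : LocalCoords n F E} {y : Rn n}

lemma fderiv_transition_comp (hy : y ∈ c.overlap c') :
    (fderiv ℝ (c'.transition c) (c.transition c' y)).comp (fderiv ℝ (c.transition c') y) =
      ContinuousLinearMap.id ℝ (Rn n) := by
  have h1 := (hasFDerivAt_transition (transition_mem hy)).comp y (hasFDerivAt_transition hy)
  refine h1.unique ((hasFDerivAt_id y).congr_of_eventuallyEq ?_)
  filter_upwards [isOpen_overlap.mem_nhds hy] with z hz using transition_transition hz

lemma det_fderiv_transition_ne_zero (hy : y ∈ c.overlap c') :
    (fderiv ℝ (c.transition c') y).det ≠ 0 := fun h => by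
  have h1 := congrArg ContinuousLinearMap.det (fderiv_transition_comp hy)
  simp only [ContinuousLinearMap.det, ContinuousLinearMap.toLinearMap_comp, LinearMap.det_comp]
    at h1 h
  rw [h, mul_zero] at h1
  exact zero_ne_one (h1.trans LinearMap.det_id)

lemma injective_fderiv_transition (hy : y ∈ c.overlap c') :
    Injective (fderiv ℝ (c.transition c') y) := fun v w h => by
  have h1 := fun v => DFunLike.congr_fun (fderiv_transition_comp hy) v
  have := congrArg (fderiv ℝ (c'.transition c) (c.transition c' y)) h
  simpa using (h1 v).symm.trans (this.trans (h1 w))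

variable [T2Space M] [CompleteSpace F] {P : Op n F E}

/-- Both sides represent one operator, with source written in c and values in c'. For test sections
supported in the overlap, the change of variables produces the Jacobian, and uniqueness of kernels
concludes. -/
lemma kernel_transition [FiniteDimensional ℂ F] {k k' : Rn n → Rn n → F →L[ℂ] F}
    (hk : IsOffDiagonalKernel c c P k) (hk' : IsOffDiagonalKernel c' c' P k') {x : Rn n}
    (hx : x ∈ c.overlap c') (hy : y ∈ c.overlap c') (hxy : x ≠ y) :
    (c.coordT c' x).comp (k x y) = |(fderiv ℝ (c.transition c') y).det| •
      (k' (c.transition c' x) (c.transition c' y)).comp (c.coordT c' y) := by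
  set φ := c.transition c' with hφ
  set U := c.overlap c' ∩ {x}ᶜ with hU
  have hUo : IsOpen U := isOpen_overlap.inter isOpen_compl_singleton
  have hUoff : U ⊆ offDiag c c x := fun z hz =>
    mem_offDiag_self hx.1 hz.1.1 fun h => hz.2 h.symm
  have hmaps : ∀ z ∈ U, φ z ∈ offDiag c' c' (φ x) := fun z hz =>
    mem_offDiag_self (transition_mem hx).1 (transition_mem hz.1).1 fun h =>
      hz.2 (injOn_transition hx hz.1 h).symm
  have c1 : ContinuousOn (fun z => (c.coordT c' x).comp (k x z)) U :=
    continuousOn_const.clm_comp ((hk.contDiffOn_snd hx.1).continuousOn.mono hUoff)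
  have cφ : ContinuousOn φ U := contDiffOn_transition.continuousOn.mono inter_subset_left
  have cT : ContinuousOn (c.coordT c') U := contDiffOn_coordT.continuousOn.mono inter_subset_left
  have cD : ContinuousOn (fun z => |(fderiv ℝ φ z).det|) U := by
    have h1 : ContinuousOn (fderiv ℝ φ) (c.overlap c') :=
      contDiffOn_transition.continuousOn_fderiv_of_isOpen isOpen_overlap (by simp)
    exact (ContinuousLinearMap.continuous_det.comp_continuousOn (h1.mono inter_subset_left)).abs
  have ck : ContinuousOn (fun z => k' (φ x) (φ z)) U :=
    (hk'.contDiffOn_snd (transition_mem hx).1).continuousOn.comp cφ hmaps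
  have c2 : ContinuousOn (fun z => |(fderiv ℝ φ z).det| • (k' (φ x) (φ z)).comp (c.coordT c' z)) U :=
    cD.smul (ck.clm_comp cT)
  have key := norm_kernel_le_of_forall_integral hUo (c1.sub c2) le_rfl ?_
    (y₀ := y) ⟨hy, fun h => hxy h.symm⟩
  · exact sub_eq_zero.1 (norm_le_zero_iff.1 key)
  intro u hu huc hus
  have hud : tsupport u ⊆ c.dom := fun z hz => (hus hz).1.1
  set s := c.testOf u hu huc hud with hs
  have hsupp : secSupport s.1 ⊆ c.chart.symm '' tsupport u := c.secSupport_testOf_subset hu huc hud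
  have hsrc : secSupport s.1 ⊆ c'.chart.source := hsupp.trans (by
    rintro _ ⟨z, hz, rfl⟩
    exact (hus hz).1.2)
  have hxs : c.chart.symm x ∉ secSupport s.1 :=
    c.symm_notMem_secSupport_testOf hu huc hud hx.1 fun h => (hus h).2 rfl
  have e1 := hk.loc_testOf hx.1 hu huc (hus.trans hUoff)
  have e2 := hk'.2 s hsrc (φ x) (transition_mem hx).1 (by rwa [symm_transition hx])
  rw [loc_transition hx] at e2
  -- The test section lives over U, so in the coordinates c' it vanishes off φ(U).
  have e3 : ∫ z in c'.dom, k' (φ x) z (c'.loc s.1 z) =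
      ∫ z in φ '' U, k' (φ x) z (c'.loc s.1 z) := by
    apply setIntegral_eq_of_subset_of_forall_sdiff_eq_zero c'.isOpen_dom.measurableSet
    · rintro _ ⟨z, hz, rfl⟩
      exact (transition_mem hz.1).1
    · rintro z ⟨hz, hzU⟩
      rw [(loc_eq_zero_iff hz _).2, map_zero]
      by_contra hne
      obtain ⟨z', hz', hzz⟩ := hsupp (subset_closure hne)
      refine hzU ⟨z', hus hz', ?_⟩
      rw [hφ, transition, hzz, c'.chart.right_inv hz]
  have e4 : ∫ z in φ '' U, k' (φ x) z (c'.loc s.1 z) =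
      ∫ z in U, |(fderiv ℝ φ z).det| • k' (φ x) (φ z) (c'.loc s.1 (φ z)) :=
    integral_image_eq_integral_abs_det_fderiv_smul volume hUo.measurableSet
      (fun z hz => (hasFDerivAt_transition hz.1).hasFDerivWithinAt)
      (injOn_transition.mono inter_subset_left) _
  have e5 : ∫ z in U, |(fderiv ℝ φ z).det| • k' (φ x) (φ z) (c'.loc s.1 (φ z)) =
      ∫ z, (|(fderiv ℝ φ z).det| • (k' (φ x) (φ z)).comp (c.coordT c' z)) (u z) := by
    trans ∫ z in U, (|(fderiv ℝ φ z).det| • (k' (φ x) (φ z)).comp (c.coordT c' z)) (u z)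
    · refine setIntegral_congr_fun hUo.measurableSet fun z hz => ?_
      have h1 : c'.loc s.1 (φ z) = c.coordT c' z (u z) := by
        rw [hφ, loc_transition hz.1]
        congr 1
        exact c.loc_secOf u hz.1.1
      simp only [h1, smul_apply, ContinuousLinearMap.comp_apply]
    · refine setIntegral_eq_integral_of_forall_compl_eq_zero fun z hz => ?_
      rw [image_eq_zero_of_notMem_tsupport fun h => hz (hus h), map_zero]
  have e6 : ∫ z, (c.coordT c' x).comp (k x z) (u z) =
      c.coordT c' x (∫ z, k x z (u z)) :=
    ContinuousLinearMap.integral_comp_comm _ (integrable_apply_of_continuousOn hUo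
      ((hk.contDiffOn_snd hx.1).continuousOn.mono hUoff) hu.continuous huc hus)
  rw [integral_sub_apply hUo c1 c2 hu.continuous huc hus, e6, ← e5, ← e4, ← e3, ← e2, ← e1,
    sub_self, norm_zero, zero_mul]

end LocalCoords

end Transition

end

end PsiDO

namespace PsiDO

open MeasureTheory Set Filter Topology Function

noncomputable section

set_option linter.unusedSectionVars false

/-! ### The logarithmic singularity as a density -/

section Products

variable {H : Type*} [NormedAddCommGroup H] [NormedSpace ℝ H]
  {F : Type*} [NormedAddCommGroup F] [NormedSpace ℂ F]

lemma HasLogExp.smul {a : ℝ → ℝ} {h : ℝ → H} {C : H} (H₁ : HasLogExp h C)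
    (ha : ContDiffAt ℝ ∞ a 0) : HasLogExp (fun t => a t • h t) (a 0 • C) := by
  have := HasLogExp.clm_apply (L := fun t => a t • ContinuousLinearMap.id ℝ H)
    (ha.smul contDiffAt_const) H₁
  simpa using this

lemma HasLogExp.bilin {G H' : Type*} [NormedAddCommGroup G] [NormedSpace ℝ G]
    [NormedAddCommGroup H'] [NormedSpace ℝ H'] {g : ℝ → G} {h : ℝ → H} {C : H}
    (H₁ : HasLogExp h C) (B : G →L[ℝ] H →L[ℝ] H') (hg : ContDiffAt ℝ ∞ g 0) :
    HasLogExp (fun t => B (g t) (h t)) (B (g 0) C) :=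
  HasLogExp.clm_apply (B.contDiff.contDiffAt.comp (0 : ℝ) hg) H₁

set_option synthInstance.maxHeartbeats 200000 in
/-- Composition of endomorphisms as a real bilinear map, with the arguments exchanged. -/
def compRightL (F : Type*) [NormedAddCommGroup F] [NormedSpace ℂ F] :
    (F →L[ℂ] F) →L[ℝ] (F →L[ℂ] F) →L[ℝ] (F →L[ℂ] F) :=
  (ContinuousLinearMap.restrictScalarsL ℂ (F →L[ℂ] F) (F →L[ℂ] F) ℝ ℝ).comp
    ((ContinuousLinearMap.compL ℂ F F F).flip.restrictScalars ℝ)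

set_option synthInstance.maxHeartbeats 200000 in
lemma HasLogExp.comp_right {T : ℝ → F →L[ℂ] F} {h : ℝ → F →L[ℂ] F} {C : F →L[ℂ] F}
    (H₁ : HasLogExp h C) (hT : ContDiffAt ℝ ∞ T 0) :
    HasLogExp (fun t => (h t).comp (T t)) (C.comp (T 0)) :=
  H₁.bilin (compRightL F) hT

end Products

section Density

variable {n : ℕ} {M : Type*} [TopologicalSpace M] [ChartedSpace (Rn n) M] [IsManifold (𝓡 n) ∞ M]
  {F : Type*} [NormedAddCommGroup F] [NormedSpace ℂ F]
  {E : M → Type*} [TopologicalSpace (TotalSpace F E)] [∀ x, TopologicalSpace (E x)]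
  [∀ x, AddCommGroup (E x)] [∀ x, Module ℂ (E x)]
  [FiberBundle F E] [VectorBundle ℂ F E] [VectorBundle ℝ F E]
  [ContMDiffVectorBundle ∞ F E (𝓡 n)]

namespace LocalCoords

/-- The differential of the inverse of the chart. -/
def frameMap (c : LocalCoords n F E) (y : Rn n) : Rn n →L[ℝ] Rn n :=
  mfderiv 𝓘(ℝ, Rn n) (𝓡 n) c.chart.symm y

variable {c c' : LocalCoords n F E} {y : Rn n}

lemma mdifferentiableAt_symm (hy : y ∈ c.dom) :
    MDifferentiableAt 𝓘(ℝ, Rn n) (𝓡 n) c.chart.symm y := by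
  have h1 : ContMDiffOn (𝓡 n) (𝓡 n) ∞ c.chart.symm c.dom :=
    contMDiffOn_symm_of_mem_maximalAtlas c.chart_mem
  exact (h1.contMDiffAt (c.isOpen_dom.mem_nhds hy)).mdifferentiableAt (by simp)

lemma frameMap_eq_comp (hy : y ∈ c.overlap c') :
    c.frameMap y = (c'.frameMap (c.transition c' y)).comp (fderiv ℝ (c.transition c') y) := by
  have e : c.chart.symm =ᶠ[𝓝 y] c'.chart.symm ∘ c.transition c' := by
    filter_upwards [isOpen_overlap.mem_nhds hy] with z hz using (symm_transition hz).symm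
  have h1 := (hasFDerivAt_transition hy).differentiableAt.mdifferentiableAt
  have h2 := mfderiv_comp y (mdifferentiableAt_symm (transition_mem hy).1) h1
  rw [mfderiv_eq_fderiv] at h2
  exact e.mfderiv_eq.trans h2

lemma det_frameMap_ne_zero (hy : y ∈ c.dom) : (c.frameMap y).det ≠ 0 := fun h => by
  have e : c.chart ∘ c.chart.symm =ᶠ[𝓝 y] id := by
    filter_upwards [c.isOpen_dom.mem_nhds hy] with z hz using c.chart.right_inv hz
  have h0 : ContMDiffOn (𝓡 n) (𝓡 n) ∞ c.chart c.chart.source :=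
    contMDiffOn_of_mem_maximalAtlas c.chart_mem
  have h1 : MDifferentiableAt (𝓡 n) 𝓘(ℝ, Rn n) c.chart (c.chart.symm y) :=
    (h0.contMDiffAt (c.chart.open_source.mem_nhds (symm_mem hy))).mdifferentiableAt (by simp)
  have h2 := mfderiv_comp y h1 (mdifferentiableAt_symm hy)
  let D : Rn n →L[ℝ] Rn n := mfderiv (𝓡 n) 𝓘(ℝ, Rn n) c.chart (c.chart.symm y)
  have h3 : ContinuousLinearMap.id ℝ (Rn n) = D.comp (c.frameMap y) :=
    ((e.mfderiv_eq (I := 𝓘(ℝ, Rn n)) (I' := 𝓘(ℝ, Rn n))).trans mfderiv_id).symm.trans h2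
  have h4 := congrArg ContinuousLinearMap.det h3
  simp only [ContinuousLinearMap.det, ContinuousLinearMap.toLinearMap_comp, LinearMap.det_comp]
    at h4 h
  rw [h, mul_zero] at h4
  exact one_ne_zero (LinearMap.det_id.symm.trans h4)

end LocalCoords

/-- The standard basis of `ℝⁿ`, as a basis of a tangent space of `M`. -/
def tangentBasis (x : M) : Module.Basis (Fin n) ℝ (TangentSpace (𝓡 n) x) :=
  (EuclideanSpace.basisFun (Fin n) ℝ).toBasis

omit [IsManifold (𝓡 n) ∞ M] in
lemma tangentBasis_apply (x : M) (i : Fin n) :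
    tangentBasis x i = (EuclideanSpace.single i (1 : ℝ) : Rn n) := by
  have h : (EuclideanSpace.basisFun (Fin n) ℝ).toBasis i = EuclideanSpace.single i (1 : ℝ) := by
    rw [OrthonormalBasis.coe_toBasis, EuclideanSpace.basisFun_apply]
  exact h

-- The linear map carrying the standard basis to v has determinant det v, so a density is determined
-- at x by its value on one basis.
omit [IsManifold (𝓡 n) ∞ M] [TopologicalSpace (TotalSpace F E)]
  [∀ x, TopologicalSpace (E x)] [FiberBundle F E] [VectorBundle ℂ F E] [VectorBundle ℝ F E] in
lemma EndDensity.toFun_eq (d : EndDensity n E) (x : M) (v : Fin n → TangentSpace (𝓡 n) x) :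
    d.toFun x v = |(tangentBasis x).det v| • d.toFun x (tangentBasis x) := by
  have h1 := d.map_comp x ((tangentBasis x).constr ℝ v) (tangentBasis x)
  have h2 : (fun i => (tangentBasis x).constr ℝ v (tangentBasis x i)) = v := by
    ext1 i; exact (tangentBasis x).constr_basis ℝ v i
  have h3 := (tangentBasis x).det_comp ((tangentBasis x).constr ℝ v) (tangentBasis x)
  rw [Module.Basis.det_self, mul_one] at h3
  rw [h2] at h1
  rw [h1, ← h3]
  congr 3

lemma LocalCoords.det_frame (c : LocalCoords n F E) (y : Rn n) :
    (tangentBasis (c.chart.symm y)).det (c.frame y) = (c.frameMap y).det := by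
  let A : TangentSpace (𝓡 n) (c.chart.symm y) →ₗ[ℝ] TangentSpace (𝓡 n) (c.chart.symm y) :=
    (c.frameMap y : Rn n →ₗ[ℝ] Rn n)
  have h := (tangentBasis (c.chart.symm y)).det_comp A (tangentBasis (c.chart.symm y))
  rw [Module.Basis.det_self, mul_one] at h
  have e : A ∘ tangentBasis (c.chart.symm y) = c.frame y := by
    ext1 i
    rw [comp_apply, tangentBasis_apply]
    rfl
  rw [e] at h
  exact h

variable [FiniteDimensional ℂ F]

namespace LocalCoords

variable {c c' : LocalCoords n F E} {y : Rn n}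

lemma endo_smul (x : M) (a : ℝ) (T : Module.End ℂ (E x)) :
    c.endo x (a • T) = a • c.endo x T := by
  ext v
  change c.triv.linearMapAt ℂ x (a • T (c.triv.symmₗ ℂ x v)) =
    a • c.triv.linearMapAt ℂ x (T (c.triv.symmₗ ℂ x v))
  exact map_smul (c.triv.linearMapAt ℂ x) (a : ℂ) _

lemma endo_injective {x : M} (hx : x ∈ c.triv.baseSet) :
    Injective (c.endo x : Module.End ℂ (E x) → _) := fun T T' h => by
  ext v
  have h1 := DFunLike.congr_fun h (c.triv.linearMapAt ℂ x v)
  change c.triv.linearMapAt ℂ x (T (c.triv.symmₗ ℂ x (c.triv.linearMapAt ℂ x v))) =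
    c.triv.linearMapAt ℂ x (T' (c.triv.symmₗ ℂ x (c.triv.linearMapAt ℂ x v))) at h1
  rw [c.triv.symmₗ_linearMapAt hx] at h1
  have h2 := congrArg (c.triv.symmₗ ℂ x) h1
  rwa [c.triv.symmₗ_linearMapAt hx, c.triv.symmₗ_linearMapAt hx] at h2

lemma coeff_eq (c : LocalCoords n F E) (d : EndDensity n E) (y : Rn n) :
    c.coeff d y = |(c.frameMap y).det| •
      c.endo (c.chart.symm y) (d.toFun _ (tangentBasis (c.chart.symm y))) := by
  rw [coeff, d.toFun_eq, endo_smul, det_frame]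

end LocalCoords

/-- One chart per point suffices: the coefficient there is a nonzero Jacobian times the value on the
standard basis, read through an isomorphism of fibres. -/
lemma EndDensity.eq_mul_of_coeff {d d' : EndDensity n E} {h : M → ℝ}
    (H : ∀ x : M, ∃ c : LocalCoords n F E, x ∈ c.chart.source ∧
      c.coeff d' (c.chart x) = h x • c.coeff d (c.chart x)) : d' = d.mul h := by
  have key : ∀ x, d'.toFun x (tangentBasis x) = h x • d.toFun x (tangentBasis x) := by
    intro x
    obtain ⟨c, hx, hc⟩ := H x
    obtain ⟨y, hy, rfl⟩ : ∃ y ∈ c.dom, c.chart.symm y = x :=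
      ⟨c.chart x, LocalCoords.chart_mem_dom hx, c.chart.left_inv hx⟩
    rw [c.chart.right_inv hy, c.coeff_eq, c.coeff_eq, smul_comm] at hc
    have h1 := smul_right_injective _ (abs_ne_zero.2 (LocalCoords.det_frameMap_ne_zero hy)) hc
    simp only [← LocalCoords.endo_smul] at h1
    exact LocalCoords.endo_injective (LocalCoords.symm_mem_baseSet hy) h1
  ext1
  funext x v
  change _ = h x • d.toFun x v
  rw [d'.toFun_eq, d.toFun_eq, key, smul_comm]

/-- Local coefficients that transform as a density come from a density. -/
lemma exists_density (C : LocalCoords n F E → Rn n → F →L[ℂ] F)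
    (hC : ∀ c c' : LocalCoords n F E, ∀ y ∈ c.overlap c', (c.coordT c' y).comp (C c y) =
      |(fderiv ℝ (c.transition c') y).det| •
        (C c' (c.transition c' y)).comp (c.coordT c' y)) :
    ∃ d : EndDensity n E, ∀ c : LocalCoords n F E, ∀ y ∈ c.dom, c.coeff d y = C c y := by
  choose κ hκ using fun x : M =>
    LocalCoords.exists_mem_source (n := n) (F := F) (E := E) x univ univ_mem
  -- The density is defined at each point through an arbitrarily chosen chart κ x. The
  -- transformation rule between c and κ x at that point makes the choice irrelevant, so no gluing
  -- is involved.
  let S : ∀ x : M, Module.End ℂ (E x) := fun x =>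
    (κ x).triv.symmₗ ℂ x ∘ₗ (C (κ x) ((κ x).chart x) : F →ₗ[ℂ] F) ∘ₗ (κ x).triv.linearMapAt ℂ x
  let d : EndDensity n E :=
    { toFun := fun x v => (|(tangentBasis x).det v| *
        |((κ x).frameMap ((κ x).chart x)).det|⁻¹) • S x
      map_comp := fun x A v => by
        have h := (tangentBasis x).det_comp A v
        have e : (A ∘ v) = fun i => A (v i) := rfl
        rw [e] at h
        rw [h, abs_mul, smul_smul, mul_assoc] }
  refine ⟨d, fun c y hy => ?_⟩
  set x := c.chart.symm y with hx
  have hov : y ∈ c.overlap (κ x) := ⟨hy, (hκ x).1⟩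
  have hb : x ∈ (κ x).triv.baseSet := (κ x).subset (hκ x).1
  have hbc : x ∈ c.triv.baseSet := LocalCoords.symm_mem_baseSet hy
  have htr : c.transition (κ x) y = (κ x).chart x := rfl
  have h0 : ((κ x).frameMap ((κ x).chart x)).det ≠ 0 := by
    rw [← htr]; exact LocalCoords.det_frameMap_ne_zero (LocalCoords.transition_mem hov).1
  have hdet : (c.frameMap y).det = ((κ x).frameMap ((κ x).chart x)).det *
      (fderiv ℝ (c.transition (κ x)) y).det := by
    rw [LocalCoords.frameMap_eq_comp hov, ← htr]
    simp only [ContinuousLinearMap.det, ContinuousLinearMap.toLinearMap_comp, LinearMap.det_comp]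
  have hcoef : c.coeff d y = |(fderiv ℝ (c.transition (κ x)) y).det| • c.endo x (S x) := by
    rw [LocalCoords.coeff]
    change c.endo x ((|(tangentBasis x).det (c.frame y)| * _) • S x) = _
    rw [LocalCoords.endo_smul, LocalCoords.det_frame, hdet, abs_mul, mul_comm, ← mul_assoc,
      inv_mul_cancel₀ (abs_ne_zero.2 h0), one_mul]
  rw [hcoef]
  have hTinj : Injective (c.coordT (κ x) y) := fun v w h => by
    have h1 := fun v => DFunLike.congr_fun (LocalCoords.coordT_comp hov) v
    have h2 := congrArg ((κ x).coordT c (c.transition (κ x) y)) h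
    exact (h1 v).symm.trans (h2.trans (h1 w))
  ext v
  apply hTinj
  have h1 := DFunLike.congr_fun (hC c (κ x) y hov) v
  rw [ContinuousLinearMap.comp_apply] at h1
  rw [h1, smul_apply, smul_apply, (c.coordT (κ x) y).map_smul_of_tower]
  congr 1
  rw [ContinuousLinearMap.comp_apply, LocalCoords.coordT_apply hov, LocalCoords.coordT_apply hov]
  change ((κ x).triv ⟨x, c.triv.symm x (c.triv.linearMapAt ℂ x ((κ x).triv.symmₗ ℂ x
    (C (κ x) ((κ x).chart x) ((κ x).triv.linearMapAt ℂ x (c.triv.symmₗ ℂ x v)))))⟩).2 = _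
  rw [c.triv.symm_linearMapAt hbc, (κ x).triv.symmₗ_apply hb, (κ x).triv.apply_mk_symm hb,
    c.triv.symmₗ_apply hbc, (κ x).triv.linearMapAt_apply, if_pos hb]
  rfl

variable [T2Space M] {P : Op n F E} {m : ℤ}

/-- Along a straight ray in c, the kernel in c' is evaluated on the curve φ(x - tθ) = φ(x) - tψ(t),
with ψ(0) = Dφ(x)θ ≠ 0, and Hadamard's lemma makes ψ smooth. The Jacobian and the change of
trivialization enter through their values at t = 0 only, and the coefficient of log t is unique. -/
lemma HasLocalExpansion.transition (hn : 1 ≤ n) {c c' : LocalCoords n F E}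
    {C C' : Rn n → F →L[ℂ] F} (h : HasLocalExpansion c m P C) (h' : HasLocalExpansion c' m P C')
    {x : Rn n} (hx : x ∈ c.overlap c') :
    (c.coordT c' x).comp (C x) = |(fderiv ℝ (c.transition c') x).det| •
      (C' (c.transition c' x)).comp (c.coordT c' x) := by
  have : CompleteSpace F := FiniteDimensional.complete ℂ F
  obtain ⟨k, -, hk, -⟩ := h.2
  obtain ⟨k', -, hk', -⟩ := h'.2
  set φ := c.transition c' with hφ
  -- Some nonzero direction is needed; it exists because n ≥ 1.
  let θ : Rn n := EuclideanSpace.single ⟨0, hn⟩ 1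
  have hθ : θ ≠ 0 := by simp [θ]
  have hray : Tendsto (fun t : ℝ => x - t • θ) (𝓝 0) (𝓝 x) := by
    have : Continuous fun t : ℝ => x - t • θ := by fun_prop
    simpa using this.tendsto 0
  have hray' : ContDiff ℝ ∞ (fun t : ℝ => x - t • θ) := by fun_prop
  have hov := hray.eventually (LocalCoords.isOpen_overlap.mem_nhds hx)
  have cφ : ∀ᶠ t in 𝓝 (0 : ℝ), ContDiffAt ℝ ∞ (fun t => φ x - φ (x - t • θ)) t := by
    filter_upwards [hov] with t ht
    exact contDiffAt_const.sub (ContDiffAt.comp (g := φ) (f := fun t : ℝ => x - t • θ) t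
      (LocalCoords.contDiffAt_transition ht) hray'.contDiffAt)
  obtain ⟨ψ, hψ, hψ0, hψe⟩ := exists_smul_eq_of_contDiffAt cφ (by simp)
  have hd : HasDerivAt (fun t : ℝ => φ x - φ (x - t • θ)) (fderiv ℝ φ x θ) 0 := by
    have h1 : HasDerivAt (fun t : ℝ => x - t • θ) (-θ) 0 := by
      simpa using ((hasDerivAt_id (0 : ℝ)).smul_const θ).const_sub x
    have h2 : HasFDerivAt φ (fderiv ℝ φ x) (x - (0 : ℝ) • θ) := by
      rw [zero_smul, sub_zero]; exact LocalCoords.hasFDerivAt_transition hx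
    simpa using (h2.comp_hasDerivAt 0 h1).const_sub (φ x)
  have hψ0' : ψ 0 ≠ 0 := by
    rw [hψ0, hd.deriv]
    exact fun h0 => hθ (LocalCoords.injective_fderiv_transition hx (h0.trans (map_zero _).symm))
  have H1 := (h.hasLogExp hk hx.1 contDiffAt_const (ψ := fun _ => θ) hθ).clm
    (((ContinuousLinearMap.compL ℂ F F F) (c.coordT c' x)).restrictScalars ℝ)
  have H2 := h'.hasLogExp hk' (LocalCoords.transition_mem hx).1 hψ hψ0'
  have hx0 : x - (0 : ℝ) • θ = x := by simp
  have t1 : ContDiffAt ℝ ∞ (fun t : ℝ => fderiv ℝ φ (x - t • θ)) 0 := by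
    have : ContDiffAt ℝ ∞ (fderiv ℝ φ) (x - (0 : ℝ) • θ) := by
      rw [hx0]
      exact (LocalCoords.contDiffAt_transition hx).fderiv_right (by simp)
    exact ContDiffAt.comp (g := fderiv ℝ φ) (f := fun t : ℝ => x - t • θ) 0 this
      hray'.contDiffAt
  have t2 : ContDiffAt ℝ ∞ (fun t : ℝ => c.coordT c' (x - t • θ)) 0 := by
    have : ContDiffAt ℝ ∞ (c.coordT c') (x - (0 : ℝ) • θ) := by
      rw [hx0]
      exact LocalCoords.contDiffOn_coordT.contDiffAt (LocalCoords.isOpen_overlap.mem_nhds hx)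
    exact ContDiffAt.comp (g := c.coordT c') (f := fun t : ℝ => x - t • θ) 0 this
      hray'.contDiffAt
  have t3 : ContDiffAt ℝ ∞ (fun t : ℝ => |(fderiv ℝ φ (x - t • θ)).det|) 0 :=
    contDiffAt_abs_det t1 (by rw [hx0]; exact LocalCoords.det_fderiv_transition_ne_zero hx)
  have H3 := (H2.comp_right t2).smul t3
  simp only [hx0] at H3
  have H4 := H1.unique (H3.congr' ?_)
  · exact H4
  · filter_upwards [hov.filter_mono nhdsWithin_le_nhds, hψe.filter_mono nhdsWithin_le_nhds,
      self_mem_nhdsWithin] with t ht1 ht2 ht3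
    have hne : x ≠ x - t • θ := fun e => by
      have : t • θ = 0 := by
        rw [eq_sub_iff_add_eq] at e
        exact add_eq_left.1 e
      exact (smul_ne_zero (ne_of_gt ht3) hθ) this
    have e1 := LocalCoords.kernel_transition hk hk' hx ht1 hne
    have e2 : φ x - t • ψ t = φ (x - t • θ) := by rw [← ht2]; abel
    rw [e2]
    exact e1.symm

/-- A pseudodifferential operator has a unique logarithmic singularity. -/
lemma IsPsiDO.existsUnique_hasLogSingularity (hn : 1 ≤ n) (hP : IsPsiDO m P) (hm : -(n : ℤ) ≤ m) :
    ∃! d, HasLogSingularity m P d := by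
  have : CompleteSpace F := FiniteDimensional.complete ℂ F
  choose C hC using fun c : LocalCoords n F E => hP.exists_hasLocalExpansion hm c
  obtain ⟨d, hd⟩ := exists_density C fun c c' y hy => (hC c).transition hn (hC c') hy
  refine ⟨d, fun c => ?_, fun d' hd' => ?_⟩
  · obtain ⟨h1, k, a, hk, ha, hexp⟩ := hC c
    refine ⟨h1.congr (hd c), k, a, hk, ha, fun x₀ hx₀ => ?_⟩
    obtain ⟨W, hW, B, hB⟩ := hexp x₀ hx₀
    refine ⟨W ∩ c.dom, inter_mem hW (c.isOpen_dom.mem_nhds hx₀), B, fun x hx y hy hxy => ?_⟩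
    rw [hd c x hx.2]
    exact hB x hx.1 y hy.1 hxy
  -- Both coefficients are the logarithmic coefficient of one kernel along one ray.
  · have h1 : d' = d.mul fun _ => 1 := EndDensity.eq_mul_of_coeff (F := F) fun x => by
      obtain ⟨c, hx, -⟩ := LocalCoords.exists_mem_source (n := n) (F := F) (E := E) x univ univ_mem
      refine ⟨c, hx, ?_⟩
      have hy := LocalCoords.chart_mem_dom hx
      rw [one_smul, hd c _ hy]
      obtain ⟨k, -, hk, -⟩ := (hC c).2
      have hθ : (EuclideanSpace.single ⟨0, hn⟩ 1 : Rn n) ≠ 0 := by simp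
      exact (HasLocalExpansion.hasLogExp (hd' c) hk hy (ψ := fun _ => _) contDiffAt_const hθ).unique
        ((hC c).hasLogExp hk hy (ψ := fun _ => _) contDiffAt_const hθ)
    rw [h1]
    ext1
    funext x v
    exact one_smul ℝ _

/-- Comparison of the logarithmic singularities of two operators whose kernels are, up to
multiplication by a smooth function and near the diagonal, equal modulo bounded functions. -/
lemma HasLogSingularity.eq_mul (hn : 1 ≤ n) {P' : Op n F E} {d d' : EndDensity n E}
    (hd : HasLogSingularity m P d) (hd' : HasLogSingularity m P' d') {h : M → ℝ}
    (H : ∀ x : M, ∃ (c : LocalCoords n F E) (k k' : Rn n → Rn n → F →L[ℂ] F) (a : Rn n → ℝ) (B : ℝ),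
      x ∈ c.chart.source ∧ IsOffDiagonalKernel c c P k ∧ IsOffDiagonalKernel c c P' k' ∧
      ContDiffAt ℝ ∞ a (c.chart x) ∧ a (c.chart x) = h x ∧
      ∀ᶠ y in 𝓝[≠] (c.chart x), ‖k' (c.chart x) y - a y • k (c.chart x) y‖ ≤ B) :
    d' = d.mul h := by
  have : CompleteSpace F := FiniteDimensional.complete ℂ F
  refine EndDensity.eq_mul_of_coeff (F := F) fun x => ?_
  obtain ⟨c, k, k', a, B, hx, hk, hk', ha, hax, hB⟩ := H x
  refine ⟨c, hx, ?_⟩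
  have hy := LocalCoords.chart_mem_dom hx
  set y := c.chart x with hydef
  let θ : Rn n := EuclideanSpace.single ⟨0, hn⟩ 1
  have hθ : θ ≠ 0 := by simp [θ]
  have H1 := HasLocalExpansion.hasLogExp (hd c) hk hy contDiffAt_const (ψ := fun _ => θ) hθ
  have H2 := HasLocalExpansion.hasLogExp (hd' c) hk' hy contDiffAt_const (ψ := fun _ => θ) hθ
  have hray' : ContDiff ℝ ∞ (fun t : ℝ => y - t • θ) := by fun_prop
  have hray : Tendsto (fun t : ℝ => y - t • θ) (𝓝[>] 0) (𝓝[≠] y) := by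
    refine tendsto_nhdsWithin_iff.2 ⟨?_, ?_⟩
    · have := hray'.continuous.tendsto 0
      simp only [zero_smul, sub_zero] at this
      exact this.mono_left nhdsWithin_le_nhds
    · filter_upwards [self_mem_nhdsWithin] with t ht e
      have : t • θ = 0 := by simpa using e
      exact (smul_ne_zero (ne_of_gt ht) hθ) this
  have hL : ContDiffAt ℝ ∞ (fun t : ℝ => a (y - t • θ)) 0 := by
    have : ContDiffAt ℝ ∞ a (y - (0 : ℝ) • θ) := by simpa using ha
    exact ContDiffAt.comp (g := a) (f := fun t : ℝ => y - t • θ) 0 this hray'.contDiffAt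
  have hO : (fun t : ℝ => k' y (y - t • θ) - a (y - t • θ) • k y (y - t • θ))
      =O[𝓝[>] 0] (fun _ => (1 : ℝ)) :=
    Asymptotics.IsBigO.of_bound B (by
      filter_upwards [hray.eventually hB] with t ht
      simpa using ht)
  have H3 := ((H1.smul hL).add_isBigO hO).congr' (h' := fun t => k' y (y - t • θ))
    (Eventually.of_forall fun t => by simp)
  have := H2.unique H3
  simpa [hax] using this

end Density

end

end PsiDO

namespace PsiDO

open MeasureTheory Set Filter Topology Function

noncomputable section

set_option linter.unusedSectionVars false

/-! ### Multiplication operators and smoothing perturbations -/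

section Conjugation

variable {n : ℕ} {M : Type*} [TopologicalSpace M] [ChartedSpace (Rn n) M] [IsManifold (𝓡 n) ∞ M]
  {F : Type*} [NormedAddCommGroup F] [NormedSpace ℂ F]
  {E : M → Type*} [TopologicalSpace (TotalSpace F E)] [∀ x, TopologicalSpace (E x)]
  [∀ x, AddCommGroup (E x)] [∀ x, Module ℂ (E x)]
  [FiberBundle F E] [VectorBundle ℂ F E] [VectorBundle ℝ F E]
  [ContMDiffVectorBundle ∞ F E (𝓡 n)]

omit [IsManifold (𝓡 n) ∞ M] [VectorBundle ℂ F E] [VectorBundle ℝ F E]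
  [ContMDiffVectorBundle ∞ F E (𝓡 n)] [FiberBundle F E] [TopologicalSpace (TotalSpace F E)]
  [∀ x, TopologicalSpace (E x)] in
lemma secSupport_smul_subset (φ : M → ℝ) (s : ∀ x, E x) :
    secSupport (fun x => φ x • s x) ⊆ secSupport s :=
  closure_mono fun x hx h => hx (by simp [h])

lemma LocalCoords.cloc_mul (c : LocalCoords n F E) (φ : M → ℝ) (s : ∀ x, E x) (y : Rn n) :
    c.cloc (fun x => φ x • s x) y = φ (c.chart.symm y) • c.cloc s y := by
  by_cases hy : y ∈ c.dom
  · rw [cloc_apply hy, cloc_apply hy, loc_mul hy]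
  · rw [cloc, cloc, indicator_of_notMem hy, indicator_of_notMem hy, smul_zero]

variable [T2Space M] [CompleteSpace F] {c : LocalCoords n F E} {P P' : Op n F E}

lemma IsOffDiagonalKernel.integral_cloc {k : Rn n → Rn n → F →L[ℂ] F} {c' : LocalCoords n F E}
    (hk : IsOffDiagonalKernel c c' P k) {u : TestSections n F E}
    (hu : secSupport u.1 ⊆ c'.chart.source) {x : Rn n} (hx : x ∈ c.dom)
    (hxu : c.chart.symm x ∉ secSupport u.1) :
    Integrable (fun y => k x y (c'.cloc u.1 y)) ∧
      c.loc (P u).1 x = ∫ y, k x y (c'.cloc u.1 y) := by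
  refine ⟨?_, by rw [hk.2 u hu x hx hxu, c'.setIntegral_loc]⟩
  refine integrable_apply_of_continuousOn (isOpen_offDiag c c' x)
    (hk.contDiffOn_snd hx).continuousOn (LocalCoords.contDiff_cloc hu u.2.1 u.2.2).continuous
    (LocalCoords.hasCompactSupport_cloc hu u.2.2) fun y hy => ?_
  obtain ⟨z, hz, rfl⟩ := LocalCoords.tsupport_cloc_subset_image hu u.2.2 hy
  refine ⟨LocalCoords.chart_mem_dom (hu hz), fun h => hxu ?_⟩
  rw [mem_singleton_iff, c'.chart.left_inv (hu hz)] at h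
  rwa [← h]

omit [T2Space M] in
lemma integrable_smooth_cloc {V : Set (Rn n)} {r : Rn n → Rn n → F →L[ℂ] F}
    {c' : LocalCoords n F E} (hr : ContDiffOn ℝ ∞ (uncurry r) (V ×ˢ c'.dom))
    {u : TestSections n F E} (hu : secSupport u.1 ⊆ c'.chart.source) {x : Rn n} (hx : x ∈ V) :
    Integrable (fun y => r x y (c'.cloc u.1 y)) := by
  refine integrable_apply_of_continuousOn c'.isOpen_dom ?_
    (LocalCoords.contDiff_cloc hu u.2.1 u.2.2).continuous
    (LocalCoords.hasCompactSupport_cloc hu u.2.2) (LocalCoords.tsupport_cloc_subset hu u.2.2)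
  have h1 : ContinuousOn (fun y : Rn n => (x, y)) c'.dom :=
    (continuous_const.prodMk continuous_id).continuousOn
  exact ContinuousOn.comp (g := uncurry r) (t := V ×ˢ c'.dom) hr.continuousOn h1
    fun y hy => ⟨hx, hy⟩

lemma LocalCoords.contDiffOn_mul_comp_symm {c' : LocalCoords n F E}
    (α β : C^∞⟮𝓡 n, M; 𝓘(ℝ, ℝ), ℝ⟯) :
    ContDiffOn ℝ ∞ (fun z : Rn n × Rn n => α (c.chart.symm z.1) * β (c'.chart.symm z.2))
      (c.dom ×ˢ c'.dom) :=
  ((c.contDiffOn_comp_symm α.contMDiff).comp contDiffOn_fst fun _ hz => hz.1).mul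
    ((c'.contDiffOn_comp_symm β.contMDiff).comp contDiffOn_snd fun _ hz => hz.2)

/-- The kernel of `α P β` plus a smoothing operator. -/
lemma IsOffDiagonalKernel.conjugate {c' : LocalCoords n F E} {k : Rn n → Rn n → F →L[ℂ] F}
    (hk : IsOffDiagonalKernel c c' P k) {α β : C^∞⟮𝓡 n, M; 𝓘(ℝ, ℝ), ℝ⟯}
    (hR : IsSmoothing (P' - mulSmooth α ∘ₗ P ∘ₗ mulTest β)) :
    ∃ r : Rn n → Rn n → F →L[ℂ] F, ContDiffOn ℝ ∞ (uncurry r) (c.dom ×ˢ c'.dom) ∧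
      IsOffDiagonalKernel c c' P' (fun x y =>
        (α (c.chart.symm x) * β (c'.chart.symm y)) • k x y + r x y) := by
  obtain ⟨r, hr, hrR⟩ := hR c c'
  refine ⟨r, hr, ?_, fun u hu x hx hxu => ?_⟩
  · have h1 : {z : Rn n × Rn n | z.1 ∈ c.dom ∧ z.2 ∈ c'.dom ∧
        c.chart.symm z.1 ≠ c'.chart.symm z.2} ⊆ c.dom ×ˢ c'.dom := fun z hz => ⟨hz.1, hz.2.1⟩
    exact ((LocalCoords.contDiffOn_mul_comp_symm α β).mono h1 |>.smul hk.1).add (hr.mono h1)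
  · have hβs : secSupport (mulTest β u).1 ⊆ secSupport u.1 := secSupport_smul_subset β u.1
    obtain ⟨i1, e1⟩ := hk.integral_cloc (u := mulTest β u) (hβs.trans hu) hx
      (fun h => hxu (hβs h))
    have i2 := integrable_smooth_cloc hr hu hx
    have e2 := hrR u hu x hx
    have e3 : (P' u).1 = ((P' - mulSmooth α ∘ₗ P ∘ₗ mulTest β) u).1 +
        fun x => α x • (P (mulTest β u)).1 x := by
      change _ = ((P' u).1 - fun x => α x • (P (mulTest β u)).1 x) + _
      abel
    have i3 : Integrable (fun y => α (c.chart.symm x) • k x y (c'.cloc (mulTest β u).1 y)) :=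
      i1.smul _
    rw [e3, LocalCoords.loc_add hx, LocalCoords.loc_mul hx, e1, e2, c'.setIntegral_loc,
      c'.setIntegral_loc, ← integral_smul, ← integral_add i2 i3]
    refine integral_congr_ae (Eventually.of_forall fun y => ?_)
    have e4 : c'.cloc (mulTest β u).1 y = β (c'.chart.symm y) • c'.cloc u.1 y :=
      c'.cloc_mul β u.1 y
    simp only [e4, add_apply, smul_apply, (k x y).map_smul_of_tower, smul_smul]
    rw [add_comm]

/-- The kernel of P' is α(x)β(y) times that of P plus a smooth kernel, bounded near the diagonal.
The factor is smooth in y with value α(x)β(x) at y = x. -/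
lemma HasLogSingularity.conjugate [FiniteDimensional ℂ F] (hn : 1 ≤ n) {m : ℤ}
    {d d' : EndDensity n E}
    (hd : HasLogSingularity m P d) (hd' : HasLogSingularity m P' d')
    {α β : C^∞⟮𝓡 n, M; 𝓘(ℝ, ℝ), ℝ⟯}
    (hR : IsSmoothing (P' - mulSmooth α ∘ₗ P ∘ₗ mulTest β)) :
    d' = d.mul fun x => α x * β x := by
  refine hd.eq_mul hn hd' fun x => ?_
  obtain ⟨c, hx, -⟩ := LocalCoords.exists_mem_source (n := n) (F := F) (E := E) x univ univ_mem
  obtain ⟨-, k, -, hk, -⟩ := hd c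
  obtain ⟨r, hr, hk'⟩ := hk.conjugate hR
  have hy := LocalCoords.chart_mem_dom hx
  have hs : c.chart.symm (c.chart x) = x := c.chart.left_inv hx
  refine ⟨c, k, _, fun y => α x * β (c.chart.symm y), ‖r (c.chart x) (c.chart x)‖ + 1, hx, hk,
    hk', contDiffAt_const.mul ((c.contDiffOn_comp_symm β.contMDiff).contDiffAt
      (c.isOpen_dom.mem_nhds hy)), by simp only [hs], ?_⟩
  have h1 : ContinuousAt (fun y : Rn n => r (c.chart x) y) (c.chart x) :=
    ContinuousAt.comp (g := uncurry r) (f := fun y : Rn n => (c.chart x, y))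
      (hr.continuousOn.continuousAt
        ((c.isOpen_dom.prod c.isOpen_dom).mem_nhds ⟨hy, hy⟩))
      (continuous_const.prodMk continuous_id).continuousAt
  have h2 : ∀ᶠ y in 𝓝 (c.chart x), ‖r (c.chart x) y‖ < ‖r (c.chart x) (c.chart x)‖ + 1 :=
    h1.norm.eventually (gt_mem_nhds (lt_add_one _))
  filter_upwards [h2.filter_mono nhdsWithin_le_nhds] with y hy
  simp only [hs, add_sub_cancel_left]
  exact hy.le

end Conjugation

end

end PsiDO

namespace PsiDO

open MeasureTheory Set Filter Topology Function

noncomputable section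

set_option linter.unusedSectionVars false

/-! ### Growth of symbols and oscillatory testing -/

section Growth

universe u

variable {n : ℕ} {F : Type u} [NormedAddCommGroup F] [NormedSpace ℂ F]
  {V : Set (Rn n)} {p : Rn n → Rn n → F →L[ℂ] F} {pj : ℕ → Rn n → Rn n → F →L[ℂ] F} {m : ℤ}

/-- The asymptotic estimate with no term removed controls large ξ, and compactness the rest.
Negative orders are rounded up to 0, which is all that the integrability arguments need. -/
lemma IsSymbol.exists_growth (h : IsSymbol m V p pj) (hV : IsOpen V) {K : Set (Rn n)}
    (hK : IsCompact K) (hKV : K ⊆ V) (a : ℕ) :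
    ∃ C : ℝ, 0 ≤ C ∧ ∀ x ∈ K, ∀ ξ, ‖iteratedFDeriv ℝ a (fun y => p y ξ) x‖ ≤
      C * (1 + ‖ξ‖) ^ m.toNat := by
  obtain ⟨C1, hC1⟩ := h.asymptotic 0 K hK hKV a 0
  have hsw : ContDiffOn ℝ ∞ (fun z : Rn n × Rn n => p z.2 z.1) (univ ×ˢ V) :=
    ContDiffOn.comp (g := uncurry p) (f := fun z : Rn n × Rn n => (z.2, z.1)) h.smooth
      (contDiff_snd.prodMk contDiff_fst).contDiffOn fun z hz => ⟨hz.2, mem_univ _⟩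
  obtain ⟨C2, hC20, hC2⟩ := exists_bound_iteratedFDeriv_partial_snd (isOpen_univ.prod hV) hsw
    (isCompact_closedBall (0 : Rn n) 1) hK (prod_mono (subset_univ _) hKV) a
  refine ⟨|C1| + C2, by positivity, fun x hx ξ => ?_⟩
  have h1 : (1 : ℝ) ≤ (1 + ‖ξ‖) ^ m.toNat := one_le_pow₀ (by linarith [norm_nonneg ξ])
  by_cases hξ : 1 ≤ ‖ξ‖
  · have h2 := hC1 x hx ξ hξ
    simp only [norm_iteratedFDeriv_zero, Finset.range_zero, Finset.sum_empty, sub_zero,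
      Nat.cast_zero] at h2
    have h3 : ‖ξ‖ ^ m ≤ (1 + ‖ξ‖) ^ m.toNat := by
      calc ‖ξ‖ ^ m ≤ ‖ξ‖ ^ (m.toNat : ℤ) := zpow_le_zpow_right₀ hξ (Int.self_le_toNat m)
        _ = ‖ξ‖ ^ m.toNat := zpow_natCast _ _
        _ ≤ _ := by gcongr; linarith
    calc _ ≤ C1 * ‖ξ‖ ^ m := h2
      _ ≤ (|C1| + C2) * ‖ξ‖ ^ m := by
        gcongr
        linarith [le_abs_self C1]
      _ ≤ _ := by gcongr
  · have h2 := hC2 a le_rfl ξ (by simpa using (not_le.1 hξ).le) x hx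
    calc _ ≤ C2 := h2
      _ ≤ (|C1| + C2) * 1 := by linarith [abs_nonneg C1]
      _ ≤ _ := by gcongr

lemma IsSymbol.exists_bound (h : IsSymbol m V p pj) (hV : IsOpen V) {K : Set (Rn n)}
    (hK : IsCompact K) (hKV : K ⊆ V) :
    ∃ C : ℝ, 0 ≤ C ∧ ∀ x ∈ K, ∀ ξ, ‖p x ξ‖ ≤ C * (1 + ‖ξ‖) ^ m.toNat := by
  obtain ⟨C, hC0, hC⟩ := h.exists_growth hV hK hKV 0
  exact ⟨C, hC0, fun x hx ξ => by simpa only [norm_iteratedFDeriv_zero] using hC x hx ξ⟩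

lemma IsSymbol.continuous_right (h : IsSymbol m V p pj) {x : Rn n} (hx : x ∈ V) :
    Continuous (p x) :=
  h.smooth.continuousOn.comp_continuous (f := fun ξ => (x, ξ)) (by fun_prop)
    (fun _ => ⟨hx, mem_univ _⟩)

/-- The principal term satisfies p_m(x, η + tξ) = t^m p_m(x, η/t + ξ), while the remainder after one
term has order m - 1. -/
lemma IsSymbol.tendsto_scaled (h : IsSymbol m V p pj) {x : Rn n} (hx : x ∈ V) {ξ : Rn n}
    (hξ : ξ ≠ 0) (η : Rn n) :
    Tendsto (fun t : ℝ => (t ^ m)⁻¹ • p x (η + t • ξ)) atTop (𝓝 (pj 0 x ξ)) := by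
  obtain ⟨C, hC⟩ := h.asymptotic 1 {x} isCompact_singleton (singleton_subset_iff.2 hx) 0 0
  have hlim : Tendsto (fun t : ℝ => t⁻¹ • η + ξ) atTop (𝓝 ξ) := by
    have := (tendsto_inv_atTop_zero (𝕜 := ℝ)).smul_const η |>.add_const ξ
    simpa using this
  have hnorm : Tendsto (fun t : ℝ => ‖t⁻¹ • η + ξ‖) atTop (𝓝 ‖ξ‖) := hlim.norm
  have hscale : ∀ t : ℝ, 0 < t → η + t • ξ = t • (t⁻¹ • η + ξ) := fun t ht => by
    rw [smul_add, smul_smul, mul_inv_cancel₀ ht.ne', one_smul]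
  have hξ0 : 0 < ‖ξ‖ := norm_pos_iff.2 hξ
  have hbig : Tendsto (fun t : ℝ => t * ‖t⁻¹ • η + ξ‖) atTop atTop :=
    tendsto_id.atTop_mul_pos hξ0 hnorm
  have hmain : Tendsto (fun t : ℝ => (t ^ m)⁻¹ • pj 0 x (η + t • ξ)) atTop (𝓝 (pj 0 x ξ)) := by
    have hcont : ContinuousAt (fun ζ => pj 0 x ζ) ξ := by
      have h1 : ContinuousOn (fun ζ => pj 0 x ζ) {0}ᶜ :=
        ContinuousOn.comp (g := uncurry (pj 0)) (h.homogeneous 0).1.continuousOn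
          (f := fun ζ => (x, ζ)) (by fun_prop) fun ζ hζ => ⟨hx, hζ⟩
      exact h1.continuousAt (isOpen_compl_singleton.mem_nhds hξ)
    refine (hcont.tendsto.comp hlim).congr' ?_
    filter_upwards [eventually_gt_atTop 0, hnorm.eventually (lt_mem_nhds hξ0)] with t ht htn
    have hne : t⁻¹ • η + ξ ≠ 0 := norm_pos_iff.1 htn
    have h2 := (h.homogeneous 0).2 x hx _ hne t ht
    simp only [comp_apply, hscale t ht]
    rw [h2, Nat.cast_zero, sub_zero, smul_smul, inv_mul_cancel₀ (zpow_ne_zero _ ht.ne'), one_smul]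
  have hrest : Tendsto (fun t : ℝ => (t ^ m)⁻¹ • (p x (η + t • ξ) - pj 0 x (η + t • ξ))) atTop
      (𝓝 0) := by
    have hb : Tendsto (fun t : ℝ => C * (‖t⁻¹ • η + ξ‖ ^ m * (t * ‖t⁻¹ • η + ξ‖)⁻¹)) atTop (𝓝 0) := by
      have := ((hnorm.zpow₀ m (Or.inl hξ0.ne')).mul hbig.inv_tendsto_atTop).const_mul C
      simpa using this
    refine squeeze_zero_norm' ?_ hb
    filter_upwards [eventually_gt_atTop 0, hnorm.eventually (lt_mem_nhds hξ0),
      hbig.eventually_ge_atTop 1] with t ht htn ht1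
    have hn' : ‖η + t • ξ‖ = t * ‖t⁻¹ • η + ξ‖ := by
      rw [hscale t ht, norm_smul, Real.norm_of_nonneg ht.le]
    have h2 := hC x rfl (η + t • ξ) (by rw [hn']; exact ht1)
    simp only [norm_iteratedFDeriv_zero, Finset.range_one, Finset.sum_singleton, Nat.cast_zero,
      sub_zero, Nat.cast_one] at h2
    rw [norm_smul, norm_inv, norm_zpow, Real.norm_of_nonneg ht.le]
    rw [hn', zpow_sub_one₀ (by positivity), mul_zpow] at h2
    calc _ ≤ (t ^ m)⁻¹ * (C * (t ^ m * ‖t⁻¹ • η + ξ‖ ^ m * (t * ‖t⁻¹ • η + ξ‖)⁻¹)) := by gcongr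
      _ = _ := by
        have : t ^ m ≠ 0 := zpow_ne_zero _ ht.ne'
        field_simp
  have := hrest.add hmain
  rw [zero_add] at this
  refine this.congr fun t => ?_
  rw [← smul_add, sub_add_cancel]

variable [CompleteSpace F]

lemma integral_osc_ft {u : Rn n → F} (hu : ContDiff ℝ ∞ u) (huc : HasCompactSupport u)
    (x : Rn n) : ((2 * Real.pi) ^ n : ℝ)⁻¹ • ∫ η, osc x η • ft u η = u x := by
  have hui : Integrable u := hu.continuous.integrable_of_hasCompactSupport huc
  have hpi : (2 * Real.pi : ℝ) ≠ 0 := by positivity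
  have e1 : ∀ η, ft u ((2 * Real.pi) • η) = FourierTransform.fourier u η := fun η => by
    have e : ft u ((2 * Real.pi) • η) = ∫ y, osc (-((2 * Real.pi) • η)) y • u y := by
      simp only [ft, osc_neg_left_comm]
    rw [e, integral_osc_eq_fourier, smul_neg, neg_smul, neg_neg, smul_smul,
      inv_mul_cancel₀ hpi, one_smul]
  have hfi : Integrable (FourierTransform.fourier u) := by
    obtain ⟨C, hC0, hC⟩ := exists_ft_decay hu huc (n + 1)
    have h1 : Integrable (ft u) := (integrable_inv_one_add_norm_pow.const_mul C).mono'
      (continuous_ft hui).aestronglyMeasurable (Eventually.of_forall hC)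
    have := h1.comp_smul hpi
    exact this.congr (Eventually.of_forall e1)
  have e2 := MeasureTheory.Measure.integral_comp_smul volume (fun η => osc x η • ft u η) (2 * Real.pi)
  rw [finrank_euclideanSpace_fin, abs_of_nonneg (by positivity)] at e2
  rw [← e2]
  have e3 : ∀ η, osc x ((2 * Real.pi) • η) • ft u ((2 * Real.pi) • η) =
      osc ((2 * Real.pi) • x) η • FourierTransform.fourier u η := fun η => by
    rw [e1, osc_smul_left]
  simp only [e3]
  rw [integral_osc_eq_fourier, neg_smul, smul_smul, inv_mul_cancel₀ hpi, one_smul,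
    ← Real.fourierInv_eq_fourier_neg]
  exact hui.fourierInv_fourier_eq hfi hu.continuous.continuousAt

lemma ft_osc_smul (u : Rn n → F) (t : ℝ) (ξ η : Rn n) :
    ft (fun y => osc (t • ξ) y • u y) η = ft u (η - t • ξ) := by
  simp only [ft]
  congr 1
  ext y
  rw [smul_smul]
  congr 1
  rw [osc_neg_left_comm, ← osc_add_left, osc_neg_left_comm]
  congr 1
  abel

/-- Testing a pseudodifferential operator on oscillating functions yields its principal symbol. -/
lemma IsSymbol.tendsto_quantize_osc (h : IsSymbol m V p pj) (hV : IsOpen V) (hm : 0 ≤ m)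
    {x : Rn n} (hx : x ∈ V) {ξ : Rn n} (hξ : ξ ≠ 0) {u : Rn n → F} (hu : ContDiff ℝ ∞ u)
    (huc : HasCompactSupport u) :
    Tendsto (fun t : ℝ => (t ^ m)⁻¹ • osc (-(t • ξ)) x • (((2 * Real.pi) ^ n : ℝ)⁻¹ •
      ∫ η, osc x η • p x η (ft (fun y => osc (t • ξ) y • u y) η))) atTop
      (𝓝 (pj 0 x ξ (u x))) := by
  obtain ⟨C, hC0, hC⟩ := h.exists_bound hV isCompact_singleton (singleton_subset_iff.2 hx)
  have hui : Integrable u := hu.continuous.integrable_of_hasCompactSupport huc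
  set k := m.toNat with hk
  obtain ⟨C', hC'0, hC'⟩ := exists_ft_decay hu huc (k + (n + 1))
  -- Modulating u translates its transform by tξ. Shifting the integration variable moves the
  -- translation into the symbol and cancels the outer oscillating factor.
  have e : ∀ t : ℝ, (t ^ m)⁻¹ • osc (-(t • ξ)) x • (((2 * Real.pi) ^ n : ℝ)⁻¹ •
      ∫ η, osc x η • p x η (ft (fun y => osc (t • ξ) y • u y) η)) =
      ((2 * Real.pi) ^ n : ℝ)⁻¹ •
        ∫ η, osc x η • ((t ^ m)⁻¹ • p x (η + t • ξ)) (ft u η) := fun t => by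
    simp only [ft_osc_smul]
    rw [← integral_add_right_eq_self (fun η => osc x η • p x η (ft u (η - t • ξ))) (t • ξ),
      smul_comm (osc _ _), smul_comm ((t ^ m)⁻¹), ← integral_smul, ← integral_smul]
    congr 2
    ext η
    rw [add_sub_cancel_right, smul_apply, smul_smul, smul_comm ((t ^ m)⁻¹)]
    congr 1
    rw [osc_comm x (η + t • ξ), osc_add_left, osc_comm x η, mul_comm (osc η x), ← mul_assoc,
      ← osc_add_left, neg_add_cancel, osc_zero_left, one_mul]
  simp only [e]
  have hlim : Tendsto (fun t : ℝ => ∫ η, osc x η • ((t ^ m)⁻¹ • p x (η + t • ξ)) (ft u η)) atTop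
      (𝓝 (∫ η, osc x η • (pj 0 x ξ) (ft u η))) := by
    refine tendsto_integral_filter_of_dominated_convergence
      (fun η => C * (1 + ‖ξ‖) ^ k * C' * ((1 + ‖η‖) ^ (n + 1))⁻¹) ?_ ?_
      (integrable_inv_one_add_norm_pow.const_mul _) ?_
    · refine Eventually.of_forall fun t => Continuous.aestronglyMeasurable ?_
      have h1 : Continuous fun η => (t ^ m)⁻¹ • p x (η + t • ξ) := by
        have h2 := h.continuous_right hx
        fun_prop
      exact (continuous_osc_right x).smul (h1.clm_apply (continuous_ft hui))
    · filter_upwards [eventually_ge_atTop 1] with t ht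
      refine Eventually.of_forall fun η => ?_
      have ht0 : 0 < t := by linarith
      rw [norm_smul, norm_osc, one_mul, smul_apply, norm_smul, norm_inv, norm_zpow,
        Real.norm_of_nonneg ht0.le]
      have htm : t ^ m = t ^ k := by rw [← zpow_natCast, hk, Int.toNat_of_nonneg hm]
      -- For t ≥ 1, 1 + ‖η + tξ‖ ≤ t(1 + ‖η‖)(1 + ‖ξ‖). The resulting t^k cancels t^{-m} because m ≥
      -- 0, leaving a bound independent of t.
      have h1 : ‖p x (η + t • ξ)‖ ≤ C * (t ^ k * ((1 + ‖η‖) * (1 + ‖ξ‖)) ^ k) := by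
        refine (hC x rfl _).trans (mul_le_mul_of_nonneg_left ?_ hC0)
        rw [← mul_pow]
        refine pow_le_pow_left₀ (by positivity) ?_ _
        have h2 := norm_add_le η (t • ξ)
        rw [norm_smul, Real.norm_of_nonneg ht0.le] at h2
        nlinarith [norm_nonneg η, norm_nonneg ξ, mul_nonneg (norm_nonneg η) (norm_nonneg ξ)]
      have h3 : (0 : ℝ) < t ^ k := by positivity
      calc (t ^ m)⁻¹ * ‖p x (η + t • ξ) (ft u η)‖
          ≤ (t ^ k)⁻¹ * (C * (t ^ k * ((1 + ‖η‖) * (1 + ‖ξ‖)) ^ k) *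
            (C' * ((1 + ‖η‖) ^ (k + (n + 1)))⁻¹)) := by
            rw [htm]
            refine mul_le_mul_of_nonneg_left ?_ (by positivity)
            exact ((p x _).le_opNorm _).trans
              (mul_le_mul h1 (hC' η) (norm_nonneg _) (by positivity))
        _ = _ := by
            rw [mul_pow, pow_add]
            have : (1 + ‖η‖) ≠ 0 := by positivity
            field_simp
    · refine Eventually.of_forall fun η => ?_
      exact (((ContinuousLinearMap.apply ℂ F (ft u η)).continuous.tendsto _).comp
        (h.tendsto_scaled hx hξ η)).const_smul _
  have h2 := hlim.const_smul (((2 * Real.pi) ^ n : ℝ)⁻¹)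
  have h3 : ((2 * Real.pi) ^ n : ℝ)⁻¹ • ∫ η, osc x η • (pj 0 x ξ) (ft u η) = pj 0 x ξ (u x) := by
    have hfi : Integrable (fun η => osc x η • ft u η) := by
      obtain ⟨D, hD0, hD⟩ := exists_ft_decay hu huc (n + 1)
      refine (integrable_inv_one_add_norm_pow.const_mul D).mono'
        ((continuous_osc_right x).smul (continuous_ft hui)).aestronglyMeasurable
        (Eventually.of_forall fun η => ?_)
      rw [norm_smul, norm_osc, one_mul]
      exact hD η
    rw [← integral_osc_ft hu huc x, (pj 0 x ξ).map_smul_of_tower,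
      ← (pj 0 x ξ).integral_comp_comm hfi]
    simp only [map_smul]
  rwa [h3] at h2

/-- The Riemann–Lebesgue lemma. It removes the smoothing contributions when operators are tested on
oscillating functions. -/
lemma tendsto_integral_osc_apply {f : Rn n → F} {ξ : Rn n} (hξ : ξ ≠ 0) :
    Tendsto (fun t : ℝ => ∫ y, osc (t • ξ) y • f y) atTop (𝓝 0) := by
  have h1 : Tendsto (fun t : ℝ => -((2 * Real.pi)⁻¹ : ℝ) • t • ξ) atTop (cocompact (Rn n)) := by
    rw [← Metric.cobounded_eq_cocompact, ← tendsto_norm_atTop_iff_cobounded]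
    have : (fun t : ℝ => ‖-((2 * Real.pi)⁻¹ : ℝ) • t • ξ‖) =
        fun t : ℝ => |t| * (‖-((2 * Real.pi)⁻¹ : ℝ)‖ * ‖ξ‖) := by
      ext t
      rw [norm_smul, norm_smul, Real.norm_eq_abs t]
      ring
    rw [this]
    refine tendsto_abs_atTop_atTop.atTop_mul_const ?_
    have := norm_pos_iff.2 hξ
    have : (0 : ℝ) < (2 * Real.pi)⁻¹ := by positivity
    rw [norm_neg, Real.norm_of_nonneg this.le]
    positivity
  simp only [integral_osc_eq_fourier]
  exact (tendsto_integral_exp_inner_smul_cocompact f).comp h1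

end Growth

end

end PsiDO

namespace PsiDO

open MeasureTheory Set Filter Topology Function

noncomputable section

set_option linter.unusedSectionVars false

/-! ### The principal symbol -/

section Principal

variable {n : ℕ} {M : Type*} [TopologicalSpace M] [ChartedSpace (Rn n) M] [IsManifold (𝓡 n) ∞ M]
  {F : Type*} [NormedAddCommGroup F] [NormedSpace ℂ F]
  {E : M → Type*} [TopologicalSpace (TotalSpace F E)] [∀ x, TopologicalSpace (E x)]
  [∀ x, AddCommGroup (E x)] [∀ x, Module ℂ (E x)]
  [FiberBundle F E] [VectorBundle ℂ F E] [VectorBundle ℝ F E]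
  [ContMDiffVectorBundle ∞ F E (𝓡 n)]

variable {c : LocalCoords n F E} {P P' : Op n F E} {m : ℤ}
  {p : Rn n → Rn n → F →L[ℂ] F} {pj : ℕ → Rn n → Rn n → F →L[ℂ] F}

lemma HasLocalSymbol.loc_eq (h : HasLocalSymbol c m P p pj) :
    ∃ r : Rn n → Rn n → F →L[ℂ] F, ContDiffOn ℝ ∞ (uncurry r) (c.dom ×ˢ c.dom) ∧
      ∀ u : TestSections n F E, secSupport u.1 ⊆ c.chart.source → ∀ x ∈ c.dom,
        c.loc (P u).1 x = ((2 * Real.pi) ^ n : ℝ)⁻¹ • (∫ ξ, osc x ξ • p x ξ (ft (c.cloc u.1) ξ)) +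
          ∫ y, r x y (c.cloc u.1 y) := by
  obtain ⟨-, r, hr, hloc⟩ := h
  refine ⟨r, hr, fun u hu x hx => ?_⟩
  rw [hloc u hu x hx, c.quantize_loc, c.setIntegral_loc]

/-- For m ≥ 0 and t ≥ 1 the prefactor has norm at most one. -/
lemma tendsto_oscillating_zero {z : ℝ → F} (hm : 0 ≤ m) (hz : Tendsto z atTop (𝓝 0))
    (x ξ : Rn n) :
    Tendsto (fun t : ℝ => (t ^ m)⁻¹ • osc (-(t • ξ)) x • z t) atTop (𝓝 0) := by
  refine squeeze_zero_norm' ?_ (tendsto_zero_iff_norm_tendsto_zero.1 hz)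
  filter_upwards [eventually_ge_atTop 1] with t ht
  rw [norm_smul, norm_smul, norm_osc, one_mul, norm_inv, norm_zpow,
    Real.norm_of_nonneg (by linarith)]
  exact mul_le_of_le_one_left (norm_nonneg _) (inv_le_one_of_one_le₀ (one_le_zpow₀ ht hm))

variable [CompleteSpace F]

lemma tendsto_smooth_oscillating {r : Rn n → Rn n → F →L[ℂ] F}
    {x : Rn n} {ξ : Rn n} (hξ : ξ ≠ 0) {u : Rn n → F} {v : ℝ → Rn n → F}
    (hv : ∀ t, v t = fun y => osc (t • ξ) y • u y) :
    Tendsto (fun t => ∫ y, r x y (v t y)) atTop (𝓝 0) := by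
  refine (tendsto_integral_osc_apply (f := fun y => r x y (u y)) hξ).congr fun t => ?_
  simp only [hv, map_smul]

lemma HasLocalSymbol.tendsto_oscillating (h : HasLocalSymbol c m P p pj) (hm : 0 ≤ m)
    {x : Rn n} (hx : x ∈ c.dom) {ξ : Rn n} (hξ : ξ ≠ 0) {u : Rn n → F} (hu : ContDiff ℝ ∞ u)
    (huc : HasCompactSupport u) {v : ℝ → TestSections n F E}
    (hvs : ∀ t, secSupport (v t).1 ⊆ c.chart.source)
    (hv : ∀ t, c.cloc (v t).1 = fun y => osc (t • ξ) y • u y) :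
    Tendsto (fun t : ℝ => (t ^ m)⁻¹ • osc (-(t • ξ)) x • c.loc (P (v t)).1 x) atTop
      (𝓝 (pj 0 x ξ (u x))) := by
  obtain ⟨r, hr, hloc⟩ := h.loc_eq
  have h1 := h.1.tendsto_quantize_osc c.isOpen_dom hm hx hξ hu huc
  have h2 := tendsto_oscillating_zero hm (tendsto_smooth_oscillating (r := r) (x := x)
    hξ hv) x ξ
  have h3 := h1.add h2
  rw [add_zero] at h3
  refine h3.congr fun t => ?_
  rw [hloc (v t) (hvs t) x hx, smul_add, smul_add]
  congr 5
  simp only [hv]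

variable [T2Space M]

/-- P' is tested on oscillating sections in two ways, through its own symbol and through αPβ, where
βu replaces u; the smoothing difference disappears in the limit. This needs no symbolic calculus and
holds for any choice of the two local symbols. -/
lemma principal_conjugate {p' : Rn n → Rn n → F →L[ℂ] F} {pj' : ℕ → Rn n → Rn n → F →L[ℂ] F}
    (h : HasLocalSymbol c m P p pj) (h' : HasLocalSymbol c m P' p' pj') (hm : 0 ≤ m)
    {α β : C^∞⟮𝓡 n, M; 𝓘(ℝ, ℝ), ℝ⟯}
    (hR : IsSmoothing (P' - mulSmooth α ∘ₗ P ∘ₗ mulTest β)) {x : Rn n} (hx : x ∈ c.dom)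
    {ξ : Rn n} (hξ : ξ ≠ 0) :
    pj' 0 x ξ = (α (c.chart.symm x) * β (c.chart.symm x)) • pj 0 x ξ := by
  ext w
  obtain ⟨ε, hε, hball⟩ := Metric.nhds_basis_closedBall.mem_iff.1 (c.isOpen_dom.mem_nhds hx)
  let φ : ContDiffBump x := ⟨ε / 2, ε, by positivity, by linarith⟩
  let u : Rn n → F := fun y => φ y • w
  have hu : ContDiff ℝ ∞ u := φ.contDiff.smul contDiff_const
  have hsup : tsupport u ⊆ tsupport φ := closure_mono fun y hy h => hy (by simp [u, h])
  have huc : HasCompactSupport u := φ.hasCompactSupport.smul_right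
  have hud : tsupport u ⊆ c.dom := hsup.trans (by rw [φ.tsupport_eq]; exact hball)
  have hux : u x = w := by simp [u, φ.one_of_mem_closedBall (Metric.mem_closedBall_self φ.rIn_pos.le)]
  let ut : ℝ → Rn n → F := fun t y => osc (t • ξ) y • u y
  have hut : ∀ t, ContDiff ℝ ∞ (ut t) := fun t =>
    (contDiff_osc.comp (contDiff_const.prodMk contDiff_id)).smul hu
  have hutc : ∀ t, HasCompactSupport (ut t) := fun t => huc.smul_left
  have hutd : ∀ t, tsupport (ut t) ⊆ c.dom := fun t => by
    have h1 : support (ut t) ⊆ support u := fun y hy h => hy (by simp [ut, h])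
    exact (closure_mono h1).trans hud
  let v : ℝ → TestSections n F E := fun t => c.testOf (ut t) (hut t) (hutc t) (hutd t)
  have hvs : ∀ t, secSupport (v t).1 ⊆ c.chart.source := fun t =>
    c.secSupport_testOf_subset_source _ _ _
  have hv : ∀ t, c.cloc (v t).1 = fun y => osc (t • ξ) y • u y := fun t =>
    c.cloc_testOf (hut t) (hutc t) (hutd t)
  have l1 := h'.tendsto_oscillating hm hx hξ hu huc hvs hv
  let uβ : Rn n → F := c.cloc (mulTest β (c.testOf u hu huc hud)).1
  have huβ : ∀ y, uβ y = β (c.chart.symm y) • u y := fun y => by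
    have := c.cloc_mul β (c.testOf u hu huc hud).1 y
    rw [c.cloc_testOf] at this
    exact this
  have hsβ : secSupport (mulTest β (c.testOf u hu huc hud)).1 ⊆ c.chart.source :=
    (secSupport_smul_subset β _).trans (c.secSupport_testOf_subset_source hu huc hud)
  have l2 := h.tendsto_oscillating hm hx hξ (u := uβ)
    (LocalCoords.contDiff_cloc hsβ (mulTest β _).2.1 (mulTest β _).2.2)
    (LocalCoords.hasCompactSupport_cloc hsβ (mulTest β _).2.2)
    (v := fun t => mulTest β (v t))
    (fun t => (secSupport_smul_subset β _).trans (hvs t))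
    (fun t => by
      ext y
      refine (c.cloc_mul β (v t).1 y).trans ?_
      rw [hv, huβ, smul_comm])
  obtain ⟨r, hr, hrR⟩ := hR c c
  have l3 := tendsto_oscillating_zero hm (tendsto_smooth_oscillating (r := r) (x := x)
    hξ hv) x ξ
  have l4 := (l2.const_smul (α (c.chart.symm x))).add l3
  rw [add_zero, huβ, hux, (pj 0 x ξ).map_smul_of_tower, smul_smul] at l4
  rw [hux] at l1
  refine tendsto_nhds_unique l1 (l4.congr fun t => ?_)
  have e2 := hrR (v t) (hvs t) x hx
  have e3 : (P' (v t)).1 = ((P' - mulSmooth α ∘ₗ P ∘ₗ mulTest β) (v t)).1 +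
      fun x => α x • (P (mulTest β (v t))).1 x := by
    change _ = ((P' (v t)).1 - fun x => α x • (P (mulTest β (v t))).1 x) + _
    abel
  rw [e3, LocalCoords.loc_add hx, LocalCoords.loc_mul hx, e2, c.setIntegral_loc, smul_add, smul_add,
    add_comm, smul_comm (α (c.chart.symm x)), smul_comm (α (c.chart.symm x))]

lemma IsElliptic.conjugate (h : IsElliptic m P) (hP' : IsPsiDO m P') (hm : 0 ≤ m)
    {α β : C^∞⟮𝓡 n, M; 𝓘(ℝ, ℝ), ℝ⟯} (hα : ∀ x, α x ≠ 0) (hβ : ∀ x, β x ≠ 0)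
    (hR : IsSmoothing (P' - mulSmooth α ∘ₗ P ∘ₗ mulTest β)) : IsElliptic m P' := by
  intro c
  obtain ⟨p, pj, hp, hell⟩ := h c
  obtain ⟨p', pj', hp'⟩ := hP'.local_form c
  refine ⟨p', pj', hp', fun x hx ξ hξ => ?_⟩
  rw [principal_conjugate hp hp' hm hR hx hξ]
  have h0 : α (c.chart.symm x) * β (c.chart.symm x) ≠ 0 := mul_ne_zero (hα _) (hβ _)
  exact (Units.mk0 _ h0 • (hell x hx ξ hξ).unit).isUnit

end Principal

end

end PsiDO

namespace PsiDO

open MeasureTheory Set Filter Topology Function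

noncomputable section

set_option linter.unusedSectionVars false

/-! ### Sequences that converge to zero against smooth kernels -/

section Null

universe u

variable {n : ℕ} {F : Type u} [NormedAddCommGroup F] [NormedSpace ℂ F]
  {V W : Set (Rn n)}

lemma tendstoUniformlyOn_zero_iff {X G : Type*} [NormedAddCommGroup G] {f : ℕ → X → G}
    {L : Set X} : TendstoUniformlyOn f (fun _ => 0) atTop L ↔
      ∀ ε > 0, ∀ᶠ j in atTop, ∀ x ∈ L, ‖f j x‖ < ε := by
  rw [Metric.tendstoUniformlyOn_iff]
  simp only [dist_zero_left]

lemma tendstoUniformlyOn_zero_of_le {X G : Type*} [NormedAddCommGroup G] {f : ℕ → X → G}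
    {L : Set X} {b : ℕ → ℝ} (hb : Tendsto b atTop (𝓝 0)) (hf : ∀ j, ∀ x ∈ L, ‖f j x‖ ≤ b j) :
    TendstoUniformlyOn f (fun _ => 0) atTop L := by
  rw [tendstoUniformlyOn_zero_iff]
  intro ε hε
  filter_upwards [hb.eventually (gt_mem_nhds hε)] with j hj x hx
  exact (hf j x hx).trans_lt hj

lemma ContDiffOn.apply_complex {X G : Type*} [NormedAddCommGroup X] [NormedSpace ℝ X]
    [NormedAddCommGroup G] [NormedSpace ℂ G] {S : Set X} {f : X → F →L[ℂ] G} {g : X → F}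
    (hf : ContDiffOn ℝ ∞ f S) (hg : ContDiffOn ℝ ∞ g S) :
    ContDiffOn ℝ ∞ (fun x => f x (g x)) S :=
  ((ContinuousLinearMap.restrictScalarsL ℂ F G ℝ ℝ).contDiff.comp_contDiffOn hf).clm_apply hg

lemma contDiffOn_kernel_apply {s : Rn n → Rn n → F →L[ℂ] F}
    (hs : ContDiffOn ℝ ∞ (uncurry s) (V ×ˢ W)) (hV : IsOpen V) (hW : IsOpen W) {w : Rn n → F}
    (hw : ContDiff ℝ ∞ w) (hwW : tsupport w ⊆ W) :
    ContDiffOn ℝ ∞ (fun z : Rn n × Rn n => s z.1 z.2 (w z.2)) (V ×ˢ univ) := by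
  rintro ⟨x, y⟩ ⟨hx, -⟩
  refine ContDiffAt.contDiffWithinAt ?_
  by_cases hy : y ∈ tsupport w
  · have h1 : ContDiffOn ℝ ∞ (fun z : Rn n × Rn n => s z.1 z.2 (w z.2)) (V ×ˢ W) :=
      ContDiffOn.apply_complex (f := uncurry s) hs (hw.comp contDiff_snd).contDiffOn
    exact h1.contDiffAt ((hV.prod hW).mem_nhds ⟨hx, hwW hy⟩)
  · refine contDiffAt_const (c := (0 : F)) |>.congr_of_eventuallyEq ?_
    have hop : (tsupport w)ᶜ ∈ 𝓝 y := (isClosed_tsupport w).isOpen_compl.mem_nhds hy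
    have : ∀ᶠ z : Rn n × Rn n in 𝓝 (x, y), z.2 ∈ (tsupport w)ᶜ :=
      (continuous_snd.tendsto (x, y)).eventually_mem hop
    filter_upwards [this] with z hz
    rw [image_eq_zero_of_notMem_tsupport hz, map_zero]

lemma hasFDerivAt_integral_of_contDiffOn {H : Type*} [NormedAddCommGroup H] [NormedSpace ℝ H]
    {h : Rn n × Rn n → H} (hh : ContDiffOn ℝ ∞ h (V ×ˢ univ)) (hV : IsOpen V)
    {K : Set (Rn n)} (hK : IsCompact K) (h0 : ∀ x, ∀ y ∉ K, h (x, y) = 0) {x : Rn n} (hx : x ∈ V) :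
    Integrable (fun y => fderiv ℝ (fun x => h (x, y)) x) ∧
    HasFDerivAt (fun x => ∫ y, h (x, y)) (∫ y, fderiv ℝ (fun x => h (x, y)) x) x := by
  obtain ⟨ε, hε, hball⟩ := Metric.nhds_basis_closedBall.mem_iff.1 (hV.mem_nhds hx)
  have hO : IsOpen (V ×ˢ (univ : Set (Rn n))) := hV.prod isOpen_univ
  have hd := contDiffOn_partial_fst_fderiv hO hh
  have hzero : ∀ x, ∀ y ∉ K, fderiv ℝ (fun x => h (x, y)) x = 0 := fun x y hy => by
    have : (fun x => h (x, y)) = fun _ => 0 := funext fun x => h0 x y hy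
    rw [this]
    exact fderiv_const_apply 0
  have hcont : ∀ x ∈ V, Continuous fun y => h (x, y) := fun x hx =>
    hh.continuousOn.comp_continuous (f := fun y => (x, y)) (by fun_prop) fun y => ⟨hx, mem_univ _⟩
  have hcont' : ∀ x ∈ V, Continuous fun y => fderiv ℝ (fun x => h (x, y)) x := fun x hx =>
    hd.continuousOn.comp_continuous (f := fun y => (x, y)) (by fun_prop) fun y => ⟨hx, mem_univ _⟩
  obtain ⟨B, hB⟩ := ((isCompact_closedBall x ε).prod hK).exists_bound_of_continuousOn
    (hd.continuousOn.mono (prod_mono hball (subset_univ _)))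
  refine ⟨(hcont' x hx).integrable_of_hasCompactSupport (HasCompactSupport.intro hK (hzero x)), ?_⟩
  refine hasFDerivAt_integral_of_dominated_of_fderiv_le (𝕜 := ℝ) (bound := K.indicator fun _ => B)
    (F := fun x y => h (x, y)) (F' := fun x y => fderiv ℝ (fun x => h (x, y)) x)
    (Metric.closedBall_mem_nhds x hε) ?_ ?_ (hcont' x hx).aestronglyMeasurable ?_ ?_ ?_
  · filter_upwards [hV.mem_nhds hx] with z hz using (hcont z hz).aestronglyMeasurable
  · exact (hcont x hx).integrable_of_hasCompactSupport (HasCompactSupport.intro hK (h0 x))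
  · refine Eventually.of_forall fun y z hz => ?_
    by_cases hy : y ∈ K
    · rw [indicator_of_mem hy]
      exact hB (z, y) ⟨hz, hy⟩
    · rw [indicator_of_notMem hy, hzero z y hy, norm_zero]
  · exact (integrable_indicator_iff hK.measurableSet).2
      (integrableOn_const hK.measure_lt_top.ne)
  · exact Eventually.of_forall fun y z hz =>
      hasFDerivAt_partial_fst hO hh (p := (z, y)) ⟨hball hz, mem_univ _⟩

/-- The partial derivative of a kernel in the direction of the `i`-th coordinate of the first
variable. -/
def kernelDeriv (i : Fin n) (s : Rn n → Rn n → F →L[ℂ] F) (x y : Rn n) : F →L[ℂ] F :=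
  fderiv ℝ (fun x => s x y) x (EuclideanSpace.single i 1)

lemma contDiffOn_kernelDeriv (i : Fin n) {s : Rn n → Rn n → F →L[ℂ] F}
    (hs : ContDiffOn ℝ ∞ (uncurry s) (V ×ˢ W)) (hV : IsOpen V) (hW : IsOpen W) :
    ContDiffOn ℝ ∞ (uncurry (kernelDeriv i s)) (V ×ˢ W) :=
  (contDiffOn_partial_fst_fderiv (hV.prod hW) hs).clm_apply contDiffOn_const

section CoordForm

variable {H : Type*} [NormedAddCommGroup H] [NormedSpace ℝ H]

/-- The linear map that sends `v` to `v dx_i`. -/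
def coordForm (i : Fin n) : H →L[ℝ] Rn n →L[ℝ] H :=
  ContinuousLinearMap.smulRightL ℝ (Rn n) H (EuclideanSpace.proj i)

/-- Nullity is tested against kernels with values in `F →L[ℂ] F`. Derivatives of such a kernel in
coordinate directions are again of this type, and `coordForm` reassembles the full derivative from
them. -/
lemma eq_sum_coordForm (T : Rn n →L[ℝ] H) :
    T = ∑ i, coordForm i (T (EuclideanSpace.single i 1)) := by
  ext v
  have h1 : v = ∑ i, v i • EuclideanSpace.single i (1 : ℝ) := by
    have := (EuclideanSpace.basisFun (Fin n) ℝ).sum_repr v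
    simpa using this.symm
  conv_lhs => rw [h1, map_sum]
  rw [sum_apply]
  refine Finset.sum_congr rfl fun i _ => ?_
  rw [map_smul]
  rfl

variable {H' : Type*} [NormedAddCommGroup H'] [NormedSpace ℝ H'] (T : Fin n → H →L[ℝ] H')

lemma contDiffOn_sum_clm {k : ℕ} {G : Fin n → Rn n → H} (hG : ∀ i, ContDiffOn ℝ k (G i) V) :
    ContDiffOn ℝ k (fun x => ∑ i, T i (G i x)) V :=
  ContDiffOn.sum fun i _ => (T i).contDiff.comp_contDiffOn (hG i)

lemma exists_bound_iteratedFDeriv_sum_clm :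
    ∃ A : ℝ, 0 ≤ A ∧ ∀ (k : ℕ) (G : Fin n → Rn n → H) (x : Rn n),
      (∀ i, ContDiffAt ℝ k (G i) x) →
      ‖iteratedFDeriv ℝ k (fun x => ∑ i, T i (G i x)) x‖ ≤
        A * ∑ i, ‖iteratedFDeriv ℝ k (G i) x‖ := by
  refine ⟨∑ i, ‖T i‖, by positivity, fun k G x hG => ?_⟩
  have h1 : ∀ i ∈ Finset.univ, ContDiffAt ℝ k (T i ∘ G i) x := fun i _ =>
    (T i).contDiff.contDiffAt.comp x (hG i)
  have e := iteratedFDeriv_fun_sum_apply h1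
  simp only [comp_apply] at e
  rw [e, Finset.mul_sum]
  refine (norm_sum_le _ _).trans (Finset.sum_le_sum fun i _ => ?_)
  rw [(T i).iteratedFDeriv_comp_left (hG i) le_rfl]
  exact ((T i).norm_compContinuousMultilinearMap_le _).trans (mul_le_mul_of_nonneg_right
    (Finset.single_le_sum (f := fun i => ‖T i‖) (fun _ _ => norm_nonneg _) (Finset.mem_univ i))
    (norm_nonneg _))

end CoordForm

section Derivatives

variable [CompleteSpace F] {s : Rn n → Rn n → F →L[ℂ] F}
  (hs : ContDiffOn ℝ ∞ (uncurry s) (V ×ˢ W)) (hV : IsOpen V) (hW : IsOpen W) {w : Rn n → F}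
  (hw : ContDiff ℝ ∞ w) (hwc : HasCompactSupport w) (hwW : tsupport w ⊆ W)

include hs hV hW hw hwc hwW

lemma hasFDerivAt_kernelInt {x : Rn n} (hx : x ∈ V) :
    HasFDerivAt (fun x => ∫ y, s x y (w y))
      (∑ i, coordForm i (∫ y, kernelDeriv i s x y (w y))) x := by
  have hh := contDiffOn_kernel_apply hs hV hW hw hwW
  obtain ⟨hint, hder⟩ := hasFDerivAt_integral_of_contDiffOn hh hV hwc.isCompact
    (fun x y hy => by simp only [image_eq_zero_of_notMem_tsupport hy, map_zero]) hx
  convert hder using 1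
  rw [eq_sum_coordForm (∫ y, fderiv ℝ (fun x => s x y (w y)) x)]
  refine Finset.sum_congr rfl fun i _ => ?_
  congr 1
  rw [ContinuousLinearMap.integral_apply hint]
  refine integral_congr_ae (Eventually.of_forall fun y => ?_)
  by_cases hy : y ∈ tsupport w
  · have h1 : HasFDerivAt (fun x => s x y) (fderiv ℝ (fun x => s x y) x) x :=
      hasFDerivAt_partial_fst (hV.prod hW) hs (p := (x, y)) ⟨hx, hwW hy⟩
    have h2 := (((ContinuousLinearMap.apply ℂ F (w y)).restrictScalars ℝ).hasFDerivAt
      (x := s x y)).comp x h1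
    have h3 : HasFDerivAt (fun x => s x y (w y)) _ x := h2
    simp only [h3.fderiv]
    rfl
  · have : (fun x => s x y (w y)) = fun _ => 0 := funext fun x => by
      rw [image_eq_zero_of_notMem_tsupport hy, map_zero]
    simp only [image_eq_zero_of_notMem_tsupport hy, map_zero]
    rw [fderiv_const_apply]
    rfl

lemma contDiffOn_kernelInt : ContDiffOn ℝ ∞ (fun x => ∫ y, s x y (w y)) V := by
  rw [contDiffOn_infty]
  intro k
  induction k generalizing s with
  | zero =>
    rw [Nat.cast_zero, contDiffOn_zero]
    exact fun x hx =>
      (hasFDerivAt_kernelInt hs hV hW hw hwc hwW hx).continuousAt.continuousWithinAt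
  | succ k ih =>
    rw [Nat.cast_succ, contDiffOn_succ_iff_fderiv_of_isOpen hV]
    refine ⟨fun x hx => (hasFDerivAt_kernelInt hs hV hW hw hwc hwW
      hx).differentiableAt.differentiableWithinAt, fun h => absurd h (by simp), ?_⟩
    have h1 : ContDiffOn ℝ k (fun x => ∑ i, coordForm i (∫ y, kernelDeriv i s x y (w y))) V :=
      contDiffOn_sum_clm (coordForm (H := F))
        (G := fun i x => ∫ y, kernelDeriv i s x y (w y)) fun i =>
          ih (contDiffOn_kernelDeriv i hs hV hW)
    exact h1.congr fun x hx => (hasFDerivAt_kernelInt hs hV hW hw hwc hwW hx).fderiv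

end Derivatives

/-- A sequence of functions on `W` whose integrals against smooth kernels converge to `0`. -/
def IsNull (W : Set (Rn n)) (w : ℕ → Rn n → F) : Prop :=
  ∀ (V : Set (Rn n)) (s : Rn n → Rn n → F →L[ℂ] F), IsOpen V →
    ContDiffOn ℝ ∞ (uncurry s) (V ×ˢ W) → ∀ L : Set (Rn n), IsCompact L → L ⊆ V →
      TendstoUniformlyOn (fun j x => ∫ y, s x y (w j y)) (fun _ => 0) atTop L

/-- Derivatives in x fall on the kernel, and a differentiated smooth kernel is a smooth kernel. As
nullity quantifies over all kernels, it controls derivatives of every order. -/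
lemma IsNull.tendsto_iteratedFDeriv [CompleteSpace F] {w : ℕ → Rn n → F} (h : IsNull W w)
    (hW : IsOpen W) (hw : ∀ j, ContDiff ℝ ∞ (w j)) (hwc : ∀ j, HasCompactSupport (w j))
    (hwW : ∀ j, tsupport (w j) ⊆ W) (hV : IsOpen V) {L : Set (Rn n)} (hL : IsCompact L)
    (hLV : L ⊆ V) (k : ℕ) : ∀ {s : Rn n → Rn n → F →L[ℂ] F},
    ContDiffOn ℝ ∞ (uncurry s) (V ×ˢ W) →
    TendstoUniformlyOn (fun j x => iteratedFDeriv ℝ k (fun x => ∫ y, s x y (w j y)) x)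
      (fun _ => 0) atTop L := by
  induction k with
  | zero =>
    intro s hs
    have := h V s hV hs L hL hLV
    rw [tendstoUniformlyOn_zero_iff] at this ⊢
    simpa only [norm_iteratedFDeriv_zero] using this
  | succ k ih =>
    intro s hs
    have h1 := fun i => ih (contDiffOn_kernelDeriv i hs hV hW)
    simp only [tendstoUniformlyOn_zero_iff] at h1 ⊢
    intro ε hε
    obtain ⟨A, hA0, hA⟩ := exists_bound_iteratedFDeriv_sum_clm (n := n) (coordForm (H := F))
    -- An error ε/(An + 1) in each of the n directions adds up, after the factor A, to less than ε.
    have hA1 : 0 < A * n + 1 := by positivity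
    filter_upwards [eventually_all.2 fun i => h1 i (ε / (A * n + 1)) (by positivity)] with j hj x hx
    rw [← norm_iteratedFDeriv_fderiv]
    have hx' := hLV hx
    have e1 : fderiv ℝ (fun x => ∫ y, s x y (w j y)) =ᶠ[𝓝 x]
        fun x => ∑ i, coordForm i (∫ y, kernelDeriv i s x y (w j y)) := by
      filter_upwards [hV.mem_nhds hx'] with z hz
      exact (hasFDerivAt_kernelInt hs hV hW (hw j) (hwc j) (hwW j) hz).fderiv
    have hsm : ∀ i, ContDiffAt ℝ k (fun x => ∫ y, kernelDeriv i s x y (w j y)) x := fun i =>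
      ((contDiffOn_kernelInt (contDiffOn_kernelDeriv i hs hV hW) hV hW (hw j) (hwc j)
        (hwW j)).contDiffAt (hV.mem_nhds hx')).of_le (by exact_mod_cast le_top)
    rw [(e1.iteratedFDeriv ℝ k).eq_of_nhds]
    calc _ ≤ A * ∑ i : Fin n, ε / (A * n + 1) :=
          (hA k _ x hsm).trans (mul_le_mul_of_nonneg_left
            (Finset.sum_le_sum fun i _ => (hj i x hx).le) hA0)
      _ = ε * (A * n / (A * n + 1)) := by
        rw [Finset.sum_const, Finset.card_univ, Fintype.card_fin, nsmul_eq_mul]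
        ring
      _ < ε := mul_lt_of_lt_one_right hε ((div_lt_one hA1).2 (lt_add_one _))

lemma exists_bound_kernel {s : Rn n → Rn n → F →L[ℂ] F}
    (hs : ContDiffOn ℝ ∞ (uncurry s) (V ×ˢ W)) {L K : Set (Rn n)} (hL : IsCompact L) (hLV : L ⊆ V)
    (hK : IsCompact K) (hKW : K ⊆ W) : ∃ B : ℝ, 0 ≤ B ∧ ∀ x ∈ L, ∀ y ∈ K, ‖s x y‖ ≤ B := by
  obtain ⟨B, hB⟩ := (hL.prod hK).exists_bound_of_continuousOn
    (hs.continuousOn.mono (prod_mono hLV hKW))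
  exact ⟨|B|, abs_nonneg B, fun x hx y hy => (hB (x, y) ⟨hx, hy⟩).trans (le_abs_self B)⟩

/-- The kernels are bounded on compact sets and all w j are supported in the same compact K, so the
integrals are controlled by the L¹ norms. -/
lemma isNull_of_tendsto_integral [CompleteSpace F] {w : ℕ → Rn n → F}
    (hw : ∀ j, Integrable (w j)) {K : Set (Rn n)}
    (hK : IsCompact K) (hKW : K ⊆ W) (hwK : ∀ j, ∀ y ∉ K, w j y = 0)
    (h : Tendsto (fun j => ∫ y, ‖w j y‖) atTop (𝓝 0)) : IsNull W w := by
  intro V s hV hs L hL hLV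
  obtain ⟨B, hB0, hB⟩ := exists_bound_kernel hs hL hLV hK hKW
  have h1 := h.const_mul B
  rw [mul_zero] at h1
  refine tendstoUniformlyOn_zero_of_le h1 fun j x hx => norm_integral_apply_le (hw j) fun y hy => ?_
  exact hB x hx y (by_contra fun hy' => hy (hwK j y hy'))

lemma isNull_of_tendstoUniformlyOn [CompleteSpace F] {w : ℕ → Rn n → F}
    (hw : ∀ j, Continuous (w j)) {K : Set (Rn n)} (hK : IsCompact K) (hKW : K ⊆ W)
    (hwK : ∀ j, ∀ y ∉ K, w j y = 0) (h : TendstoUniformlyOn w (fun _ => 0) atTop K) :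
    IsNull W w := by
  have hi : ∀ j, Integrable (w j) := fun j =>
    (hw j).integrable_of_hasCompactSupport (HasCompactSupport.intro hK (hwK j))
  refine isNull_of_tendsto_integral hi hK hKW hwK ?_
  rw [tendstoUniformlyOn_zero_iff] at h
  rw [Metric.tendsto_nhds]
  intro ε hε
  have hv : 0 < volume.real K + 1 := by positivity
  filter_upwards [h (ε / (volume.real K + 1)) (by positivity)] with j hj
  have e : ∫ y, ‖w j y‖ = ∫ y in K, ‖w j y‖ :=
    (setIntegral_eq_integral_of_forall_compl_eq_zero fun y hy => by simp [hwK j y hy]).symm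
  rw [dist_zero_right, Real.norm_of_nonneg (integral_nonneg fun y => norm_nonneg _), e]
  have h2 : (fun y => ‖w j y‖) ≤ᵐ[volume.restrict K] fun _ => ε / (volume.real K + 1) := by
    filter_upwards [ae_restrict_mem hK.measurableSet] with y hy using (hj y hy).le
  have h3 := integral_mono_ae (hi j).norm.integrableOn
    (integrableOn_const hK.measure_lt_top.ne) h2
  refine h3.trans_lt ?_
  rw [setIntegral_const, smul_eq_mul, ← mul_div_assoc, div_lt_iff₀ hv, mul_comm]
  exact mul_lt_mul_of_pos_left (lt_add_one _) hε

lemma IsNull.add [CompleteSpace F] {w w' : ℕ → Rn n → F} (h : IsNull W w) (h' : IsNull W w')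
    (hW : IsOpen W) (hw : ∀ j, Continuous (w j)) (hwc : ∀ j, HasCompactSupport (w j))
    (hwW : ∀ j, tsupport (w j) ⊆ W) (hw' : ∀ j, Continuous (w' j))
    (hwc' : ∀ j, HasCompactSupport (w' j)) (hwW' : ∀ j, tsupport (w' j) ⊆ W) :
    IsNull W (fun j y => w j y + w' j y) := by
  intro V s hV hs L hL hLV
  have h1 := h V s hV hs L hL hLV
  have h2 := h' V s hV hs L hL hLV
  rw [tendstoUniformlyOn_zero_iff] at h1 h2 ⊢
  intro ε hε
  filter_upwards [h1 (ε / 2) (by positivity), h2 (ε / 2) (by positivity)] with j hj1 hj2 x hx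
  have hc : ContinuousOn (s x) W := ContinuousOn.comp (g := uncurry s) (f := fun y => (x, y))
    hs.continuousOn (by fun_prop) fun y hy => ⟨hLV hx, hy⟩
  simp only [map_add]
  rw [integral_add (integrable_apply_of_continuousOn hW hc (hw j) (hwc j) (hwW j))
    (integrable_apply_of_continuousOn hW hc (hw' j) (hwc' j) (hwW' j))]
  linarith [norm_add_le (∫ y, s x y (w j y)) (∫ y, s x y (w' j y)), hj1 x hx, hj2 x hx]

end Null

end

end PsiDO

namespace PsiDO

open MeasureTheory Set Filter Topology Function

noncomputable section

set_option linter.unusedSectionVars false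

/-! ### Pseudodifferential operators and sequences that converge to zero in `L¹` -/

section QuantizeNull

universe u

variable {n : ℕ} {F : Type u} [NormedAddCommGroup F] [NormedSpace ℂ F]
  {V W : Set (Rn n)} {q : Rn n → Rn n → F →L[ℂ] F} {qj : ℕ → Rn n → Rn n → F →L[ℂ] F} {m : ℤ}

section Bilinear

variable {X G H H' : Type*} [NormedAddCommGroup X] [NormedSpace ℝ X]
  [NormedAddCommGroup G] [NormedSpace ℝ G] [NormedAddCommGroup H] [NormedSpace ℝ H]
  [NormedAddCommGroup H'] [NormedSpace ℝ H'] (B : G →L[ℝ] H →L[ℝ] H') {U : Set X}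

lemma contDiffOn_bilinear {f : X → G} {g : X → H} (hf : ContDiffOn ℝ ∞ f U)
    (hg : ContDiffOn ℝ ∞ g U) : ContDiffOn ℝ ∞ (fun x => B (f x) (g x)) U :=
  (B.contDiff.comp_contDiffOn hf).clm_apply hg

-- Leibniz' rule, with ∑ (k choose i) = 2^k. The constant depends on B and N only, hence serves all
-- values of the parameters x and ξ below.
set_option synthInstance.maxHeartbeats 200000 in
lemma exists_bound_iteratedFDeriv_bilinear (N : ℕ) : ∃ A : ℝ, 0 ≤ A ∧
    ∀ (U : Set X) (f : X → G) (g : X → H), IsOpen U → ContDiffOn ℝ ∞ f U → ContDiffOn ℝ ∞ g U →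
      ∀ x ∈ U, ∀ k ≤ N, ∀ b b' : ℝ, (∀ i ≤ N, ‖iteratedFDeriv ℝ i f x‖ ≤ b) →
        (∀ i ≤ N, ‖iteratedFDeriv ℝ i g x‖ ≤ b') →
        ‖iteratedFDeriv ℝ k (fun y => B (f y) (g y)) x‖ ≤ A * (b * b') := by
  refine ⟨‖B‖ * 2 ^ N, by positivity, fun U f g hU hf hg x hx k hk b b' hb hb' => ?_⟩
  have hb0 : 0 ≤ b := (norm_nonneg _).trans (hb 0 (Nat.zero_le _))
  have hb0' : 0 ≤ b' := (norm_nonneg _).trans (hb' 0 (Nat.zero_le _))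
  have h1 := B.norm_iteratedFDerivWithin_le_of_bilinear hf hg hU.uniqueDiffOn hx (n := k)
    (by exact_mod_cast le_top)
  simp only [iteratedFDerivWithin_of_isOpen _ hU hx] at h1
  rw [mul_assoc]
  refine h1.trans (mul_le_mul_of_nonneg_left ?_ (by positivity))
  calc _ ≤ ∑ i ∈ Finset.range (k + 1), (k.choose i : ℝ) * (b * b') := by
        refine Finset.sum_le_sum fun i hi => ?_
        rw [mul_assoc]
        have hi' : i ≤ k := by simpa [Nat.lt_succ_iff] using hi
        gcongr
        · exact hb i (hi'.trans hk)
        · exact hb' (k - i) ((Nat.sub_le _ _).trans hk)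
    _ = 2 ^ k * (b * b') := by
        rw [← Finset.sum_mul, ← Nat.cast_sum, Nat.sum_range_choose]
        push_cast
        rfl
    _ ≤ _ := by
        gcongr
        norm_num

end Bilinear

lemma contDiff_cutoff_comp {θ : Rn n → ℝ} (hθ : ContDiff ℝ ∞ θ) (hθW : tsupport θ ⊆ W)
    (hW : IsOpen W) {f : Rn n → F →L[ℂ] F} (hf : ContDiffOn ℝ ∞ f W) :
    ContDiff ℝ ∞ (fun y => θ y • f y) := by
  rw [contDiff_iff_contDiffAt]
  intro y
  by_cases hy : y ∈ tsupport θ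
  · exact hθ.contDiffAt.smul (hf.contDiffAt (hW.mem_nhds (hθW hy)))
  · refine contDiffAt_const (c := (0 : F →L[ℂ] F)) |>.congr_of_eventuallyEq ?_
    filter_upwards [(isClosed_tsupport θ).isOpen_compl.mem_nhds hy] with z hz
    rw [image_eq_zero_of_notMem_tsupport hz, zero_smul]

lemma IsSymbol.contDiffOn_left (h : IsSymbol m W q qj) (ξ : Rn n) :
    ContDiffOn ℝ ∞ (fun y => q y ξ) W :=
  ContDiffOn.comp (g := uncurry q) (f := fun y : Rn n => (y, ξ)) h.smooth
    (contDiff_id.prodMk contDiff_const).contDiffOn fun _ hy => ⟨hy, mem_univ _⟩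

lemma contDiffOn_comp_complex {X : Type*} [NormedAddCommGroup X] [NormedSpace ℝ X] {S : Set X}
    {f g : X → F →L[ℂ] F} (hf : ContDiffOn ℝ ∞ f S) (hg : ContDiffOn ℝ ∞ g S) :
    ContDiffOn ℝ ∞ (fun x => (g x).comp (f x)) S :=
  contDiffOn_bilinear (compRightL F) hf hg

/-- The transpose of a pseudodifferential operator applied to a smooth kernel. -/
def bracket (s : Rn n → Rn n → F →L[ℂ] F) (θ : Rn n → ℝ) (q : Rn n → Rn n → F →L[ℂ] F)
    (x ξ : Rn n) : F →L[ℂ] F :=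
  ∫ y, osc ξ y • (θ y • (s x y).comp (q y ξ))

/-- The integrand is smooth and compactly supported in y, with y-derivatives of size (1 + ‖ξ‖)^{m⁺},
where m⁺ is `m.toNat`. Decay of order m⁺ + n + 1 of its Fourier integral at frequency ξ absorbs this
growth and leaves an integrable function of ξ. -/
lemma IsSymbol.exists_bound_bracket (h : IsSymbol m W q qj) (hW : IsOpen W) (hV : IsOpen V)
    {θ : Rn n → ℝ} (hθ : ContDiff ℝ ∞ θ) (hθc : HasCompactSupport θ) (hθW : tsupport θ ⊆ W)
    {s : Rn n → Rn n → F →L[ℂ] F} (hs : ContDiffOn ℝ ∞ (uncurry s) (V ×ˢ W))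
    {L : Set (Rn n)} (hL : IsCompact L) (hLV : L ⊆ V) :
    ∃ C : ℝ, 0 ≤ C ∧ ∀ x ∈ L, ∀ ξ, ‖bracket s θ q x ξ‖ ≤ C * ((1 + ‖ξ‖) ^ (n + 1))⁻¹ := by
  set N := m.toNat + (n + 1) with hN
  have hK : IsCompact (tsupport θ) := hθc.isCompact
  choose Cq hCq0 hCq using fun a => h.exists_growth hW hK hθW a
  have hsθ : ContDiffOn ℝ ∞ (fun z : Rn n × Rn n => θ z.2 • s z.1 z.2) (V ×ˢ W) :=
    (hθ.comp contDiff_snd).contDiffOn.smul hs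
  obtain ⟨Bs, hBs0, hBs⟩ := exists_bound_iteratedFDeriv_partial_snd (hV.prod hW) hsθ hL hK
    (prod_mono hLV hθW) N
  obtain ⟨C₀, hC₀0, hC₀⟩ := exists_fourier_decay_of_tower (G := F →L[ℂ] F) N hK
  obtain ⟨C₁, hC₁0, hC₁⟩ := exists_fourier_decay_of_tower (G := F →L[ℂ] F) 0 hK
  obtain ⟨A, hA0, hA⟩ : ∃ A : ℝ, 0 ≤ A ∧ ∀ x ∈ L, ∀ ξ, ∀ k ≤ N, ∀ y ∈ tsupport θ,
      ‖iteratedFDeriv ℝ k (fun y => θ y • (s x y).comp (q y ξ)) y‖ ≤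
        A * (1 + ‖ξ‖) ^ m.toNat := by
    obtain ⟨A, hA0, hA⟩ := exists_bound_iteratedFDeriv_bilinear (X := Rn n) (compRightL F) N
    have hsum := Finset.sum_nonneg fun a (_ : a ∈ Finset.range (N + 1)) => hCq0 a
    refine ⟨A * ((∑ a ∈ Finset.range (N + 1), Cq a) * Bs), by positivity,
      fun x hx ξ k hk y hy => ?_⟩
    have h1 := hA W _ (fun y => θ y • s x y) hW (h.contDiffOn_left ξ)
      (ContDiffOn.comp (g := fun z : Rn n × Rn n => θ z.2 • s z.1 z.2) (f := fun y : Rn n => (x, y))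
        hsθ (contDiff_const.prodMk contDiff_id).contDiffOn fun y hy => ⟨hLV hx, hy⟩)
      y (hθW hy) k hk ((∑ a ∈ Finset.range (N + 1), Cq a) * (1 + ‖ξ‖) ^ m.toNat) Bs
      (fun i hi => (hCq i y hy ξ).trans (mul_le_mul_of_nonneg_right
        (Finset.single_le_sum (f := Cq) (fun a _ => hCq0 a)
          (Finset.mem_range.2 (Nat.lt_succ_of_le hi))) (by positivity)))
      (fun i hi => hBs i hi x hx y hy)
    have e : (fun y => compRightL F (q y ξ) (θ y • s x y)) =
        fun y => θ y • (s x y).comp (q y ξ) := funext fun y => map_smul _ _ _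
    rw [e] at h1
    refine h1.trans (le_of_eq ?_)
    ring
  refine ⟨2 ^ N * ((C₀ + C₁) * A), by positivity, fun x hx ξ => ?_⟩
  have hf : ContDiff ℝ ∞ (fun y => θ y • (s x y).comp (q y ξ)) :=
    contDiff_cutoff_comp hθ hθW hW (contDiffOn_comp_complex (h.contDiffOn_left ξ)
      (ContDiffOn.comp (g := uncurry s) (f := fun y : Rn n => (x, y)) hs
        (contDiff_const.prodMk contDiff_id).contDiffOn fun y hy => ⟨hLV hx, hy⟩))
  have hf0 : ∀ y ∉ tsupport θ, θ y • (s x y).comp (q y ξ) = 0 := fun y hy => by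
    rw [image_eq_zero_of_notMem_tsupport hy, zero_smul]
  have b0 := hC₀ _ hf hf0 _ (hA x hx ξ) ξ
  have b1 := hC₁ _ hf hf0 _ (fun k hk => hA x hx ξ k (hk.trans (Nat.zero_le _))) ξ
  rw [pow_zero, one_mul] at b1
  change ‖ξ‖ ^ N * ‖bracket s θ q x ξ‖ ≤ _ at b0
  change ‖bracket s θ q x ξ‖ ≤ _ at b1
  have hp : (1 + ‖ξ‖) ^ N ≤ 2 ^ N * (1 + ‖ξ‖ ^ N) := by
    refine (add_pow_le zero_le_one (norm_nonneg ξ) N).trans ?_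
    rw [one_pow]
    gcongr
    · norm_num
    · omega
  rw [← div_eq_mul_inv, le_div_iff₀ (by positivity)]
  refine le_of_mul_le_mul_left ?_ (by positivity : 0 < (1 + ‖ξ‖) ^ m.toNat)
  calc (1 + ‖ξ‖) ^ m.toNat * (‖bracket s θ q x ξ‖ * (1 + ‖ξ‖) ^ (n + 1))
      = (1 + ‖ξ‖) ^ N * ‖bracket s θ q x ξ‖ := by rw [hN, pow_add]; ring
    _ ≤ 2 ^ N * (1 + ‖ξ‖ ^ N) * ‖bracket s θ q x ξ‖ := by gcongr
    _ = 2 ^ N * (‖ξ‖ ^ N * ‖bracket s θ q x ξ‖ + ‖bracket s θ q x ξ‖) := by ring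
    _ ≤ 2 ^ N * (C₀ * (A * (1 + ‖ξ‖) ^ m.toNat) + C₁ * (A * (1 + ‖ξ‖) ^ m.toNat)) := by gcongr
    _ = _ := by ring

variable [CompleteSpace F]

/-- Fubini transfers the operator from w to the smooth kernel. The cutoff θ makes the y-integral
compactly supported, and `ft w` decays faster than the symbol grows. -/
lemma IsSymbol.integral_kernel_quantize (h : IsSymbol m W q qj) (hW : IsOpen W)
    {θ : Rn n → ℝ} (hθ : ContDiff ℝ ∞ θ) (hθc : HasCompactSupport θ) (hθW : tsupport θ ⊆ W)
    {s : Rn n → F →L[ℂ] F} (hs : ContinuousOn s W)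
    {w : Rn n → F} (hw : ContDiff ℝ ∞ w) (hwc : HasCompactSupport w) (x : Rn n) :
    ∫ y, s y (θ y • ∫ ξ, osc y ξ • q y ξ (ft w ξ)) =
      ∫ ξ, bracket (fun _ y => s y) θ q x ξ (ft w ξ) := by
  have hwi : Integrable w := hw.continuous.integrable_of_hasCompactSupport hwc
  have hK : IsCompact (tsupport θ) := hθc.isCompact
  obtain ⟨C, hC0, hC⟩ := h.exists_bound hW hK hθW
  obtain ⟨C', hC'0, hC'⟩ := exists_ft_decay hw hwc (m.toNat + (n + 1))
  obtain ⟨Cs, hCs⟩ := hK.exists_bound_of_continuousOn (hs.mono hθW)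
  obtain ⟨Cθ, hCθ⟩ := hK.exists_bound_of_continuousOn hθ.continuous.continuousOn
  -- the integrand of the double integral
  set Φ : Rn n × Rn n → F := fun z => osc z.2 z.1 • θ z.1 • s z.1 (q z.1 z.2 (ft w z.2)) with hΦ
  have hcont : Continuous Φ := by
    rw [continuous_iff_continuousAt]
    rintro ⟨y, ξ⟩
    by_cases hy : y ∈ tsupport θ
    · have hyW := hθW hy
      have c1 : ContinuousAt (fun z : Rn n × Rn n => s z.1) (y, ξ) :=
        ContinuousAt.comp (g := s) (f := Prod.fst) (hs.continuousAt (hW.mem_nhds hyW))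
          continuousAt_fst
      have c2 : ContinuousAt (fun z : Rn n × Rn n => q z.1 z.2) (y, ξ) :=
        h.smooth.continuousOn.continuousAt ((hW.prod isOpen_univ).mem_nhds ⟨hyW, mem_univ _⟩)
      have c3 : ContinuousAt (fun z : Rn n × Rn n => ft w z.2) (y, ξ) :=
        ((continuous_ft hwi).comp continuous_snd).continuousAt
      have c4 : ContinuousAt (fun z : Rn n × Rn n => osc z.2 z.1) (y, ξ) :=
        (continuous_osc.comp continuous_swap).continuousAt
      have c5 : ContinuousAt (fun z : Rn n × Rn n => θ z.1) (y, ξ) :=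
        (hθ.continuous.comp continuous_fst).continuousAt
      exact c4.smul (c5.smul (c1.clm_apply (c2.clm_apply c3)))
    · refine continuousAt_const (y := (0 : F)) |>.congr ?_
      have hop : (tsupport θ)ᶜ ∈ 𝓝 y := (isClosed_tsupport θ).isOpen_compl.mem_nhds hy
      have : ∀ᶠ z : Rn n × Rn n in 𝓝 (y, ξ), z.1 ∈ (tsupport θ)ᶜ :=
        (continuous_fst.tendsto (y, ξ)).eventually_mem hop
      filter_upwards [this] with z hz
      rw [hΦ]
      simp only [image_eq_zero_of_notMem_tsupport hz, zero_smul, smul_zero]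
  have hint : Integrable Φ (volume.prod volume) := by
    have i1 : Integrable ((tsupport θ).indicator fun _ : Rn n => |Cθ| * |Cs|) :=
      (integrable_indicator_iff hK.measurableSet).2 (integrableOn_const hK.measure_lt_top.ne)
    have i2 := integrable_inv_one_add_norm_pow (n := n) |>.const_mul (C * C')
    refine (i1.mul_prod i2).mono' hcont.aestronglyMeasurable (Eventually.of_forall ?_)
    rintro ⟨y, ξ⟩
    by_cases hy : y ∈ tsupport θ
    · rw [hΦ]
      simp only [indicator_of_mem hy, norm_smul, norm_osc, one_mul]
      have b1 : ‖q y ξ (ft w ξ)‖ ≤ C * C' * ((1 + ‖ξ‖) ^ (n + 1))⁻¹ := by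
        refine ((q y ξ).le_opNorm _).trans ((mul_le_mul (hC y hy ξ) (hC' ξ) (norm_nonneg _)
          (by positivity)).trans (le_of_eq ?_))
        rw [pow_add]
        have : (1 + ‖ξ‖) ≠ 0 := by positivity
        field_simp
      have b2 : ‖s y (q y ξ (ft w ξ))‖ ≤ |Cs| * (C * C' * ((1 + ‖ξ‖) ^ (n + 1))⁻¹) :=
        ((s y).le_opNorm _).trans (mul_le_mul ((hCs y hy).trans (le_abs_self _)) b1
          (norm_nonneg _) (abs_nonneg _))
      calc _ ≤ |Cθ| * (|Cs| * (C * C' * ((1 + ‖ξ‖) ^ (n + 1))⁻¹)) :=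
            mul_le_mul ((hCθ y hy).trans (le_abs_self _)) b2 (norm_nonneg _) (abs_nonneg _)
        _ = _ := by ring
    · rw [hΦ]
      simp only [image_eq_zero_of_notMem_tsupport hy, zero_smul, smul_zero, norm_zero,
        indicator_of_notMem hy, zero_mul, le_refl]
  have e1 : ∀ y, s y (θ y • ∫ ξ, osc y ξ • q y ξ (ft w ξ)) = ∫ ξ, Φ (y, ξ) := fun y => by
    by_cases hy : y ∈ tsupport θ
    · have i : Integrable (fun ξ => osc y ξ • q y ξ (ft w ξ)) := by
        have hc : Continuous (fun ξ => osc y ξ • q y ξ (ft w ξ)) :=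
          (continuous_osc_right y).smul ((h.continuous_right (hθW hy)).clm_apply
            (continuous_ft hwi))
        refine (integrable_inv_one_add_norm_pow.const_mul (C * C')).mono' hc.aestronglyMeasurable
          (Eventually.of_forall fun ξ => ?_)
        rw [norm_smul, norm_osc, one_mul]
        refine ((q y ξ).le_opNorm _).trans ((mul_le_mul (hC y hy ξ) (hC' ξ) (norm_nonneg _)
          (by positivity)).trans (le_of_eq ?_))
        rw [pow_add]
        have : (1 + ‖ξ‖) ≠ 0 := by positivity
        field_simp
      rw [(s y).map_smul_of_tower, ← (s y).integral_comp_comm i, ← integral_smul]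
      refine integral_congr_ae (Eventually.of_forall fun ξ => ?_)
      simp only [hΦ, map_smul]
      rw [smul_comm, osc_comm]
    · simp only [hΦ, image_eq_zero_of_notMem_tsupport hy, zero_smul, smul_zero, map_zero,
        integral_zero]
  have e2 : ∀ ξ, bracket (fun _ y => s y) θ q x ξ (ft w ξ) = ∫ y, Φ (y, ξ) := fun ξ => by
    have hc : Continuous (fun y => θ y • (s y).comp (q y ξ)) := by
      rw [continuous_iff_continuousAt]
      intro y
      by_cases hy : y ∈ tsupport θ
      · have hn := hW.mem_nhds (hθW hy)
        exact hθ.continuous.continuousAt.smul ((hs.continuousAt hn).clm_comp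
          ((h.contDiffOn_left ξ).continuousOn.continuousAt hn))
      · refine continuousAt_const (y := (0 : F →L[ℂ] F)) |>.congr ?_
        filter_upwards [(isClosed_tsupport θ).isOpen_compl.mem_nhds hy] with z hz
        rw [image_eq_zero_of_notMem_tsupport hz, zero_smul]
    have i : Integrable (fun y => osc ξ y • (θ y • (s y).comp (q y ξ))) := by
      refine ((continuous_osc_right ξ).smul hc).integrable_of_hasCompactSupport
        (HasCompactSupport.intro hK fun y hy => ?_)
      simp only [Pi.smul_apply', image_eq_zero_of_notMem_tsupport hy, zero_smul, smul_zero]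
    rw [bracket, ContinuousLinearMap.integral_apply i]
    rfl
  simp only [e1, e2]
  exact integral_integral_swap hint

/-- The functions q(y, D)w need not be small in L¹, but their pairings with smooth kernels are:
after transposition these are integrals of an integrable bracket against `ft w`, whose supremum is
at most the L¹ norm of w. -/
lemma IsSymbol.isNull_quantize (h : IsSymbol m W q qj) (hW : IsOpen W)
    {θ : Rn n → ℝ} (hθ : ContDiff ℝ ∞ θ) (hθc : HasCompactSupport θ) (hθW : tsupport θ ⊆ W)
    {w : ℕ → Rn n → F} (hw : ∀ j, ContDiff ℝ ∞ (w j)) (hwc : ∀ j, HasCompactSupport (w j))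
    (hlim : Tendsto (fun j => ∫ y, ‖w j y‖) atTop (𝓝 0)) :
    IsNull W (fun j y => θ y • (((2 * Real.pi) ^ n : ℝ)⁻¹ •
      ∫ ξ, osc y ξ • q y ξ (ft (w j) ξ))) := by
  intro V s hV hs L hL hLV
  obtain ⟨C, hC0, hC⟩ := h.exists_bound_bracket hW hV hθ hθc hθW hs hL hLV
  set cst : ℝ := ((2 * Real.pi) ^ n : ℝ)⁻¹ with hcst
  have hcst0 : 0 ≤ cst := by positivity
  set I : ℝ := ∫ ξ : Rn n, C * ((1 + ‖ξ‖) ^ (n + 1))⁻¹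
  have h1 := hlim.const_mul (cst * I)
  rw [mul_zero] at h1
  refine tendstoUniformlyOn_zero_of_le h1 fun j x hx => ?_
  have hsx : ContinuousOn (s x) W := ContinuousOn.comp (g := uncurry s) (f := fun y => (x, y))
    hs.continuousOn (by fun_prop) fun y hy => ⟨hLV hx, hy⟩
  have e := h.integral_kernel_quantize hW hθ hθc hθW hsx (hw j) (hwc j) x
  have e' : ∀ y, s x y (θ y • (cst • ∫ ξ, osc y ξ • q y ξ (ft (w j) ξ))) =
      cst • s x y (θ y • ∫ ξ, osc y ξ • q y ξ (ft (w j) ξ)) := fun y => by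
    rw [smul_comm, (s x y).map_smul_of_tower]
  simp only [e']
  rw [integral_smul, e, norm_smul, Real.norm_of_nonneg hcst0, mul_assoc]
  refine mul_le_mul_of_nonneg_left ?_ hcst0
  rw [← integral_mul_const]
  refine norm_integral_le_of_norm_le
    ((integrable_inv_one_add_norm_pow.const_mul C).mul_const _) (Eventually.of_forall fun ξ => ?_)
  exact ((bracket s θ q x ξ).le_opNorm _).trans
    (mul_le_mul (hC x hx ξ) (norm_ft_le (w j) ξ) (norm_nonneg _) (by positivity))

end QuantizeNull

end

end PsiDO

namespace PsiDO

open MeasureTheory Set Filter Topology Function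

noncomputable section

set_option linter.unusedSectionVars false

/-! ### Convergence of smooth sections -/

section Convergence

variable {n : ℕ} {M : Type*} [TopologicalSpace M] [ChartedSpace (Rn n) M] [IsManifold (𝓡 n) ∞ M]
  {F : Type*} [NormedAddCommGroup F] [NormedSpace ℂ F]
  {E : M → Type*} [TopologicalSpace (TotalSpace F E)] [∀ x, TopologicalSpace (E x)]
  [∀ x, AddCommGroup (E x)] [∀ x, Module ℂ (E x)]
  [FiberBundle F E] [VectorBundle ℂ F E] [VectorBundle ℝ F E]
  [ContMDiffVectorBundle ∞ F E (𝓡 n)]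

lemma TendsToZero.add {s t : ℕ → SmoothSections n F E} (hs : TendsToZero s) (ht : TendsToZero t) :
    TendsToZero (fun j => s j + t j) := by
  intro c L hL hLc k
  have h1 := hs c L hL hLc k
  have h2 := ht c L hL hLc k
  rw [tendstoUniformlyOn_zero_iff] at h1 h2 ⊢
  intro ε hε
  filter_upwards [h1 (ε / 2) (by positivity), h2 (ε / 2) (by positivity)] with j hj1 hj2 x hx
  have hxd := c.isOpen_dom.mem_nhds (hLc hx)
  have e : c.loc (s j + t j).1 =ᶠ[𝓝 x] fun y => c.loc (s j).1 y + c.loc (t j).1 y := by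
    filter_upwards [hxd] with y hy using LocalCoords.loc_add hy _ _
  have d : ∀ s : SmoothSections n F E, ContDiffAt ℝ k (c.loc s.1) x := fun s =>
    ((c.contDiffOn_loc s.2).contDiffAt hxd).of_le (by exact_mod_cast le_top)
  rw [(e.iteratedFDeriv ℝ k).eq_of_nhds, fun_iteratedFDeriv_add_apply (d _) (d _)]
  linarith [norm_add_le (iteratedFDeriv ℝ k (c.loc (s j).1) x)
    (iteratedFDeriv ℝ k (c.loc (t j).1) x), hj1 x hx, hj2 x hx]

lemma tendsToZero_sum {ι : Type*} (S : Finset ι) {s : ι → ℕ → SmoothSections n F E}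
    (hs : ∀ i ∈ S, TendsToZero (s i)) : TendsToZero (fun j => ∑ i ∈ S, s i j) := by
  classical
  induction S using Finset.induction_on with
  | empty =>
    intro c L hL hLc k
    refine tendstoUniformlyOn_zero_of_le tendsto_const_nhds fun j x hx => ?_
    have e : c.loc (0 : SmoothSections n F E).1 =ᶠ[𝓝 x] fun _ => 0 := by
      filter_upwards [c.isOpen_dom.mem_nhds (hLc hx)] with y hy using LocalCoords.loc_zero hy
    simp only [Finset.sum_empty]
    rw [(e.iteratedFDeriv ℝ k).eq_of_nhds, iteratedFDeriv_fun_zero]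
    simp
  | insert i S hi ih =>
    simp only [Finset.sum_insert hi]
    exact (hs i (Finset.mem_insert_self i S)).add
      (ih fun i hi => hs i (Finset.mem_insert_of_mem hi))

lemma TendsToZero.mul {s : ℕ → SmoothSections n F E} (hs : TendsToZero s)
    (φ : C^∞⟮𝓡 n, M; 𝓘(ℝ, ℝ), ℝ⟯) : TendsToZero (fun j => mulSmooth φ (s j)) := by
  intro c L hL hLc k
  obtain ⟨A, hA0, hA⟩ := exists_bound_iteratedFDeriv_bilinear (X := Rn n)
    (ContinuousLinearMap.lsmul ℝ ℝ : ℝ →L[ℝ] F →L[ℝ] F) k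
  have hφ := c.contDiffOn_comp_symm φ.contMDiff
  have hb : ∀ i : ℕ, ∃ b : ℝ, ∀ x ∈ L, ‖iteratedFDeriv ℝ i (fun y => φ (c.chart.symm y)) x‖ ≤ b :=
    fun i => hL.exists_bound_of_continuousOn (((hφ.continuousOn_iteratedFDerivWithin
      (m := i) (by exact_mod_cast le_top) c.isOpen_dom.uniqueDiffOn).congr fun x hx =>
        (iteratedFDerivWithin_of_isOpen i c.isOpen_dom hx).symm).mono hLc)
  choose b hb using hb
  set b' := ∑ i ∈ Finset.range (k + 1), |b i| with hb'
  have hb'0 : 0 ≤ b' := Finset.sum_nonneg fun _ _ => abs_nonneg _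
  have hbb' : ∀ x ∈ L, ∀ i ≤ k, ‖iteratedFDeriv ℝ i (fun y => φ (c.chart.symm y)) x‖ ≤ b' :=
    fun x hx i hi => (hb i x hx).trans ((le_abs_self _).trans
      (Finset.single_le_sum (f := fun i => |b i|) (fun _ _ => abs_nonneg _)
        (Finset.mem_range.2 (Nat.lt_succ_of_le hi))))
  have h1 := fun i => hs c L hL hLc i
  simp only [tendstoUniformlyOn_zero_iff] at h1 ⊢
  intro ε hε
  have hpos : 0 < A * b' + 1 := by positivity
  filter_upwards [(Finset.range (k + 1)).eventually_all.2 fun i _ =>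
    h1 i (ε / (A * b' + 1)) (by positivity)] with j hj x hx
  have e : c.loc (mulSmooth φ (s j)).1 =ᶠ[𝓝 x]
      fun y => ContinuousLinearMap.lsmul ℝ ℝ (φ (c.chart.symm y)) (c.loc (s j).1 y) := by
    filter_upwards [c.isOpen_dom.mem_nhds (hLc hx)] with y hy using LocalCoords.loc_mul hy φ _
  rw [(e.iteratedFDeriv ℝ k).eq_of_nhds]
  refine (hA c.dom _ _ c.isOpen_dom hφ (c.contDiffOn_loc (s j).2) x (hLc hx) k le_rfl b'
    (ε / (A * b' + 1)) (hbb' x hx)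
    fun i hi => (hj i (Finset.mem_range.2 (Nat.lt_succ_of_le hi)) x hx).le).trans_lt ?_
  rw [← mul_assoc, ← mul_div_assoc, div_lt_iff₀ hpos]
  nlinarith

lemma TendsToZero.tendsto_loc {s : ℕ → SmoothSections n F E} (hs : TendsToZero s)
    (c : LocalCoords n F E) {x : Rn n} (hx : x ∈ c.dom) :
    Tendsto (fun j => c.loc (s j).1 x) atTop (𝓝 0) := by
  have h := hs c {x} isCompact_singleton (singleton_subset_iff.2 hx) 0
  rw [tendstoUniformlyOn_zero_iff] at h
  rw [Metric.tendsto_nhds]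
  intro ε hε
  filter_upwards [h ε hε] with j hj
  simpa [norm_iteratedFDeriv_zero] using hj x rfl

/-- A sequence of test sections that smoothing operators map to sequences converging to zero. -/
def IsWeaklyNull (v : ℕ → TestSections n F E) : Prop :=
  ∀ R : Op n F E, IsSmoothing R → TendsToZero (fun j => R (v j))

lemma IsWeaklyNull.add {v v' : ℕ → TestSections n F E} (h : IsWeaklyNull v)
    (h' : IsWeaklyNull v') : IsWeaklyNull (fun j => v j + v' j) := fun R hR => by
  simpa only [map_add] using (h R hR).add (h' R hR)

lemma isWeaklyNull_sum {ι : Type*} (S : Finset ι) {v : ι → ℕ → TestSections n F E}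
    (hv : ∀ i ∈ S, IsWeaklyNull (v i)) : IsWeaklyNull (fun j => ∑ i ∈ S, v i j) := fun R hR => by
  simpa only [map_sum] using tendsToZero_sum S fun i hi => hv i hi R hR

lemma IsSmoothing.comp_mulTest {R : Op n F E} (hR : IsSmoothing R)
    (φ : C^∞⟮𝓡 n, M; 𝓘(ℝ, ℝ), ℝ⟯) : IsSmoothing (R ∘ₗ mulTest φ) := by
  intro c c'
  obtain ⟨r, hr, h⟩ := hR c c'
  refine ⟨fun x y => φ (c'.chart.symm y) • r x y,
    ((c'.contDiffOn_comp_symm φ.contMDiff).comp contDiffOn_snd fun _ hz => hz.2).smul hr,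
    fun u hu x hx => ?_⟩
  have e := h (mulTest φ u) ((secSupport_smul_subset φ u.1).trans hu) x hx
  rw [LinearMap.comp_apply, e, c'.setIntegral_loc, c'.setIntegral_loc]
  refine integral_congr_ae (Eventually.of_forall fun y => ?_)
  have e4 : c'.cloc (mulTest φ u).1 y = φ (c'.chart.symm y) • c'.cloc u.1 y := c'.cloc_mul φ u.1 y
  simp only [e4, smul_apply, (r x y).map_smul_of_tower]

lemma IsWeaklyNull.mul {v : ℕ → TestSections n F E} (h : IsWeaklyNull v)
    (φ : C^∞⟮𝓡 n, M; 𝓘(ℝ, ℝ), ℝ⟯) : IsWeaklyNull (fun j => mulTest φ (v j)) :=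
  fun R hR => h (R ∘ₗ mulTest φ) (hR.comp_mulTest φ)

/-- In every pair of coordinates a smoothing operator is integration against a smooth kernel, so
nullity in one patch gives convergence of all derivatives in any other. -/
lemma isWeaklyNull_of_isNull [CompleteSpace F] {v : ℕ → TestSections n F E} {c : LocalCoords n F E}
    (hv : ∀ j, secSupport (v j).1 ⊆ c.chart.source) (h : IsNull c.dom fun j => c.cloc (v j).1) :
    IsWeaklyNull v := by
  intro R hR c' L hL hLc k
  obtain ⟨r, hr, hRr⟩ := hR c' c
  have h1 := h.tendsto_iteratedFDeriv c.isOpen_dom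
    (fun j => LocalCoords.contDiff_cloc (hv j) (v j).2.1 (v j).2.2)
    (fun j => LocalCoords.hasCompactSupport_cloc (hv j) (v j).2.2)
    (fun j => LocalCoords.tsupport_cloc_subset (hv j) (v j).2.2) c'.isOpen_dom hL hLc k hr
  refine h1.congr (Eventually.of_forall fun j x hx => ?_)
  have e : c'.loc (R (v j)).1 =ᶠ[𝓝 x] fun x => ∫ y, r x y (c.cloc (v j).1 y) := by
    filter_upwards [c'.isOpen_dom.mem_nhds (hLc hx)] with y hy
    rw [hRr (v j) (hv j) y hy, c.setIntegral_loc]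
  exact (e.iteratedFDeriv ℝ k).eq_of_nhds.symm

/-- A finite smooth partition of unity on a compact set, subordinate to trivializing
coordinates. -/
lemma exists_finite_partition [T2Space M] [SigmaCompactSpace M] {K : Set M} (hK : IsCompact K) :
    ∃ (S : Finset M) (c : M → LocalCoords n F E) (χ : M → C^∞⟮𝓡 n, M; 𝓘(ℝ, ℝ), ℝ⟯),
      (∀ i, tsupport (χ i) ⊆ (c i).chart.source) ∧ (∀ i x, |χ i x| ≤ 1) ∧
        ∀ x ∈ K, ∑ i ∈ S, χ i x = 1 := by
  choose c hc _ using fun x : M => LocalCoords.exists_mem_source (n := n) (F := F) (E := E) x univ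
    univ_mem
  obtain ⟨f, hf⟩ := SmoothPartitionOfUnity.exists_isSubordinate (𝓡 n) hK.isClosed
    (fun x => (c x).chart.source) (fun x => (c x).chart.open_source)
    fun x _ => mem_iUnion.2 ⟨x, hc x⟩
  have hfin := f.locallyFinite.finite_nonempty_inter_compact hK
  refine ⟨hfin.toFinset, c, f, hf, fun i x => ?_, fun x hx => ?_⟩
  · rw [abs_of_nonneg (f.nonneg i x)]
    exact f.le_one i x
  · rw [← f.sum_eq_one hx]
    refine (finsum_eq_sum_of_support_subset _ fun i hi => ?_).symm
    simp only [Finite.coe_toFinset]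
    exact ⟨x, hi, hx⟩

/-- A smooth cutoff function. -/
lemma exists_cutoff [T2Space M] [SigmaCompactSpace M] {K U : Set M} (hK : IsCompact K)
    (hU : IsOpen U) (hKU : K ⊆ U) : ∃ θ : C^∞⟮𝓡 n, M; 𝓘(ℝ, ℝ), ℝ⟯,
      HasCompactSupport θ ∧ tsupport θ ⊆ U ∧ (∀ᶠ x in 𝓝ˢ K, θ x = 1) ∧ ∀ x, θ x ∈ Icc (0 : ℝ) 1 := by
  have : LocallyCompactSpace M := ChartedSpace.locallyCompactSpace (Rn n) M
  obtain ⟨L, hL, hKL, hLU⟩ := exists_compact_between hK hU hKU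
  obtain ⟨θ, h1, h0, h01⟩ := exists_contMDiffMap_one_nhds_of_subset_interior (𝓡 n) (n := (⊤ : ℕ∞))
    hK.isClosed hKL
  have hs : tsupport θ ⊆ L :=
    closure_minimal (fun x hx => by_contra fun h => hx (h0 x h)) hL.isClosed
  exact ⟨θ, hL.of_isClosed_subset (isClosed_tsupport _) hs, hs.trans hLU, h1, h01⟩

lemma secSupport_smul_subset_tsupport (φ : M → ℝ) (s : ∀ x, E x) :
    secSupport (fun x => φ x • s x) ⊆ tsupport φ :=
  closure_mono fun x hx h => hx (by simp [h])

lemma eq_zero_of_notMem_secSupport {s : ∀ x, E x} {x : M} (hx : x ∉ secSupport s) : s x = 0 :=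
  by_contra fun h => hx (subset_closure h)

lemma eq_sum_mulTest {S : Finset M} {χ : M → C^∞⟮𝓡 n, M; 𝓘(ℝ, ℝ), ℝ⟯} {K : Set M}
    (hχ : ∀ x ∈ K, ∑ i ∈ S, χ i x = 1) {v : TestSections n F E} (hv : ∀ x ∉ K, v.1 x = 0) :
    v = ∑ i ∈ S, mulTest (χ i) v := by
  ext x
  have e : (∑ i ∈ S, mulTest (χ i) v).1 x = ∑ i ∈ S, χ i x • v.1 x := by
    rw [AddSubmonoidClass.coe_finsetSum, Finset.sum_apply]
    rfl
  rw [e]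
  by_cases hx : x ∈ K
  · rw [← Finset.sum_smul, hχ x hx, one_smul]
  · simp [hv x hx]

/-- A finite partition of unity cuts the sections into pieces supported in coordinate patches, where
uniform convergence on a fixed compact set gives nullity. -/
lemma isWeaklyNull_of_tendsToZero [T2Space M] [SigmaCompactSpace M] [CompleteSpace F]
    {v : ℕ → TestSections n F E} {K : Set M} (hK : IsCompact K) (hv : ∀ j, ∀ x ∉ K, (v j).1 x = 0)
    (h : TendsToZero fun j => incl (v j)) : IsWeaklyNull v := by
  obtain ⟨S, c, χ, hχs, hχ1, hχ⟩ := exists_finite_partition (n := n) (F := F) (E := E) hK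
  have h1 : ∀ i ∈ S, IsWeaklyNull fun j => mulTest (χ i) (v j) := by
    intro i _
    have hsub : ∀ j, secSupport (mulTest (χ i) (v j)).1 ⊆ tsupport (χ i) := fun j =>
      secSupport_smul_subset_tsupport (χ i) (v j).1
    have hsubK : ∀ j, secSupport (mulTest (χ i) (v j)).1 ⊆ K := fun j =>
      closure_minimal (fun x hx => by_contra fun hxK => hx
        (by change χ i x • (v j).1 x = 0; rw [hv j x hxK, smul_zero])) hK.isClosed
    have hc : ∀ j, secSupport (mulTest (χ i) (v j)).1 ⊆ (c i).chart.source := fun j =>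
      (hsub j).trans (hχs i)
    set L := (c i).chart '' (tsupport (χ i) ∩ K) with hL
    have hLc : IsCompact L := (hK.inter_left (isClosed_tsupport _)).image_of_continuousOn
      ((c i).chart.continuousOn.mono (inter_subset_left.trans (hχs i)))
    have hLd : L ⊆ (c i).dom := by
      rintro _ ⟨x, hx, rfl⟩
      exact LocalCoords.chart_mem_dom (hχs i hx.1)
    refine isWeaklyNull_of_isNull hc (isNull_of_tendstoUniformlyOn
      (fun j => (LocalCoords.contDiff_cloc (hc j) (mulTest (χ i) (v j)).2.1
        (mulTest (χ i) (v j)).2.2).continuous) hLc hLd (fun j y hy => ?_) ?_)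
    · refine image_eq_zero_of_notMem_tsupport fun hy' => hy ?_
      exact (LocalCoords.tsupport_cloc_subset_image (hc j) (mulTest (χ i) (v j)).2.2).trans
        (image_mono (subset_inter (hsub j) (hsubK j))) hy'
    · have h2 := h (c i) L hLc hLd 0
      rw [tendstoUniformlyOn_zero_iff] at h2 ⊢
      intro ε hε
      filter_upwards [h2 ε hε] with j hj y hy
      have e : (c i).cloc (mulTest (χ i) (v j)).1 y =
          χ i ((c i).chart.symm y) • (c i).cloc (v j).1 y := (c i).cloc_mul (χ i) (v j).1 y
      rw [e, norm_smul, LocalCoords.cloc_apply (hLd hy)]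
      have h3 := hj y hy
      rw [norm_iteratedFDeriv_zero] at h3
      exact (mul_le_of_le_one_left (norm_nonneg _) (hχ1 i _)).trans_lt h3
  have h2 := isWeaklyNull_sum S h1
  have e : v = fun j => ∑ i ∈ S, mulTest (χ i) (v j) := funext fun j => eq_sum_mulTest hχ (hv j)
  rwa [e]

end Convergence

end

end PsiDO

namespace PsiDO

open MeasureTheory Set Filter Topology Function

noncomputable section

set_option linter.unusedSectionVars false

/-! ### Images of weakly null sequences under pseudodifferential operators -/

section Propagation

lemma contDiff_of_contDiffOn_of_eq_zero {n : ℕ} {G : Type*} [NormedAddCommGroup G]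
    [NormedSpace ℝ G] {U K : Set (Rn n)} (hU : IsOpen U) (hK : IsClosed K) (hKU : K ⊆ U)
    {f : Rn n → G} (hf : ContDiffOn ℝ ∞ f U) (h0 : ∀ y ∉ K, f y = 0) : ContDiff ℝ ∞ f := by
  rw [contDiff_iff_contDiffAt]
  intro y
  by_cases hy : y ∈ K
  · exact hf.contDiffAt (hU.mem_nhds (hKU hy))
  · refine contDiffAt_const (c := (0 : G)) |>.congr_of_eventuallyEq ?_
    filter_upwards [hK.isOpen_compl.mem_nhds hy] with z hz using h0 z hz

variable {n : ℕ} {M : Type*} [TopologicalSpace M] [ChartedSpace (Rn n) M] [IsManifold (𝓡 n) ∞ M]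
  {F : Type*} [NormedAddCommGroup F] [NormedSpace ℂ F]
  {E : M → Type*} [TopologicalSpace (TotalSpace F E)] [∀ x, TopologicalSpace (E x)]
  [∀ x, AddCommGroup (E x)] [∀ x, Module ℂ (E x)]
  [FiberBundle F E] [VectorBundle ℂ F E] [VectorBundle ℝ F E]
  [ContMDiffVectorBundle ∞ F E (𝓡 n)]

namespace LocalCoords

variable (c : LocalCoords n F E)

/-- A function in local coordinates, extended by zero. -/
def clocFun (θ : M → ℝ) : Rn n → ℝ := c.dom.indicator fun y => θ (c.chart.symm y)

variable {c}

lemma clocFun_apply {y : Rn n} (hy : y ∈ c.dom) (θ : M → ℝ) :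
    c.clocFun θ y = θ (c.chart.symm y) := indicator_of_mem hy _

variable {θ : C^∞⟮𝓡 n, M; 𝓘(ℝ, ℝ), ℝ⟯} (hθc : HasCompactSupport θ)
  (hθs : tsupport θ ⊆ c.chart.source)

include hθc hθs

lemma isCompact_image_tsupport_fun : IsCompact (c.chart '' tsupport θ) :=
  hθc.isCompact.image_of_continuousOn (c.chart.continuousOn.mono hθs)

lemma tsupport_clocFun_subset : tsupport (c.clocFun θ) ⊆ c.chart '' tsupport θ := by
  refine closure_minimal (fun y hy => ?_) (isCompact_image_tsupport_fun hθc hθs).isClosed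
  have hyd : y ∈ c.dom := by
    by_contra h
    exact hy (indicator_of_notMem h _)
  have h1 : θ (c.chart.symm y) ≠ 0 := fun h => hy (by rw [clocFun_apply hyd]; exact h)
  exact ⟨c.chart.symm y, subset_closure h1, c.chart.right_inv hyd⟩

lemma tsupport_clocFun_subset_dom : tsupport (c.clocFun θ) ⊆ c.dom := by
  refine (tsupport_clocFun_subset hθc hθs).trans ?_
  rintro _ ⟨x, hx, rfl⟩
  exact chart_mem_dom (hθs hx)

lemma hasCompactSupport_clocFun : HasCompactSupport (c.clocFun θ) :=
  (isCompact_image_tsupport_fun hθc hθs).of_isClosed_subset (isClosed_tsupport _)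
    (tsupport_clocFun_subset hθc hθs)

lemma contDiff_clocFun : ContDiff ℝ ∞ (c.clocFun θ) :=
  contDiff_of_contDiffOn_of_eq_zero c.isOpen_dom (isClosed_tsupport _)
    (tsupport_clocFun_subset_dom hθc hθs)
    ((c.contDiffOn_comp_symm θ.contMDiff).congr fun _ hy => clocFun_apply hy θ)
    fun _ hy => image_eq_zero_of_notMem_tsupport hy

end LocalCoords

variable [CompleteSpace F] {c : LocalCoords n F E} {Q Q₀ : Op n F E}
  {u v : ℕ → TestSections n F E} {K₀ : Set M}

lemma isNull_cloc_of_tendsto_integral (hK₀ : IsCompact K₀) (hK₀c : K₀ ⊆ c.chart.source)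
    (hu : ∀ j, secSupport (u j).1 ⊆ K₀)
    (hlim : Tendsto (fun j => ∫ y, ‖c.cloc (u j).1 y‖) atTop (𝓝 0)) :
    IsNull c.dom fun j => c.cloc (u j).1 := by
  have hus := fun j => (hu j).trans hK₀c
  refine isNull_of_tendsto_integral
    (fun j => (LocalCoords.contDiff_cloc (hus j) (u j).2.1
      (u j).2.2).continuous.integrable_of_hasCompactSupport
        (LocalCoords.hasCompactSupport_cloc (hus j) (u j).2.2))
    (hK₀.image_of_continuousOn (c.chart.continuousOn.mono hK₀c)) ?_ (fun j y hy => ?_) hlim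
  · rintro _ ⟨x, hx, rfl⟩
    exact LocalCoords.chart_mem_dom (hK₀c hx)
  · refine image_eq_zero_of_notMem_tsupport fun h => hy ?_
    exact (LocalCoords.tsupport_cloc_subset_image (hus j) (u j).2.2).trans
      (image_mono (hu j)) h

lemma isWeaklyNull_of_tendsto_integral (hK₀ : IsCompact K₀) (hK₀c : K₀ ⊆ c.chart.source)
    (hu : ∀ j, secSupport (u j).1 ⊆ K₀)
    (hlim : Tendsto (fun j => ∫ y, ‖c.cloc (u j).1 y‖) atTop (𝓝 0)) : IsWeaklyNull u :=
  isWeaklyNull_of_isNull (fun j => (hu j).trans hK₀c)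
    (isNull_cloc_of_tendsto_integral hK₀ hK₀c hu hlim)

/-- Inside the patch that contains the supports, Q₀ is p(x, D) plus a smooth kernel. The first part
is weakly null by transposition; the second tends to zero uniformly. -/
lemma isWeaklyNull_near {m : ℤ} (hQ : IsPsiDO m Q) (hT : IsSmoothing (Q - Q₀)) (hK₀ : IsCompact K₀)
    (hK₀c : K₀ ⊆ c.chart.source) (hu : ∀ j, secSupport (u j).1 ⊆ K₀)
    (hlim : Tendsto (fun j => ∫ y, ‖c.cloc (u j).1 y‖) atTop (𝓝 0))
    (hv : ∀ j, (v j).1 = (Q₀ (u j)).1)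
    {θ : C^∞⟮𝓡 n, M; 𝓘(ℝ, ℝ), ℝ⟯} (hθc : HasCompactSupport θ) (hθs : tsupport θ ⊆ c.chart.source)
    (hθ1 : ∀ x, |θ x| ≤ 1) : IsWeaklyNull fun j => mulTest θ (v j) := by
  have hus := fun j => (hu j).trans hK₀c
  have hws : ∀ j, secSupport (mulTest θ (v j)).1 ⊆ c.chart.source := fun j =>
    (secSupport_smul_subset_tsupport θ (v j).1).trans hθs
  obtain ⟨p, pj, hp⟩ := hQ.local_form c
  obtain ⟨r, hr, hloc⟩ := hp.loc_eq
  obtain ⟨t, ht, hTt⟩ := hT c c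
  have hrt : ContDiffOn ℝ ∞ (uncurry fun x y => r x y - t x y) (c.dom ×ˢ c.dom) := hr.sub ht
  have huD := fun j => LocalCoords.contDiff_cloc (hus j) (u j).2.1 (u j).2.2
  have huC := fun j => LocalCoords.hasCompactSupport_cloc (hus j) (u j).2.2
  have huS := fun j => LocalCoords.tsupport_cloc_subset (hus j) (u j).2.2
  set θ' := c.clocFun θ with hθ'
  have hθ'd := LocalCoords.tsupport_clocFun_subset_dom hθc hθs
  have hθ'c := LocalCoords.hasCompactSupport_clocFun hθc hθs
  have hθ'D := LocalCoords.contDiff_clocFun hθc hθs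
  -- Z is the contribution of the symbol, G that of the smooth kernel r - t, with t the kernel of Q
  -- - Q₀.
  set Z : ℕ → Rn n → F := fun j y => θ' y • (((2 * Real.pi) ^ n : ℝ)⁻¹ •
      ∫ ξ, osc y ξ • p y ξ (ft (c.cloc (u j).1) ξ)) with hZ
  set G : ℕ → Rn n → F := fun j y => θ' y • ∫ z, (r y z - t y z) (c.cloc (u j).1 z) with hG
  have hGD : ∀ j, ContDiff ℝ ∞ (G j) := fun j =>
    contDiff_of_contDiffOn_of_eq_zero c.isOpen_dom (isClosed_tsupport θ') hθ'd
      (hθ'D.contDiffOn.smul (contDiffOn_kernelInt hrt c.isOpen_dom c.isOpen_dom (huD j) (huC j)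
        (huS j))) fun y hy => by
          simp only [hG, image_eq_zero_of_notMem_tsupport hy, zero_smul]
  have hsum : ∀ j y, c.cloc (mulTest θ (v j)).1 y = Z j y + G j y := by
    intro j y
    have e1 : c.cloc (mulTest θ (v j)).1 y = θ (c.chart.symm y) • c.cloc (v j).1 y :=
      c.cloc_mul θ (v j).1 y
    by_cases hy : y ∈ c.dom
    · have e2 : (v j).1 = (Q (u j)).1 - ((Q - Q₀) (u j)).1 := by
        rw [hv j]
        change _ = (Q (u j)).1 - ((Q (u j)).1 - (Q₀ (u j)).1)
        abel
      have i1 := integrable_smooth_cloc hr (hus j) hy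
      have i2 := integrable_smooth_cloc ht (hus j) hy
      rw [e1, LocalCoords.cloc_apply hy, e2, LocalCoords.loc_sub hy, hloc (u j) (hus j) y hy,
        hTt (u j) (hus j) y hy, c.setIntegral_loc, add_sub_assoc, ← integral_sub i1 i2, smul_add]
      simp only [hZ, hG, hθ', LocalCoords.clocFun_apply hy, sub_apply]
    · have h0 : θ' y = 0 := indicator_of_notMem hy _
      rw [e1]
      simp only [hZ, hG, h0, zero_smul, LocalCoords.cloc, indicator_of_notMem hy, smul_zero,
        add_zero]
  have hwD := fun j => LocalCoords.contDiff_cloc (hws j) (mulTest θ (v j)).2.1 (mulTest θ (v j)).2.2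
  have hZeq : ∀ j, Z j = fun y => c.cloc (mulTest θ (v j)).1 y - G j y := fun j =>
    funext fun y => by rw [hsum, add_sub_cancel_right]
  -- Continuity of Z comes for free: Z is the localized image section, which is smooth, minus G.
  have hZc : ∀ j, Continuous (Z j) := fun j => by
    rw [hZeq]
    exact (hwD j).continuous.sub (hGD j).continuous
  have hZ0 : ∀ j, support (Z j) ⊆ support θ' := fun j y hy h => hy (by
    simp only [hZ, h, zero_smul])
  have hG0 : ∀ j, support (G j) ⊆ support θ' := fun j y hy h => hy (by
    simp only [hG, h, zero_smul])
  have hZN : IsNull c.dom Z := hp.1.isNull_quantize c.isOpen_dom hθ'D hθ'c hθ'd huD huC hlim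
  have hGN : IsNull c.dom G := by
    refine isNull_of_tendstoUniformlyOn (fun j => (hGD j).continuous) hθ'c.isCompact hθ'd
      (fun j y (hy : y ∉ tsupport θ') => by
        simp only [hG, image_eq_zero_of_notMem_tsupport hy, zero_smul]) ?_
    have h1 := isNull_cloc_of_tendsto_integral hK₀ hK₀c hu hlim c.dom _ c.isOpen_dom hrt
      (tsupport θ') hθ'c.isCompact hθ'd
    rw [tendstoUniformlyOn_zero_iff] at h1 ⊢
    intro ε hε
    filter_upwards [h1 ε hε] with j hj y hy
    rw [hG, norm_smul]
    have h2 : ‖θ' y‖ ≤ 1 := by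
      rw [hθ', LocalCoords.clocFun_apply (hθ'd hy)]
      exact hθ1 _
    exact (mul_le_of_le_one_left (norm_nonneg _) h2).trans_lt (hj y hy)
  have hN := hZN.add hGN c.isOpen_dom hZc (fun j => hθ'c.mono (hZ0 j))
    (fun j => (closure_mono (hZ0 j)).trans hθ'd) (fun j => (hGD j).continuous)
    (fun j => hθ'c.mono (hG0 j)) (fun j => (closure_mono (hG0 j)).trans hθ'd)
  refine isWeaklyNull_of_isNull hws ?_
  have e : (fun j => c.cloc (mulTest θ (v j)).1) = fun j y => Z j y + G j y :=
    funext fun j => funext fun y => hsum j y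
  rwa [e]

variable [T2Space M]

/-- On the support of ψ, disjoint from K₀, only values of the kernel off the diagonal occur. They
are bounded on compact sets, so sequences null in L¹ have uniformly null images. -/
lemma isWeaklyNull_far {m : ℤ} (hQ : IsPsiDO m Q) (hT : IsSmoothing (Q - Q₀)) (hK₀ : IsCompact K₀)
    (hK₀c : K₀ ⊆ c.chart.source) (hu : ∀ j, secSupport (u j).1 ⊆ K₀)
    (hlim : Tendsto (fun j => ∫ y, ‖c.cloc (u j).1 y‖) atTop (𝓝 0))
    (hv : ∀ j, (v j).1 = (Q₀ (u j)).1) {K₁ : Set M} (hK₁ : IsCompact K₁)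
    (hvK : ∀ j, secSupport (v j).1 ⊆ K₁) {c' : LocalCoords n F E}
    {ψ : C^∞⟮𝓡 n, M; 𝓘(ℝ, ℝ), ℝ⟯} (hψs : tsupport ψ ⊆ c'.chart.source)
    (hψK : Disjoint (tsupport ψ) K₀) (hψ1 : ∀ x, |ψ x| ≤ 1) :
    IsWeaklyNull fun j => mulTest ψ (v j) := by
  have hus := fun j => (hu j).trans hK₀c
  have hsub : ∀ j, secSupport (mulTest ψ (v j)).1 ⊆ tsupport ψ := fun j =>
    secSupport_smul_subset_tsupport ψ (v j).1
  have hsubK : ∀ j, secSupport (mulTest ψ (v j)).1 ⊆ K₁ := fun j =>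
    (secSupport_smul_subset ψ (v j).1).trans (hvK j)
  have hws := fun j => (hsub j).trans hψs
  obtain ⟨k, hk⟩ := hQ.smooth_off_diagonal c' c
  obtain ⟨t, ht, hTt⟩ := hT c' c
  set L := c'.chart '' (tsupport ψ ∩ K₁) with hL
  have hLc : IsCompact L := (hK₁.inter_left (isClosed_tsupport _)).image_of_continuousOn
    (c'.chart.continuousOn.mono (inter_subset_left.trans hψs))
  have hLd : L ⊆ c'.dom := by
    rintro _ ⟨x, hx, rfl⟩
    exact LocalCoords.chart_mem_dom (hψs hx.1)
  have hLK : ∀ y ∈ L, c'.chart.symm y ∉ K₀ := by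
    rintro _ ⟨x, hx, rfl⟩ h
    rw [c'.chart.left_inv (hψs hx.1)] at h
    exact disjoint_left.1 hψK hx.1 h
  set L₀ := c.chart '' K₀ with hL₀
  have hL₀c : IsCompact L₀ := hK₀.image_of_continuousOn (c.chart.continuousOn.mono hK₀c)
  have hL₀d : L₀ ⊆ c.dom := by
    rintro _ ⟨x, hx, rfl⟩
    exact LocalCoords.chart_mem_dom (hK₀c hx)
  obtain ⟨B, hB⟩ := (hLc.prod hL₀c).exists_bound_of_continuousOn (hk.1.continuousOn.mono (by
    rintro ⟨y, z⟩ ⟨hy, hz⟩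
    refine ⟨hLd hy, hL₀d hz, fun h => hLK y hy ?_⟩
    obtain ⟨x, hx, rfl⟩ := hz
    simp only at h
    rw [h, c.chart.left_inv (hK₀c hx)]
    exact hx))
  obtain ⟨B', hB'0, hB'⟩ := exists_bound_kernel ht hLc hLd hL₀c hL₀d
  have huL : ∀ j z, c.cloc (u j).1 z ≠ 0 → z ∈ L₀ := fun j z hz =>
    (LocalCoords.tsupport_cloc_subset_image (hus j) (u j).2.2).trans (image_mono (hu j))
      (subset_closure hz)
  have huI : ∀ j, Integrable (c.cloc (u j).1) := fun j =>
    (LocalCoords.contDiff_cloc (hus j) (u j).2.1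
      (u j).2.2).continuous.integrable_of_hasCompactSupport
        (LocalCoords.hasCompactSupport_cloc (hus j) (u j).2.2)
  refine isWeaklyNull_of_isNull hws (isNull_of_tendstoUniformlyOn
    (fun j => (LocalCoords.contDiff_cloc (hws j) (mulTest ψ (v j)).2.1
      (mulTest ψ (v j)).2.2).continuous) hLc hLd (fun j y hy => ?_) ?_)
  · refine image_eq_zero_of_notMem_tsupport fun hy' => hy ?_
    exact (LocalCoords.tsupport_cloc_subset_image (hws j) (mulTest ψ (v j)).2.2).trans
      (image_mono (subset_inter (hsub j) (hsubK j))) hy'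
  · have h1 := hlim.const_mul (B + B')
    rw [mul_zero] at h1
    refine tendstoUniformlyOn_zero_of_le h1 fun j y hy => ?_
    have hyd := hLd hy
    have e1 : c'.cloc (mulTest ψ (v j)).1 y = ψ (c'.chart.symm y) • c'.cloc (v j).1 y :=
      c'.cloc_mul ψ (v j).1 y
    have e2 : (v j).1 = (Q (u j)).1 - ((Q - Q₀) (u j)).1 := by
      rw [hv j]
      change _ = (Q (u j)).1 - ((Q (u j)).1 - (Q₀ (u j)).1)
      abel
    rw [e1, norm_smul, LocalCoords.cloc_apply hyd, e2, LocalCoords.loc_sub hyd,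
      (hk.integral_cloc (hus j) hyd fun h => hLK y hy (hu j h)).2, hTt (u j) (hus j) y hyd,
      c.setIntegral_loc]
    refine (mul_le_of_le_one_left (norm_nonneg _) (hψ1 _)).trans ((norm_sub_le _ _).trans ?_)
    rw [add_mul]
    exact add_le_add
      (norm_integral_apply_le (huI j) fun z hz => hB (y, z) ⟨hy, huL j z hz⟩)
      (norm_integral_apply_le (huI j) fun z hz => hB' y hy z (huL j z hz))

variable [SigmaCompactSpace M]

/-- A properly supported pseudodifferential operator maps `L¹`-null sequences supported in a
coordinate patch to weakly null sequences. -/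
lemma IsPsiDO.isWeaklyNull {m : ℤ} (hQ : IsPsiDO m Q) (hT : IsSmoothing (Q - Q₀))
    (hQ₀ : IsProperlySupported Q₀) {Qc : TestSections n F E →ₗ[ℂ] TestSections n F E}
    (hQc : incl ∘ₗ Qc = Q₀) (hK₀ : IsCompact K₀) (hK₀c : K₀ ⊆ c.chart.source)
    (hu : ∀ j, secSupport (u j).1 ⊆ K₀)
    (hlim : Tendsto (fun j => ∫ y, ‖c.cloc (u j).1 y‖) atTop (𝓝 0)) :
    IsWeaklyNull fun j => Qc (u j) := by
  have hv : ∀ j, (Qc (u j)).1 = (Q₀ (u j)).1 := fun j => by rw [← hQc]; rfl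
  obtain ⟨K₁, hK₁, hK₁Q⟩ := hQ₀.1 K₀ hK₀
  have hvK : ∀ j, secSupport (Qc (u j)).1 ⊆ K₁ := fun j => by
    rw [hv]
    exact hK₁Q (u j) (hu j)
  -- θ equals 1 near K₀, so each χ i * (1 - θ) is supported away from K₀; the partition χ is taken
  -- on a compact set K₁ that contains the supports of all images.
  obtain ⟨θ, hθc, hθs, hθK, hθ01⟩ := exists_cutoff (n := n) hK₀ c.chart.open_source hK₀c
  obtain ⟨S, c', χ, hχs, hχ1, hχ⟩ := exists_finite_partition (n := n) (F := F) (E := E) hK₁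
  have hnear := isWeaklyNull_near hQ hT hK₀ hK₀c hu hlim hv hθc hθs fun x => by
    rw [abs_of_nonneg (hθ01 x).1]
    exact (hθ01 x).2
  have hfar : ∀ i ∈ S, IsWeaklyNull fun j => mulTest (χ i * (1 - θ)) (Qc (u j)) := by
    intro i _
    refine isWeaklyNull_far hQ hT hK₀ hK₀c hu hlim hv hK₁ hvK (c' := c' i)
      ((closure_mono (support_mul_subset_left _ _)).trans (hχs i)) ?_ fun x => ?_
    · rw [disjoint_right]
      intro x hx
      rw [notMem_tsupport_iff_eventuallyEq]
      filter_upwards [(eventually_nhdsSet_iff_forall.1 hθK) x hx] with y hy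
      change χ i y * (1 - θ y) = 0
      rw [hy, sub_self, mul_zero]
    · change |χ i x * (1 - θ x)| ≤ 1
      rw [abs_mul]
      refine mul_le_one₀ (hχ1 i x) (abs_nonneg _) ?_
      rw [abs_of_nonneg (by linarith [(hθ01 x).2])]
      linarith [(hθ01 x).1]
  have h := hnear.add (isWeaklyNull_sum S hfar)
  have e : (fun j => Qc (u j)) = fun j => mulTest θ (Qc (u j)) +
      ∑ i ∈ S, mulTest (χ i * (1 - θ)) (Qc (u j)) := by
    funext j
    have e1 : ∀ i, mulTest (χ i * (1 - θ)) (Qc (u j)) =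
        mulTest (χ i) (mulTest (1 - θ) (Qc (u j))) := fun i => by
      ext x
      exact mul_smul (χ i x) (1 - θ x) ((Qc (u j)).1 x)
    simp only [e1]
    rw [← eq_sum_mulTest hχ (v := mulTest (1 - θ) (Qc (u j))) fun x hx => ?_]
    · ext x
      change (Qc (u j)).1 x = θ x • (Qc (u j)).1 x + (1 - θ x) • (Qc (u j)).1 x
      rw [← add_smul, add_sub_cancel, one_smul]
    · change (1 - θ x) • (Qc (u j)).1 x = 0
      rw [eq_zero_of_notMem_secSupport fun h => hx (hvK j h), smul_zero]
  rwa [e]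

end Propagation

end

end PsiDO

namespace PsiDO

open MeasureTheory Set Filter Topology Function

noncomputable section

set_option linter.unusedSectionVars false

/-! ### Comparison of parametrices -/

section Parametrices

variable {n : ℕ} {M : Type*} [TopologicalSpace M] [ChartedSpace (Rn n) M] [IsManifold (𝓡 n) ∞ M]
  {F : Type*} [NormedAddCommGroup F] [NormedSpace ℂ F]
  {E : M → Type*} [TopologicalSpace (TotalSpace F E)] [∀ x, TopologicalSpace (E x)]
  [∀ x, AddCommGroup (E x)] [∀ x, Module ℂ (E x)]
  [FiberBundle F E] [VectorBundle ℂ F E] [VectorBundle ℝ F E]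
  [ContMDiffVectorBundle ∞ F E (𝓡 n)]

variable [T2Space M] [SigmaCompactSpace M] [CompleteSpace F]

/-- The product of a smooth section and a compactly supported smooth function. -/
def cutoffSection (χ : C^∞⟮𝓡 n, M; 𝓘(ℝ, ℝ), ℝ⟯) (hχ : HasCompactSupport χ)
    (s : SmoothSections n F E) : TestSections n F E :=
  ⟨(mulSmooth χ s).1, (mulSmooth χ s).2, hχ.isCompact.of_isClosed_subset isClosed_closure
    (secSupport_smul_subset_tsupport χ s.1)⟩

/-- The extension of a properly supported pseudodifferential operator to smooth sections is
continuous. -/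
lemma tendsto_extension {m : ℤ} {Q Q₀ : Op n F E}
    {Qe : SmoothSections n F E →ₗ[ℂ] SmoothSections n F E} (hQ : IsPsiDO m Q)
    (hT : IsSmoothing (Q - Q₀)) (hQ₀ : IsProperlySupported Q₀)
    (hQe : ∀ K' K : Set M, IsCompact K' → IsCompact K → Controls Q₀ K' K →
      ∀ (s : SmoothSections n F E) (u : TestSections n F E),
        (∀ y ∈ K', u.1 y = s.1 y) → ∀ x ∈ K, (Qe s).1 x = (Q₀ u).1 x)
    {s : ℕ → SmoothSections n F E} (hs : TendsToZero s) (c : LocalCoords n F E) {x : Rn n}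
    (hx : x ∈ c.dom) : Tendsto (fun j => c.loc (Qe (s j)).1 x) atTop (𝓝 0) := by
  -- By proper support the value at the point only sees the sections on a compact set K', so s j may
  -- be replaced by its product with a cutoff equal to 1 near K'.
  obtain ⟨K', hK', hctrl⟩ := hQ₀.2 {c.chart.symm x} isCompact_singleton
  obtain ⟨χ, hχc, -, hχ, -⟩ := exists_cutoff (n := n) hK' isOpen_univ (subset_univ _)
  set u := fun j => cutoffSection χ hχc (s j) with hu
  have hu0 : TendsToZero fun j => incl (u j) := hs.mul χ
  have huK : ∀ j, ∀ y ∉ tsupport χ, (u j).1 y = 0 := fun j y hy => by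
    change χ y • (s j).1 y = 0
    rw [image_eq_zero_of_notMem_tsupport hy, zero_smul]
  have h1 := (hQ.continuous u ⟨_, hχc.isCompact, huK⟩ hu0).tendsto_loc c hx
  have h2 := (isWeaklyNull_of_tendsToZero hχc.isCompact huK hu0 _ hT).tendsto_loc c hx
  have h3 := h1.sub h2
  rw [sub_zero] at h3
  refine h3.congr fun j => ?_
  rw [← LocalCoords.loc_sub hx]
  refine c.loc_congr ?_
  rw [hQe K' _ hK' isCompact_singleton hctrl (s j) (u j) (fun y hy => ?_) _ rfl]
  · change (Q (u j)).1 _ - ((Q (u j)).1 _ - (Q₀ (u j)).1 _) = _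
    abel
  · change χ y • (s j).1 y = _
    rw [hχ.self_of_nhdsSet y hy, one_smul]

variable {m : ℤ} {P P' Q Q' : Op n F E} {α β α' β' : C^∞⟮𝓡 n, M; 𝓘(ℝ, ℝ), ℝ⟯}

/-- If `P' = α P β` modulo smoothing operators, then parametrices satisfy `Q' = β⁻¹ Q α⁻¹` up to
an operator that is continuous in the `L¹`-topology. -/
lemma IsParametrix.tendsto_sub (hQ : IsParametrix m P Q) (hQ' : IsParametrix m P' Q')
    (hα : ∀ x, α x * α' x = 1) (hβ : ∀ x, β x * β' x = 1)
    (hR : IsSmoothing (P' - mulSmooth α ∘ₗ P ∘ₗ mulTest β))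
    {c : LocalCoords n F E} {K₀ : Set M} (hK₀ : IsCompact K₀) (hK₀c : K₀ ⊆ c.chart.source)
    {u : ℕ → TestSections n F E} (hu : ∀ j, secSupport (u j).1 ⊆ K₀)
    (hlim : Tendsto (fun j => ∫ y, ‖c.cloc (u j).1 y‖) atTop (𝓝 0)) {x : Rn n} (hx : x ∈ c.dom) :
    Tendsto (fun j => c.loc (Q' (u j) - mulSmooth β' (Q (mulTest α' (u j)))).1 x) atTop
      (𝓝 0) := by
  obtain ⟨hQΨ, Q₀, Qc, Qe, hT, hQ₀, hQc, -, hS, -⟩ := hQ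
  obtain ⟨hQΨ', Q₀', Qc', Qe', hT', hQ₀', hQc', hQe', -, hS'⟩ := hQ'
  have hw : ∀ j, secSupport (mulTest α' (u j)).1 ⊆ K₀ := fun j =>
    (secSupport_smul_subset α' (u j).1).trans (hu j)
  have hwlim : Tendsto (fun j => ∫ y, ‖c.cloc (mulTest α' (u j)).1 y‖) atTop (𝓝 0) := by
    obtain ⟨B, hB⟩ := hK₀.exists_bound_of_continuousOn α'.contMDiff.continuous.continuousOn
    have h1 := hlim.const_mul |B|
    rw [mul_zero] at h1
    refine squeeze_zero (fun j => integral_nonneg fun y => norm_nonneg _) (fun j => ?_) h1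
    have hint : ∀ v : TestSections n F E, secSupport v.1 ⊆ K₀ →
        Integrable fun y => ‖c.cloc v.1 y‖ := fun v hv =>
      ((LocalCoords.contDiff_cloc (hv.trans hK₀c) v.2.1
        v.2.2).continuous.integrable_of_hasCompactSupport
          (LocalCoords.hasCompactSupport_cloc (hv.trans hK₀c) v.2.2)).norm
    rw [← integral_const_mul]
    refine integral_mono (hint _ (hw j)) ((hint _ (hu j)).const_mul _) fun y => ?_
    have e : c.cloc (mulTest α' (u j)).1 y = α' (c.chart.symm y) • c.cloc (u j).1 y :=
      c.cloc_mul α' (u j).1 y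
    simp only [e, norm_smul]
    by_cases hy : c.cloc (u j).1 y = 0
    · simp [hy]
    · refine mul_le_mul_of_nonneg_right ((hB _ ?_).trans (le_abs_self B)) (norm_nonneg _)
      have hus := (hu j).trans hK₀c
      obtain ⟨z, hz, rfl⟩ := LocalCoords.tsupport_cloc_subset_image hus (u j).2.2
        (subset_closure hy)
      rw [c.chart.left_inv (hus hz)]
      exact hu j hz
  have hun := isWeaklyNull_of_tendsto_integral hK₀ hK₀c hu hlim
  have hwn := isWeaklyNull_of_tendsto_integral hK₀ hK₀c hw hwlim
  have hvn := (hQΨ.isWeaklyNull hT hQ₀ hQc hK₀ hK₀c hw hwlim).mul β'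
  set v := fun j => mulTest β' (Qc (mulTest α' (u j))) with hv
  set S := P ∘ₗ Qc - incl with hSdef
  set S' := Qe' ∘ₗ P' - incl with hSdef'
  set R := P' - mulSmooth α ∘ₗ P ∘ₗ mulTest β with hRdef
  have hs : TendsToZero fun j => mulSmooth α (S (mulTest α' (u j))) + R (v j) :=
    ((hwn S hS).mul α).add (hvn R hR)
  -- As v = β'Qα'u, the factors β and α cancel β' and α': P'v = αPQα'u + Rv = u + αS(α'u) + Rv,
  -- where PQ = 1 + S.
  have hPv : ∀ j, P' (v j) =
      incl (u j) + (mulSmooth α (S (mulTest α' (u j))) + R (v j)) := by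
    intro j
    have e1 : mulTest β (v j) = Qc (mulTest α' (u j)) := by
      ext y
      change β y • β' y • (Qc (mulTest α' (u j))).1 y = _
      rw [smul_smul, hβ, one_smul]
    have e2 : mulSmooth α (incl (mulTest α' (u j))) = incl (u j) := by
      ext y
      change α y • α' y • (u j).1 y = _
      rw [smul_smul, hα, one_smul]
      rfl
    have e3 : P' (v j) = R (v j) + mulSmooth α (P (mulTest β (v j))) := by
      rw [hRdef, LinearMap.sub_apply, LinearMap.comp_apply, LinearMap.comp_apply,
        sub_add_cancel]
    have e4 : P (Qc (mulTest α' (u j))) = S (mulTest α' (u j)) + incl (mulTest α' (u j)) := by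
      rw [hSdef, LinearMap.sub_apply, LinearMap.comp_apply, sub_add_cancel]
    rw [e3, e1, e4, map_add, e2]
    abel
  -- Applying Q' to the formula for P'v, with Q'P' = 1 + S', gives Q'u - v = S'v - Q'(αS(α'u) + Rv).
  -- Both terms tend to zero, as do the corrections for replacing Q, Q' by their properly supported
  -- representatives.
  have hext := tendsto_extension hQΨ' hT' hQ₀' hQe' hs c hx
  have h1 := (hvn S' hS').tendsto_loc c hx
  have h2 := (hun _ hT').tendsto_loc c hx
  have h3 := ((hwn _ hT).mul β').tendsto_loc c hx
  have h4 := ((h1.sub hext).add h2).sub h3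
  simp only [sub_zero, add_zero] at h4
  refine h4.congr fun j => ?_
  rw [← LocalCoords.loc_sub hx, ← LocalCoords.loc_add hx, ← LocalCoords.loc_sub hx]
  refine c.loc_congr ?_
  obtain ⟨K', hK', hctrl⟩ := hQ₀'.2 {c.chart.symm x} isCompact_singleton
  have hincl : (Qe' (incl (u j))).1 (c.chart.symm x) = (Q₀' (u j)).1 (c.chart.symm x) :=
    hQe' K' _ hK' isCompact_singleton hctrl (incl (u j)) (u j) (fun _ _ => rfl) _ rfl
  have e5 : S' (v j) = Qe' (incl (u j)) +
      Qe' (mulSmooth α (S (mulTest α' (u j))) + R (v j)) - incl (v j) := by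
    rw [← map_add, ← hPv j]
    rfl
  have e6 : incl (v j) = mulSmooth β' (Q₀ (mulTest α' (u j))) := by
    rw [← hQc]
    rfl
  rw [e5, e6]
  change (((Qe' (incl (u j))).1 (c.chart.symm x) + _ -
    β' (c.chart.symm x) • (Q₀ (mulTest α' (u j))).1 (c.chart.symm x)) - _ +
    ((Q' (u j)).1 (c.chart.symm x) - (Q₀' (u j)).1 (c.chart.symm x)) -
    β' (c.chart.symm x) • ((Q (mulTest α' (u j))).1 (c.chart.symm x) -
      (Q₀ (mulTest α' (u j))).1 (c.chart.symm x))) =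
    (Q' (u j)).1 (c.chart.symm x) -
      β' (c.chart.symm x) • (Q (mulTest α' (u j))).1 (c.chart.symm x)
  rw [hincl, smul_sub]
  abel

/-- An operator that maps `L¹`-null sequences to null sequences is bounded. -/
lemma exists_bound_of_tendsto {c : LocalCoords n F E} {A : Op n F E} {x : Rn n} (hx : x ∈ c.dom)
    {K₀ : Set M}
    (h : ∀ u : ℕ → TestSections n F E, (∀ j, secSupport (u j).1 ⊆ K₀) →
      Tendsto (fun j => ∫ y, ‖c.cloc (u j).1 y‖) atTop (𝓝 0) →
      Tendsto (fun j => c.loc (A (u j)).1 x) atTop (𝓝 0)) :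
    ∃ C : ℝ, 0 ≤ C ∧ ∀ u : TestSections n F E, secSupport u.1 ⊆ K₀ →
      ‖c.loc (A u).1 x‖ ≤ C * ∫ y, ‖c.cloc u.1 y‖ := by
  by_contra! hC
  choose u hu hlt using fun j : ℕ => hC (j + 1) (by positivity)
  have hI : ∀ j, 0 ≤ ∫ y, ‖c.cloc (u j).1 y‖ := fun j => integral_nonneg fun y => norm_nonneg _
  set a : ℕ → ℝ := fun j => ‖c.loc (A (u j)).1 x‖ with ha
  have ha0 : ∀ j, 0 < a j := fun j =>
    (mul_nonneg (by positivity) (hI j)).trans_lt (hlt j)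
  -- If no constant works, there are u j with ‖A(u j)(x)‖ exceeding (j + 1) times the L¹ norm.
  -- Dividing by a j gives L¹ norms at most 1/(j + 1), yet values of norm 1 at x.
  set w : ℕ → TestSections n F E := fun j => (((a j)⁻¹ : ℝ) : ℂ) • u j with hw
  have hnorm : ∀ j, ‖(((a j)⁻¹ : ℝ) : ℂ)‖ = (a j)⁻¹ := fun j => by
    rw [Complex.norm_real, Real.norm_of_nonneg (inv_nonneg.2 (ha0 j).le)]
  have hcl : ∀ j y, ‖c.cloc (w j).1 y‖ = (a j)⁻¹ * ‖c.cloc (u j).1 y‖ := fun j y => by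
    rw [← hnorm j, ← norm_smul]
    by_cases hy : y ∈ c.dom
    · rw [LocalCoords.cloc_apply hy, LocalCoords.cloc_apply hy, ← LocalCoords.loc_smul hy]
      rfl
    · rw [LocalCoords.cloc, LocalCoords.cloc, indicator_of_notMem hy, indicator_of_notMem hy,
        smul_zero]
  have hws : ∀ j, secSupport (w j).1 ⊆ secSupport (u j).1 := fun j =>
    closure_mono fun y (hy : (w j).1 y ≠ 0) h0 => hy (by
      change (((a j)⁻¹ : ℝ) : ℂ) • (u j).1 y = 0
      rw [h0, smul_zero])
  have h1 := h w (fun j => (hws j).trans (hu j)) (by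
    refine squeeze_zero (fun j => integral_nonneg fun y => norm_nonneg _) (fun j => ?_)
      tendsto_one_div_add_atTop_nhds_zero_nat
    simp only [hcl]
    rw [integral_const_mul, inv_mul_le_iff₀ (ha0 j), mul_one_div, le_div_iff₀ (by positivity),
      mul_comm]
    exact (hlt j).le)
  have h2 : ∀ j, ‖c.loc (A (w j)).1 x‖ = 1 := fun j => by
    have e : (A (w j)).1 = (((a j)⁻¹ : ℝ) : ℂ) • (A (u j)).1 := by
      rw [hw]
      simp only [map_smul]
      rfl
    rw [e, LocalCoords.loc_smul hx, norm_smul, hnorm]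
    exact inv_mul_cancel₀ (ha0 j).ne'
  have h3 := h1.norm
  simp only [h2, norm_zero] at h3
  exact one_ne_zero (tendsto_nhds_unique tendsto_const_nhds h3)

/-- The Green kernel logarithmic singularities of `P` and of `α P β`. -/
lemma IsParametrix.logSingularity_conjugate [FiniteDimensional ℂ F] (hn : 1 ≤ n)
    (hQ : IsParametrix m P Q) (hQ' : IsParametrix m P' Q')
    (hα : ∀ x, α x * α' x = 1) (hβ : ∀ x, β x * β' x = 1)
    (hR : IsSmoothing (P' - mulSmooth α ∘ₗ P ∘ₗ mulTest β)) {d d' : EndDensity n E}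
    (hd : HasLogSingularity (-m) Q d) (hd' : HasLogSingularity (-m) Q' d') :
    d' = d.mul fun x => β' x * α' x := by
  refine hd.eq_mul hn hd' fun p => ?_
  obtain ⟨c, hp, -⟩ := LocalCoords.exists_mem_source (n := n) (F := F) (E := E) p univ univ_mem
  obtain ⟨-, k, -, hk, -⟩ := hd c
  obtain ⟨-, k', -, hk', -⟩ := hd' c
  set x := c.chart p with hx
  have hxd : x ∈ c.dom := LocalCoords.chart_mem_dom hp
  have hsx : c.chart.symm x = p := c.chart.left_inv hp
  obtain ⟨δ, hδ, hball⟩ := Metric.nhds_basis_closedBall.mem_iff.1 (c.isOpen_dom.mem_nhds hxd)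
  set K₀ := c.chart.symm '' Metric.closedBall x δ with hK₀
  have hK₀c : IsCompact K₀ :=
    (isCompact_closedBall x δ).image_of_continuousOn (c.continuousOn_symm.mono hball)
  have hK₀s : K₀ ⊆ c.chart.source := by
    rintro _ ⟨y, hy, rfl⟩
    exact LocalCoords.symm_mem (hball hy)
  -- C may depend on x: the logarithmic coefficient at x is read along a ray ending at x, so a bound
  -- for fixed x and varying y is enough.
  obtain ⟨C, hC0, hC⟩ := exists_bound_of_tendsto (A := Q' - mulSmooth β' ∘ₗ Q ∘ₗ mulTest α')
    hxd (K₀ := K₀) fun u hu hlim => hQ.tendsto_sub hQ' hα hβ hR hK₀c hK₀s hu hlim hxd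
  have hα's := c.contDiffOn_comp_symm α'.contMDiff
  refine ⟨c, k, k', fun y => β' p * α' (c.chart.symm y), C, hp, hk, hk',
    contDiffAt_const.mul (hα's.contDiffAt (c.isOpen_dom.mem_nhds hxd)), by simp only [← hx, hsx], ?_⟩
  have hU : IsOpen (Metric.ball x δ ∩ {x}ᶜ) := Metric.isOpen_ball.inter isOpen_compl_singleton
  have hUd : Metric.ball x δ ∩ {x}ᶜ ⊆ c.dom := fun y hy =>
    hball (Metric.ball_subset_closedBall hy.1)
  have hUoff : Metric.ball x δ ∩ {x}ᶜ ⊆ offDiag c c x := fun y hy =>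
    mem_offDiag_self hxd (hUd hy) fun h => hy.2 h.symm
  have c1 : ContinuousOn (k' x) (Metric.ball x δ ∩ {x}ᶜ) :=
    (hk'.contDiffOn_snd hxd).continuousOn.mono hUoff
  have c2 : ContinuousOn (fun y => (β' p * α' (c.chart.symm y)) • k x y)
      (Metric.ball x δ ∩ {x}ᶜ) :=
    ((contDiffOn_const.mul hα's).continuousOn.mono hUd).smul
      ((hk.contDiffOn_snd hxd).continuousOn.mono hUoff)
  have hmem : Metric.ball x δ ∩ {x}ᶜ ∈ 𝓝[≠] x :=
    inter_mem (nhdsWithin_le_nhds (Metric.ball_mem_nhds x hδ)) self_mem_nhdsWithin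
  filter_upwards [hmem] with y hy
  refine norm_kernel_le_of_forall_integral hU (c1.sub c2) hC0 (fun φ hφ hφc hφs => ?_) hy
  have hφd := hφs.trans hUd
  set s := c.testOf φ hφ hφc hφd with hs
  have hsrc : secSupport s.1 ⊆ c.chart.source := c.secSupport_testOf_subset_source hφ hφc hφd
  have hsK : secSupport s.1 ⊆ K₀ := (c.secSupport_testOf_subset hφ hφc hφd).trans
    (image_mono fun z hz => Metric.ball_subset_closedBall (hφs hz).1)
  have hxs : c.chart.symm x ∉ secSupport s.1 :=
    c.symm_notMem_secSupport_testOf hφ hφc hφd hxd fun h => (hφs h).2 rfl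
  have hαs : secSupport (mulTest α' s).1 ⊆ secSupport s.1 := secSupport_smul_subset α' s.1
  have h1 := hC s hsK
  have e1 := (hk'.integral_cloc hsrc hxd hxs).2
  have e2 := (hk.integral_cloc (u := mulTest α' s) (hαs.trans hsrc) hxd fun h => hxs (hαs h)).2
  have e3 : ((Q' - mulSmooth β' ∘ₗ Q ∘ₗ mulTest α') s).1 =
      (Q' s).1 - fun x => β' x • (Q (mulTest α' s)).1 x := rfl
  rw [e3, LocalCoords.loc_sub hxd, LocalCoords.loc_mul hxd, e1, e2, c.cloc_testOf, hsx,
    ← integral_smul] at h1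
  have e4 := integral_sub_apply hU c1 c2 hφ.continuous hφc hφs
  rw [Pi.sub_def] at e4
  convert h1 using 2
  refine e4.trans ?_
  congr 1
  refine integral_congr_ae (Eventually.of_forall fun z => ?_)
  have e5 : c.cloc (mulTest α' s).1 z = α' (c.chart.symm z) • φ z := by
    rw [← c.cloc_testOf hφ hφc hφd]
    exact c.cloc_mul α' s.1 z
  simp only [e5, smul_apply, (k x z).map_smul_of_tower, smul_smul]

end Parametrices

end

end PsiDO

namespace PsiDO

open MeasureTheory Set Filter Topology Function

noncomputable section

set_option linter.unusedSectionVars false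

/-! ### The conformal class -/

section Conformal

variable {n : ℕ} {M : Type*} [TopologicalSpace M] [ChartedSpace (Rn n) M] [IsManifold (𝓡 n) ∞ M]

-- Since g = e⁰g, the hypotheses on the family apply to the operator attached to g itself.
set_option synthInstance.maxHeartbeats 400000 in
lemma self_mem_conformalClass (g : RiemMetric n M) : g ∈ conformalClass g := by
  refine ⟨0, ?_⟩
  have h : (conformalChange 0 g).inner = g.inner := by
    funext x
    change Real.exp 0 • g.inner x = g.inner x
    rw [Real.exp_zero, one_smul]
  cases g
  simp only [conformalChange] at h ⊢
  congr
  exact h.symm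

end Conformal

end

end PsiDO

theorem mainTheorem5 {n : ℕ} (hn : 1 ≤ n)
    {M : Type*} [TopologicalSpace M] [T2Space M] [SecondCountableTopology M]
    [ChartedSpace (Rn n) M] [IsManifold (𝓡 n) ∞ M]
    {F : Type*} [NormedAddCommGroup F] [NormedSpace ℂ F] [FiniteDimensional ℂ F]
    {E : M → Type*} [TopologicalSpace (TotalSpace F E)] [∀ x, TopologicalSpace (E x)]
    [∀ x, AddCommGroup (E x)] [∀ x, Module ℂ (E x)]
    [FiberBundle F E] [VectorBundle ℂ F E] [VectorBundle ℝ F E]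
    [ContMDiffVectorBundle ∞ F E (𝓡 n)]
    (g : RiemMetric n M) (m : ℤ) (w w' : ℝ) (P : RiemMetric n M → Op n F E)
    (hP : ∀ g' ∈ conformalClass g, IsPsiDO m (P g'))
    (hconf : ∀ f : C^∞⟮𝓡 n, M; 𝓘(ℝ, ℝ), ℝ⟯,
      IsSmoothing (P (conformalChange f g)
        - mulSmooth (expFun w' f) ∘ₗ P g ∘ₗ mulTest (expFun (-w) f))) :
    (-(n : ℤ) ≤ m → ∀ f : C^∞⟮𝓡 n, M; 𝓘(ℝ, ℝ), ℝ⟯,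
      (∃! c, HasLogSingularity m (P g) c) ∧
      (∃! c, HasLogSingularity m (P (conformalChange f g)) c) ∧
      ∀ c c' : EndDensity n E, HasLogSingularity m (P g) c →
        HasLogSingularity m (P (conformalChange f g)) c' →
        c' = EndDensity.mul (fun x => Real.exp (-(w - w') * f x)) c) ∧
    (IsElliptic m (P g) → 0 ≤ m → m ≤ n → ∀ f : C^∞⟮𝓡 n, M; 𝓘(ℝ, ℝ), ℝ⟯,
      IsElliptic m (P (conformalChange f g)) ∧
      (∀ Q, IsParametrix m (P g) Q → ∃! c, HasLogSingularity (-m) Q c) ∧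
      (∀ Q, IsParametrix m (P (conformalChange f g)) Q → ∃! c, HasLogSingularity (-m) Q c) ∧
      ∀ c c' : EndDensity n E, HasGreenLogSingularity m (P g) c →
        HasGreenLogSingularity m (P (conformalChange f g)) c' →
        c' = EndDensity.mul (fun x => Real.exp (-(w' - w) * f x)) c) := by
  have hF : CompleteSpace F := FiniteDimensional.complete ℂ F
  -- With second countability this makes M σ-compact, as required for smooth partitions of unity.
  have hM : LocallyCompactSpace M := ChartedSpace.locallyCompactSpace (Rn n) M
  have hPg : IsPsiDO m (P g) := hP g (self_mem_conformalClass g)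
  have hPf : ∀ f, IsPsiDO m (P (conformalChange f g)) := fun f => hP _ ⟨f, rfl⟩
  refine ⟨fun hm f => ⟨hPg.existsUnique_hasLogSingularity hn hm,
    (hPf f).existsUnique_hasLogSingularity hn hm, fun c c' hc hc' => ?_⟩,
    fun hell hm hmn f => ⟨hell.conjugate (hPf f) hm (fun x => (Real.exp_pos _).ne')
      (fun x => (Real.exp_pos _).ne') (hconf f),
      -- A parametrix has order -m, and -m ≥ -n is the bound m ≤ n.
      fun Q hQ => hQ.1.existsUnique_hasLogSingularity hn (neg_le_neg hmn),
      fun Q hQ => hQ.1.existsUnique_hasLogSingularity hn (neg_le_neg hmn),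
      fun c c' ⟨Q, hQ, hc⟩ ⟨Q', hQ', hc'⟩ => ?_⟩⟩
  · rw [hc.conjugate hn hc' (hconf f)]
    congr 1
    funext x
    change Real.exp (w' * f x) * Real.exp (-w * f x) = _
    rw [← Real.exp_add]
    congr 1
    ring
  -- The inverse factors act in the opposite order: Q becomes e^{wf}Qe^{-w'f}, whose coefficient is
  -- multiplied by e^{(w-w')f}.
  · rw [hQ.logSingularity_conjugate hn hQ' (α' := expFun (-w') f) (β' := expFun w f)
      (fun x => ?_) (fun x => ?_) (hconf f) hc hc']
    · congr 1
      funext x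
      change Real.exp (w * f x) * Real.exp (-w' * f x) = _
      rw [← Real.exp_add]
      congr 1
      ring
    · change Real.exp (w' * f x) * Real.exp (-w' * f x) = 1
      rw [← Real.exp_add, neg_mul, add_neg_cancel, Real.exp_zero]
    · change Real.exp (-w * f x) * Real.exp (w * f x) = 1
      rw [← Real.exp_add, neg_mul, neg_add_cancel, Real.exp_zero]
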